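/- **Theorem (IND-CPA security of the tokenization algorithm).** Let $\kappa$ be the security parameter. For each $\kappa$ let $\ell=\ell(\kappa)$ and $k=k(\kappa)$ be natural numbers bounded by polynomials in $\kappa$, put $n=\lceil\log_2(10^{\ell})\rceil$ and $m=k+n$, and let $\mathbb P=\{0,\dots,9\}^{\ell}$ be the set of numeric codes and $\mathbb U$ the set of all finite binary strings. For a string $Y$ of digits or bits, $\overline Y$ denotes the integer it represents (most significant digit on the left), and $[y]_b^s$ denotes the $s$-digit representation of $y$ in base $b$. Let $E:\mathbb K\times\{0,1\}^m\to\{0,1\}^m$ be a block cipher, that is, $\mathbb K=\mathbb K_\kappa$ is a finite non-empty key space and each $E(K,\cdot)$ is a permutation, and let $f:\mathbb U\times\mathbb P\to\{0,1\}^{k}$ be a public function that is computable in time polynomial in $\kappa$ and the length of $u$, and is collision-resistant: every probabilistic polynomial-time (PPT) algorithm outputs two distinct pairs $(X_1,u_1)\ne(X_2,u_2)$ with $f(u_1,X_1)=f(u_2,X_2)$ only with negligible probability. The tokenization algorithm $T(K,X,u)$, which has access to a database of the tokens generated so far, is: 1. $t:=f(u,X)\,\|\,[\overline X]_2^{n}$;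 2. $c:=E(K,t)$; 3. if $(\overline c \bmod 2^n)\ge 10^{\ell}$, then $t:=c$ and go back to 2; 4. $\mathtt{token}:=[\overline c\bmod 2^n]_{10}^{\ell}$; 5. if $\mathtt{token}$ is already in the database, then $u:=u+1$ (binary successor) and go back to 1; 6. return $\mathtt{token}$, which is then inserted in the database. In the IND-CPA game for $E$ (respectively $T$), a uniformly random key $K$ is drawn (and the database is empty at the start). In Phase I the adversary adaptively chooses messages, which are elements of $\{0,1\}^m$ (respectively pairs $(X,u)\in\mathbb P\times\mathbb U$), and receives their values under $E(K,\cdot)$ (respectively $T(K,\cdot,\cdot)$). She then chooses two challenge messages, neither of them chosen in Phase I, and receives the value of the $\nu$-th one, where $\nu\in\{0,1\}$ is a uniformly random secret bit. In Phase II she continues to query, but may not choose a challenge message. Finally she outputs a guess $\nu'$. Requests that break these rules are refused, and if $T$ does not terminate on a request (which can only happen in Step 5) the adversary is told so and the game goes on. The advantage is $\left|\Pr[\nu'=\nu]-\tfrac12\right|$, and $E$ (respectively $T$) is IND-CPA secure if every PPT adversary has negligible advantage, as a function of $\kappa$. All algorithms receive $\kappa,\ell,n,k$ in unary, and a PPT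 algorithm is one that halts within a number of steps polynomial in $\kappa$ for all outcomes of its coins and all answers (of the correct format) to its queries. **If $E$ is IND-CPA secure, then $T$ is IND-CPA secure.** -/

import Mathlib

namespace Tokenization

/-! ## A machine model: WHILE programs over binary trees, with coins and an oracle

Values are binary trees; a program works on registers holding trees, using constant-time access to
the two subtrees, pairing, and a test for the empty tree. With one time unit per executed command
this is the usual WHILE language, polynomially equivalent to multitape Turing machines. -/

/-- The data of the machine: binary trees. -/
inductive Val
  | nil
  | node (l r : Val)

/-- A memory: the contents of the registers. -/
abbrev Store := ℕ → Val

/-- Expressions. -/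
inductive Expr
  | var (x : ℕ)
  | nil
  | cons (a b : Expr)
  | hd (a : Expr)
  | tl (a : Expr)

def Val.left : Val → Val
  | .nil => .nil
  | .node l _ => l

def Val.right : Val → Val
  | .nil => .nil
  | .node _ r => r

def Expr.eval (s : Store) : Expr → Val
  | .var x => s x
  | .nil => .nil
  | .cons a b => .node (a.eval s) (b.eval s)
  | .hd a => (a.eval s).left
  | .tl a => (a.eval s).right

/-- Programs. `ite x p q` runs `p` if register `x` is not `nil` and `q` otherwise; `loop x p` repeats
`p` while register `x` is not `nil`; `flip x` stores a fair coin in `x`; `query x e` sends the value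
of `e` to the oracle and stores the answer in `x`. -/
inductive Prog
  | assign (x : ℕ) (e : Expr)
  | seq (p q : Prog)
  | ite (x : ℕ) (p q : Prog)
  | loop (x : ℕ) (p : Prog)
  | flip (x : ℕ)
  | query (x : ℕ) (e : Expr)

/-- A configuration: the commands still to be executed, and the memory. -/
abbrev Config := List Prog × Store

/-! Wire formats: how the mathematical objects are written as trees. -/

def encBool : Bool → Val
  | false => .nil
  | true => .node .nil .nil

def unary : ℕ → Val
  | 0 => .nil
  | n + 1 => .node .nil (unary n)

def encList {α : Type} (g : α → Val) : List α → Val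
  | [] => .nil
  | a :: l => .node (g a) (encList g l)

def encPair {α β : Type} (g : α → Val) (h : β → Val) (p : α × β) : Val :=
  .node (g p.1) (h p.2)

def encOption {α : Type} (g : α → Val) : Option α → Val
  | none => .nil
  | some a => .node .nil (g a)

/-- A binary string of fixed length as a list of bits, most significant bit first. -/
def encBits {w : ℕ} (x : BitVec w) : Val :=
  encList encBool (List.ofFn fun i : Fin w => x.getMsb i)

/-- What a machine does next: halt, make a silent step, flip a coin, or ask its oracle. -/
inductive Action
  | halt (s : Store)
  | tick (c : Config)
  | flip (k : Bool → Config)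
  | ask (q : Val) (k : Val → Config)

open Classical in
noncomputable def next : Config → Action
  | ([], s) => .halt s
  | (.assign x e :: ps, s) => .tick (ps, Function.update s x (e.eval s))
  | (.seq p q :: ps, s) => .tick (p :: q :: ps, s)
  | (.ite x p q :: ps, s) => .tick ((if s x = .nil then q else p) :: ps, s)
  | (.loop x p :: ps, s) => .tick (if s x = .nil then ps else p :: .loop x p :: ps, s)
  | (.flip x :: ps, s) => .flip fun b => (ps, Function.update s x (encBool b))
  | (.query x e :: ps, s) => .ask (e.eval s) fun a => (ps, Function.update s x a)

/-- The machine halts after at most `t` steps, whatever the coins and whatever the oracle answers,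
as long as every answer lies in `ok`. -/
def HaltsWithin (ok : Set Val) : ℕ → Config → Prop
  | 0, c => ∃ s, next c = .halt s
  | t + 1, c =>
    match next c with
    | .halt _ => True
    | .tick c' => HaltsWithin ok t c'
    | .flip k => ∀ b, HaltsWithin ok t (k b)
    | .ask _ k => ∀ a ∈ ok, HaltsWithin ok t (k a)

/-- The machine halts after exactly `t` steps, all of them silent, with memory `s`. -/
def RunsTo : ℕ → Config → Store → Prop
  | 0, c, s => next c = .halt s
  | t + 1, c, s => ∃ c', next c = .tick c' ∧ RunsTo t c' s

/-- The memory after at most `t` steps, as a random variable, when the queries are answered by the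
stateful oracle `O`. -/
noncomputable def run {σ : Type} (O : σ → Val → Val × σ) : ℕ → Config → σ → PMF Store
  | 0, c, _ => PMF.pure c.2
  | t + 1, c, st =>
    match next c with
    | .halt s => PMF.pure s
    | .tick c' => run O t c' st
    | .flip k => (PMF.uniformOfFintype Bool).bind fun b => run O t (k b) st
    | .ask q k => run O t (k (O st q).1) (O st q).2

/-- The memory holding the values of a list in registers `0, 1, 2, …`. -/
def load (l : List Val) : Store := fun x => l.getD x .nil

/-- Negligible functions of the security parameter. -/
def Negligible (g : ℕ → ℝ) : Prop :=
  Asymptotics.SuperpolynomialDecay Filter.atTop (fun κ : ℕ => (κ : ℝ)) g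

/-- At most polynomial growth. -/
def PolyBounded (g : ℕ → ℕ) : Prop :=
  ∃ p : Polynomial ℕ, ∀ κ, g κ ≤ p.eval κ

/-! ## The chosen-plaintext game -/

/-- What the challenger runs, for one value of the security parameter: it draws a uniform key, and
answers each message in a way that may depend on (and update) a database. -/
structure Service where
  Key : Type
  [keyFintype : Fintype Key]
  [keyNonempty : Nonempty Key]
  Msg : Type
  Resp : Type
  Db : Type
  /-- the database at the start -/
  start : Db
  reply : Key → Db → Msg → Resp × Db
  encMsg : Msg → Val
  encResp : Resp → Val

attribute [instance] Service.keyFintype Service.keyNonempty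

/-- The requests of an adversary: an ordinary query, or the challenge pair. -/
inductive Request (M : Type)
  | ordinary (m : M)
  | challenge (m₀ m₁ : M)

def encRequest {M : Type} (g : M → Val) : Request M → Val
  | .ordinary m => .node .nil (g m)
  | .challenge m₀ m₁ => .node (.node .nil .nil) (.node (g m₀) (g m₁))

/-- The challenger's memory: the database, the messages of Phase I, and the challenge pair once
there is one (from then on the game is in Phase II). -/
structure GameState (S : Service) where
  db : S.Db
  asked : Set S.Msg
  pair : Option (S.Msg × S.Msg)

open Classical in
/-- The challenger with key `K` and secret bit `ν`. `none` is the refusal of a request that the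
rules forbid. -/
noncomputable def challenger (S : Service) (K : S.Key) (ν : Bool) (st : GameState S) :
    Request S.Msg → Option S.Resp × GameState S
  | .ordinary m =>
    match st.pair with
    | none =>
      (some (S.reply K st.db m).1,
        { db := (S.reply K st.db m).2, asked := insert m st.asked, pair := none })
    | some (m₀, m₁) =>
      if m = m₀ ∨ m = m₁ then (none, st)
      else (some (S.reply K st.db m).1, { st with db := (S.reply K st.db m).2 })
  | .challenge m₀ m₁ =>
    if st.pair.isSome ∨ m₀ ∈ st.asked ∨ m₁ ∈ st.asked then (none, st)
    else
      (some (S.reply K st.db (if ν then m₁ else m₀)).1,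
        { st with db := (S.reply K st.db (if ν then m₁ else m₀)).2, pair := some (m₀, m₁) })

/-- The challenger as an oracle on trees; trees that encode no request are refused. -/
noncomputable def challengerOracle (S : Service) (K : S.Key) (ν : Bool)
    (st : GameState S) (q : Val) : Val × GameState S :=
  match Function.partialInv (encRequest S.encMsg) q with
  | none => (encOption S.encResp none, st)
  | some r => (encOption S.encResp (challenger S K ν st r).1, (challenger S K ν st r).2)

open Classical in
/-- The guess of the adversary is read off register `0`. -/
noncomputable def guess (s : Store) : Bool := decide (s 0 ≠ .nil)

/-- The joint law of the secret bit and of the guess. -/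
noncomputable def game (S : Service) (input : List Val) (A : Prog) (t : ℕ) : PMF (Bool × Bool) :=
  (PMF.uniformOfFintype S.Key).bind fun K =>
    (PMF.uniformOfFintype Bool).bind fun ν =>
      (run (challengerOracle S K ν) t ([A], load input) ⟨S.start, ∅, none⟩).map
        fun s => (ν, guess s)

/-- The advantage `|Pr[ν' = ν] - 1/2|`. -/
noncomputable def advantage (S : Service) (input : List Val) (A : Prog) (t : ℕ) : ℝ :=
  |((game S input A t).toOuterMeasure {b | b.2 = b.1}).toReal - 1 / 2|

/-- Every probabilistic polynomial-time adversary has negligible advantage. -/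
def INDCPA (input : ℕ → List Val) (S : ℕ → Service) : Prop :=
  ∀ (A : Prog) (p : Polynomial ℕ),
    (∀ κ, HaltsWithin (Set.range (encOption (S κ).encResp)) (p.eval κ) ([A], load (input κ))) →
    Negligible fun κ => advantage (S κ) (input κ) A (p.eval κ)

/-! ## The tokenization algorithm -/

/-- Numeric codes: strings of `ℓ` decimal digits. Tokens have the same format. -/
abbrev Code (ℓ : ℕ) := Fin ℓ → Fin 10

/-- A digit string, most significant digit on the left, as an integer below `10 ^ ℓ`. -/
def codeEquiv (ℓ : ℕ) : Code ℓ ≃ Fin (10 ^ ℓ) :=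
  (Equiv.arrowCongr Fin.revPerm (Equiv.refl (Fin 10))).trans finFunctionFinEquiv

/-- `⌈log₂ (10 ^ ℓ)⌉`. -/
abbrev bitLen (ℓ : ℕ) : ℕ := Nat.clog 2 (10 ^ ℓ)

/-- The representation of a code in base `2` with `bitLen ℓ` digits. -/
def codeBits {ℓ : ℕ} (X : Code ℓ) : BitVec (bitLen ℓ) := BitVec.ofNat _ (codeEquiv ℓ X)

/-- Additional inputs: binary strings of arbitrary length. -/
abbrev AddInput := List Bool

/-- Successor of a binary number, least significant bit first. -/
def incrLow : List Bool → List Bool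
  | [] => [true]
  | false :: u => true :: u
  | true :: u => false :: incrLow u

/-- `u + 1` for a binary string `u`, most significant bit on the left. -/
def incr (u : AddInput) : AddInput := (incrLow u.reverse).reverse

section Algorithm

variable {ℓ k : ℕ}

/-- The last `bitLen ℓ` bits of a block are the expansion of a number below `10 ^ ℓ`. -/
def InRange (ℓ k : ℕ) (c : BitVec (k + bitLen ℓ)) : Prop := c.toNat % 2 ^ bitLen ℓ < 10 ^ ℓ

/-- Step 1: the block `f(u, X) || [X]₂ⁿ`. -/
def block (f : AddInput → Code ℓ → BitVec k) (u : AddInput) (X : Code ℓ) :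
    BitVec (k + bitLen ℓ) :=
  f u X ++ codeBits X

theorem block_inRange (f : AddInput → Code ℓ → BitVec k) (u : AddInput) (X : Code ℓ) :
    InRange ℓ k (block f u X) := by
  have h : (codeEquiv ℓ X : ℕ) < 10 ^ ℓ := (codeEquiv ℓ X).2
  have h2 : 10 ^ ℓ ≤ 2 ^ bitLen ℓ := Nat.le_pow_clog (by norm_num) _
  unfold InRange block
  rw [BitVec.toNat_append, Nat.or_mod_two_pow, Nat.shiftLeft_eq, Nat.mul_mod_left, Nat.zero_or,
    codeBits, BitVec.toNat_ofNat, Nat.mod_mod, Nat.mod_eq_of_lt (h.trans_le h2)]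
  exact h

theorem exists_inRange (π : Equiv.Perm (BitVec (k + bitLen ℓ))) (t : BitVec (k + bitLen ℓ))
    (ht : InRange ℓ k t) : ∃ i, InRange ℓ k (π^[i + 1] t) := by
  have : Finite (BitVec (k + bitLen ℓ)) := Finite.of_injective BitVec.toFin
    fun a b h => BitVec.eq_of_toFin_eq h
  refine ⟨orderOf π - 1, ?_⟩
  rw [Nat.sub_add_cancel (orderOf_pos π), ← Equiv.Perm.coe_pow, pow_orderOf_eq_one]
  exact ht

open Classical in
/-- Steps 2 and 3: apply the permutation `π` once, and again as long as the result is not in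
range. -/
noncomputable def walk (π : Equiv.Perm (BitVec (k + bitLen ℓ))) (t : BitVec (k + bitLen ℓ))
    (ht : InRange ℓ k t) : {c : BitVec (k + bitLen ℓ) // InRange ℓ k c} :=
  ⟨π^[Nat.find (exists_inRange π t ht) + 1] t, Nat.find_spec (exists_inRange π t ht)⟩

/-- Steps 1 to 4: the candidate token. -/
noncomputable def candidate (f : AddInput → Code ℓ → BitVec k)
    (π : Equiv.Perm (BitVec (k + bitLen ℓ))) (u : AddInput) (X : Code ℓ) : Code ℓ :=
  (codeEquiv ℓ).symm ⟨_, (walk π (block f u X) (block_inRange f u X)).2⟩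

open Classical in
/-- The tokenization algorithm: replace `u` by `u + 1` until the candidate token is not in the
database `db`. The value is `none` exactly if this never happens, that is, if the algorithm does not
terminate. -/
noncomputable def tokenize (f : AddInput → Code ℓ → BitVec k)
    (π : Equiv.Perm (BitVec (k + bitLen ℓ))) (db : Set (Code ℓ)) (X : Code ℓ) (u : AddInput) :
    Option (Code ℓ) :=
  if h : ∃ j, candidate f π (incr^[j] u) X ∉ db then
    some (candidate f π (incr^[Nat.find h] u) X)
  else none

end Algorithm

/-- A code is written as its integer value in base `2`. -/
def encCode {ℓ : ℕ} (X : Code ℓ) : Val := encBits (codeBits X)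

def encInput : AddInput → Val := encList encBool

/-- The block cipher `E` as run by the challenger. -/
def cipherService {K : Type} [Fintype K] [Nonempty K] {m : ℕ} (E : K → Equiv.Perm (BitVec m)) :
    Service where
  Key := K
  Msg := BitVec m
  Resp := BitVec m
  Db := Unit
  start := ()
  reply key _ x := (E key x, ())
  encMsg := encBits
  encResp := encBits

/-- The tokenization algorithm as run by the challenger: the database is empty at the start, and
each token is inserted once it is generated. -/
noncomputable def tokenService {K : Type} [Fintype K] [Nonempty K] {ℓ k : ℕ}
    (f : AddInput → Code ℓ → BitVec k) (E : K → Equiv.Perm (BitVec (k + bitLen ℓ))) :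
    Service where
  Key := K
  Msg := Code ℓ × AddInput
  Resp := Option (Code ℓ)
  Db := Set (Code ℓ)
  start := ∅
  reply key db m :=
    (tokenize f (E key) db m.1 m.2, db ∪ {a | tokenize f (E key) db m.1 m.2 = some a})
  encMsg := encPair encCode encInput
  encResp := encOption encCode

/-- The public parameters, in unary: the security parameter, the number of digits, the number of
bits of a code, and the number of padding bits. -/
def params (ℓ k : ℕ → ℕ) (κ : ℕ) : List Val :=
  [unary κ, unary (ℓ κ), unary (bitLen (ℓ κ)), unary (k κ)]

/-- The family `f` is computed by one deterministic program, in time polynomial in the security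
parameter and in the length of the additional input. -/
def PolyTimeComputable (ℓ k : ℕ → ℕ) (f : ∀ κ, AddInput → Code (ℓ κ) → BitVec (k κ)) : Prop :=
  ∃ (F : Prog) (p : Polynomial ℕ), ∀ (κ : ℕ) (u : AddInput) (X : Code (ℓ κ)),
    ∃ t ≤ p.eval (κ + u.length), ∃ s,
      RunsTo t ([F], load (params ℓ k κ ++ [encInput u, encCode X])) s ∧
      s 0 = encBits (f κ u X)

/-- Register `0` holds two distinct pairs with the same image. -/
def FoundCollision {ℓ k : ℕ} (f : AddInput → Code ℓ → BitVec k) (s : Store) : Prop :=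
  ∃ (a b : Code ℓ × AddInput), a ≠ b ∧ f a.2 a.1 = f b.2 b.1 ∧
    s 0 = .node (encPair encCode encInput a) (encPair encCode encInput b)

/-- No probabilistic polynomial-time algorithm finds collisions with more than negligible
probability. There is no oracle: every query is answered by `nil`. -/
def CollisionResistant (ℓ k : ℕ → ℕ) (f : ∀ κ, AddInput → Code (ℓ κ) → BitVec (k κ)) : Prop :=
  ∀ (A : Prog) (p : Polynomial ℕ),
    (∀ κ, HaltsWithin {.nil} (p.eval κ) ([A], load (params ℓ k κ))) →
    Negligible fun κ =>
      ((run (fun (_ : Unit) _ => (Val.nil, ())) (p.eval κ) ([A], load (params ℓ k κ))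
        ()).toOuterMeasure {s | FoundCollision (f κ) s}).toReal

end Tokenization

open Tokenization

namespace Tokenization

/-! ## Dialogues: finite trees of coin flips and questions -/

/-! An adversary against the token service is run against a simulator, `simStep`, which has nothing
but a cipher at its disposal. The simulator follows the tokenization algorithm with cut-offs: a
bounded number of candidate tokens per request, at most `κ` encryptions per candidate, and no block
is ever encrypted twice. When a cut-off strikes, it gives up (`bad`). An additional input whose
candidate for the same code was computed before is skipped without encryption. Its candidate is in
the database already, so the algorithm would pass on to the successor too. If a starting block
belongs to a different message handled earlier, a collision of `f` has been found; it is recorded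
and the simulator gives up.

Consequently all blocks sent to the cipher are distinct. The crucial invariant is `SimInv.fresh`: a
starting block is in range, whereas every other block sent during a walk is out of range (otherwise
the walk would have ended there), so a starting block that was sent before must be recorded as the
start of an earlier walk.

Four comparisons give the theorem. First, with the true cipher the simulator answers exactly like
the token service until it gives up. If giving up counts as success, no success probability
decreases (`value_le_real`).

Second, the values of the cipher may be replaced by independent uniform blocks. For a random index
`i`, the first `i` questions are passed on, the next question `q` is submitted together with a
random block `r` as the challenge pair, and later questions are answered at random. Since the
encryption of a uniform block is uniform, the two values of the secret bit produce consecutive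
hybrids, up to the small chance that `r` was queried before; distinctness of the questions makes `q`
itself admissible (`value_hybrid`, `real_sub_unif_le`).

Third, with uniform answers each step of a walk is in range with probability at least one half, and
then its last bits form a uniform code (`unif_walk_le`). Rejecting the codes in the database leaves
a uniform new token. Repeated blocks, overlong walks and exhausted attempts are improbable
(`attemptsBound_le`, `unif_handle_le`). Collisions are improbable as well, because the simulation
with random answers needs no oracle and is thus a collision finder (`exists_collision_adversary`).

Fourth, uniform new tokens carry no information on the secret bit, so in the ideal game winning and
losing balance exactly (`ideal_add_ideal`). Hence both "won or gave up" and "lost or gave up" have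
probability at most one half plus a negligible term, which bounds the advantage from both sides
(`token_indcpa_bound`). That `2 ^ (-(k + n))` is negligible also follows from collision resistance:
two random inputs collide with probability at least `2 ^ (-k)` (`exists_random_collision`).

The remaining work shows that the reductions are polynomial-time programs. Interactions are modelled
by dialogues, and `Follows` relates a machine to a dialogue. `Computes`, `PT`, `FP` and `FPH` form
calculi for composing programs with time bounds. `exists_mainProg` then joins the adversary and the
simulator into one program. -/

inductive Dialog (Q R α : Type)
  | ret (a : α)
  | flip (k : Bool → Dialog Q R α)
  | ask (q : Q) (k : R → Dialog Q R α)

namespace Dialog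

variable {Q R Q' R' α β γ δ σ τ : Type}

def bind : Dialog Q R α → (α → Dialog Q R β) → Dialog Q R β
  | ret a, f => f a
  | flip k, f => flip fun b => (k b).bind f
  | ask q k, f => ask q fun r => (k r).bind f

@[simp] theorem ret_bind (a : α) (f : α → Dialog Q R β) : (ret a).bind f = f a := rfl

@[simp] theorem flip_bind (k : Bool → Dialog Q R α) (f : α → Dialog Q R β) :
    (flip k).bind f = flip fun b => (k b).bind f := rfl

@[simp] theorem ask_bind (q : Q) (k : R → Dialog Q R α) (f : α → Dialog Q R β) :
    (ask q k).bind f = ask q fun r => (k r).bind f := rfl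

theorem bind_assoc (d : Dialog Q R α) (f : α → Dialog Q R β) (g : β → Dialog Q R γ) :
    (d.bind f).bind g = d.bind fun a => (f a).bind g := by
  induction d with
  | ret a => rfl
  | flip k ih => simp [ih]
  | ask q k ih => simp [ih]

@[simp] theorem bind_ret (d : Dialog Q R α) : d.bind ret = d := by
  induction d with
  | ret a => rfl
  | flip k ih => simp [ih]
  | ask q k ih => simp [ih]

/-- `b` is a possible result if all answers lie in `ok`. -/
def Leaf (ok : R → Prop) : Dialog Q R α → α → Prop
  | ret a, b => b = a
  | flip k, b => ∃ c, (k c).Leaf ok b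
  | ask _ k, b => ∃ r, ok r ∧ (k r).Leaf ok b

@[simp] theorem leaf_ret {ok : R → Prop} {a b : α} : (ret a : Dialog Q R α).Leaf ok b ↔ b = a :=
  Iff.rfl

theorem leaf_bind {ok : R → Prop} {d : Dialog Q R α} {f : α → Dialog Q R β} {b : β} :
    (d.bind f).Leaf ok b ↔ ∃ a, d.Leaf ok a ∧ (f a).Leaf ok b := by
  induction d with
  | ret a => simp
  | flip k ih =>
    simp only [flip_bind, Leaf, ih]
    exact ⟨fun ⟨c, a, h⟩ => ⟨a, ⟨c, h.1⟩, h.2⟩, fun ⟨a, ⟨c, h⟩, h'⟩ => ⟨c, a, h, h'⟩⟩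
  | ask q k ih =>
    simp only [ask_bind, Leaf, ih]
    exact ⟨fun ⟨c, hc, a, h⟩ => ⟨a, ⟨c, hc, h.1⟩, h.2⟩, fun ⟨a, ⟨c, hc, h⟩, h'⟩ => ⟨c, hc, a, h, h'⟩⟩

/-- Answer the questions by stateful dialogues with somebody else. -/
def handle (h : σ → Q → Dialog Q' R' (R × σ)) : Dialog Q R α → σ → Dialog Q' R' (α × σ)
  | ret a, s => ret (a, s)
  | flip k, s => flip fun b => (k b).handle h s
  | ask q k, s => (h s q).bind fun p => (k p.1).handle h p.2

theorem handle_bind (h : σ → Q → Dialog Q' R' (R × σ)) (d : Dialog Q R α)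
    (f : α → Dialog Q R β) (s : σ) :
    (d.bind f).handle h s = (d.handle h s).bind fun p => (f p.1).handle h p.2 := by
  induction d generalizing s with
  | ret a => rfl
  | flip k ih => simp [handle, ih]
  | ask q k ih => simp [handle, ih, bind_assoc]

/-- The state of the handler keeps `inv`, so all answers it gives are admissible and the outer
dialogue stays on one of its admissible branches. Thus facts that presuppose admissible answers
survive when an oracle is replaced by a simulator. -/
theorem leaf_handle {h : σ → Q → Dialog Q' R' (R × σ)} {ok : R → Prop} {ok' : R' → Prop}
    {inv : σ → Prop}
    (hh : ∀ s q r s', inv s → (h s q).Leaf ok' (r, s') → ok r ∧ inv s')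
    {d : Dialog Q R α} {s : σ} (hs : inv s) {a : α} {s' : σ}
    (hl : (d.handle h s).Leaf ok' (a, s')) : d.Leaf ok a ∧ inv s' := by
  induction d generalizing s with
  | ret b =>
    obtain ⟨rfl, rfl⟩ := Prod.mk.inj hl
    exact ⟨rfl, hs⟩
  | flip k ih =>
    obtain ⟨c, hc⟩ := hl
    exact ⟨⟨c, (ih c hs hc).1⟩, (ih c hs hc).2⟩
  | ask q k ih =>
    obtain ⟨⟨r, t⟩, h1, h2⟩ := leaf_bind.1 hl
    obtain ⟨hr, ht⟩ := hh s q r t hs h1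
    exact ⟨⟨r, hr, (ih r ht h2).1⟩, (ih r ht h2).2⟩

/-- Monadic left fold. -/
def foldM (g : α → γ → Dialog Q R α) : α → List γ → Dialog Q R α
  | a, [] => ret a
  | a, x :: l => (g a x).bind fun b => foldM g b l

@[simp] theorem foldM_nil (g : α → γ → Dialog Q R α) (a : α) : foldM g a [] = ret a := rfl

@[simp] theorem foldM_cons (g : α → γ → Dialog Q R α) (a : α) (x : γ) (l : List γ) :
    foldM g a (x :: l) = (g a x).bind fun b => foldM g b l := rfl

theorem foldM_ret (g : α → γ → α) (a : α) (l : List γ) :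
    foldM (fun a x => (ret (g a x) : Dialog Q R α)) a l = ret (l.foldl g a) := by
  induction l generalizing a with
  | nil => rfl
  | cons x l ih => simp [ih]

theorem handle_foldM (h : σ → Q → Dialog Q' R' (R × σ)) (g : α → γ → Dialog Q R α) (a : α)
    (l : List γ) (s : σ) :
    (foldM g a l).handle h s = foldM (fun p x => (g p.1 x).handle h p.2) (a, s) l := by
  induction l generalizing a s with
  | nil => rfl
  | cons x l ih => simp [handle_bind, ih]

theorem leaf_foldM {ok : R → Prop} {g : α → γ → Dialog Q R α} {l : List γ} (I : ℕ → α → Prop)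
    (hI : ∀ i < l.length, ∀ x ∈ l, ∀ a b, I i a → (g a x).Leaf ok b → I (i + 1) b)
    {a b : α} (ha : I 0 a) (hb : (foldM g a l).Leaf ok b) : I l.length b := by
  induction l generalizing a I with
  | nil => obtain rfl := hb; exact ha
  | cons x l ih =>
    obtain ⟨c, hc, hb⟩ := leaf_bind.1 hb
    exact ih (fun i => I (i + 1)) (fun i hi y hy a b => hI (i + 1) (by simpa using hi) y (by simp [hy]) a b)
      (hI 0 (by simp) x (by simp) a c ha hc) hb

/-- The expectation of `F` when a stateful oracle answers the questions. -/
noncomputable def value (O : σ → Q → R × σ) : Dialog Q R α → σ → (α → ℝ) → ℝ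
  | ret a, _, F => F a
  | flip k, s, F => ((k false).value O s F + (k true).value O s F) / 2
  | ask q k, s, F => (k (O s q).1).value O (O s q).2 F

theorem value_mono {O : σ → Q → R × σ} {d : Dialog Q R α} {s : σ} {F G : α → ℝ}
    (h : ∀ a, F a ≤ G a) : d.value O s F ≤ d.value O s G := by
  induction d generalizing s with
  | ret a => exact h a
  | flip k ih => simp only [value]; linarith [ih false (s := s), ih true (s := s)]
  | ask q k ih => exact ih _

theorem value_const {O : σ → Q → R × σ} {d : Dialog Q R α} {s : σ} {x : ℝ} :
    d.value O s (fun _ => x) = x := by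
  induction d generalizing s with
  | ret a => rfl
  | flip k ih => simp only [value, ih]; ring
  | ask q k ih => exact ih _

theorem value_sub_const {O : σ → Q → R × σ} {d : Dialog Q R α} {s : σ} {x : ℝ} {F : α → ℝ} :
    d.value O s (fun a => x - F a) = x - d.value O s F := by
  induction d generalizing s with
  | ret a => rfl
  | flip k ih => simp only [value, ih]; ring
  | ask q k ih => exact ih _

end Dialog

/-! ### Machines that carry out dialogues -/

open Dialog

/-- The interaction of a machine during its first `t` steps. -/
noncomputable def dialog : ℕ → Config → Dialog Val Val Store
  | 0, c => .ret c.2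
  | t + 1, c =>
    match next c with
    | .halt s => .ret s
    | .tick c' => dialog t c'
    | .flip k => .flip fun b => dialog t (k b)
    | .ask q k => .ask q fun a => dialog t (k a)

theorem toReal_uniformBool_bind {α : Type} (f : Bool → PMF α) (S : Set α) :
    (((PMF.uniformOfFintype Bool).bind f).toOuterMeasure S).toReal =
      (((f false).toOuterMeasure S).toReal + ((f true).toOuterMeasure S).toReal) / 2 := by
  have hne : ∀ b, (f b).toOuterMeasure S ≠ ⊤ := fun b =>
    ne_top_of_le_ne_top ENNReal.one_ne_top <| by
      rw [PMF.toOuterMeasure_apply, ← (f b).tsum_coe]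
      exact ENNReal.tsum_le_tsum fun x => Set.indicator_le_self _ _ x
  rw [PMF.toOuterMeasure_bind_apply, tsum_fintype, Fintype.sum_bool, ENNReal.toReal_add]
  · simp [ENNReal.toReal_mul]; ring
  · exact ENNReal.mul_ne_top (PMF.apply_ne_top _ _) (hne _)
  · exact ENNReal.mul_ne_top (PMF.apply_ne_top _ _) (hne _)

-- Turns probabilities of events about machines into the recursively defined real number `value`, so
-- that all later estimates are inductions over dialogues without any measure theory.
open Classical in
theorem toReal_run {σ : Type} (O : σ → Val → Val × σ) (t : ℕ) (c : Config) (st : σ)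
    (S : Set Store) :
    ((run O t c st).toOuterMeasure S).toReal =
      (dialog t c).value O st fun s => if s ∈ S then 1 else 0 := by
  induction t generalizing c st with
  | zero =>
    simp only [run, dialog, value, PMF.toOuterMeasure_pure_apply]
    split_ifs <;> simp
  | succ t ih =>
    rw [run, dialog]
    cases next c with
    | halt s =>
      simp only [value, PMF.toOuterMeasure_pure_apply]
      split_ifs <;> simp
    | tick c' => exact ih c' st
    | flip k => simp only [toReal_uniformBool_bind, value, ih]
    | ask q k => exact ih _ _

/-- The machine `c` carries out the dialogue `d` in at most `n` steps, and then halts with a memory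
that represents the result. -/
inductive Follows {β : Type} (Rel : β → Store → Prop) : ℕ → Config → Dialog Val Val β → Prop
  | halt {n c s b} (h : next c = .halt s) (hb : Rel b s) : Follows Rel n c (.ret b)
  | tick {n c c' d} (h : next c = .tick c') (hd : Follows Rel n c' d) : Follows Rel (n + 1) c d
  | flip {n c k d} (h : next c = .flip k) (hd : ∀ b, Follows Rel n (k b) (d b)) :
      Follows Rel (n + 1) c (.flip d)
  | ask {n c q k d} (h : next c = .ask q k) (hd : ∀ a, Follows Rel n (k a) (d a)) :
      Follows Rel (n + 1) c (.ask q d)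

namespace Follows

variable {β : Type} {Rel : β → Store → Prop}

theorem succ {n : ℕ} {c : Config} {d : Dialog Val Val β} (h : Follows Rel n c d) :
    Follows Rel (n + 1) c d := by
  induction h with
  | halt h hb => exact .halt h hb
  | tick h _ ih => exact .tick h ih
  | flip h _ ih => exact .flip h ih
  | ask h _ ih => exact .ask h ih

theorem mono {n n' : ℕ} {c : Config} {d : Dialog Val Val β} (h : Follows Rel n c d)
    (hn : n ≤ n') : Follows Rel n' c d := by
  induction hn with
  | refl => exact h
  | step _ ih => exact ih.succ

/-- A machine that follows a dialogue does so for every answer whatsoever, so one bound serves for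
all sets of admissible answers: those of the cipher as well as the trivial ones of the collision
game. -/
theorem haltsWithin {n : ℕ} {c : Config} {d : Dialog Val Val β} (h : Follows Rel n c d)
    (ok : Set Val) : HaltsWithin ok n c := by
  induction h with
  | @halt n c s b h hb =>
    cases n with
    | zero => exact ⟨s, h⟩
    | succ n => simp [HaltsWithin, h]
  | tick h _ ih => simpa [HaltsWithin, h] using ih
  | flip h _ ih => simpa [HaltsWithin, h] using ih
  | ask h _ ih => simpa [HaltsWithin, h] using fun a _ => ih a

/-- The machine has halted when its budget is used up, so cutting its interaction off at that point
loses nothing, and the law of the output can be read off the abstract dialogue, for any oracle. -/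
theorem value_dialog {n : ℕ} {c : Config} {d : Dialog Val Val β} (h : Follows Rel n c d)
    {σ : Type} (O : σ → Val → Val × σ) {F : Store → ℝ} {G : β → ℝ}
    (hFG : ∀ b s, Rel b s → F s = G b) (st : σ) :
    (dialog n c).value O st F = d.value O st G := by
  induction h generalizing st with
  | @halt n c s b h hb =>
    cases n with
    -- Without steps left `dialog` returns the current memory; it is the final one, because only an
    -- empty list of commands halts.
    | zero =>
      obtain ⟨ps, s'⟩ := c
      have : s' = s := by
        cases ps with
        | nil => simpa [next] using h
        | cons p ps => cases p <;> simp [next] at h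
      subst this
      exact hFG _ _ hb
    | succ n => simpa [dialog, h, value] using hFG _ _ hb
  | tick h _ ih => simpa [dialog, h] using ih st
  | flip h _ ih => simp [dialog, h, value, ih]
  | ask h _ ih => simpa [dialog, h, value] using ih _ _

end Follows

end Tokenization

namespace Tokenization
open Dialog

/-! ## Programs that transform one encoded value -/

/-- Types whose elements are written as trees. -/
class Enc (α : Type) where
  enc : α → Val

open Enc

instance : Enc Val := ⟨id⟩
instance : Enc Unit := ⟨fun _ => .nil⟩
instance : Enc Bool := ⟨encBool⟩
instance {α β : Type} [Enc α] [Enc β] : Enc (α × β) := ⟨encPair enc enc⟩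
instance {α : Type} [Enc α] : Enc (List α) := ⟨encList enc⟩
instance {α : Type} [Enc α] : Enc (Option α) := ⟨encOption enc⟩

section
variable {α β : Type} [Enc α] [Enc β]
@[simp] theorem enc_val (v : Val) : enc v = v := rfl
@[simp] theorem enc_unit (v : Unit) : enc v = .nil := rfl
@[simp] theorem enc_false : enc false = .nil := rfl
@[simp] theorem enc_true : enc true = .node .nil .nil := rfl
@[simp] theorem enc_pair (a : α) (b : β) : enc (a, b) = .node (enc a) (enc b) := rfl
@[simp] theorem enc_nil : enc ([] : List α) = .nil := rfl
@[simp] theorem enc_cons (a : α) (l : List α) : enc (a :: l) = .node (enc a) (enc l) := rfl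
@[simp] theorem enc_none : enc (none : Option α) = .nil := rfl
@[simp] theorem enc_some (a : α) : enc (some a) = .node .nil (enc a) := rfl
end

/-- The expression with all variables replaced by `r`. -/
def Expr.at (r : ℕ) : Expr → Expr
  | .var _ => .var r
  | .nil => .nil
  | .cons a b => .cons (a.at r) (b.at r)
  | .hd a => .hd (a.at r)
  | .tl a => .tl (a.at r)

theorem Expr.eval_at (r : ℕ) (s : Store) (e : Expr) : (e.at r).eval s = e.eval fun _ => s r := by
  induction e <;> simp_all [Expr.at, Expr.eval]

variable {α β γ δ ε : Type} [Enc α] [Enc β] [Enc γ] [Enc δ] [Enc ε]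

/-- Whatever the base register `r` is, the program `P r` carries out the dialogue `d` in at most
`T` steps if register `r` holds `a`; it leaves the result in `r` and the registers below `r`
untouched. -/
def Computes (P : ℕ → Prog) (T : ℕ) (a : α) (d : Dialog Val Val β) : Prop :=
  ∀ ⦃γ : Type⦄ (Rel : γ → Store → Prop) (n r : ℕ) (s : Store) (ps : List Prog)
    (k : β → Dialog Val Val γ), s r = enc a →
    (∀ b s', d.Leaf (fun _ => True) b → s' r = enc b → (∀ x < r, s' x = s x) →
      Follows Rel n (ps, s') (k b)) →
    Follows Rel (T + n) (P r :: ps, s) (d.bind k)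

/-- Run `P`, then `Q`. -/
def seqProg (P Q : ℕ → Prog) (r : ℕ) : Prog := .seq (P r) (Q r)

/-- Run `P` and keep the input next to the output. -/
def keepProg (P : ℕ → Prog) (r : ℕ) : Prog :=
  .seq (.assign (r + 1) (.var r)) (.seq (P (r + 1)) (.assign r (.cons (.var r) (.var (r + 1)))))

/-- Branch on the result of `P`. -/
def iteProg (P Q Q' : ℕ → Prog) (r : ℕ) : Prog :=
  .seq (.assign (r + 1) (.var r)) (.seq (P (r + 1)) (.ite (r + 1) (Q r) (Q' r)))

/-- The loop over a list, with an environment and an accumulator. -/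
def foldProg (Q : ℕ → Prog) (r : ℕ) : Prog :=
  .seq (.assign (r + 1) (.hd (.hd (.var r)))) <| .seq (.assign (r + 2) (.tl (.hd (.var r)))) <|
  .seq (.assign r (.tl (.var r))) <| .seq
    (.loop r <| .seq (.assign (r + 3) (.cons (.cons (.var (r + 1)) (.var (r + 2))) (.hd (.var r)))) <|
      .seq (Q (r + 3)) <| .seq (.assign (r + 2) (.var (r + 3))) (.assign r (.tl (.var r)))) <|
  .assign r (.var (r + 2))

namespace Computes

theorem mono {P : ℕ → Prog} {T T' : ℕ} {a : α} {d : Dialog Val Val β} (h : Computes P T a d)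
    (hT : T ≤ T') : Computes P T' a d :=
  fun _ Rel n r s ps k hr hk => (h Rel n r s ps k hr hk).mono (by omega)

theorem expr (e : Expr) (a : α) (b : β) (h : e.eval (fun _ => enc a) = enc b) :
    Computes (fun r => .assign r (e.at r)) 1 a (.ret b) := by
  intro γ Rel n r s ps k hr hk
  rw [add_comm]
  refine .tick (c' := (ps, Function.update s r (enc b))) ?_ (hk b _ rfl (by simp) ?_)
  · rw [next, Expr.eval_at, hr, h]
  · intro x hx; simp [hx.ne]

theorem seq {P Q : ℕ → Prog} {T T' : ℕ} {a : α} {d : Dialog Val Val β}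
    {f : β → Dialog Val Val γ} (hP : Computes P T a d)
    (hQ : ∀ b, d.Leaf (fun _ => True) b → Computes Q T' b (f b)) :
    Computes (seqProg P Q) (T + T' + 1) a (d.bind f) := by
  intro δ Rel n r s ps k hr hk
  rw [show T + T' + 1 + n = T + (T' + n) + 1 by ring, bind_assoc]
  refine .tick rfl (hP Rel (T' + n) r s (Q r :: ps) _ hr fun b s' hb hs' hx => ?_)
  refine hQ b hb Rel n r s' ps k hs' fun c s'' hc hs'' hx' => ?_
  exact hk c s'' (leaf_bind.2 ⟨b, hb, hc⟩) hs'' fun x h => (hx' x h).trans (hx x h)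

/-- Keep the input next to the output. -/
theorem keep {P : ℕ → Prog} {T : ℕ} {a : α} {d : Dialog Val Val β} (hP : Computes P T a d) :
    Computes (keepProg P) (T + 4) a (d.bind fun b => .ret (a, b)) := by
  intro δ Rel n r s ps k hr hk
  rw [show T + 4 + n = (T + (n + 1)) + 1 + 1 + 1 by ring, bind_assoc]
  refine .tick rfl (.tick rfl (.tick rfl ?_))
  refine hP Rel _ _ _ _ _ (by simp [Expr.eval, hr]) fun b s' hb hs' hx => ?_
  refine .tick rfl (hk (a, b) _ (leaf_bind.2 ⟨b, hb, rfl⟩) ?_ fun x hxr => ?_)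
  · have := hx r (by omega)
    rw [Function.update_of_ne (by omega)] at this
    simp [Expr.eval, this, hs', hr]
  · rw [Function.update_of_ne hxr.ne, hx x (by omega), Function.update_of_ne (by omega)]

theorem ite {P Q Q' : ℕ → Prog} {T T' : ℕ} {a : α} {t : Bool} {d d' : Dialog Val Val β}
    (hP : Computes P T a (.ret t)) (hQ : t = true → Computes Q T' a d)
    (hQ' : t = false → Computes Q' T' a d') :
    Computes (iteProg P Q Q') (T + T' + 4) a (cond t d d') := by
  intro δ Rel n r s ps k hr hk
  rw [show T + T' + 4 + n = (T + ((T' + n) + 1)) + 1 + 1 + 1 by ring]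
  refine .tick rfl (.tick rfl (.tick rfl ?_))
  have := hP Rel ((T' + n) + 1) (r + 1) (Function.update s (r + 1) (s r))
    (.ite (r + 1) (Q r) (Q' r) :: ps) (fun _ => (cond t d d').bind k) (by simp [hr])
  refine this fun b s' hb hs' hx => ?_
  have hr' : s' r = enc a := by rw [hx r (by omega), Function.update_of_ne (by omega), hr]
  have hx' : ∀ x < r, s' x = s x := fun x h => by
    rw [hx x (by omega), Function.update_of_ne (by omega)]
  obtain rfl := hb
  cases b with
  | true =>
    refine .tick (by rw [next]) ?_
    rw [if_neg (by simp [hs'])]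
    exact hQ rfl Rel n r s' ps k hr' fun c s'' hc hs hx'' =>
      hk c s'' hc hs fun x h => (hx'' x h).trans (hx' x h)
  | false =>
    refine .tick (by rw [next]) ?_
    rw [if_pos (by simp [hs'])]
    exact hQ' rfl Rel n r s' ps k hr' fun c s'' hc hs hx'' =>
      hk c s'' hc hs fun x h => (hx'' x h).trans (hx' x h)

/-- `I i` is what is known of the accumulator after `i` rounds; the body only has to be fast on
accumulators that really occur. The overhead of a round is seven steps: four before the body (loop
test, sequencing, assignment, sequencing) and three after it. -/
theorem fold_loop {ζ : Type} {Q : ℕ → Prog} {T : ℕ} {e : ε} {g : α → γ → Dialog Val Val α} {r : ℕ}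
    (l : List γ) (I : ℕ → α → Prop)
    (hQ : ∀ (i : ℕ) (hi : i < l.length) (a : α), I i a → Computes Q T ((e, a), l[i]) (g a l[i]) ∧
      ∀ b, (g a l[i]).Leaf (fun _ => True) b → I (i + 1) b) {a : α} (ha : I 0 a)
    (Rel : ζ → Store → Prop) (n : ℕ) (s : Store) (ps : List Prog) (k : α → Dialog Val Val ζ)
    (hr : s r = enc l) (h1 : s (r + 1) = enc e) (h2 : s (r + 2) = enc a)
    (hk : ∀ b s', (foldM g a l).Leaf (fun _ => True) b → s' (r + 2) = enc b →
      (∀ x < r, s' x = s x) → Follows Rel n (ps, s') (k b)) :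
    Follows Rel (l.length * (T + 7) + 1 + n)
      ((.loop r <| .seq (.assign (r + 3)
        (.cons (.cons (.var (r + 1)) (.var (r + 2))) (.hd (.var r)))) <|
      .seq (Q (r + 3)) <| .seq (.assign (r + 2) (.var (r + 3))) (.assign r (.tl (.var r)))) :: ps, s)
      ((foldM g a l).bind k) := by
  induction l generalizing s a I with
  | nil =>
    rw [show ([] : List γ).length * (T + 7) + 1 + n = n + 1 by simp; ring]
    refine .tick (by rw [next]) ?_
    rw [if_pos (by simp [hr])]
    exact hk a s rfl h2 fun _ _ => rfl
  | cons y l ih =>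
    rw [show (y :: l).length * (T + 7) + 1 + n =
      (T + ((l.length * (T + 7) + 1 + n) + 1 + 1 + 1)) + 1 + 1 + 1 + 1 by simp; ring]
    refine .tick (by rw [next]) ?_
    rw [if_neg (by simp [hr])]
    refine .tick rfl (.tick rfl (.tick rfl ?_))
    obtain ⟨hc, hI⟩ := hQ 0 (by simp) a ha
    rw [foldM_cons, bind_assoc]
    refine hc Rel _ _ _ _ _ (by simp [Expr.eval, hr, h1, h2, Val.left]) fun b s' hb hs' hx => ?_
    have e0 := hx r (by omega)
    have e1 := hx (r + 1) (by omega)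
    rw [Function.update_of_ne (by omega)] at e0 e1
    refine .tick rfl (.tick rfl (.tick rfl ?_))
    refine ih (fun i => I (i + 1)) (fun i hi a => hQ (i + 1) (by simpa using hi) a)
      (hI b hb) _ ?_ ?_ ?_ ?_
    · simp [Expr.eval, e0, hr, Val.right]
    · simp [e1, h1]
    · simp [Expr.eval, hs']
    · intro c s'' hc' h2' hx''
      refine hk c s'' (leaf_bind.2 ⟨b, hb, hc'⟩) h2' fun x h => ?_
      rw [hx'' x h, Function.update_of_ne (by omega), Function.update_of_ne (by omega),
        hx x (by omega), Function.update_of_ne (by omega)]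

theorem fold {Q : ℕ → Prog} {T : ℕ} {e : ε} {g : α → γ → Dialog Val Val α}
    {l : List γ} (I : ℕ → α → Prop)
    (hQ : ∀ (i : ℕ) (hi : i < l.length) (a : α), I i a → Computes Q T ((e, a), l[i]) (g a l[i]) ∧
      ∀ b, (g a l[i]).Leaf (fun _ => True) b → I (i + 1) b) {a : α} (ha : I 0 a) :
    Computes (foldProg Q) (l.length * (T + 7) + 10) ((e, a), l) (foldM g a l) := by
  intro δ Rel n r s ps k hr hk
  rw [show l.length * (T + 7) + 10 + n = (l.length * (T + 7) + 1 + (n + 1)) + 1 + 1 + 1 + 1 + 1 + 1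
    + 1 + 1 by ring]
  refine .tick rfl (.tick rfl (.tick rfl (.tick rfl (.tick rfl (.tick rfl (.tick rfl ?_))))))
  refine .succ ?_
  refine fold_loop l I hQ ha Rel (n + 1) _ _ k ?_ ?_ ?_ ?_
  · simp [Expr.eval, hr, Val.right]
  · simp [Expr.eval, hr, Val.left]
  · simp [Expr.eval, hr, Val.left, Val.right]
  · intro b s' hb hs' hx
    refine .tick rfl (hk b _ hb (by simp [Expr.eval, hs']) fun x h => ?_)
    rw [Function.update_of_ne (by omega), hx x h]
    simp [h.ne, show x ≠ r + 1 by omega, show x ≠ r + 2 by omega]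

theorem flipCoin (a : α) :
    Computes (fun r => .flip r) 1 a (.flip fun b => (.ret b : Dialog Val Val Bool)) := by
  intro γ Rel n r s ps k hr hk
  rw [add_comm]
  refine .flip (k := fun b => (ps, Function.update s r (encBool b))) rfl fun b => ?_
  exact hk b _ ⟨b, rfl⟩ (by simp [enc]) fun x hx => by simp [hx.ne]

theorem query (v : Val) :
    Computes (fun r => .query r (.var r)) 1 v (.ask v fun a => (.ret a : Dialog Val Val Val)) := by
  intro γ Rel n r s ps k hr hk
  rw [add_comm]
  refine .ask (k := fun b => (ps, Function.update s r b)) ?_ fun b => ?_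
  · rw [next, Expr.eval, hr]; rfl
  · exact hk b _ ⟨b, trivial, rfl⟩ (by simp) fun x hx => by simp [hx.ne]

end Computes

end Tokenization

namespace Tokenization
open Dialog Enc

variable {α β γ δ ε : Type} [Enc α] [Enc β] [Enc γ] [Enc δ] [Enc ε]

/-! ## Polynomial bounds -/

theorem polynomial_eval_mono (p : Polynomial ℕ) : Monotone fun n => p.eval n := by
  intro a b h
  simp only [Polynomial.eval_eq_sum_range]
  gcongr

namespace PolyBounded

theorem eval (p : Polynomial ℕ) : PolyBounded fun κ => p.eval κ := ⟨p, fun _ => le_rfl⟩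

theorem const (c : ℕ) : PolyBounded fun _ => c := ⟨.C c, fun _ => by simp⟩

theorem id : PolyBounded fun κ => κ := ⟨.X, fun _ => by simp⟩

variable {g h : ℕ → ℕ}

theorem add (hg : PolyBounded g) (hh : PolyBounded h) : PolyBounded fun κ => g κ + h κ := by
  obtain ⟨p, hp⟩ := hg
  obtain ⟨q, hq⟩ := hh
  exact ⟨p + q, fun κ => by simpa using add_le_add (hp κ) (hq κ)⟩

theorem mul (hg : PolyBounded g) (hh : PolyBounded h) : PolyBounded fun κ => g κ * h κ := by
  obtain ⟨p, hp⟩ := hg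
  obtain ⟨q, hq⟩ := hh
  exact ⟨p * q, fun κ => by simpa using Nat.mul_le_mul (hp κ) (hq κ)⟩

theorem mono (hg : PolyBounded g) (hh : ∀ κ, h κ ≤ g κ) : PolyBounded h := by
  obtain ⟨p, hp⟩ := hg
  exact ⟨p, fun κ => (hh κ).trans (hp κ)⟩

theorem comp_eval (p : Polynomial ℕ) (hg : PolyBounded g) : PolyBounded fun κ => p.eval (g κ) := by
  obtain ⟨q, hq⟩ := hg
  exact ⟨p.comp q, fun κ => by simpa using polynomial_eval_mono p (hq κ)⟩

end PolyBounded

/-- The height of a tree. -/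
def Val.ht : Val → ℕ
  | .nil => 0
  | .node l r => max l.ht r.ht + 1

@[simp] theorem Val.ht_nil : Val.nil.ht = 0 := rfl
@[simp] theorem Val.ht_node (l r : Val) : (Val.node l r).ht = max l.ht r.ht + 1 := rfl

theorem length_le_ht (l : List α) : l.length ≤ (enc l).ht := by
  induction l with
  | nil => simp
  | cons a l ih => simp; omega

theorem ht_le_of_mem {l : List α} {a : α} (h : a ∈ l) : (enc a).ht ≤ (enc l).ht := by
  induction h with
  | head => simp; omega
  | tail _ _ ih => simp; omega

theorem ht_list_le {l : List α} {b : ℕ} (h : ∀ a ∈ l, (enc a).ht ≤ b) :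
    (enc l).ht ≤ l.length + b := by
  induction l with
  | nil => simp
  | cons a l ih =>
    have := ih fun x hx => h x (by simp [hx])
    have := h a (by simp)
    simp; omega

/-- The size of an expression. -/
def Expr.size : Expr → ℕ
  | .var _ => 0
  | .nil => 0
  | .cons a b => max a.size b.size + 1
  | .hd a => a.size
  | .tl a => a.size

theorem Val.ht_left (v : Val) : v.left.ht ≤ v.ht := by cases v <;> simp [Val.left]; omega
theorem Val.ht_right (v : Val) : v.right.ht ≤ v.ht := by cases v <;> simp [Val.right]; omega

theorem Expr.ht_eval_le (e : Expr) {s : Store} {b : ℕ} (h : ∀ x, (s x).ht ≤ b) :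
    (e.eval s).ht ≤ b + e.size := by
  induction e with
  | var x => simpa [Expr.eval, Expr.size] using h x
  | nil => simp [Expr.eval]
  | cons a c iha ihc => simp [Expr.eval, Expr.size]; omega
  | hd a ih => exact (Val.ht_left _).trans ih
  | tl a ih => exact (Val.ht_right _).trans ih

/-! ## Deterministic functions computable in time polynomial in the height -/

-- Inputs are measured by height and not by size: pairing a register with itself doubles the size in
-- one step but adds only one to the height. The height bounds the length of a list and grows
-- linearly in time. The second clause, on the height of the result, is what makes the notion closed
-- under composition.
@[fun_prop]
def PT (f : α → β) : Prop :=
  ∃ (P : ℕ → Prog) (p q : Polynomial ℕ), ∀ a,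
    Computes P (p.eval (enc a).ht) a (.ret (f a)) ∧ (enc (f a)).ht ≤ q.eval (enc a).ht

namespace PT

theorem expr {f : α → β} (e : Expr) (h : ∀ a, e.eval (fun _ => enc a) = enc (f a)) : PT f := by
  refine ⟨fun r => .assign r (e.at r), .C 1, .X + .C e.size, fun a => ⟨?_, ?_⟩⟩
  · simpa using Computes.expr e a (f a) (h a)
  · simpa [← h] using e.ht_eval_le fun _ => le_rfl

@[fun_prop] theorem id : PT (id : α → α) := .expr (.var 0) fun _ => rfl

@[fun_prop] theorem id' : PT (fun a : α => a) := .expr (.var 0) fun _ => rfl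

/-- The expression denoting a given tree. -/
def constExpr : Val → Expr
  | .nil => .nil
  | .node l r => .cons (constExpr l) (constExpr r)

@[fun_prop] theorem const (b : β) : PT fun _ : α => b := by
  refine .expr (constExpr (enc b)) fun a => ?_
  generalize enc b = v
  induction v <;> simp_all [constExpr, Expr.eval]

@[fun_prop] theorem comp {g : β → γ} {f : α → β} (hg : PT g) (hf : PT f) : PT fun a => g (f a) := by
  obtain ⟨P, p, q, h⟩ := hf
  obtain ⟨P', p', q', h'⟩ := hg
  refine ⟨seqProg P P', p + p'.comp q + 1, q'.comp q, fun a => ⟨?_, ?_⟩⟩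
  · have := (h a).1.seq (f := fun b => .ret (g b)) (Q := P') (T' := p'.eval (q.eval (enc a).ht))
      fun b hb => by
        obtain rfl := hb
        exact (h' (f a)).1.mono (polynomial_eval_mono p' (h a).2)
    simpa using this
  · simpa using (h' (f a)).2.trans (polynomial_eval_mono q' (h a).2)

theorem keep {f : α → β} (hf : PT f) : PT fun a => (a, f a) := by
  obtain ⟨P, p, q, h⟩ := hf
  refine ⟨keepProg P, p + .C 4, .X + q + 1, fun a => ⟨by simpa using (h a).1.keep, ?_⟩⟩
  have := (h a).2
  simp; omega

@[fun_prop] theorem fst {f : α → β × γ} (hf : PT f) : PT fun a => (f a).1 :=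
  comp (g := Prod.fst) (.expr (.hd (.var 0)) fun _ => rfl) hf

@[fun_prop] theorem snd {f : α → β × γ} (hf : PT f) : PT fun a => (f a).2 :=
  comp (g := Prod.snd) (.expr (.tl (.var 0)) fun _ => rfl) hf

@[fun_prop] theorem prodMk {f : α → β} {g : α → γ} (hf : PT f) (hg : PT g) :
    PT fun a => (f a, g a) := by
  have h1 : PT fun p : (α × β) × γ => (p.1.2, p.2) :=
    .expr (.cons (.tl (.hd (.var 0))) (.tl (.var 0))) fun _ => rfl
  have h2 : PT fun p : α × β => g p.1 := comp hg (fst id)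
  exact comp h1 (comp h2.keep hf.keep)

@[fun_prop] theorem cond {t : α → Bool} {f g : α → β} (ht : PT t) (hf : PT f) (hg : PT g) :
    PT fun a => cond (t a) (f a) (g a) := by
  obtain ⟨P, p, q, h⟩ := ht
  obtain ⟨P1, p1, q1, h1⟩ := hf
  obtain ⟨P2, p2, q2, h2⟩ := hg
  refine ⟨iteProg P P1 P2, p + (p1 + p2) + 4, q1 + q2, fun a => ⟨?_, ?_⟩⟩
  · have := (h a).1.ite (T' := p1.eval (enc a).ht + p2.eval (enc a).ht)
      (fun _ => (h1 a).1.mono (by omega)) (fun _ => (h2 a).1.mono (by omega))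
    cases hta : t a <;> simpa [hta] using this
  · have := (h1 a).2
    have := (h2 a).2
    cases hta : t a <;> simp [hta] <;> omega

/-- Iterating a polynomial-time body may cause exponential growth of the accumulator. A polynomial
bound on all intermediate accumulators, which are the results for the prefixes of the list, excludes
this. -/
theorem foldl_of_bound {l : ε → List γ} {init : ε → α} {g : ε → α → γ → α} (hl : PT l)
    (hi : PT init) (hg : PT fun p : (ε × α) × γ => g p.1.1 p.1.2 p.2) (q : Polynomial ℕ)
    (hq : ∀ e l', l' <+: l e → (enc (l'.foldl (g e) (init e))).ht ≤ q.eval (enc e).ht) :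
    PT fun e => (l e).foldl (g e) (init e) := by
  have hin : PT fun e => ((e, init e), l e) := by fun_prop
  obtain ⟨P, p, p', h⟩ := hin
  obtain ⟨Q, r, r', hQ⟩ := hg
  obtain ⟨_, _, pl, hpl⟩ := hl
  refine ⟨seqProg P (foldProg Q), p + (pl * (r.comp (.X + q + pl + 2) + 7) + 10) + 1, q, fun e =>
    ⟨?_, hq e (l e) (List.prefix_rfl)⟩⟩
  have hlen : (l e).length ≤ pl.eval (enc e).ht := (length_le_ht _).trans (hpl e).2
  have := (h e).1.seq (f := fun b => foldM (fun a x => .ret (g b.1.1 a x)) b.1.2 b.2)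
    (Q := foldProg Q)
    (T' := pl.eval (enc e).ht * (r.eval ((enc e).ht + q.eval (enc e).ht + pl.eval (enc e).ht + 2) + 7) + 10)
    fun b hb => by
      obtain rfl := hb
      refine (Computes.fold (T := r.eval ((enc e).ht + q.eval (enc e).ht + pl.eval (enc e).ht + 2))
        (fun i a => a = ((l e).take i).foldl (g e) (init e)) (fun i hi a ha => ?_) rfl).mono
        (by gcongr)
      subst ha
      refine ⟨(hQ ((e, _), (l e)[i])).1.mono (polynomial_eval_mono r ?_), fun b hb => ?_⟩
      · have h1 := hq e _ (List.take_prefix i (l e))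
        have h2 := (ht_le_of_mem (List.getElem_mem hi)).trans (hpl e).2
        simp; omega
      · obtain rfl := hb
        rw [List.take_add_one, List.foldl_append]
        simp [hi]
  simpa [foldM_ret] using this

/-- If a round adds at most a constant to the maximum of the heights involved, the accumulator grows
linearly in the number of rounds, so `foldl_of_bound` applies. -/
theorem foldl {l : ε → List γ} {init : ε → α} {g : ε → α → γ → α} (hl : PT l)
    (hi : PT init) (hg : PT fun p : (ε × α) × γ => g p.1.1 p.1.2 p.2) (c : ℕ)
    (hc : ∀ e a x, (enc (g e a x)).ht ≤ max (enc e).ht (max (enc a).ht (enc x).ht) + c) :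
    PT fun e => (l e).foldl (g e) (init e) := by
  have hl' := hl
  have hi' := hi
  obtain ⟨_, _, pl, hpl⟩ := hl'
  obtain ⟨_, _, pi, hpi⟩ := hi'
  refine foldl_of_bound hl hi hg (.X + pi + pl + pl * .C c) fun e l' hl' => ?_
  have key : ∀ (l' : List γ) (a : α), (enc (l'.foldl (g e) a)).ht ≤
      max (enc e).ht (max (enc a).ht (enc l').ht) + l'.length * c := by
    intro l'
    induction l' with
    | nil => intro a; simp
    | cons x l' ih =>
      intro a
      have h1 := ih (g e a x)
      have h2 := hc e a x
      simp only [List.foldl_cons, List.length_cons, enc_cons, Val.ht_node, Nat.succ_mul] at *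
      omega
  have h1 := key l' (init e)
  have h2 : l'.length ≤ pl.eval (enc e).ht :=
    (hl'.length_le.trans (length_le_ht _)).trans (hpl e).2
  have h3 : (enc l').ht ≤ (enc (l e)).ht := by
    obtain ⟨t, ht⟩ := hl'
    rw [← ht]
    clear * -
    induction l' with
    | nil => simp
    | cons x l' ih => simp; omega
  have h4 := (hpi e).2
  have h5 := (hpl e).2
  have h6 := Nat.mul_le_mul_right c h2
  simp only [Polynomial.eval_add, Polynomial.eval_X, Polynomial.eval_mul, Polynomial.eval_C]
  omega

end PT

/-! ## Dialogues carried out in time polynomial in the security parameter -/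

/-- Unlike in `PT`, time is measured in the security parameter, on inputs restricted by `S`, and the
program may interact. One program serves all parameters. Nothing is said about the heights of
results; these are controlled by invariants of the possible results. -/
def FP (S : ℕ → α → Prop) (g : ℕ → α → Dialog Val Val β) : Prop :=
  ∃ (P : ℕ → Prog) (p : Polynomial ℕ), ∀ κ a, S κ a → Computes P (p.eval κ) a (g κ a)

/-- The possible results, whatever the answers. -/
abbrev Dialog.AnyLeaf {Q R α : Type} (d : Dialog Q R α) (a : α) : Prop := d.Leaf (fun _ => True) a

/-- The inputs satisfying `S` have polynomial height. -/
def PolyHeight (S : ℕ → α → Prop) : Prop :=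
  ∃ b : ℕ → ℕ, PolyBounded b ∧ ∀ κ a, S κ a → (enc a).ht ≤ b κ

namespace FP

variable {S S' : ℕ → α → Prop}

theorem mono {g : ℕ → α → Dialog Val Val β} (h : FP S g) (hS : ∀ κ a, S' κ a → S κ a) :
    FP S' g := by
  obtain ⟨P, p, h⟩ := h
  exact ⟨P, p, fun κ a ha => h κ a (hS κ a ha)⟩

theorem congr {g g' : ℕ → α → Dialog Val Val β} (h : FP S g) (hS : ∀ κ a, S κ a → g κ a = g' κ a) :
    FP S g' := by
  obtain ⟨P, p, h⟩ := h
  exact ⟨P, p, fun κ a ha => hS κ a ha ▸ h κ a ha⟩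

theorem of_pt {f : α → β} (hf : PT f) (hS : PolyHeight S) : FP S fun _ a => .ret (f a) := by
  obtain ⟨P, p, _, h⟩ := hf
  obtain ⟨b, hb, hS⟩ := hS
  obtain ⟨q, hq⟩ := hb.comp_eval p
  exact ⟨P, q, fun κ a ha => (h a).1.mono ((polynomial_eval_mono p (hS κ a ha)).trans (hq κ))⟩

theorem comp {S' : ℕ → β → Prop} {g : ℕ → α → Dialog Val Val β} {g' : ℕ → β → Dialog Val Val γ}
    (hg : FP S g) (hg' : FP S' g') (h : ∀ κ a b, S κ a → (g κ a).AnyLeaf b → S' κ b) :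
    FP S fun κ a => (g κ a).bind (g' κ) := by
  obtain ⟨P, p, hP⟩ := hg
  obtain ⟨P', p', hP'⟩ := hg'
  refine ⟨seqProg P P', p + p' + 1, fun κ a ha => ?_⟩
  simpa using (hP κ a ha).seq fun b hb => hP' κ b (h κ a b ha hb)

theorem comp_pt {S' : ℕ → β → Prop} {f : α → β} {g' : ℕ → β → Dialog Val Val γ}
    (hg' : FP S' g') (hf : PT f) (hS : PolyHeight S) (h : ∀ κ a, S κ a → S' κ (f a)) :
    FP S fun κ a => g' κ (f a) :=
  (of_pt hf hS).comp hg' fun κ a b ha hb => by obtain rfl := hb; exact h κ a ha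

theorem keep {g : ℕ → α → Dialog Val Val β} (hg : FP S g) :
    FP S fun κ a => (g κ a).bind fun b => .ret (a, b) := by
  obtain ⟨P, p, hP⟩ := hg
  exact ⟨keepProg P, p + 4, fun κ a ha => by simpa using (hP κ a ha).keep⟩

theorem bind {S' : ℕ → α × β → Prop} {g : ℕ → α → Dialog Val Val β}
    {g' : ℕ → α → β → Dialog Val Val γ} (hg : FP S g) (hg' : FP S' fun κ p => g' κ p.1 p.2)
    (h : ∀ κ a b, S κ a → (g κ a).AnyLeaf b → S' κ (a, b)) :
    FP S fun κ a => (g κ a).bind (g' κ a) := by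
  refine (hg.keep.comp hg' fun κ a p ha hp => ?_).congr fun κ a _ => by simp [bind_assoc]
  obtain ⟨b, hb, rfl⟩ := leaf_bind.1 hp
  exact h κ a b ha hb

theorem cond {t : α → Bool} {g g' : ℕ → α → Dialog Val Val β} (ht : PT t) (hS : PolyHeight S)
    (hg : FP (fun κ a => S κ a ∧ t a = true) g) (hg' : FP (fun κ a => S κ a ∧ t a = false) g') :
    FP S fun κ a => cond (t a) (g κ a) (g' κ a) := by
  obtain ⟨P, p, hP⟩ := of_pt ht hS
  obtain ⟨P1, p1, h1⟩ := hg
  obtain ⟨P2, p2, h2⟩ := hg'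
  refine ⟨iteProg P P1 P2, p + (p1 + p2) + 4, fun κ a ha => ?_⟩
  have := (hP κ a ha).ite (T' := p1.eval κ + p2.eval κ)
      (fun h => (h1 κ a ⟨ha, h⟩).mono (by omega)) (fun h => (h2 κ a ⟨ha, h⟩).mono (by omega))
  simpa using this

/-- The number of rounds depends on the length of the list only. The accumulator may be of unbounded
height, as happens when the answer of an unrestricted oracle is read. -/
theorem foldM_of_length {S : ℕ → (ε × α) × List γ → Prop} {S' : ℕ → (ε × α) × γ → Prop}
    {g : ℕ → ε → α → γ → Dialog Val Val α}
    (hg : FP S' fun κ p => g κ p.1.1 p.1.2 p.2) (I : ℕ → (ε × α) × List γ → ℕ → α → Prop)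
    {b : ℕ → ℕ} (hb : PolyBounded b) (hS : ∀ κ p, S κ p → p.2.length ≤ b κ)
    (h0 : ∀ κ p, S κ p → I κ p 0 p.1.2)
    (hI : ∀ κ p, S κ p → ∀ i < p.2.length, ∀ x ∈ p.2, ∀ a, I κ p i a →
      S' κ ((p.1.1, a), x) ∧ ∀ b, (g κ p.1.1 a x).AnyLeaf b → I κ p (i + 1) b) :
    FP S fun κ p => Dialog.foldM (g κ p.1.1) p.1.2 p.2 := by
  obtain ⟨Q, q, hQ⟩ := hg
  obtain ⟨pb, hb⟩ := hb
  refine ⟨foldProg Q, pb * (q + 7) + 10, fun κ p hp => ?_⟩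
  refine (Computes.fold (T := q.eval κ) (I κ p) (fun i hi a ha => ?_) (h0 κ p hp)).mono ?_
  · obtain ⟨h1, h2⟩ := hI κ p hp i hi _ (List.getElem_mem hi) a ha
    exact ⟨hQ κ _ h1, h2⟩
  · have h1 := (hS κ p hp).trans (hb κ)
    simp only [Polynomial.eval_add, Polynomial.eval_mul, Polynomial.eval_ofNat]
    gcongr

theorem foldM {S : ℕ → (ε × α) × List γ → Prop} {S' : ℕ → (ε × α) × γ → Prop}
    {g : ℕ → ε → α → γ → Dialog Val Val α}
    (hg : FP S' fun κ p => g κ p.1.1 p.1.2 p.2) (I : ℕ → (ε × α) × List γ → ℕ → α → Prop)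
    (hS : PolyHeight S) (h0 : ∀ κ p, S κ p → I κ p 0 p.1.2)
    (hI : ∀ κ p, S κ p → ∀ i < p.2.length, ∀ x ∈ p.2, ∀ a, I κ p i a →
      S' κ ((p.1.1, a), x) ∧ ∀ b, (g κ p.1.1 a x).AnyLeaf b → I κ p (i + 1) b) :
    FP S fun κ p => Dialog.foldM (g κ p.1.1) p.1.2 p.2 := by
  obtain ⟨b, hb, hS⟩ := hS
  refine foldM_of_length hg I hb (fun κ p hp => ?_) h0 hI
  have h1 := length_le_ht p.2
  have h2 := hS κ p hp
  have h3 : (enc p).ht = max (enc p.1).ht (enc p.2).ht + 1 := rfl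
  omega

theorem flipCoin : FP (fun _ (_ : Unit) => True)
    fun _ _ => .flip fun b => (.ret b : Dialog Val Val Bool) :=
  ⟨fun r => .flip r, .C 1, fun _ a _ => by simpa using Computes.flipCoin a⟩

theorem query : FP (fun _ (_ : Val) => True)
    fun _ v => .ask v fun a => (.ret a : Dialog Val Val Val) :=
  ⟨fun r => .query r (.var r), .C 1, fun _ v _ => by simpa using Computes.query v⟩

end FP

end Tokenization

namespace Tokenization
open Dialog Enc

variable {α β γ δ ε : Type} [Enc α] [Enc β] [Enc γ] [Enc δ] [Enc ε]

/-! ## Elementary functions on lists of bits -/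

abbrev Bits := List Bool

/-- Whether a tree is non-empty. -/
def Val.isNode : Val → Bool
  | .nil => false
  | .node _ _ => true

@[simp] theorem isNode_enc_bool (b : Bool) : (enc b).isNode = b := by cases b <;> rfl

@[simp] theorem ht_enc_bool_le (b : Bool) : (enc b).ht ≤ 1 := by cases b <;> simp

theorem Computes.isNode (v : Val) : Computes
    (fun r => .ite r (.assign r (.cons .nil .nil)) (.assign r .nil)) 2 v (.ret v.isNode) := by
  intro γ Rel n r s ps k hr hk
  rw [add_comm]
  refine .tick (by rw [next]) ?_
  cases v with
  | nil =>
    rw [if_pos (by simp [hr])]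
    exact .tick rfl (hk _ _ rfl (by simp [Expr.eval, Val.isNode]) fun x hx => by simp [hx.ne])
  | node a b =>
    rw [if_neg (by simp [hr])]
    exact .tick rfl (hk _ _ rfl (by simp [Expr.eval, Val.isNode]) fun x hx => by simp [hx.ne])

namespace PT

/-- A machine sees encodings only, so operations on lists and options reduce to operations on trees.
-/
theorem of_enc {f : α → β} (h : PT fun a => enc (f a)) : PT f := by
  obtain ⟨P, p, q, h⟩ := h
  refine ⟨P, p, q, fun a => ⟨fun _ Rel n r s ps k hr hk => ?_, (h a).2⟩⟩
  exact (h a).1 Rel n r s ps (fun _ => k (f a)) hr fun b s' hb hs' hx =>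
    hk (f a) s' rfl (by obtain rfl := hb; exact hs') hx

@[fun_prop] theorem toVal {f : α → β} (hf : PT f) : PT fun a => enc (f a) :=
  comp (g := fun b : β => enc b) (.expr (.var 0) fun _ => rfl) hf

@[fun_prop] theorem isNode {f : α → Val} (hf : PT f) : PT fun a => (f a).isNode := by
  refine comp (g := Val.isNode) ⟨fun r => .ite r (.assign r (.cons .nil .nil)) (.assign r .nil),
    .C 2, .C 1, fun a => ⟨?_, ?_⟩⟩ hf
  · simpa using Computes.isNode a
  · simp

@[fun_prop] theorem left {f : α → Val} (hf : PT f) : PT fun a => (f a).left :=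
  comp (g := Val.left) (.expr (.hd (.var 0)) fun _ => rfl) hf

@[fun_prop] theorem right {f : α → Val} (hf : PT f) : PT fun a => (f a).right :=
  comp (g := Val.right) (.expr (.tl (.var 0)) fun _ => rfl) hf

@[fun_prop] theorem node {f g : α → Val} (hf : PT f) (hg : PT g) :
    PT fun a => Val.node (f a) (g a) :=
  comp (g := fun p : Val × Val => Val.node p.1 p.2)
    (.expr (.cons (.hd (.var 0)) (.tl (.var 0))) fun _ => rfl) (prodMk hf hg)

@[fun_prop] theorem not {f : α → Bool} (hf : PT f) : PT fun a => !(f a) := by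
  have : PT fun a => _root_.cond (f a) false true := by fun_prop
  convert this using 2 with a; cases f a <;> rfl

@[fun_prop] theorem and {f g : α → Bool} (hf : PT f) (hg : PT g) : PT fun a => f a && g a := by
  have : PT fun a => _root_.cond (f a) (g a) false := by fun_prop
  convert this using 2 with a; cases f a <;> rfl

@[fun_prop] theorem or {f g : α → Bool} (hf : PT f) (hg : PT g) : PT fun a => f a || g a := by
  have : PT fun a => _root_.cond (f a) true (g a) := by fun_prop
  convert this using 2 with a; cases f a <;> rfl

@[fun_prop] theorem xor {f g : α → Bool} (hf : PT f) (hg : PT g) :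
    PT fun a => Bool.xor (f a) (g a) := by
  have : PT fun a => _root_.cond (f a) (!(g a)) (g a) := by fun_prop
  convert this using 2 with a; cases f a <;> cases g a <;> rfl

@[fun_prop] theorem cons {f : α → β} {g : α → List β} (hf : PT f) (hg : PT g) :
    PT fun a => f a :: g a := by
  have : PT fun a => Val.node (enc (f a)) (enc (g a)) := by fun_prop
  exact of_enc this

@[fun_prop] theorem tail {f : α → List β} (hf : PT f) : PT fun a => (f a).tail := by
  have : PT fun a => (enc (f a)).right := by fun_prop
  refine of_enc ?_
  convert this using 2 with a; cases f a <;> rfl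

@[fun_prop] theorem isEmpty {f : α → List β} (hf : PT f) : PT fun a => (f a).isEmpty := by
  have : PT fun a => !(enc (f a)).isNode := by fun_prop
  convert this using 2 with a; cases f a <;> rfl

@[fun_prop] theorem headD {f : α → List β} {g : α → β} (hf : PT f) (hg : PT g) :
    PT fun a => (f a).headD (g a) := by
  have : PT fun a => _root_.cond (f a).isEmpty (enc (g a)) (enc (f a)).left := by fun_prop
  refine of_enc ?_
  convert this using 2 with a; cases f a <;> rfl

@[fun_prop] theorem some {f : α → β} (hf : PT f) : PT fun a => Option.some (f a) := by
  have : PT fun a => Val.node .nil (enc (f a)) := by fun_prop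
  exact of_enc this

@[fun_prop] theorem isSome {f : α → Option β} (hf : PT f) : PT fun a => (f a).isSome := by
  have : PT fun a => (enc (f a)).isNode := by fun_prop
  convert this using 2 with a; cases f a <;> rfl

@[fun_prop] theorem getD {f : α → Option β} {g : α → β} (hf : PT f) (hg : PT g) :
    PT fun a => (f a).getD (g a) := by
  have : PT fun a => _root_.cond (f a).isSome (enc (f a)).right (enc (g a)) := by fun_prop
  refine of_enc ?_
  convert this using 2 with a; cases f a <;> rfl

end PT

theorem ht_tail_le (l : List α) : (enc l.tail).ht ≤ (enc l).ht := by
  cases l <;> simp; omega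

theorem ht_bits_le (l : Bits) : (enc l).ht ≤ l.length + 1 := by
  have := ht_list_le (l := l) (b := 1) fun a _ => ht_enc_bool_le a
  omega

section Functions

@[fun_prop] theorem PT.reverse {f : α → List β} (hf : PT f) : PT fun a => (f a).reverse := by
  have : PT fun a => (f a).foldl (fun acc x => x :: acc) [] := by
    refine PT.foldl hf (by fun_prop) (by fun_prop) 1 fun e a x => ?_
    simp; omega
  simpa using this

@[fun_prop] theorem PT.append {f g : α → List β} (hf : PT f) (hg : PT g) :
    PT fun a => f a ++ g a := by
  have : PT fun a => (f a).reverse.foldl (fun acc x => x :: acc) (g a) := by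
    refine PT.foldl (by fun_prop) (by fun_prop) (by fun_prop) 1 fun e a x => ?_
    simp; omega
  simpa using this

/-- Equality of bit strings. -/
def eqb (a b : Bits) : Bool :=
  let r := a.foldl (fun (p : Bool × Bits) x =>
    (p.1 && (!p.2.isEmpty && !(Bool.xor (p.2.headD false) x)), p.2.tail)) (true, b)
  r.1 && r.2.isEmpty

@[simp] theorem eqb_iff {a b : Bits} : eqb a b = true ↔ a = b := by
  have key : ∀ (a b : Bits) (t : Bool), (let r := a.foldl (fun (p : Bool × Bits) x =>
      (p.1 && (!p.2.isEmpty && !(Bool.xor (p.2.headD false) x)), p.2.tail)) (t, b)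
      r.1 && r.2.isEmpty) = true ↔ t = true ∧ a = b := by
    intro a
    induction a with
    | nil => intro b t; cases b <;> simp
    | cons x a ih =>
      intro b t
      simp only [List.foldl_cons] at ih ⊢
      rw [ih]
      cases b with
      | nil => simp
      | cons y b => cases t <;> cases x <;> cases y <;> simp
  exact (key a b true).trans (by simp)

@[fun_prop] theorem PT.eqb {f g : α → Bits} (hf : PT f) (hg : PT g) :
    PT fun a => eqb (f a) (g a) := by
  have : PT fun a => (f a).foldl (fun (p : Bool × Bits) x =>
      (p.1 && (!p.2.isEmpty && !(Bool.xor (p.2.headD false) x)), p.2.tail)) (true, g a) := by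
    refine PT.foldl hf (by fun_prop) (by fun_prop) 1 fun e a x => ?_
    have := ht_tail_le a.2
    have := ht_enc_bool_le (a.1 && (!a.2.isEmpty && !(Bool.xor (a.2.headD false) x)))
    rcases a with ⟨a1, a2⟩
    simp only [enc_pair, Val.ht_node] at *
    omega
  unfold Tokenization.eqb
  fun_prop

/-- Messages to the token service: the bits of a code, and an additional input. -/
abbrev BMsg := Bits × Bits

def meqb (p q : BMsg) : Bool := eqb p.1 q.1 && eqb p.2 q.2

@[simp] theorem meqb_iff {p q : BMsg} : meqb p q = true ↔ p = q := by
  simp [meqb, Prod.ext_iff]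

@[fun_prop] theorem PT.meqb {f g : α → BMsg} (hf : PT f) (hg : PT g) :
    PT fun a => meqb (f a) (g a) := by
  unfold Tokenization.meqb
  fun_prop

/-- Membership in a list, for a given equality test. -/
def memBy (eq : β → β → Bool) (x : β) (l : List β) : Bool :=
  l.foldl (fun r y => r || eq y x) false

omit [Enc β] in
theorem memBy_iff {eq : β → β → Bool} (heq : ∀ a b, eq a b = true ↔ a = b) {x : β} {l : List β} :
    memBy eq x l = true ↔ x ∈ l := by
  have key : ∀ (l : List β) (t : Bool), l.foldl (fun r y => r || eq y x) t = true ↔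
      t = true ∨ x ∈ l := by
    intro l
    induction l with
    | nil => simp
    | cons y l ih =>
      intro t
      rw [List.foldl_cons, ih, Bool.or_eq_true, heq, List.mem_cons, or_assoc, @eq_comm _ x y]
  exact (key l false).trans (by simp)

theorem PT.memBy {eq : β → β → Bool} (heq : PT fun p : β × β => eq p.1 p.2) {f : α → β}
    {g : α → List β} (hf : PT f) (hg : PT g) : PT fun a => memBy eq (f a) (g a) := by
  have h : PT fun a => (g a).foldl (fun r y => r || eq y (f a)) false := by
    refine PT.foldl (ε := α) (init := fun _ => false) (g := fun a r y => r || eq y (f a)) hg (by fun_prop) ?_ 1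
      fun e a x => ?_
    · have : PT fun p : (α × Bool) × β => eq p.2 (f p.1.1) :=
        PT.comp (g := fun p : β × β => eq p.1 p.2) (f := fun p : (α × Bool) × β => (p.2, f p.1.1)) heq (by fun_prop)
      fun_prop
    · have := ht_enc_bool_le (a || eq x (f e))
      omega
  exact h

def memb (x : Bits) (l : List Bits) : Bool := memBy eqb x l
def mmemb (x : BMsg) (l : List BMsg) : Bool := memBy meqb x l

@[simp] theorem memb_iff {x : Bits} {l : List Bits} : memb x l = true ↔ x ∈ l :=
  memBy_iff fun _ _ => eqb_iff
@[simp] theorem mmemb_iff {x : BMsg} {l : List BMsg} : mmemb x l = true ↔ x ∈ l :=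
  memBy_iff fun _ _ => meqb_iff

@[fun_prop] theorem PT.memb {f : α → Bits} {g : α → List Bits} (hf : PT f) (hg : PT g) :
    PT fun a => memb (f a) (g a) := by
  have h : PT fun p : Bits × Bits => Tokenization.eqb p.1 p.2 := by fun_prop
  exact PT.memBy h hf hg
@[fun_prop] theorem PT.mmemb {f : α → BMsg} {g : α → List BMsg} (hf : PT f) (hg : PT g) :
    PT fun a => mmemb (f a) (g a) := by
  have h : PT fun p : BMsg × BMsg => Tokenization.meqb p.1 p.2 := by fun_prop
  exact PT.memBy h hf hg

/-- The entry of an association list under a given key. -/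
def findb (b : Bits) (l : List (Bits × BMsg)) : Option BMsg :=
  l.foldl (fun r e => cond (eqb e.1 b) (some e.2) r) none

theorem findb_aux (b : Bits) (l : List (Bits × BMsg)) (t : Option BMsg) :
    (l.foldl (fun r e => cond (eqb e.1 b) (some e.2) r) t = t ∨
      ∃ p, (b, p) ∈ l ∧ l.foldl (fun r e => cond (eqb e.1 b) (some e.2) r) t = some p) ∧
    (∀ p, (b, p) ∈ l → ∃ q, l.foldl (fun r e => cond (eqb e.1 b) (some e.2) r) t = some q) := by
  induction l generalizing t with
  | nil => simp
  | cons e l ih =>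
    obtain ⟨h1, h2⟩ := ih (cond (eqb e.1 b) (some e.2) t)
    rw [List.foldl_cons]
    by_cases he : e.1 = b
    · have : eqb e.1 b = true := by simpa using he
      rw [this] at h1 h2 ⊢
      simp only [cond_true] at h1 h2 ⊢
      refine ⟨Or.inr ?_, fun p _ => ?_⟩
      · rcases h1 with h1 | ⟨p, hp, h1⟩
        · exact ⟨e.2, by simp [← he], h1⟩
        · exact ⟨p, by simp [hp], h1⟩
      · rcases h1 with h1 | ⟨p, hp, h1⟩
        exacts [⟨_, h1⟩, ⟨_, h1⟩]
    · have : eqb e.1 b = false := by rw [Bool.eq_false_iff, ne_eq, eqb_iff]; exact he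
      rw [this] at h1 h2 ⊢
      simp only [cond_false] at h1 h2 ⊢
      refine ⟨h1.imp_right fun ⟨p, hp, h⟩ => ⟨p, by simp [hp], h⟩, fun p hp => h2 p ?_⟩
      rcases List.mem_cons.1 hp with rfl | h
      · exact absurd rfl he
      · exact h

theorem mem_of_findb {b : Bits} {l : List (Bits × BMsg)} {p : BMsg} (h : findb b l = some p) :
    (b, p) ∈ l := by
  rcases (findb_aux b l none).1 with h' | ⟨q, hq, h'⟩
  · rw [findb, h'] at h; cases h
  · rw [findb, h'] at h; cases h; exact hq

theorem findb_eq_none {b : Bits} {l : List (Bits × BMsg)} (h : findb b l = none) (p : BMsg) :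
    (b, p) ∉ l := fun hp => by
  obtain ⟨q, hq⟩ := (findb_aux b l none).2 p hp
  rw [findb, hq] at h; cases h

@[fun_prop] theorem PT.findb {f : α → Bits} {g : α → List (Bits × BMsg)} (hf : PT f) (hg : PT g) :
    PT fun a => findb (f a) (g a) := by
  have h : PT fun a => (g a).foldl (fun r e => _root_.cond (Tokenization.eqb e.1 (f a))
      (Option.some e.2) r) none := by
    refine PT.foldl (ε := α) (init := fun _ => none)
      (g := fun a r e => _root_.cond (Tokenization.eqb e.1 (f a)) (Option.some e.2) r) hg (by fun_prop) (by fun_prop) 1 fun e a x => ?_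
    cases Tokenization.eqb x.1 (f e)
    · simp; omega
    · rcases x with ⟨x1, x2⟩
      simp only [cond_true, enc_pair, enc_some, Val.ht_node, Val.ht_nil]
      omega
  exact h

/-- Drop as many elements as the first list has. -/
def dropU (k : List γ) (c : List β) : List β := k.foldl (fun c _ => c.tail) c

omit [Enc β] [Enc γ] in
theorem dropU_eq (k : List γ) (c : List β) : dropU k c = c.drop k.length := by
  induction k generalizing c with
  | nil => rfl
  | cons x k ih =>
    show dropU k c.tail = _
    rw [ih]; cases c <;> simp

@[fun_prop] theorem PT.dropU {f : α → List γ} {g : α → List β} (hf : PT f) (hg : PT g) :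
    PT fun a => dropU (f a) (g a) := by
  have h : PT fun a => (f a).foldl (fun (c : List β) _ => c.tail) (g a) := by
    refine PT.foldl hf hg (by fun_prop) 0 fun e a x => ?_
    have := ht_tail_le a
    omega
  exact h

/-- The successor, as a loop over the bits. -/
theorem incr_eq_foldl (u : Bits) : incr u =
    (let r := u.reverse.foldl (fun (p : Bool × Bits) x => (p.1 && x, Bool.xor p.1 x :: p.2)) (true, [])
    cond r.1 (true :: r.2) r.2) := by
  have key : ∀ (l acc : Bits) (c : Bool),
      (let r := l.foldl (fun (p : Bool × Bits) x => (p.1 && x, Bool.xor p.1 x :: p.2)) (c, acc)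
      cond r.1 (true :: r.2) r.2) = (cond c (incrLow l) l).reverse ++ acc := by
    intro l
    induction l with
    | nil => intro acc c; cases c <;> simp [incrLow]
    | cons x l ih =>
      intro acc c
      simp only [List.foldl_cons] at ih ⊢
      rw [ih]
      cases c <;> cases x <;> simp [incrLow]
  rw [key, incr]; simp

@[fun_prop] theorem PT.incr {f : α → Bits} (hf : PT f) : PT fun a => incr (f a) := by
  have h : PT fun a => (f a).reverse.foldl
      (fun (p : Bool × Bits) x => (p.1 && x, Bool.xor p.1 x :: p.2)) (true, []) := by
    refine PT.foldl (by fun_prop) (by fun_prop) (by fun_prop) 3 fun e a x => ?_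
    rcases a with ⟨a1, a2⟩
    have := ht_enc_bool_le (a1 && x)
    have := ht_enc_bool_le (Bool.xor a1 x)
    simp only [enc_pair, enc_cons, Val.ht_node] at *
    omega
  simp only [incr_eq_foldl]
  fun_prop

/-- The number with the given bits, least significant bit first. -/
def lval : Bits → ℕ
  | [] => 0
  | b :: l => b.toNat + 2 * lval l

theorem lval_append (a b : Bits) : lval (a ++ b) = lval a + 2 ^ a.length * lval b := by
  induction a with
  | nil => simp [lval]
  | cons x a ih => simp [lval, ih]; ring

theorem lval_lt (a : Bits) : lval a < 2 ^ a.length := by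
  induction a with
  | nil => simp [lval]
  | cons x a ih => simp only [lval, List.length_cons, pow_succ]; cases x <;> simp <;> omega

theorem lval_incrLow (a : Bits) : lval (incrLow a) = lval a + 1 := by
  induction a with
  | nil => rfl
  | cons x a ih => cases x <;> simp [incrLow, lval, ih] <;> ring

/-- The string gets longer only when the carry passes through ones alone. This keeps the counter in
`lval_count` free of superfluous digits. -/
theorem length_incrLow (a : Bits) : (incrLow a).length = a.length ∨
    (incrLow a).length = a.length + 1 ∧ lval a + 1 = 2 ^ a.length := by
  induction a with
  | nil => simp [incrLow, lval]
  | cons x a ih =>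
    cases x
    · simp [incrLow]
    · simp only [incrLow, List.length_cons, lval, pow_succ]
      rcases ih with h | h
      · simp [h]
      · right; simp; omega

theorem length_incr_le (u : Bits) : (incr u).length ≤ u.length + 1 := by
  have := length_incrLow u.reverse
  simp only [incr, List.length_reverse] at *
  omega

theorem lval_incr (u : Bits) : lval (incr u).reverse = lval u.reverse + 1 := by
  simp [incr, lval_incrLow]

/-- Binary addition with carry, least significant bit first; the result is one bit longer than the
second argument. -/
def addC (c : Bool) (x y : Bits) : Bits :=
  let r := y.foldl (fun (p : Bool × Bits × Bits) b =>
    ((p.2.1.headD false && b) || (p.1 && (Bool.xor (p.2.1.headD false) b)), p.2.1.tail,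
      Bool.xor p.1 (Bool.xor (p.2.1.headD false) b) :: p.2.2)) (c, x, [])
  (r.1 :: r.2.2).reverse

theorem lval_addC (c : Bool) (x y : Bits) (h : x.length ≤ y.length) :
    lval (addC c x y) = c.toNat + lval x + lval y ∧ (addC c x y).length = y.length + 1 := by
  have key : ∀ (y x acc : Bits) (c : Bool), x.length ≤ y.length →
      (let r := y.foldl (fun (p : Bool × Bits × Bits) b =>
        ((p.2.1.headD false && b) || (p.1 && (Bool.xor (p.2.1.headD false) b)), p.2.1.tail,
        Bool.xor p.1 (Bool.xor (p.2.1.headD false) b) :: p.2.2)) (c, x, acc)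
      lval (r.1 :: r.2.2).reverse = lval acc.reverse + 2 ^ acc.length * (c.toNat + lval x + lval y) ∧
      (r.1 :: r.2.2).reverse.length = acc.length + y.length + 1) := by
    intro y
    induction y with
    | nil =>
      intro x acc c h
      obtain rfl := List.length_eq_zero_iff.1 (Nat.le_zero.1 h)
      simp [lval_append, lval]
    | cons b y ih =>
      intro x acc c h
      simp only [List.foldl_cons] at ih ⊢
      obtain ⟨h1, h2⟩ := ih x.tail (Bool.xor c (Bool.xor (x.headD false) b) :: acc)
        ((x.headD false && b) || (c && (Bool.xor (x.headD false) b))) (by simp at h ⊢; omega)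
      refine ⟨h1.trans ?_, h2.trans ?_⟩
      · simp only [List.reverse_cons, lval_append, List.length_reverse, List.length_cons, pow_succ,
          lval, add_assoc, mul_assoc]
        rw [← mul_add]
        congr 2
        cases x with
        | nil => cases b <;> cases c <;> simp [lval]; omega
        | cons a x => cases a <;> cases b <;> cases c <;> simp [lval] <;> omega
      · simp only [List.length_cons]; ring
  obtain ⟨h1, h2⟩ := key y x [] c h
  exact ⟨h1.trans (by simp [lval]), h2.trans (by simp)⟩

@[fun_prop] theorem PT.addC {c : α → Bool} {f g : α → Bits} (hc : PT c) (hf : PT f) (hg : PT g) :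
    PT fun a => addC (c a) (f a) (g a) := by
  have h : PT fun a => (g a).foldl (fun (p : Bool × Bits × Bits) b =>
    ((p.2.1.headD false && b) || (p.1 && (Bool.xor (p.2.1.headD false) b)), p.2.1.tail,
      Bool.xor p.1 (Bool.xor (p.2.1.headD false) b) :: p.2.2)) (c a, f a, []) := by
    refine PT.foldl (by fun_prop) (by fun_prop) (by fun_prop) 3 fun e a x => ?_
    rcases a with ⟨a1, a2, a3⟩
    have := ht_enc_bool_le ((a2.headD false && x) || (a1 && (Bool.xor (a2.headD false) x)))
    have := ht_enc_bool_le (Bool.xor a1 (Bool.xor (a2.headD false) x))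
    have := ht_tail_le a2
    simp only [enc_pair, enc_cons, Val.ht_node] at *
    omega
  unfold Tokenization.addC
  fun_prop

/-- The binary representation of `10 ^ l - 1`. -/
def nines (l : List Unit) : Bits :=
  l.foldl (fun x _ => true :: addC true x (true :: true :: x)) [false]

/-- If `x` represents `v`, then the sum with carry is `1 + v + (4 v + 3) = 5 v + 4`, and a further
one at the low end gives `10 v + 9`. So each round multiplies the value plus one by ten and adds
four digits. -/
theorem lval_nines (l : List Unit) :
    lval (nines l) + 1 = 10 ^ l.length ∧ (nines l).length = 4 * l.length + 1 := by
  have key : ∀ (l : List Unit) (x : Bits),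
      lval (l.foldl (fun x _ => true :: addC true x (true :: true :: x)) x) + 1 =
        10 ^ l.length * (lval x + 1) ∧
      (l.foldl (fun x _ => true :: addC true x (true :: true :: x)) x).length =
        4 * l.length + x.length := by
    intro l
    induction l with
    | nil => simp
    | cons u l ih =>
      intro x
      obtain ⟨h1, h2⟩ := lval_addC true x (true :: true :: x) (by simp; omega)
      obtain ⟨h3, h4⟩ := ih (true :: addC true x (true :: true :: x))
      rw [List.foldl_cons, h3, h4]
      simp only [lval, h1, List.length_cons, h2, pow_succ, mul_assoc]
      refine ⟨?_, by ring⟩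
      congr 1
      simp; ring
  obtain ⟨h1, h2⟩ := key l [false]
  exact ⟨h1.trans (by simp [lval]), h2.trans (by simp)⟩

@[fun_prop] theorem PT.nines {f : α → List Unit} (hf : PT f) : PT fun a => nines (f a) := by
  refine PT.foldl (l := f) (init := fun _ => [false])
    (g := fun _ (x : Bits) _ => true :: Tokenization.addC true x (true :: true :: x)) hf (by fun_prop)
    (by fun_prop) 6 fun e a x => ?_
  have := (lval_addC true a (true :: true :: a) (by simp; omega)).2
  have h := ht_bits_le (true :: Tokenization.addC true a (true :: true :: a))
  have := length_le_ht a
  simp only [List.length_cons] at *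
  omega

/-- Comparison, least significant bit first: whether `v ≤ t`, for `v` at most as long as `t`. -/
def leb (t v : Bits) : Bool :=
  (t.foldl (fun (p : Bool × Bits) b =>
    (cond (Bool.xor (p.2.headD false) b) b p.1, p.2.tail)) (true, v)).1

/-- Bits are read from the low end, so the last difference overrides the earlier ones. In `key` the
flag is the verdict on the bits already read and acts like an extra unit on the side of `t`. -/
theorem leb_iff {t v : Bits} (h : v.length ≤ t.length) : leb t v = true ↔ lval v ≤ lval t := by
  have key : ∀ (t v : Bits) (c : Bool), v.length ≤ t.length →
      ((t.foldl (fun (p : Bool × Bits) b =>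
        (cond (Bool.xor (p.2.headD false) b) b p.1, p.2.tail)) (c, v)).1 = true ↔
      lval v < lval t + c.toNat) := by
    intro t
    induction t with
    | nil =>
      intro v c h
      obtain rfl := List.length_eq_zero_iff.1 (Nat.le_zero.1 h)
      cases c <;> simp [lval]
    | cons b t ih =>
      intro v c h
      rw [List.foldl_cons, ih _ _ (by simp at h ⊢; omega)]
      cases v with
      | nil => cases b <;> cases c <;> simp [lval]
      | cons a v => cases a <;> cases b <;> cases c <;> simp [lval] <;> omega
  simpa [leb, Nat.lt_succ_iff] using key t v true h

@[fun_prop] theorem PT.leb {f g : α → Bits} (hf : PT f) (hg : PT g) :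
    PT fun a => leb (f a) (g a) := by
  have h : PT fun a => (f a).foldl (fun (p : Bool × Bits) b =>
      (_root_.cond (Bool.xor (p.2.headD false) b) b p.1, p.2.tail)) (true, g a) := by
    refine PT.foldl (by fun_prop) (by fun_prop) (by fun_prop) 1 fun e a x => ?_
    rcases a with ⟨a1, a2⟩
    have := ht_enc_bool_le (_root_.cond (Bool.xor (a2.headD false) x) x a1)
    have := ht_tail_le a2
    simp only [enc_pair, Val.ht_node] at *
    omega
  unfold Tokenization.leb
  fun_prop

/-- The length of a list in binary, most significant bit first. -/
def count (l : List β) : Bits := l.foldl (fun v _ => incr v) []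

-- Binary notation without leading zeros has at most logarithmic length. The bound keeps `2 ^ (count
-- l).length` polynomial, as is needed when a random number with that many digits is written in
-- unary.
omit [Enc β] in
theorem lval_count (l : List β) : lval (count l).reverse = l.length ∧
    (l ≠ [] → 2 ^ (count l).length ≤ 2 * l.length) := by
  have key : ∀ (l : List β) (v : Bits), (v ≠ [] → 2 ^ v.length ≤ 2 * lval v.reverse) →
      lval (l.foldl (fun v _ => incr v) v).reverse = lval v.reverse + l.length ∧
      (l.foldl (fun v _ => incr v) v ≠ [] → 2 ^ (l.foldl (fun v _ => incr v) v).length ≤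
        2 * (lval v.reverse + l.length)) := by
    intro l
    induction l with
    | nil => intro v hv; simpa using hv
    | cons x l ih =>
      intro v hv
      have hi : 2 ^ (incr v).length ≤ 2 * lval (incr v).reverse := by
        have := length_incrLow v.reverse
        rw [lval_incr]
        simp only [incr, List.length_reverse] at *
        by_cases hv' : v = []
        · subst hv'; simp [incrLow, lval]
        · have := hv hv'
          rcases ‹_ ∨ _› with h | h
          · rw [h]; omega
          · rw [h.1, pow_succ]; omega
      obtain ⟨h1, h2⟩ := ih (incr v) fun _ => hi
      rw [lval_incr] at h1 h2
      simp only [List.foldl_cons, List.length_cons]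
      refine ⟨by omega, fun h => ?_⟩
      have := h2 h
      omega
  obtain ⟨h1, h2⟩ := key l [] (by simp)
  refine ⟨by simpa [lval, count] using h1, fun hl => ?_⟩
  have : count l ≠ [] := fun h => hl <| List.length_eq_zero_iff.1 <| by
    have := h1.symm
    rw [show l.foldl (fun v _ => incr v) [] = [] from h] at this
    simpa [lval] using this
  simpa [lval, count] using h2 this

@[fun_prop] theorem PT.count {f : α → List β} (hf : PT f) : PT fun a => count (f a) := by
  refine PT.foldl (l := f) (init := fun _ => [])
    (g := fun _ (v : Bits) (_ : β) => Tokenization.incr v) hf (by fun_prop) (by fun_prop) 2 fun e a x => ?_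
  have := length_incr_le a
  have := ht_bits_le (Tokenization.incr a)
  have := length_le_ht a
  omega

/-- A tree as a list of trees. -/
def Val.toList : Val → List Val
  | .nil => []
  | .node l r => l :: r.toList

@[simp] theorem Val.enc_toList (v : Val) : enc v.toList = v := by
  induction v with
  | nil => rfl
  | node l r _ ih => simp [Val.toList, ih]

@[fun_prop] theorem PT.toList {f : α → Val} (hf : PT f) : PT fun a => (f a).toList :=
  of_enc (by simpa using hf)

/-- The bits that a tree represents. -/
def Val.toBits (v : Val) : Bits := (v.toList.foldl (fun acc x => x.isNode :: acc) []).reverse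

/-- Whether a tree represents a list of bits. -/
def Val.isBits (v : Val) : Bool :=
  v.toList.foldl (fun r x => r && (!x.isNode || (!x.left.isNode && !x.right.isNode))) true

theorem Val.toBits_eq (v : Val) : v.toBits = v.toList.map Val.isNode := by
  have key : ∀ (l : List Val) (acc : Bits), l.foldl (fun acc x => x.isNode :: acc) acc =
      (l.map Val.isNode).reverse ++ acc := by
    intro l
    induction l with
    | nil => simp
    | cons x l ih => intro acc; simp [ih]
  simp [Val.toBits, key]

@[simp] theorem Val.toBits_enc (b : Bits) : (enc b).toBits = b := by
  induction b with
  | nil => rfl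
  | cons x b ih =>
    rw [Val.toBits_eq] at *
    simpa [Val.toList] using ih

theorem Val.length_toBits_le (v : Val) : v.toBits.length ≤ v.ht := by
  rw [Val.toBits_eq, List.length_map]
  simpa using length_le_ht v.toList

theorem Val.isBits_iff (v : Val) : v.isBits = true ↔ enc v.toBits = v := by
  have key : ∀ (l : List Val) (t : Bool), l.foldl (fun r x => r && (!x.isNode ||
      (!x.left.isNode && !x.right.isNode))) t = true ↔ t = true ∧ enc (l.map Val.isNode) = enc l := by
    intro l
    induction l with
    | nil => simp
    | cons x l ih =>
      intro t
      rw [List.foldl_cons, ih]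
      rcases x with _ | ⟨_ | ⟨a, b⟩, _ | ⟨c, d⟩⟩ <;> simp [Val.isNode, Val.left, Val.right]
  rw [Val.isBits, key, Val.toBits_eq]
  simp

@[fun_prop] theorem PT.toBits {f : α → Val} (hf : PT f) : PT fun a => (f a).toBits := by
  have : PT fun a => (f a).toList.foldl (fun acc x => x.isNode :: acc) [] := by
    refine PT.foldl (by fun_prop) (by fun_prop) (by fun_prop) 2 fun e a x => ?_
    have := ht_enc_bool_le x.isNode
    simp only [enc_cons, Val.ht_node] at *; omega
  unfold Val.toBits
  fun_prop

@[fun_prop] theorem PT.isBits {f : α → Val} (hf : PT f) : PT fun a => (f a).isBits := by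
  unfold Val.isBits
  refine PT.foldl (by fun_prop) (by fun_prop) (by fun_prop) 1 fun e a x => ?_
  have := ht_enc_bool_le (a && (!x.isNode || (!x.left.isNode && !x.right.isNode)))
  omega

/-- The first bits that a tree represents, filled up with zeros. -/
def readBits (l : List Unit) (v : Val) : Bits :=
  (l.foldl (fun (p : Val × Bits) _ => (p.1.right, p.1.left.isNode :: p.2)) (v, [])).2.reverse

theorem readBits_enc {l : List Unit} {b : Bits} (h : b.length = l.length) :
    readBits l (enc b) = b := by
  have key : ∀ (l : List Unit) (b acc : Bits), b.length = l.length →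
      (l.foldl (fun (p : Val × Bits) _ => (p.1.right, p.1.left.isNode :: p.2)) (enc b, acc)).2 =
        b.reverse ++ acc := by
    intro l
    induction l with
    | nil => intro b acc h; obtain rfl := List.length_eq_zero_iff.1 h; rfl
    | cons u l ih =>
      intro b acc h
      cases b with
      | nil => simp at h
      | cons x b => simpa [Val.left, Val.right] using ih b (x :: acc) (by simpa using h)
  simp [readBits, key l b [] h]

@[simp] theorem length_readBits (l : List Unit) (v : Val) : (readBits l v).length = l.length := by
  have key : ∀ (l : List Unit) (v : Val) (acc : Bits),
      (l.foldl (fun (p : Val × Bits) _ => (p.1.right, p.1.left.isNode :: p.2)) (v, acc)).2.length =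
        l.length + acc.length := by
    intro l
    induction l with
    | nil => simp
    | cons u l ih => intro v acc; simp [ih]; ring
  simp [readBits, key]

theorem ht_units (n : ℕ) : (enc (List.replicate n ())).ht = n := by
  induction n with
  | zero => rfl
  | succ n ih => simp [List.replicate_succ, ih]

theorem units_eq (l : List Unit) : l = List.replicate l.length () := by
  rw [List.eq_replicate_iff]; simp

theorem PT.mulU : PT fun p : List Unit × List Unit => List.replicate (p.1.length * p.2.length) () := by
  have key : ∀ l l' acc : List Unit, l'.foldl (fun acc _ => l ++ acc) acc =
      List.replicate (l'.length * l.length + acc.length) () := by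
    intro l l'
    induction l' with
    | nil => intro acc; simpa using units_eq acc
    | cons u l' ih =>
      intro acc
      rw [List.foldl_cons, ih]; congr 1; simp; ring
  have : PT fun p : List Unit × List Unit => p.2.foldl (fun acc _ => p.1 ++ acc) [] := by
    refine PT.foldl_of_bound (ε := List Unit × List Unit) (g := fun p acc _ => p.1 ++ acc)
      (by fun_prop) (by fun_prop) (by fun_prop) (.X * .X) fun e l' hl' => ?_
    rw [key, ht_units]
    have h1 := length_le_ht e.1
    have h2 := hl'.length_le.trans (length_le_ht e.2)
    rcases e with ⟨a, b⟩
    simp only [List.length_nil, add_zero, Polynomial.eval_mul, Polynomial.eval_X, enc_pair,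
      Val.ht_node] at *
    exact Nat.mul_le_mul (by omega) (by omega)
  convert this using 2 with p
  rw [key, mul_comm]; simp

/-- Sums and products of unary numbers are computable, so the reductions can compute their own
polynomial bounds from the security parameter. -/
theorem PT.evalU (q : Polynomial ℕ) :
    PT fun l : List Unit => List.replicate (q.eval l.length) () := by
  induction q using Polynomial.induction_on' with
  | add p q hp hq =>
    have : PT fun l : List Unit =>
      List.replicate (p.eval l.length) () ++ List.replicate (q.eval l.length) () := by fun_prop
    simpa using this
  | monomial n a =>
    induction n with
    | zero => simpa using PT.const (List.replicate a ())
    | succ n ih =>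
      have h : PT fun l : List Unit => (List.replicate ((Polynomial.monomial n a).eval l.length) (), l) :=
        by fun_prop
      have := PT.comp PT.mulU h
      simpa [pow_succ, mul_assoc] using this

end Functions

end Tokenization

namespace Tokenization
open Dialog Enc

variable {α β γ δ ε : Type} [Enc α] [Enc β] [Enc γ] [Enc δ] [Enc ε]

/-! ## Bit vectors as lists of bits -/

/-- The bits, most significant bit first. -/
def bitsOf {w : ℕ} (x : BitVec w) : Bits := List.ofFn fun i : Fin w => x.getMsb i

/-- The bit vector with the given bits, most significant bit first. -/
def ofBits (w : ℕ) (b : Bits) : BitVec w := BitVec.ofNat w (lval b.reverse)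

theorem enc_bitsOf {w : ℕ} (x : BitVec w) : enc (bitsOf x) = encBits x := rfl

@[simp] theorem length_bitsOf {w : ℕ} (x : BitVec w) : (bitsOf x).length = w := by simp [bitsOf]

theorem testBit_lval (l : Bits) (i : ℕ) : (lval l).testBit i = l.getD i false := by
  induction l generalizing i with
  | nil => simp [lval]
  | cons b l ih =>
    cases i with
    | zero => cases b <;> simp [lval, Nat.testBit_zero]
    | succ i =>
      rw [Nat.testBit_succ, List.getD_cons_succ, ← ih]
      congr 1
      cases b <;> simp [lval]; omega

theorem lval_bitsOf {w : ℕ} (x : BitVec w) : lval (bitsOf x).reverse = x.toNat := by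
  refine Nat.eq_of_testBit_eq fun i => ?_
  rw [testBit_lval]
  by_cases h : i < w
  · rw [List.getD_eq_getElem _ _ (by simpa using h), List.getElem_reverse]
    simp only [bitsOf, List.getElem_ofFn, List.length_ofFn]
    change x.toNat.testBit (w - 1 - (w - 1 - i)) = _
    congr 1
    omega
  · rw [List.getD_eq_default _ _ (by simpa using h), BitVec.testBit_toNat,
      BitVec.getLsbD_of_ge _ _ (by omega)]

theorem ofBits_bitsOf {w : ℕ} (x : BitVec w) : ofBits w (bitsOf x) = x := by
  simp [ofBits, lval_bitsOf]

theorem bitsOf_injective {w : ℕ} : Function.Injective (bitsOf (w := w)) :=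
  fun x y h => by rw [← ofBits_bitsOf x, h, ofBits_bitsOf]

theorem lval_injective {a b : Bits} (h : a.length = b.length) (hv : lval a = lval b) : a = b := by
  refine List.ext_getElem h fun i h1 h2 => ?_
  have := testBit_lval a i
  rw [hv, testBit_lval, List.getD_eq_getElem _ _ h1, List.getD_eq_getElem _ _ h2] at this
  exact this.symm

theorem bitsOf_ofBits {w : ℕ} {b : Bits} (h : b.length = w) : bitsOf (ofBits w b) = b := by
  have h1 : (bitsOf (ofBits w b)).reverse = b.reverse := by
    refine lval_injective (by simp [h]) ?_
    rw [lval_bitsOf, ofBits, BitVec.toNat_ofNat, Nat.mod_eq_of_lt]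
    simpa [h] using lval_lt b.reverse
  simpa using congrArg List.reverse h1

theorem bitsOf_append {v w : ℕ} (x : BitVec v) (y : BitVec w) :
    bitsOf (x ++ y) = bitsOf x ++ bitsOf y := by
  have h1 : (bitsOf (x ++ y)).reverse = (bitsOf x ++ bitsOf y).reverse := by
    refine lval_injective (by simp [Nat.add_comm]) ?_
    rw [lval_bitsOf, List.reverse_append, lval_append, lval_bitsOf, lval_bitsOf,
      BitVec.toNat_append, Nat.shiftLeft_eq, List.length_reverse, length_bitsOf, Nat.add_comm,
      Nat.two_pow_add_eq_or_of_lt y.isLt, mul_comm]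
  simpa using congrArg List.reverse h1

/-- Deleting leading bits is reduction modulo a power of two. This identifies `Pub.low` with the
residue in Steps 3 and 4 of the algorithm. -/
theorem lval_reverse_drop (k : ℕ) (c : Bits) :
    lval (c.drop k).reverse = lval c.reverse % 2 ^ (c.length - k) := by
  have h : lval c.reverse = lval (c.drop k).reverse +
      2 ^ (c.drop k).reverse.length * lval (c.take k).reverse := by
    rw [← lval_append, ← List.reverse_append, List.take_append_drop]
  rw [h]
  rw [List.length_reverse, List.length_drop, Nat.add_mul_mod_self_left, Nat.mod_eq_of_lt]
  simpa using lval_lt (c.drop k).reverse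

/-- The bits of a code. -/
def codeB {ℓ : ℕ} (X : Code ℓ) : Bits := bitsOf (codeBits X)

theorem enc_codeB {ℓ : ℕ} (X : Code ℓ) : enc (codeB X) = encCode X := rfl

@[simp] theorem length_codeB {ℓ : ℕ} (X : Code ℓ) : (codeB X).length = bitLen ℓ := length_bitsOf _

theorem ten_pow_le_two_pow (ℓ : ℕ) : 10 ^ ℓ ≤ 2 ^ bitLen ℓ := Nat.le_pow_clog (by norm_num) _

theorem lval_codeB {ℓ : ℕ} (X : Code ℓ) : lval (codeB X).reverse = codeEquiv ℓ X := by
  rw [codeB, lval_bitsOf, codeBits, BitVec.toNat_ofNat, Nat.mod_eq_of_lt]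
  exact (codeEquiv ℓ X).2.trans_le (ten_pow_le_two_pow ℓ)

theorem codeB_injective {ℓ : ℕ} : Function.Injective (codeB (ℓ := ℓ)) := fun X Y h => by
  have := lval_codeB X
  rw [h, lval_codeB] at this
  exact ((codeEquiv ℓ).injective (Fin.ext this)).symm

theorem exists_codeB_iff {ℓ : ℕ} {b : Bits} :
    (∃ X : Code ℓ, codeB X = b) ↔ b.length = bitLen ℓ ∧ lval b.reverse < 10 ^ ℓ := by
  refine ⟨?_, fun ⟨h1, h2⟩ => ?_⟩
  · rintro ⟨X, rfl⟩
    exact ⟨length_codeB X, by rw [lval_codeB]; exact (codeEquiv ℓ X).2⟩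
  · refine ⟨(codeEquiv ℓ).symm ⟨_, h2⟩, List.reverse_injective (lval_injective (by simp [h1]) ?_)⟩
    rw [lval_codeB]; simp

/-! ## Running a given program on registers of its own -/

def Expr.regs : Expr → ℕ
  | .var x => x + 1
  | .nil => 0
  | .cons a b => max a.regs b.regs
  | .hd a => a.regs
  | .tl a => a.regs

def Prog.regs : Prog → ℕ
  | .assign x e => max (x + 1) e.regs
  | .seq p q => max p.regs q.regs
  | .ite x p q => max (x + 1) (max p.regs q.regs)
  | .loop x p => max (x + 1) p.regs
  | .flip x => x + 1
  | .query x e => max (x + 1) e.regs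

def Expr.shift (d : ℕ) : Expr → Expr
  | .var x => .var (d + x)
  | .nil => .nil
  | .cons a b => .cons (a.shift d) (b.shift d)
  | .hd a => .hd (a.shift d)
  | .tl a => .tl (a.shift d)

def Prog.shift (d : ℕ) : Prog → Prog
  | .assign x e => .assign (d + x) (e.shift d)
  | .seq p q => .seq (p.shift d) (q.shift d)
  | .ite x p q => .ite (d + x) (p.shift d) (q.shift d)
  | .loop x p => .loop (d + x) (p.shift d)
  | .flip x => .flip (d + x)
  | .query x e => .query (d + x) (e.shift d)

theorem Expr.eval_shift {d B : ℕ} {s s' : Store} (h : ∀ x < B, s' (d + x) = s x) {e : Expr}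
    (he : e.regs ≤ B) : (e.shift d).eval s' = e.eval s := by
  induction e with
  | var x => exact h x he
  | nil => rfl
  | cons a b iha ihb =>
    simp only [Expr.regs, max_le_iff] at he
    simp [Expr.shift, Expr.eval, iha he.1, ihb he.2]
  | hd a ih => simp [Expr.shift, Expr.eval, ih he]
  | tl a ih => simp [Expr.shift, Expr.eval, ih he]

/-- The program for `f` comes with fixed registers. Moved up by `d`, it runs on a private block of
the memory and leaves everything below intact. Only the first `B` registers matter, since it
mentions no others. -/
theorem follows_shift {d B : ℕ} {γ : Type} {Rel : γ → Store → Prop} {n : ℕ} {rest : List Prog}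
    {k : Dialog Val Val γ} {t : ℕ} {ps : List Prog} {s sf s' : Store} (hps : ∀ p ∈ ps, p.regs ≤ B)
    (hrun : RunsTo t (ps, s) sf) (hs : ∀ x < B, s' (d + x) = s x)
    (hk : ∀ s'', (∀ x < B, s'' (d + x) = sf x) → (∀ x < d, s'' x = s' x) →
      Follows Rel n (rest, s'') k) :
    Follows Rel (t + n) (ps.map (Prog.shift d) ++ rest, s') k := by
  induction t generalizing ps s s' with
  | zero =>
    cases ps with
    | nil =>
      obtain rfl : s = sf := by simpa [RunsTo, next] using hrun
      simpa using hk s' hs fun _ _ => rfl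
    | cons p ps => cases p <;> simp [RunsTo, next] at hrun
  | succ t ih =>
    obtain ⟨c', hc, hrun⟩ := hrun
    rw [show t + 1 + n = t + n + 1 by ring]
    cases ps with
    | nil => simp [next] at hc
    | cons p ps =>
      have hp := hps p (by simp)
      have hps' : ∀ q ∈ ps, q.regs ≤ B := fun q hq => hps q (by simp [hq])
      cases p with
      | assign x e =>
        simp only [Prog.regs, max_le_iff] at hp
        obtain rfl : _ = c' := by simpa [next] using hc
        refine .tick rfl (ih hps' hrun (fun y hy => ?_) fun s'' h1 h2 => hk s'' h1 fun y hy => ?_)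
        · rw [Expr.eval_shift hs hp.2]
          simp [Function.update_apply, hs y hy]
        · rw [h2 y hy, Function.update_of_ne (by omega)]
      | seq p q =>
        simp only [Prog.regs, max_le_iff] at hp
        obtain rfl : _ = c' := by simpa [next] using hc
        exact .tick rfl (ih (ps := p :: q :: ps) (by simp; tauto) hrun hs hk)
      | ite x p q =>
        simp only [Prog.regs, max_le_iff] at hp
        obtain rfl : _ = c' := by simpa [next] using hc
        refine .tick (by rw [List.map_cons, Prog.shift, List.cons_append, next]) ?_
        rw [hs x hp.1]
        split_ifs at hrun ⊢ with h
        · exact ih (ps := q :: ps) (by simp; tauto) hrun hs hk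
        · exact ih (ps := p :: ps) (by simp; tauto) hrun hs hk
      | loop x p =>
        simp only [Prog.regs, max_le_iff] at hp
        obtain rfl : _ = c' := by simpa [next] using hc
        refine .tick (by rw [List.map_cons, Prog.shift, List.cons_append, next]) ?_
        rw [hs x hp.1]
        split_ifs at hrun ⊢ with h
        · exact ih hps' hrun hs hk
        · exact ih (ps := p :: .loop x p :: ps) (by simp [Prog.regs]; tauto) hrun hs hk
      | flip x => simp [next] at hc
      | query x e => simp [next] at hc

/-- Set the registers `r, …, r + n - 1` to `nil`, then run `p`. -/
def clear (r : ℕ) : ℕ → Prog → Prog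
  | 0, p => p
  | n + 1, p => .seq (.assign (r + n) .nil) (clear r n p)

theorem follows_clear {γ : Type} {Rel : γ → Store → Prop} {n r : ℕ} {ps : List Prog} {p : Prog}
    {k : Dialog Val Val γ} (N : ℕ) {s : Store}
    (h : Follows Rel n (p :: ps, fun x => if r ≤ x ∧ x < r + N then .nil else s x) k) :
    Follows Rel (2 * N + n) (clear r N p :: ps, s) k := by
  induction N generalizing s with
  | zero =>
    have : (fun x => if r ≤ x ∧ x < r + 0 then .nil else s x) = s := by
      ext x; rw [if_neg (by omega)]
    rw [this] at h
    simpa [clear] using h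
  | succ N ih =>
    rw [show 2 * (N + 1) + n = 2 * N + n + 1 + 1 by ring]
    refine .tick rfl (.tick rfl (ih ?_))
    convert h using 3 with x
    by_cases h1 : x = r + N
    · subst h1; simp [Expr.eval]
    · simp only [Function.update_of_ne h1]
      congr 1
      simp only [eq_iff_iff]; omega

/-- The public parameters as lists. -/
abbrev Params := List Unit × List Unit × List Unit × List Unit

def paramsOf (ℓ k : ℕ → ℕ) (κ : ℕ) : Params :=
  (.replicate κ (), .replicate (ℓ κ) (), .replicate (bitLen (ℓ κ)) (), .replicate (k κ) ())

theorem enc_units (n : ℕ) : enc (List.replicate n ()) = unary n := by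
  induction n with
  | zero => rfl
  | succ n ih => simp [List.replicate_succ, ih, unary]

/-- Run `F` on the parameters and two bit strings. -/
def callProg (F : Prog) (r : ℕ) : Prog :=
  clear (r + 1) (max F.regs 6) <|
    .seq (.assign (r + 1) (.hd (.hd (.var r)))) <|
    .seq (.assign (r + 2) (.hd (.tl (.hd (.var r))))) <|
    .seq (.assign (r + 3) (.hd (.tl (.tl (.hd (.var r)))))) <|
    .seq (.assign (r + 4) (.tl (.tl (.tl (.hd (.var r)))))) <|
    .seq (.assign (r + 5) (.hd (.tl (.var r)))) <|
    .seq (.assign (r + 6) (.tl (.tl (.var r)))) <|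
    .seq (F.shift (r + 1)) (.assign r (.var (r + 1)))

theorem computes_callProg {F : Prog} {ℓ k : ℕ → ℕ} {κ t : ℕ} {u X b : Bits} {sf : Store}
    (hrun : RunsTo t ([F], load (params ℓ k κ ++ [enc u, enc X])) sf) (hb : sf 0 = enc b) :
    Computes (callProg F) (2 * max F.regs 6 + t + 14) (paramsOf ℓ k κ, u, X) (.ret b) := by
  intro γ Rel n r s ps c hr hk
  rw [show 2 * max F.regs 6 + t + 14 + n = 2 * max F.regs 6 + ((t + (n + 1)) + 1 + 1 + 1 + 1 + 1 + 1
    + 1 + 1 + 1 + 1 + 1 + 1 + 1) by ring]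
  refine follows_clear _ ?_
  -- Six assignments load the four parameters, the additional input and the code; the other seven
  -- steps unfold sequencing commands.
  iterate 13 refine .tick rfl ?_
  refine follows_shift (B := max F.regs 6) (d := r + 1) (Rel := Rel) (n := n + 1)
    (rest := .assign r (.var (r + 1)) :: ps) (k := (ret b).bind c) (ps := [F]) (by simp) hrun (fun x hx => ?_) fun s'' h1 h2 => .tick rfl (hk b _ rfl ?_ fun x hxr => ?_)
  · have hr' : s r = .node (.node (unary κ) (.node (unary (ℓ κ)) (.node (unary (bitLen (ℓ κ)))
        (unary (k κ))))) (.node (enc u) (enc X)) := by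
      rw [hr]; simp [paramsOf, enc_units]
    have h6 : x = 0 ∨ x = 1 ∨ x = 2 ∨ x = 3 ∨ x = 4 ∨ x = 5 ∨ 6 ≤ x := by omega
    rcases h6 with rfl | rfl | rfl | rfl | rfl | rfl | h6
    iterate 6
      · simp [Expr.eval, hr', Val.left, Val.right, load, params]
    have hl : load (params ℓ k κ ++ [enc u, enc X]) x = .nil := by
      rw [load, List.getD_eq_default]; simpa [params] using h6
    rw [hl]
    simp only [Function.update_apply]
    repeat rw [if_neg (by omega)]
    rw [if_pos (by omega)]
  · have := h1 0 (by omega)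
    rw [add_zero] at this
    simp [Expr.eval, this, hb]
  · rw [Function.update_of_ne hxr.ne, h2 x (by omega)]
    simp only [Function.update_apply]
    repeat rw [if_neg (by omega)]

open Classical in
/-- The function `f` on lists of bits. -/
noncomputable def onBits {ℓ k : ℕ} (f : AddInput → Code ℓ → BitVec k) (u X : Bits) : Bits :=
  if h : ∃ C : Code ℓ, codeB C = X then bitsOf (f u h.choose) else []

theorem onBits_codeB {ℓ k : ℕ} (f : AddInput → Code ℓ → BitVec k) (u : Bits) (X : Code ℓ) :
    onBits f u (codeB X) = bitsOf (f u X) := by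
  have h : ∃ C : Code ℓ, codeB C = codeB X := ⟨X, rfl⟩
  rw [onBits, dif_pos h, codeB_injective h.choose_spec]

theorem FP.onBits {ℓ k : ℕ → ℕ} {f : ∀ κ, AddInput → Code (ℓ κ) → BitVec (k κ)}
    (hf : PolyTimeComputable ℓ k f) {b : ℕ → ℕ} (hb : PolyBounded b) :
    FP (fun κ (p : Params × Bits × Bits) => p.1 = paramsOf ℓ k κ ∧ p.2.1.length ≤ b κ ∧
      ∃ C : Code (ℓ κ), codeB C = p.2.2)
      fun κ p => .ret (Tokenization.onBits (f κ) p.2.1 p.2.2) := by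
  obtain ⟨F, p, hF⟩ := hf
  obtain ⟨q, hq⟩ := (PolyBounded.id.add hb).comp_eval p
  refine ⟨callProg F, .C (2 * max F.regs 6) + q + 14, fun κ ⟨pr, u, X⟩ h => ?_⟩
  obtain ⟨rfl, hu, C, rfl⟩ := h
  obtain ⟨t, ht, s, hs, h0⟩ := hF κ u C
  refine (computes_callProg hs ?_).mono ?_
  · rw [h0, onBits_codeB]; rfl
  · have := polynomial_eval_mono p (show κ + u.length ≤ κ + b κ by simpa using hu)
    have := hq κ
    simp at *; omega

end Tokenization

namespace Tokenization
open Dialog Enc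

variable {α β γ δ ε : Type} [Enc α] [Enc β] [Enc γ] [Enc δ] [Enc ε]

/-! ## The simulator of the token service -/

/-- The constants of the simulator: the public parameters, the binary representation of
`10 ^ ℓ - 1`, and the number of attempts per request. -/
structure Pub where
  prm : Params
  theta : Bits
  fuel : List Unit

instance : Enc Pub := ⟨fun p => enc (p.prm, p.theta, p.fuel)⟩

/-- The state of the simulator: the secret bit, whether it has failed, a collision of `f` if it has
come across one, the tokens, the blocks sent to the cipher, the starting blocks of the candidate
tokens together with what they were computed from, and the bookkeeping of the challenger. -/
structure Sim where
  pub : Pub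
  nu : Bool
  bad : Bool
  coll : Option (BMsg × BMsg)
  toks : List Bits
  asked : List Bits
  done : List (Bits × BMsg)
  msgs : List BMsg
  pair : Option (BMsg × BMsg)

/-- The fields of the state as a tuple. -/
def Sim.tuple (s : Sim) := (s.pub, s.nu, s.bad, s.coll, s.toks, s.asked, s.done, s.msgs, s.pair)

instance : Enc Sim := ⟨fun s => enc s.tuple⟩

namespace PT

@[fun_prop] theorem pub_mk {f : α → Params} {g : α → Bits} {h : α → List Unit} (hf : PT f)
    (hg : PT g) (hh : PT h) : PT fun a => Pub.mk (f a) (g a) (h a) :=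
  of_enc (f := fun a => Pub.mk (f a) (g a) (h a))
    (show PT fun a => enc (f a, g a, h a) by fun_prop)

theorem pub_tuple : PT fun p : Pub => (p.prm, p.theta, p.fuel) := .expr (.var 0) fun _ => rfl

@[fun_prop] theorem pub_prm {f : α → Pub} (hf : PT f) : PT fun a => (f a).prm :=
  (comp pub_tuple hf).fst

@[fun_prop] theorem pub_theta {f : α → Pub} (hf : PT f) : PT fun a => (f a).theta :=
  (comp pub_tuple hf).snd.fst

@[fun_prop] theorem pub_fuel {f : α → Pub} (hf : PT f) : PT fun a => (f a).fuel :=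
  (comp pub_tuple hf).snd.snd

@[fun_prop] theorem sim_mk {f1 : α → Pub} {f2 f3 : α → Bool} {f4 : α → Option (BMsg × BMsg)}
    {f5 f6 : α → List Bits} {f7 : α → List (Bits × BMsg)} {f8 : α → List BMsg}
    {f9 : α → Option (BMsg × BMsg)} (h1 : PT f1) (h2 : PT f2) (h3 : PT f3) (h4 : PT f4)
    (h5 : PT f5) (h6 : PT f6) (h7 : PT f7) (h8 : PT f8) (h9 : PT f9) :
    PT fun a => Sim.mk (f1 a) (f2 a) (f3 a) (f4 a) (f5 a) (f6 a) (f7 a) (f8 a) (f9 a) :=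
  of_enc (f := fun a => Sim.mk (f1 a) (f2 a) (f3 a) (f4 a) (f5 a) (f6 a) (f7 a) (f8 a) (f9 a))
    (show PT fun a => enc (f1 a, f2 a, f3 a, f4 a, f5 a, f6 a, f7 a, f8 a, f9 a) by fun_prop)

theorem sim_tuple : PT Sim.tuple := .expr (.var 0) fun _ => rfl

variable {f : α → Sim}

@[fun_prop] theorem sim_pub (hf : PT f) : PT fun a => (f a).pub := (comp sim_tuple hf).fst
@[fun_prop] theorem sim_nu (hf : PT f) : PT fun a => (f a).nu := (comp sim_tuple hf).snd.fst
@[fun_prop] theorem sim_bad (hf : PT f) : PT fun a => (f a).bad := (comp sim_tuple hf).snd.snd.fst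
@[fun_prop] theorem sim_coll (hf : PT f) : PT fun a => (f a).coll :=
  (comp sim_tuple hf).snd.snd.snd.fst
@[fun_prop] theorem sim_toks (hf : PT f) : PT fun a => (f a).toks :=
  (comp sim_tuple hf).snd.snd.snd.snd.fst
@[fun_prop] theorem sim_asked (hf : PT f) : PT fun a => (f a).asked :=
  (comp sim_tuple hf).snd.snd.snd.snd.snd.fst
@[fun_prop] theorem sim_done (hf : PT f) : PT fun a => (f a).done :=
  (comp sim_tuple hf).snd.snd.snd.snd.snd.snd.fst
@[fun_prop] theorem sim_msgs (hf : PT f) : PT fun a => (f a).msgs :=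
  (comp sim_tuple hf).snd.snd.snd.snd.snd.snd.snd.fst
@[fun_prop] theorem sim_pair (hf : PT f) : PT fun a => (f a).pair :=
  (comp sim_tuple hf).snd.snd.snd.snd.snd.snd.snd.snd

end PT

namespace Pub

/-- The last bits of a block. -/
def low (pub : Pub) (c : Bits) : Bits := dropU pub.prm.2.2.2 c

/-- Whether the last bits of a block represent a code. -/
def inR (pub : Pub) (c : Bits) : Bool := leb pub.theta (pub.low c).reverse

/-- Whether a tree represents a message. -/
def validMsg (pub : Pub) (v : Val) : Bool :=
  v.isNode && v.left.isBits && (dropU v.left.toBits pub.prm.2.2.1).isEmpty &&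
    (dropU pub.prm.2.2.1 v.left.toBits).isEmpty && leb pub.theta v.left.toBits.reverse &&
    v.right.isBits

end Pub

/-- The message that a tree represents. -/
def msgOf (v : Val) : BMsg := (v.left.toBits, v.right.toBits)

@[fun_prop] theorem PT.low {f : α → Pub} {g : α → Bits} (hf : PT f) (hg : PT g) :
    PT fun a => (f a).low (g a) := by unfold Pub.low; fun_prop

@[fun_prop] theorem PT.inR {f : α → Pub} {g : α → Bits} (hf : PT f) (hg : PT g) :
    PT fun a => (f a).inR (g a) := by unfold Pub.inR; fun_prop

@[fun_prop] theorem PT.validMsg {f : α → Pub} {g : α → Val} (hf : PT f) (hg : PT g) :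
    PT fun a => (f a).validMsg (g a) := by unfold Pub.validMsg; fun_prop

@[fun_prop] theorem PT.msgOf {f : α → Val} (hf : PT f) : PT fun a => msgOf (f a) := by
  unfold Tokenization.msgOf; fun_prop

/-- What a request asks for: the message to be tokenized and the updated state, or nothing if the
request is refused. -/
def decideReq (st : Sim) (q : Val) : Option (BMsg × Sim) :=
  cond q.isNode
    (cond q.left.isNode
      (cond (!q.left.left.isNode && !q.left.right.isNode && q.right.isNode &&
          st.pub.validMsg q.right.left && st.pub.validMsg q.right.right)
        (cond (st.pair.isSome || mmemb (msgOf q.right.left) st.msgs ||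
            mmemb (msgOf q.right.right) st.msgs)
          none
          (some (cond st.nu (msgOf q.right.right) (msgOf q.right.left),
            { st with pair := some (msgOf q.right.left, msgOf q.right.right) })))
        none)
      (cond (st.pub.validMsg q.right)
        (cond st.pair.isSome
          (cond (meqb (msgOf q.right) (st.pair.getD default).1 ||
              meqb (msgOf q.right) (st.pair.getD default).2)
            none (some (msgOf q.right, st)))
          (some (msgOf q.right, { st with msgs := msgOf q.right :: st.msgs })))
        none))
    none

theorem PT.decideReq : PT fun p : Sim × Val => decideReq p.1 p.2 := by
  unfold Tokenization.decideReq
  fun_prop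

abbrev BDialog := Dialog Bits Bits

/-- The starting block of the candidate token. -/
noncomputable def blockB {ℓ k : ℕ} (f : AddInput → Code ℓ → BitVec k) (u X : Bits) : Bits :=
  onBits f u X ++ X

/-- One step of the walk; the state consists of the blocks sent so far, the current block, whether
the walk is over, and whether it has failed. -/
def walkStep (pub : Pub) (p : List Bits × Bits × Bool × Bool) :
    BDialog (List Bits × Bits × Bool × Bool) :=
  cond (p.2.2.1 || p.2.2.2) (.ret p) <|
    cond (memb p.2.1 p.1) (.ret (p.1, p.2.1, false, true)) <|
      .ask p.2.1 fun c => .ret (p.2.1 :: p.1, c, pub.inR c, false)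

def walkB (pub : Pub) (asked : List Bits) (b : Bits) : BDialog (List Bits × Bits × Bool × Bool) :=
  foldM (fun p (_ : Unit) => walkStep pub p) (asked, b, false, false) pub.prm.1

section

variable {ℓ k : ℕ} (f : AddInput → Code ℓ → BitVec k)

/-- What to do after looking up the block of `u`, the first component of the state: go on to the
successor, or stop, having come across a collision or not. -/
def skipNext (X : Bits) (p : Bits × Bool × Option (BMsg × BMsg)) (o : Option BMsg) :
    Bits × Bool × Option (BMsg × BMsg) :=
  cond o.isSome
    (cond (meqb (o.getD default) (X, p.1)) (incr p.1, false, none)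
      (p.1, true, some (o.getD default, (X, p.1))))
    (p.1, true, none)

noncomputable def skipStep (done : List (Bits × BMsg)) (X : Bits)
    (p : Bits × Bool × Option (BMsg × BMsg)) : Bits × Bool × Option (BMsg × BMsg) :=
  cond p.2.1 p (skipNext X p (findb (blockB f p.1 X) done))

/-- Skip the additional inputs whose candidate tokens have been computed already. -/
noncomputable def skip (done : List (Bits × BMsg)) (X u : Bits) : Bits × Bool × Option (BMsg × BMsg) :=
  (default :: done).foldl (fun p _ => skipStep f done X p) (u, false, none)

/-- The state after a walk that started at the block `b` of `u` and `X`. -/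
def afterWalk (st : Sim) (X u b : Bits) (w : List Bits × Bits × Bool × Bool) :
    Sim × Bits × Option Bits :=
  cond w.2.2.1
    (cond (memb (st.pub.low w.2.1) st.toks)
      ({ st with asked := w.1, done := (b, X, u) :: st.done }, incr u, none)
      ({ st with asked := w.1, done := (b, X, u) :: st.done }, u, some (st.pub.low w.2.1)))
    ({ st with asked := w.1, done := (b, X, u) :: st.done, bad := true }, u, none)

/-- One attempt to find a new token. -/
noncomputable def attempt (st : Sim) (X u : Bits) : BDialog (Sim × Bits × Option Bits) :=
  let s := skip f st.done X u
  cond s.2.2.isSome (.ret ({ st with bad := true, coll := s.2.2 }, s.1, none)) <|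
    (walkB st.pub st.asked (blockB f s.1 X)).bind fun w =>
      .ret (afterWalk st X s.1 (blockB f s.1 X) w)

noncomputable def tokStep (X : Bits) (p : Sim × Bits × Option Bits) :
    BDialog (Sim × Bits × Option Bits) :=
  cond (p.1.bad || p.2.2.isSome) (.ret p) (attempt f p.1 X p.2.1)

/-- Whether all codes are in the database. -/
def Sim.full (st : Sim) : Bool := !(leb st.pub.theta (count st.toks).reverse)

def finish (p : Sim × Bits × Option Bits) : Sim × Option Bits :=
  cond p.2.2.isSome ({ p.1 with toks := p.2.2.getD default :: p.1.toks }, p.2.2) <|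
    cond p.1.full (p.1, none) ({ p.1 with bad := true }, none)

noncomputable def tokenizeB (st : Sim) (m : BMsg) : BDialog (Sim × Option Bits) :=
  (foldM (fun p (_ : Unit) => tokStep f m.1 p) (st, m.2, none) st.pub.fuel).bind fun p =>
    .ret (finish p)

/-- The reaction of the simulator to one request. -/
noncomputable def simStep (st : Sim) (q : Val) : BDialog (Val × Sim) :=
  cond (st.bad || !(decideReq st q).isSome) (.ret (.nil, st)) <|
    (tokenizeB f ((decideReq st q).getD (default, st)).2 ((decideReq st q).getD (default, st)).1).bind
      fun p => .ret (enc (some p.2), p.1)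

end

@[fun_prop] theorem PT.full {f : α → Sim} (hf : PT f) : PT fun a => (f a).full := by
  unfold Sim.full; fun_prop

@[fun_prop] theorem PT.skipNext : PT fun p : Bits × (Bits × Bool × Option (BMsg × BMsg)) × Option BMsg =>
    skipNext p.1 p.2.1 p.2.2 := by
  unfold Tokenization.skipNext
  fun_prop

theorem PT.finish : PT finish := by
  unfold Tokenization.finish
  fun_prop

theorem PT.afterWalk : PT fun p : Sim × Bits × Bits × Bits × List Bits × Bits × Bool × Bool =>
    afterWalk p.1 p.2.1 p.2.2.1 p.2.2.2.1 p.2.2.2.2 := by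
  unfold Tokenization.afterWalk
  fun_prop

/-! ## Invariants of dialogues with a cipher -/

namespace Dialog

variable {m : ℕ} {ok ok' : Bits → Bits → Prop}

/-- All questions are new (`A` holds those asked so far) and of length `m`, and the result satisfies
`Q`, provided that all answers are admissible. -/
def wp (m : ℕ) (ok : Bits → Bits → Prop) {α : Type} : BDialog α → List Bits →
    (List Bits → α → Prop) → Prop
  | ret a, A, Q => Q A a
  | flip k, A, Q => ∀ b, (k b).wp m ok A Q
  | ask q k, A, Q => q ∉ A ∧ q.length = m ∧ ∀ r, ok q r → (k r).wp m ok (q :: A) Q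

variable {α β γ : Type}

@[simp] theorem wp_ret {a : α} {A : List Bits} {Q : List Bits → α → Prop} :
    (ret a : BDialog α).wp m ok A Q ↔ Q A a := Iff.rfl

theorem wp_mono {d : BDialog α} {A : List Bits} {Q Q' : List Bits → α → Prop}
    (h : d.wp m ok A Q) (hQ : ∀ A a, Q A a → Q' A a) : d.wp m ok A Q' := by
  induction d generalizing A with
  | ret a => exact hQ _ _ h
  | flip k ih => exact fun b => ih b (h b)
  | ask q k ih => exact ⟨h.1, h.2.1, fun r hr => ih r (h.2.2 r hr)⟩

theorem wp_bind {d : BDialog α} {g : α → BDialog β} {A : List Bits} {Q : List Bits → β → Prop} :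
    (d.bind g).wp m ok A Q ↔ d.wp m ok A fun A a => (g a).wp m ok A Q := by
  induction d generalizing A with
  | ret a => rfl
  | flip k ih => simp [wp, ih]
  | ask q k ih => simp [wp, ih]

theorem wp_foldM {g : α → γ → BDialog α} {l : List γ} (I : ℕ → List Bits → α → Prop)
    (h : ∀ i < l.length, ∀ A a, ∀ x ∈ l, I i A a → (g a x).wp m ok A (I (i + 1)))
    {A : List Bits} {a : α} (h0 : I 0 A a) : (foldM g a l).wp m ok A (I l.length) := by
  induction l generalizing I A a with
  | nil => exact h0
  | cons x l ih =>
    rw [foldM_cons, wp_bind]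
    refine wp_mono (h 0 (by simp) A a x (by simp) h0) fun A a ha => ?_
    exact ih (fun i => I (i + 1)) (fun i hi A a y hy =>
      h (i + 1) (by simpa using hi) A a y (by simp [hy])) ha

/-- Time bounds speak of possible results, while the invariants of the simulator are proved in terms
of `wp`, which also tracks the questions. This lemma transports the latter to the former. -/
theorem wp_leaf {d : BDialog α} {A : List Bits} {Q : List Bits → α → Prop} {okr : Bits → Prop}
    (h : d.wp m ok A Q) (hok : ∀ q r, okr r → ok q r) {a : α} (ha : d.Leaf okr a) :
    ∃ A', Q A' a := by
  induction d generalizing A with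
  | ret b => obtain rfl := ha; exact ⟨_, h⟩
  | flip k ih => obtain ⟨c, hc⟩ := ha; exact ih c (h c) hc
  | ask q k ih => obtain ⟨r, hr, hc⟩ := ha; exact ih r (h.2.2 r (hok q r hr)) hc

end Dialog

/-! ## The invariants of the simulator -/

/-- The constants of the simulator for given parameters. -/
def pubOf (ℓ k : ℕ → ℕ) (J : ℕ → ℕ) (κ : ℕ) : Pub :=
  ⟨paramsOf ℓ k κ, nines (.replicate (ℓ κ) ()), .replicate (J κ) ()⟩

/-- The constants fit the lengths of codes and of blocks. -/
structure Pub.Fits (pub : Pub) (ℓ k : ℕ) : Prop where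
  nn : pub.prm.2.2.1.length = bitLen ℓ
  kk : pub.prm.2.2.2.length = k
  theta : lval pub.theta + 1 = 10 ^ ℓ
  length_theta : pub.theta.length = 4 * ℓ + 1

theorem pubOf_fits (ℓ k J : ℕ → ℕ) (κ : ℕ) : (pubOf ℓ k J κ).Fits (ℓ κ) (k κ) where
  nn := by simp [pubOf, paramsOf]
  kk := by simp [pubOf, paramsOf]
  theta := by simpa [pubOf] using (lval_nines (.replicate (ℓ κ) ())).1
  length_theta := by simpa [pubOf] using (lval_nines (.replicate (ℓ κ) ())).2

theorem bitLen_le (ℓ : ℕ) : bitLen ℓ ≤ 4 * ℓ := by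
  refine Nat.clog_le_of_le_pow ?_
  rw [pow_mul]
  exact Nat.pow_le_pow_left (by norm_num) ℓ

/-- A message with a valid code and a bounded additional input. -/
def OkMsg (ℓ U : ℕ) (p : BMsg) : Prop := (∃ C : Code ℓ, codeB C = p.1) ∧ p.2.length ≤ U

theorem OkMsg.mono {ℓ U U' : ℕ} {p : BMsg} (h : OkMsg ℓ U p) (hU : U ≤ U') : OkMsg ℓ U' p :=
  ⟨h.1, h.2.trans hU⟩

namespace Pub.Fits

variable {pub : Pub} {ℓ k : ℕ} (hp : pub.Fits ℓ k)
include hp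

theorem leb_iff {b : Bits} (hb : b.length = bitLen ℓ) :
    leb pub.theta b.reverse = true ↔ lval b.reverse < 10 ^ ℓ := by
  have := bitLen_le ℓ
  rw [Tokenization.leb_iff (by rw [hp.length_theta]; simp; omega), ← hp.theta, Nat.lt_succ_iff]

theorem low_eq (c : Bits) : pub.low c = c.drop k := by rw [Pub.low, dropU_eq, hp.kk]

theorem inR_iff {c : Bits} (hc : c.length = k + bitLen ℓ) :
    pub.inR c = true ↔ ∃ C : Code ℓ, codeB C = pub.low c := by
  rw [Pub.inR, hp.leb_iff (by simp [hp.low_eq, hc]), exists_codeB_iff]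
  simp [hp.low_eq, hc]

theorem validMsg_iff {v : Val} :
    pub.validMsg v = true ↔ enc (msgOf v) = v ∧ ∃ C : Code ℓ, codeB C = (msgOf v).1 := by
  cases v with
  | nil => simp [Pub.validMsg, Val.isNode, msgOf]
  | node l r =>
    simp only [Pub.validMsg, Val.isNode, Val.left, Val.right, Bool.true_and, Bool.and_eq_true,
      Val.isBits_iff, dropU_eq, hp.nn, msgOf, enc_pair, Val.node.injEq, List.isEmpty_iff,
      List.drop_eq_nil_iff, exists_codeB_iff]
    constructor
    · rintro ⟨⟨⟨⟨h1, h2⟩, h3⟩, h4⟩, h5⟩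
      have : l.toBits.length = bitLen ℓ := le_antisymm h3 h2
      exact ⟨⟨h1, h5⟩, this, (hp.leb_iff this).1 h4⟩
    · rintro ⟨⟨h1, h5⟩, h2, h3⟩
      exact ⟨⟨⟨⟨h1, h2.ge⟩, h2.le⟩, (hp.leb_iff h2).2 h3⟩, h5⟩

end Pub.Fits

section Invariants

variable {ℓ k : ℕ} (f : AddInput → Code ℓ → BitVec k)

theorem blockB_codeB (u : Bits) (X : Code ℓ) : blockB f u (codeB X) = bitsOf (block f u X) := by
  rw [blockB, onBits_codeB, block, bitsOf_append]; rfl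

theorem length_blockB {u X : Bits} (hX : ∃ C : Code ℓ, codeB C = X) :
    (blockB f u X).length = k + bitLen ℓ := by
  obtain ⟨C, rfl⟩ := hX
  rw [blockB_codeB, length_bitsOf]

/-- The hash value occupies the leading bits, so cutting it off leaves the code. In particular a
starting block is always in range. -/
theorem low_blockB {pub : Pub} (hp : pub.Fits ℓ k) {u X : Bits} (hX : ∃ C : Code ℓ, codeB C = X) :
    pub.low (blockB f u X) = X := by
  obtain ⟨C, rfl⟩ := hX
  rw [hp.low_eq, blockB, onBits_codeB, List.drop_append_of_le_length (by simp)]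
  simp

/-- Two different messages with the same block. -/
def IsColl (ℓ U : ℕ) {k : ℕ} (f : AddInput → Code ℓ → BitVec k) (p : BMsg × BMsg) : Prop :=
  OkMsg ℓ U p.1 ∧ OkMsg ℓ U p.2 ∧ p.1 ≠ p.2 ∧ blockB f p.1.2 p.1.1 = blockB f p.2.2 p.2.1

/-- The state after `j` bookkeeping steps and `i` attempts. -/
structure SimInv (pub : Pub) (U H j i : ℕ) (st : Sim) : Prop where
  pub_eq : st.pub = pub
  toks_len : st.toks.length ≤ j
  toks : ∀ t ∈ st.toks, ∃ C : Code ℓ, codeB C = t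
  nodup : st.toks.Nodup
  asked_len : st.asked.length ≤ i * pub.prm.1.length
  asked : ∀ x ∈ st.asked, x.length = k + bitLen ℓ
  done_len : st.done.length ≤ i
  done : ∀ e ∈ st.done, e.1 = blockB f e.2.2 e.2.1 ∧ OkMsg ℓ U e.2
  msgs_len : st.msgs.length ≤ j
  msgs : ∀ p ∈ st.msgs, OkMsg ℓ H p
  pair : ∀ p, st.pair = some p → OkMsg ℓ H p.1 ∧ OkMsg ℓ H p.2
  coll : ∀ p, st.coll = some p → IsColl ℓ U f p
  bad_of_coll : st.coll.isSome = true → st.bad = true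
  fresh : st.bad = false → ∀ x ∈ st.asked, pub.inR x = true → ∃ p, (x, p) ∈ st.done

variable {f}

theorem SimInv.mono {pub : Pub} {U H j i j' i' : ℕ} {st : Sim} (h : SimInv f pub U H j i st)
    (hj : j ≤ j') (hi : i ≤ i') : SimInv f pub U H j' i' st :=
  { h with
    toks_len := h.toks_len.trans hj
    msgs_len := h.msgs_len.trans hj
    done_len := h.done_len.trans hi
    asked_len := h.asked_len.trans (Nat.mul_le_mul_right _ hi) }

end Invariants

end Tokenization

/-! ### Preservation of the invariants of the simulator -/

namespace Tokenization
open Dialog Enc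

variable {α β γ δ ε : Type} [Enc α] [Enc β] [Enc γ] [Enc δ] [Enc ε]

theorem lval_incr_iterate (u : Bits) (i : ℕ) :
    lval (incr^[i] u).reverse = lval u.reverse + i := by
  induction i with
  | zero => rfl
  | succ i ih => rw [Function.iterate_succ_apply', lval_incr, ih]; ring

theorem incr_iterate_injective (u : Bits) : Function.Injective fun i => incr^[i] u := by
  intro i j h
  have := congrArg (fun v : Bits => lval v.reverse) h
  simp only [lval_incr_iterate] at this
  omega

theorem length_incr_iterate_le (u : Bits) (i : ℕ) : (incr^[i] u).length ≤ u.length + i := by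
  induction i with
  | zero => rfl
  | succ i ih =>
    rw [Function.iterate_succ_apply']
    have := length_incr_le (incr^[i] u)
    omega

section Invariants

variable {ℓ k : ℕ} (f : AddInput → Code ℓ → BitVec k)

/-- The successors of `u` are pairwise different because each raises the value by one, so at most
`done.length` of them have been processed. The loop has one more round than that and therefore
stops: at a block without an entry, or at a block recorded for another message, which yields a
collision. -/
theorem skip_spec (done : List (Bits × BMsg)) (X u : Bits) :
    ∃ j ≤ done.length, (skip f done X u).1 = incr^[j] u ∧
      (∀ i < j, (blockB f (incr^[i] u) X, (X, incr^[i] u)) ∈ done) ∧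
      ((skip f done X u).2.2 = none → ∀ p, (blockB f (incr^[j] u) X, p) ∉ done) ∧
      ∀ c, (skip f done X u).2.2 = some c →
        c.1 ≠ c.2 ∧ c.2 = (X, incr^[j] u) ∧ (blockB f (incr^[j] u) X, c.1) ∈ done := by
  let P : ℕ → Bits × Bool × Option (BMsg × BMsg) → Prop := fun n p =>
    ∃ j ≤ n, p.1 = incr^[j] u ∧ (∀ i < j, (blockB f (incr^[i] u) X, (X, incr^[i] u)) ∈ done) ∧
      (p.2.1 = false → j = n ∧ p.2.2 = none) ∧
      (p.2.1 = true → j < n ∧ (p.2.2 = none → ∀ q, (blockB f (incr^[j] u) X, q) ∉ done)) ∧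
      ∀ c, p.2.2 = some c →
        c.1 ≠ c.2 ∧ c.2 = (X, incr^[j] u) ∧ (blockB f (incr^[j] u) X, c.1) ∈ done
  have key : ∀ (l : List (Bits × BMsg)) (n : ℕ) (p), P n p →
      P (n + l.length) (l.foldl (fun p _ => skipStep f done X p) p) := by
    intro l
    induction l with
    | nil => intro n p h; exact h
    | cons x l ih =>
      intro n p h
      rw [List.foldl_cons, List.length_cons, show n + (l.length + 1) = n + 1 + l.length by ring]
      refine ih _ _ ?_
      obtain ⟨v, isEnd, c⟩ := p
      obtain ⟨j, hj, hv, hd, h1, h2, h3⟩ := h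
      dsimp only at hv h1 h2 h3
      subst hv
      cases isEnd with
      | true =>
        refine ⟨j, by omega, rfl, hd, by simp [skipStep], fun _ => ⟨by have := (h2 rfl).1; omega, ?_⟩, h3⟩
        exact (h2 rfl).2
      | false =>
        obtain ⟨rfl, rfl⟩ := h1 rfl
        simp only [skipStep, cond_false]
        cases hfb : findb (blockB f (incr^[j] u) X) done with
        | none =>
          exact ⟨j, by omega, rfl, hd, by simp [skipNext], fun _ => ⟨by omega, fun _ => findb_eq_none hfb⟩,
            by simp [skipNext]⟩
        | some q =>
          have hq := mem_of_findb hfb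
          by_cases hqe : q = (X, incr^[j] u)
          · have : meqb q (X, incr^[j] u) = true := by simpa using hqe
            simp only [skipNext, Option.isSome_some, Option.getD_some, this, cond_true]
            refine ⟨j + 1, le_rfl, by rw [Function.iterate_succ_apply'], fun i hi => ?_,
              by simp, by simp, by simp⟩
            rcases Nat.lt_succ_iff_lt_or_eq.1 hi with h | rfl
            · exact hd i h
            · rw [← hqe]; exact hq
          · have : meqb q (X, incr^[j] u) = false := by
              rw [Bool.eq_false_iff, ne_eq, meqb_iff]; exact hqe
            simp only [skipNext, Option.isSome_some, Option.getD_some, this, cond_true, cond_false]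
            refine ⟨j, by omega, rfl, hd, by simp, by simp, fun c hc => ?_⟩
            obtain rfl := Option.some.inj hc
            exact ⟨hqe, rfl, hq⟩
  obtain ⟨j, hj, hv, hd, h1, h2, h3⟩ := key (default :: done) 0 (u, false, none)
    ⟨0, le_rfl, rfl, by simp, by simp, by simp, by simp⟩
  rw [zero_add, List.length_cons] at hj h1 h2
  change (skip f done X u).2.1 = false → _ at h1
  change (skip f done X u).2.1 = true → _ at h2
  -- Pigeonhole: if all `done.length + 1` rounds had moved on, as many different messages would
  -- occur among the entries of `done`.
  have h_end : (skip f done X u).2.1 = true := by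
    by_contra hc
    obtain ⟨rfl, -⟩ := h1 (by simpa using hc)
    have hsub : (Finset.range (done.length + 1)).image (fun i => (X, incr^[i] u)) ⊆
        (done.map Prod.snd).toFinset := by
      intro p hp
      obtain ⟨i, hi, rfl⟩ := Finset.mem_image.1 hp
      exact List.mem_toFinset.2 (List.mem_map.2 ⟨_, hd i (Finset.mem_range.1 hi), rfl⟩)
    have := Finset.card_le_card hsub
    rw [Finset.card_image_of_injective _ fun a b h =>
      incr_iterate_injective u (Prod.mk.inj h).2, Finset.card_range] at this
    have := (List.toFinset_card_le (done.map Prod.snd)).trans_eq (List.length_map _)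
    omega
  exact ⟨j, by have := (h2 h_end).1; omega, hv, hd, (h2 h_end).2, h3⟩

variable {f}
variable {pub : Pub} {ok : Bits → Bits → Prop}

/-- What is known about the state of a walk that started at `b` with the blocks `A₀` sent before,
after `i` steps. -/
structure WalkInv (pub : Pub) (m : ℕ) (A₀ : List Bits) (b : Bits) (i : ℕ)
    (w : List Bits × Bits × Bool × Bool) : Prop where
  length : ∀ x ∈ w.1, x.length = m
  card : w.1.length ≤ A₀.length + i
  cur : w.2.1.length = m
  inR : w.2.2.1 = true → pub.inR w.2.1 = true
  new : ∀ x ∈ w.1, x ∈ A₀ ∨ x = b ∨ pub.inR x = false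
  cur_new : w.2.2.1 = false → w.2.1 = b ∨ pub.inR w.2.1 = false

/-- A block is sent only after it has been compared with all earlier ones, and the walk goes on only
from its start or from an answer out of range. These two facts are the source of distinctness and of
`SimInv.fresh`. -/
theorem walkInv_step {m : ℕ} (hok : ∀ q r, q.length = m → ok q r → r.length = m) {A₀ : List Bits}
    {b : Bits} {i : ℕ} {w : List Bits × Bits × Bool × Bool} (h : WalkInv pub m A₀ b i w) :
    (walkStep pub w).wp m ok w.1 fun A w' => A = w'.1 ∧ WalkInv pub m A₀ b (i + 1) w' := by
  obtain ⟨A, c, fin, bad⟩ := w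
  have hc := h.card
  have hcn := h.cur_new
  have hnew := h.new
  dsimp only at hc hcn hnew
  rw [walkStep]
  cases hfb : (fin || bad) with
  | true => exact ⟨rfl, h.length, by dsimp only; omega, h.cur, h.inR, h.new, h.cur_new⟩
  | false =>
    simp only [Bool.or_eq_false_iff] at hfb
    obtain ⟨rfl, rfl⟩ := hfb
    cases hm : memb c A with
    | true => exact ⟨rfl, h.length, by dsimp only; omega, h.cur, by simp, h.new, h.cur_new⟩
    | false =>
      have hcA : c ∉ A := fun hcA => by simp [memb_iff.2 hcA] at hm
      refine ⟨hcA, h.cur, fun r hr => ⟨rfl, ?_, ?_, hok _ _ h.cur hr, id, ?_, Or.inr⟩⟩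
      · simpa using ⟨h.cur, h.length⟩
      · simp; omega
      · intro x hx
        rcases List.mem_cons.1 hx with rfl | hx
        · exact Or.inr (hcn rfl)
        · exact hnew x hx

theorem walkInv_walk {m : ℕ} (hok : ∀ q r, q.length = m → ok q r → r.length = m) {A₀ : List Bits}
    {b : Bits} (hA : ∀ x ∈ A₀, x.length = m) (hb : b.length = m) :
    (walkB pub A₀ b).wp m ok A₀ fun A w => A = w.1 ∧ WalkInv pub m A₀ b pub.prm.1.length w := by
  have h0 : WalkInv pub m A₀ b 0 (A₀, b, false, false) :=
    ⟨hA, by simp, hb, by simp, fun x hx => Or.inl hx, fun _ => Or.inl rfl⟩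
  refine wp_foldM (fun i A w => A = w.1 ∧ WalkInv pub m A₀ b i w)
    (fun i _ A w _ _ h => ?_) ⟨rfl, h0⟩
  obtain ⟨rfl, h⟩ := h
  exact walkInv_step hok h

/-- The parts of the state that an attempt does not change. -/
structure Sim.Same (st st' : Sim) : Prop where
  nu : st'.nu = st.nu
  msgs : st'.msgs = st.msgs
  pair : st'.pair = st.pair
  toks : st'.toks = st.toks

variable (hp : pub.Fits ℓ k)
  (hok : ∀ q r, q.length = k + bitLen ℓ → ok q r → r.length = k + bitLen ℓ)
include hp hok

/-- An entry of `done` with the same block but a different message gives `IsColl`; otherwise a walk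
starts and its block is recorded. The additional input grows by at most one bit per skipped entry,
and by one more if the candidate is rejected. -/
theorem simInv_attempt {U H j i : ℕ} {st : Sim} (h : SimInv f pub U H j i st) (hbad : st.bad = false)
    {X u : Bits} (hX : ∃ C : Code ℓ, codeB C = X) (hu : u.length + i + 2 ≤ U) :
    (attempt f st X u).wp (k + bitLen ℓ) ok st.asked fun A p => A = p.1.asked ∧
      SimInv f pub U H j (i + 1) p.1 ∧ st.Same p.1 ∧ p.2.1.length ≤ u.length + i + 2 ∧
      ∀ t, p.2.2 = some t → (∃ C : Code ℓ, codeB C = t) ∧ t ∉ p.1.toks := by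
  obtain ⟨s, hs, hv, hd, hnone, hsome⟩ := skip_spec f st.done X u
  have hvl := length_incr_iterate_le u s
  have hdl := h.done_len
  rw [attempt]
  rw [hv]
  cases hc : (skip f st.done X u).2.2 with
  | some c =>
    obtain ⟨h1, h2, h3⟩ := hsome c hc
    have hi := h.mono le_rfl (Nat.le_succ i)
    refine ⟨rfl, ⟨hi.pub_eq, hi.toks_len, hi.toks, hi.nodup, hi.asked_len, hi.asked, hi.done_len,
      hi.done, hi.msgs_len, hi.msgs, hi.pair, ?_, fun _ => rfl, fun hb => by cases hb⟩,
      ⟨rfl, rfl, rfl, rfl⟩, by dsimp only; omega, by simp⟩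
    intro p hpc
    obtain rfl := Option.some.inj hpc
    obtain ⟨h4, h5⟩ := h.done _ h3
    rw [IsColl, h2]
    exact ⟨h5, ⟨hX, by dsimp only; omega⟩, h2 ▸ h1, h4.symm⟩
  | none =>
    simp only [Option.isSome_none, cond_false, wp_bind]
    have hb : (blockB f (incr^[s] u) X).length = k + bitLen ℓ := length_blockB f hX
    rw [h.pub_eq]
    refine wp_mono (walkInv_walk hok h.asked hb) ?_
    rintro _ w ⟨rfl, hw⟩
    obtain ⟨A, c, fin, bad⟩ := w
    have hwc := hw.card
    have hal := h.asked_len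
    have hwn := hw.new
    dsimp only at hwc hwn
    have hinv : ∀ b' : Bool, SimInv f pub U H j (i + 1) { st with
        asked := A, done := (blockB f (incr^[s] u) X, X, incr^[s] u) :: st.done, bad := b' } := by
      intro b'
      refine ⟨h.pub_eq, h.toks_len, h.toks, h.nodup, ?_, hw.length, by simpa using hdl, ?_,
        h.msgs_len, h.msgs, h.pair, h.coll, ?_, ?_⟩
      · simp only [Nat.succ_mul]; omega
      · intro e he
        rcases List.mem_cons.1 he with rfl | he
        · exact ⟨rfl, hX, by dsimp only; omega⟩
        · exact h.done e he
      · intro hcs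
        have := h.bad_of_coll hcs
        simp [hbad] at this
      -- A block in range was sent before this attempt, or is the starting block that has just been
      -- recorded. All other blocks of the walk are out of range.
      · intro _ x hx hxR
        rcases hwn x hx with h1 | rfl | h1
        · obtain ⟨p, hp⟩ := h.fresh hbad x h1 hxR
          exact ⟨p, List.mem_cons_of_mem _ hp⟩
        · exact ⟨_, List.mem_cons_self⟩
        · simp [h1] at hxR
    have hinv' := hinv st.bad
    rw [wp_ret, afterWalk]
    cases fin with
    | false => exact ⟨rfl, hinv true, ⟨rfl, rfl, rfl, rfl⟩, by simp; omega, by simp⟩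
    | true =>
      have hinc := length_incr_le (incr^[s] u)
      cases ht : memb (st.pub.low c) st.toks with
      | true => exact ⟨rfl, hinv', ⟨rfl, rfl, rfl, rfl⟩, by simp; omega, by simp⟩
      | false =>
        refine ⟨rfl, hinv', ⟨rfl, rfl, rfl, rfl⟩, by simp; omega, fun t htt => ?_⟩
        simp only [cond_true, cond_false, Option.some.injEq] at htt ⊢
        subst htt
        refine ⟨?_, fun hm => by simp [memb_iff.2 hm] at ht⟩
        rw [h.pub_eq]
        exact (hp.inR_iff hw.cur).1 (hw.inR rfl)

theorem simInv_tokStep {U H j i : ℕ} {st st₀ : Sim} (h : SimInv f pub U H j i st)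
    {X u : Bits} (hX : ∃ C : Code ℓ, codeB C = X) (hu : u.length + i + 2 ≤ U) {res : Option Bits}
    (hst : st₀.Same st)
    (hres : ∀ t, res = some t → (∃ C : Code ℓ, codeB C = t) ∧ t ∉ st.toks) :
    (tokStep f X (st, u, res)).wp (k + bitLen ℓ) ok st.asked fun A p => A = p.1.asked ∧
      SimInv f pub U H j (i + 1) p.1 ∧ st₀.Same p.1 ∧ p.2.1.length ≤ u.length + i + 2 ∧
      ∀ t, p.2.2 = some t → (∃ C : Code ℓ, codeB C = t) ∧ t ∉ p.1.toks := by
  rw [tokStep]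
  cases hb : (st.bad || res.isSome) with
  | true => exact ⟨rfl, h.mono le_rfl (Nat.le_succ i), hst, by dsimp only; omega, hres⟩
  | false =>
    simp only [Bool.or_eq_false_iff] at hb
    refine wp_mono (simInv_attempt hp hok h hb.1 hX hu) ?_
    rintro A p ⟨h1, h2, h3, h4, h5⟩
    exact ⟨h1, h2, ⟨h3.nu.trans hst.nu, h3.msgs.trans hst.msgs, h3.pair.trans hst.pair,
      h3.toks.trans hst.toks⟩, h4, h5⟩

/-- The invariant during the attempts for one request. -/
def TokInv (f : AddInput → Code ℓ → BitVec k) (pub : Pub) (U H j i L I : ℕ) (st₀ : Sim) (a : ℕ)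
    (A : List Bits) (p : Sim × Bits × Option Bits) : Prop :=
  A = p.1.asked ∧ SimInv f pub U H j (i + a) p.1 ∧ st₀.Same p.1 ∧
    p.2.1.length ≤ L + a * (I + 2) ∧
    ∀ t, p.2.2 = some t → (∃ C : Code ℓ, codeB C = t) ∧ t ∉ p.1.toks

/-- The growth in one attempt depends on the number of entries of `done`, hence on all earlier
attempts, which `I` bounds. So the lengths stay below `L + fuel * (I + 2)`, and polynomially many
attempts keep them polynomial. -/
theorem tokInv_step {U H j i L I : ℕ} {st₀ : Sim} {a : ℕ} {A : List Bits}
    {p : Sim × Bits × Option Bits} {X : Bits} (hX : ∃ C : Code ℓ, codeB C = X)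
    (ha : a < pub.fuel.length) (hI : i + pub.fuel.length ≤ I)
    (hU : L + pub.fuel.length * (I + 2) ≤ U) (h : TokInv f pub U H j i L I st₀ a A p) :
    (tokStep f X p).wp (k + bitLen ℓ) ok A (TokInv f pub U H j i L I st₀ (a + 1)) := by
  obtain ⟨st, u, res⟩ := p
  obtain ⟨rfl, h1, h2, h3, h4⟩ := h
  dsimp only at h1 h2 h3 h4
  have h5 : (a + 1) * (I + 2) ≤ pub.fuel.length * (I + 2) := Nat.mul_le_mul_right _ ha
  rw [Nat.succ_mul] at h5
  refine wp_mono (simInv_tokStep hp hok h1 hX (by omega) h2 h4) ?_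
  rintro A ⟨st', u', res'⟩ ⟨g1, g2, g3, g4, g5⟩
  refine ⟨g1, g2, g3, ?_, g5⟩
  dsimp only at g4 ⊢
  rw [Nat.succ_mul]
  omega

theorem tokInv_fold {U H j i L I : ℕ} {st : Sim} (h : SimInv f pub U H j i st) {m : BMsg}
    (hm : OkMsg ℓ L m) (hI : i + pub.fuel.length ≤ I) (hU : L + pub.fuel.length * (I + 2) ≤ U) :
    (foldM (fun p (_ : Unit) => tokStep f m.1 p) (st, m.2, none) st.pub.fuel).wp
      (k + bitLen ℓ) ok st.asked (TokInv f pub U H j i L I st pub.fuel.length) := by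
  rw [h.pub_eq]
  refine wp_foldM (TokInv f pub U H j i L I st) (fun a ha A p _ _ h => ?_)
    ⟨rfl, h, ⟨rfl, rfl, rfl, rfl⟩, by simpa using hm.2, by simp⟩
  exact tokInv_step hp hok hm.1 ha hI hU h

omit hp hok in
theorem simInv_finish {U H j i : ℕ} {p : Sim × Bits × Option Bits} (h : SimInv f pub U H j i p.1)
    (hres : ∀ t, p.2.2 = some t → (∃ C : Code ℓ, codeB C = t) ∧ t ∉ p.1.toks) :
    (finish p).1.asked = p.1.asked ∧ SimInv f pub U H (j + 1) i (finish p).1 ∧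
      ∀ t, (finish p).2 = some t → ∃ C : Code ℓ, codeB C = t := by
  obtain ⟨st, u, res⟩ := p
  have h' := h.mono (Nat.le_succ j) le_rfl
  cases res with
  | some t =>
    obtain ⟨h1, h2⟩ := hres t rfl
    refine ⟨rfl, ?_, fun t' ht => by obtain rfl := Option.some.inj ht; exact h1⟩
    refine { h' with toks_len := by simpa [finish] using h.toks_len, toks := ?_, nodup := ?_ }
    · intro t' ht'
      rcases List.mem_cons.1 ht' with rfl | ht'
      · exact h1
      · exact h.toks t' ht'
    · exact List.nodup_cons.2 ⟨h2, h.nodup⟩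
  | none =>
    cases hf : st.full with
    | true => simpa [finish, hf] using h'
    | false =>
      simp only [finish, hf, Option.isSome_none, cond_false]
      refine ⟨trivial, { h' with bad_of_coll := fun _ => rfl, fresh := fun hb => by cases hb }, by simp⟩

theorem simInv_tokenize {U H j i L I : ℕ} {st : Sim} (h : SimInv f pub U H j i st) {m : BMsg}
    (hm : OkMsg ℓ L m) (hI : i + pub.fuel.length ≤ I) (hU : L + pub.fuel.length * (I + 2) ≤ U) :
    (tokenizeB f st m).wp (k + bitLen ℓ) ok st.asked fun A p => A = p.1.asked ∧
      SimInv f pub U H (j + 1) (i + pub.fuel.length) p.1 ∧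
      ∀ t, p.2 = some t → ∃ C : Code ℓ, codeB C = t := by
  rw [tokenizeB, wp_bind]
  refine wp_mono (tokInv_fold hp hok h hm hI hU) ?_
  rintro A p ⟨rfl, h1, h2, h3, h4⟩
  obtain ⟨g1, g2, g3⟩ := simInv_finish h1 h4
  exact ⟨g1.symm, g2, g3⟩

omit hok in
/-- The message and the state after the bookkeeping. -/
theorem simInv_decide {U H j i : ℕ} {st : Sim} (h : SimInv f pub U H j i st) {q : Val}
    (hq : q.ht ≤ H) {m : BMsg} {st' : Sim} (hd : decideReq st q = some (m, st')) :
    OkMsg ℓ H m ∧ SimInv f pub U H (j + 1) i st' ∧ st'.asked = st.asked ∧ st'.bad = st.bad ∧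
      st'.toks = st.toks ∧ st'.nu = st.nu ∧ st'.done = st.done ∧ st'.coll = st.coll := by
  have h' := h.mono (Nat.le_succ j) le_rfl
  have hmsg : ∀ v : Val, v.ht ≤ H → st.pub.validMsg v = true → OkMsg ℓ H (msgOf v) := by
    intro v hv hval
    rw [h.pub_eq] at hval
    obtain ⟨-, h2⟩ := hp.validMsg_iff.1 hval
    exact ⟨h2, (Val.length_toBits_le _).trans ((Val.ht_right v).trans hv)⟩
  have hr := Val.ht_right q
  have hrr := Val.ht_right q.right
  have hrl := Val.ht_left q.right
  rw [decideReq] at hd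
  cases h1 : q.isNode <;> simp only [h1, cond_true, cond_false, reduceCtorEq] at hd
  cases h2 : q.left.isNode <;> simp only [h2, cond_true, cond_false] at hd
  · cases h3 : st.pub.validMsg q.right <;> simp only [h3, cond_true, cond_false, reduceCtorEq] at hd
    have hm := hmsg _ (by omega) h3
    cases h4 : st.pair.isSome <;> simp only [h4, cond_true, cond_false] at hd
    · simp only [Option.some.injEq, Prod.mk.injEq] at hd
      obtain ⟨rfl, rfl⟩ := hd
      refine ⟨hm, { h' with msgs_len := by simpa using h.msgs_len, msgs := ?_ }, rfl, rfl, rfl, rfl, rfl, rfl⟩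
      intro p hp
      rcases List.mem_cons.1 hp with rfl | hp
      · exact hm
      · exact h.msgs p hp
    · cases h5 : (meqb (msgOf q.right) (st.pair.getD default).1 ||
        meqb (msgOf q.right) (st.pair.getD default).2) <;>
        simp only [h5, cond_true, cond_false, reduceCtorEq, Option.some.injEq, Prod.mk.injEq] at hd
      obtain ⟨rfl, rfl⟩ := hd
      exact ⟨hm, h', rfl, rfl, rfl, rfl, rfl, rfl⟩
  · cases h3 : (!q.left.left.isNode && !q.left.right.isNode && q.right.isNode &&
      st.pub.validMsg q.right.left && st.pub.validMsg q.right.right) <;>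
      simp only [h3, cond_true, cond_false, reduceCtorEq] at hd
    simp only [Bool.and_eq_true] at h3
    cases h4 : (st.pair.isSome || mmemb (msgOf q.right.left) st.msgs ||
      mmemb (msgOf q.right.right) st.msgs) <;>
      simp only [h4, cond_true, cond_false, reduceCtorEq, Option.some.injEq, Prod.mk.injEq] at hd
    obtain ⟨rfl, rfl⟩ := hd
    have hm0 := hmsg q.right.left (by omega) h3.1.2
    have hm1 := hmsg q.right.right (by omega) h3.2
    refine ⟨by cases st.nu <;> simpa, { h' with pair := ?_ }, rfl, rfl, rfl, rfl, rfl, rfl⟩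
    intro p hp
    obtain rfl := Option.some.inj hp
    exact ⟨hm0, hm1⟩

/-- A request records at most one message and one token, which accounts for `j + 2`. That the answer
is a legal one of the token service is what allows the time bound of the adversary to be used in the
simulation. -/
theorem simInv_simStep {U H j i I : ℕ} {st : Sim} (h : SimInv f pub U H j i st) {q : Val}
    (hq : q.ht ≤ H) (hI : i + pub.fuel.length ≤ I) (hU : H + pub.fuel.length * (I + 2) ≤ U) :
    (simStep f st q).wp (k + bitLen ℓ) ok st.asked fun A p => A = p.2.asked ∧
      SimInv f pub U H (j + 2) (i + pub.fuel.length) p.2 ∧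
      p.1 ∈ Set.range (encOption (encOption (encCode (ℓ := ℓ)))) := by
  rw [simStep]
  cases hd : decideReq st q with
  | none =>
    simp only [Option.isSome_none, Bool.not_false, Bool.or_true, cond_true, wp_ret]
    exact ⟨trivial, h.mono (by omega) (by omega), none, rfl⟩
  | some r =>
    cases hb : st.bad with
    | true => exact ⟨rfl, h.mono (by omega) (by omega), none, rfl⟩
    | false =>
      obtain ⟨m, st'⟩ := r
      obtain ⟨h1, h2, h3, -⟩ := simInv_decide hp h hq hd
      simp only [Option.isSome_some, Bool.not_true, Bool.or_false, cond_false, Option.getD_some,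
        wp_bind, ← h3]
      refine wp_mono (simInv_tokenize hp hok h2 h1 hI hU) ?_
      rintro A ⟨st'', o⟩ ⟨rfl, g1, g2⟩
      refine ⟨rfl, g1, ?_⟩
      cases o with
      | none => exact ⟨some none, rfl⟩
      | some t =>
        obtain ⟨C, rfl⟩ := g2 t rfl
        exact ⟨some (some C), rfl⟩

end Invariants

end Tokenization

/-! ### Dialogues with a cipher whose questions are answered by a handler -/

namespace Tokenization
open Dialog Enc

variable {α β γ δ ε : Type} [Enc α] [Enc β] [Enc γ] [Enc δ] [Enc ε]

namespace FP

variable {S : ℕ → α → Prop}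

theorem expr {f : α → β} (e : Expr) (h : ∀ a, e.eval (fun _ => enc a) = enc (f a)) :
    FP S fun _ a => .ret (f a) :=
  ⟨fun r => .assign r (e.at r), .C 1, fun _ a _ => by simpa using Computes.expr e a (f a) (h a)⟩

theorem comp_expr {S' : ℕ → β → Prop} {f : α → β} {g' : ℕ → β → Dialog Val Val γ} (hg' : FP S' g')
    (e : Expr) (he : ∀ a, e.eval (fun _ => enc a) = enc (f a)) (h : ∀ κ a, S κ a → S' κ (f a)) :
    FP S fun κ a => g' κ (f a) :=
  (expr e he).comp hg' fun κ a b ha hb => by obtain rfl := hb; exact h κ a ha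

theorem map_expr {g : ℕ → α → Dialog Val Val β} (hg : FP S g) {f : β → γ} (e : Expr)
    (he : ∀ a, e.eval (fun _ => enc a) = enc (f a)) :
    FP S fun κ a => (g κ a).bind fun b => .ret (f b) :=
  hg.comp (S' := fun _ _ => True) (expr e he) fun _ _ _ _ _ => trivial

end FP

theorem PolyHeight.prod {S : ℕ → α → Prop} {S' : ℕ → β → Prop} (hS : PolyHeight S)
    (hS' : PolyHeight S') : PolyHeight fun κ (p : α × β) => S κ p.1 ∧ S' κ p.2 := by
  obtain ⟨b, hb, h⟩ := hS
  obtain ⟨b', hb', h'⟩ := hS'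
  refine ⟨fun κ => b κ + b' κ + 1, (hb.add hb').add (.const 1), fun κ p hp => ?_⟩
  have := h κ _ hp.1
  have := h' κ _ hp.2
  change max (enc p.1).ht (enc p.2).ht + 1 ≤ b κ + b' κ + 1
  omega

theorem PolyHeight.mono {S S' : ℕ → α → Prop} (hS : PolyHeight S) (h : ∀ κ a, S' κ a → S κ a) :
    PolyHeight S' := by
  obtain ⟨b, hb, hS⟩ := hS
  exact ⟨b, hb, fun κ a ha => hS κ a (h κ a ha)⟩

/-- A way to answer questions for the values of a cipher with blocks of length `m`, by interaction
with an oracle on trees. -/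
structure Handler (m : ℕ → ℕ) where
  σ : Type
  [encState : Enc σ]
  step : σ → Bits → Dialog Val Val (Bits × σ)
  Inv : ℕ → σ → Prop
  polyHeight : PolyHeight Inv
  leaf : ∀ {κ s q r s'}, Inv κ s → (step s q).AnyLeaf (r, s') → r.length = m κ ∧ Inv κ s'
  fp : FP (fun κ (p : σ × Bits) => Inv κ p.1 ∧ p.2.length = m κ) fun _ p => step p.1 p.2

attribute [instance] Handler.encState

/-- A dialogue with a cipher that is carried out in polynomial time once its questions are answered
by the handler. -/
def FPH {m : ℕ → ℕ} (H : Handler m) (S : ℕ → α → Prop) (g : ℕ → α → BDialog β) : Prop :=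
  FP (fun κ (p : α × H.σ) => S κ p.1 ∧ H.Inv κ p.2) fun κ p => (g κ p.1).handle H.step p.2

/-- The possible results if all answers have length `m`. -/
abbrev Dialog.LenLeaf {α : Type} (m : ℕ) (d : BDialog α) (a : α) : Prop :=
  d.Leaf (fun r => r.length = m) a

theorem Handler.leaf_handle {m : ℕ → ℕ} (H : Handler m) {κ : ℕ} {α : Type} {d : BDialog α}
    {s s' : H.σ} {a : α} (hs : H.Inv κ s) (h : (d.handle H.step s).AnyLeaf (a, s')) :
    d.LenLeaf (m κ) a ∧ H.Inv κ s' :=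
  Dialog.leaf_handle (inv := H.Inv κ) (fun _ _ _ _ hi hl => H.leaf hi hl) hs h

namespace FPH

variable {m : ℕ → ℕ} {H : Handler m} {S S' : ℕ → α → Prop}

theorem mono {g : ℕ → α → BDialog β} (h : FPH H S g) (hS : ∀ κ a, S' κ a → S κ a) : FPH H S' g :=
  FP.mono h fun κ p hp => ⟨hS κ p.1 hp.1, hp.2⟩

theorem congr {g g' : ℕ → α → BDialog β} (h : FPH H S g) (hS : ∀ κ a, S κ a → g κ a = g' κ a) :
    FPH H S g' :=
  FP.congr h fun κ p hp => by rw [hS κ p.1 hp.1]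

theorem of_fp {F : ℕ → α → β} (h : FP S fun κ a => .ret (F κ a)) : FPH H S fun κ a => .ret (F κ a) :=
  ((h.comp_expr (S := fun κ (p : α × H.σ) => S κ p.1 ∧ H.Inv κ p.2) (f := Prod.fst) (.hd (.var 0))
    (fun _ => rfl) fun _ _ hp => hp.1).keep).map_expr
    (f := fun p : (α × H.σ) × β => (p.2, p.1.2)) (.cons (.tl (.var 0)) (.tl (.hd (.var 0))))
    fun _ => rfl

theorem of_pt {f : α → β} (hf : PT f) (hS : PolyHeight S) : FPH H S fun _ a => .ret (f a) :=
  of_fp (F := fun _ => f) (FP.of_pt hf hS)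

theorem comp_pt {S' : ℕ → β → Prop} {f : α → β} {g' : ℕ → β → BDialog γ} (hg' : FPH H S' g')
    (hf : PT f) (hS : PolyHeight S) (h : ∀ κ a, S κ a → S' κ (f a)) :
    FPH H S fun κ a => g' κ (f a) := by
  refine FP.comp_pt (f := fun p : α × H.σ => (f p.1, p.2)) hg' (by fun_prop)
    (hS.prod H.polyHeight) fun κ p hp => ⟨h κ _ hp.1, hp.2⟩

theorem bind {S' : ℕ → α × β → Prop} {g : ℕ → α → BDialog β} {g' : ℕ → α → β → BDialog γ}
    (hg : FPH H S g) (hg' : FPH H S' fun κ p => g' κ p.1 p.2)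
    (h : ∀ κ a b, S κ a → (g κ a).LenLeaf (m κ) b → S' κ (a, b)) :
    FPH H S fun κ a => (g κ a).bind (g' κ a) := by
  have h1 : FP (fun κ (p : (α × H.σ) × (β × H.σ)) => S' κ (p.1.1, p.2.1) ∧ H.Inv κ p.2.2)
      fun κ p => (g' κ p.1.1 p.2.1).handle H.step p.2.2 :=
    FP.comp_expr (f := fun p : (α × H.σ) × (β × H.σ) => ((p.1.1, p.2.1), p.2.2)) hg'
      (.cons (.cons (.hd (.hd (.var 0))) (.hd (.tl (.var 0)))) (.tl (.tl (.var 0))))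
      (fun _ => rfl) fun _ _ hp => hp
  refine (FP.bind (g' := fun κ (p : α × H.σ) (q : β × H.σ) => (g' κ p.1 q.1).handle H.step q.2)
    hg h1 fun κ p q hp hq => ?_).congr fun κ p _ => (handle_bind _ _ _ _).symm
  have := H.leaf_handle hp.2 hq
  exact ⟨h κ _ _ hp.1 this.1, this.2⟩

theorem cond {t : α → Bool} {g g' : ℕ → α → BDialog β} (ht : PT t) (hS : PolyHeight S)
    (hg : FPH H (fun κ a => S κ a ∧ t a = true) g)
    (hg' : FPH H (fun κ a => S κ a ∧ t a = false) g') :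
    FPH H S fun κ a => cond (t a) (g κ a) (g' κ a) := by
  refine (FP.cond (t := fun p : α × H.σ => t p.1) (by fun_prop) (hS.prod H.polyHeight)
    (FP.mono hg ?_) (FP.mono hg' ?_)).congr fun κ p _ => ?_
  · exact fun κ p hp => ⟨⟨hp.1.1, hp.2⟩, hp.1.2⟩
  · exact fun κ p hp => ⟨⟨hp.1.1, hp.2⟩, hp.1.2⟩
  · cases h : t p.1 <;> simp [h]

theorem ask : FPH H (fun κ (q : Bits) => q.length = m κ) fun _ q => .ask q fun r => .ret r := by
  refine (FP.comp_expr (f := fun p : Bits × H.σ => (p.2, p.1)) H.fp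
    (.cons (.tl (.var 0)) (.hd (.var 0))) (fun _ => rfl) fun _ p hp => hp.symm).congr fun κ p _ => ?_
  simp only [handle]
  exact (bind_ret _).symm

/-- By `handle_foldM` the state of the handler becomes part of the accumulator, and a loop of
dialogues with the cipher is again a loop. The rest rearranges tuples. -/
theorem foldM {S : ℕ → (ε × α) × List γ → Prop} {S' : ℕ → (ε × α) × γ → Prop}
    {g : ℕ → ε → α → γ → BDialog α}
    (hg : FPH H S' fun κ p => g κ p.1.1 p.1.2 p.2) (I : ℕ → (ε × α) × List γ → ℕ → α → Prop)
    (hS : PolyHeight S) (h0 : ∀ κ p, S κ p → I κ p 0 p.1.2)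
    (hI : ∀ κ p, S κ p → ∀ i < p.2.length, ∀ x ∈ p.2, ∀ a, I κ p i a →
      S' κ ((p.1.1, a), x) ∧ ∀ b, (g κ p.1.1 a x).LenLeaf (m κ) b → I κ p (i + 1) b) :
    FPH H S fun κ p => Dialog.foldM (g κ p.1.1) p.1.2 p.2 := by
  have h1 : FP (fun κ (p : (ε × (α × H.σ)) × γ) => S' κ ((p.1.1, p.1.2.1), p.2) ∧ H.Inv κ p.1.2.2)
      fun κ p => (g κ p.1.1 p.1.2.1 p.2).handle H.step p.1.2.2 :=
    FP.comp_expr (f := fun p : (ε × (α × H.σ)) × γ => (((p.1.1, p.1.2.1), p.2), p.1.2.2)) hg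
      (.cons (.cons (.cons (.hd (.hd (.var 0))) (.hd (.tl (.hd (.var 0))))) (.tl (.var 0)))
        (.tl (.tl (.hd (.var 0)))))
      (fun _ => rfl) fun _ _ hp => hp
  have h2 : FP (fun κ (p : (ε × (α × H.σ)) × List γ) => S κ ((p.1.1, p.1.2.1), p.2) ∧ H.Inv κ p.1.2.2)
      fun κ p => Dialog.foldM (fun (a : α × H.σ) x => (g κ p.1.1 a.1 x).handle H.step a.2) p.1.2 p.2 := by
    refine FP.foldM (g := fun κ e (a : α × H.σ) x => (g κ e a.1 x).handle H.step a.2) h1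
      (fun κ p i a => I κ ((p.1.1, p.1.2.1), p.2) i a.1 ∧ H.Inv κ a.2) ?_
      (fun κ p hp => ⟨h0 κ _ hp.1, hp.2⟩) fun κ p hp i hi x hx a ha => ?_
    · obtain ⟨b, hb, hS⟩ := hS.prod H.polyHeight
      refine ⟨fun κ => b κ + 2, hb.add (.const 2), fun κ p hp => ?_⟩
      have := hS κ (((p.1.1, p.1.2.1), p.2), p.1.2.2) hp
      simp only [enc_pair, Val.ht_node] at this
      change max (max (enc p.1.1).ht (max (enc p.1.2.1).ht (enc p.1.2.2).ht + 1) + 1) (enc p.2).ht + 1 ≤ b κ + 2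
      omega
    · obtain ⟨h3, h4⟩ := hI κ _ hp.1 i hi x hx a.1 ha.1
      refine ⟨⟨h3, ha.2⟩, fun b hb => ?_⟩
      have := H.leaf_handle ha.2 hb
      exact ⟨h4 _ this.1, this.2⟩
  refine (FP.comp_expr (f := fun p : ((ε × α) × List γ) × H.σ => ((p.1.1.1, (p.1.1.2, p.2)), p.1.2))
    h2 (.cons (.cons (.hd (.hd (.hd (.var 0)))) (.cons (.tl (.hd (.hd (.var 0)))) (.tl (.var 0))))
      (.tl (.hd (.var 0)))) (fun _ => rfl) fun _ _ hp => hp).congr fun κ p _ => ?_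
  exact (handle_foldM _ _ _ _ _).symm

end FPH

end Tokenization

/-! ### Heights of the simulator's states and the running time of a walk -/

namespace Tokenization
open Dialog Enc

variable {α β γ δ ε : Type} [Enc α] [Enc β] [Enc γ] [Enc δ] [Enc ε]

namespace PolyHeight

theorem of_le {S : ℕ → α → Prop} {b : ℕ → ℕ} (hb : PolyBounded b)
    (h : ∀ κ a, S κ a → (enc a).ht ≤ b κ) : PolyHeight S := ⟨b, hb, h⟩

theorem list {S : ℕ → α → Prop} (hS : PolyHeight S) {b : ℕ → ℕ} (hb : PolyBounded b) :
    PolyHeight fun κ (l : List α) => l.length ≤ b κ ∧ ∀ a ∈ l, S κ a := by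
  obtain ⟨c, hc, hS⟩ := hS
  exact .of_le (hb.add hc) fun κ l hl =>
    (ht_list_le fun a ha => hS κ a (hl.2 a ha)).trans (Nat.add_le_add_right hl.1 _)

theorem option {S : ℕ → α → Prop} (hS : PolyHeight S) :
    PolyHeight fun κ (o : Option α) => ∀ a, o = some a → S κ a := by
  obtain ⟨c, hc, hS⟩ := hS
  refine .of_le (hc.add (.const 1)) fun κ o ho => ?_
  cases o with
  | none => simp
  | some a => have := hS κ a (ho a rfl); simp; omega

theorem bits {b : ℕ → ℕ} (hb : PolyBounded b) : PolyHeight fun κ (l : Bits) => l.length ≤ b κ :=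
  .of_le (hb.add (.const 1)) fun _ l hl => (ht_bits_le l).trans (Nat.add_le_add_right hl _)

theorem bool : PolyHeight fun _ (_ : Bool) => True :=
  .of_le (.const 1) fun _ b _ => ht_enc_bool_le b

theorem unit : PolyHeight fun _ (_ : Unit) => True := .of_le (.const 0) fun _ _ _ => le_rfl

theorem units {b : ℕ → ℕ} (hb : PolyBounded b) :
    PolyHeight fun κ (l : List Unit) => l = List.replicate (b κ) () :=
  .of_le hb fun κ l hl => by rw [hl, ht_units]

end PolyHeight

theorem polyBounded_bitLen {ℓ : ℕ → ℕ} (hℓ : PolyBounded ℓ) : PolyBounded fun κ => bitLen (ℓ κ) :=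
  ((PolyBounded.const 4).mul hℓ).mono fun _ => bitLen_le _

section

variable {ℓ k J : ℕ → ℕ} (hℓ : PolyBounded ℓ) (hk : PolyBounded k) (hJ : PolyBounded J)
include hℓ hk

theorem polyHeight_params : PolyHeight fun κ (p : Params) => p = paramsOf ℓ k κ :=
  ((PolyHeight.units PolyBounded.id).prod ((PolyHeight.units hℓ).prod
    ((PolyHeight.units (polyBounded_bitLen hℓ)).prod (.units hk)))).mono <| by
      rintro κ _ rfl; exact ⟨rfl, rfl, rfl, rfl⟩

include hJ

theorem polyHeight_pub : PolyHeight fun κ (p : Pub) => p = pubOf ℓ k J κ := by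
  refine .of_le (b := fun κ => (enc (pubOf ℓ k J κ)).ht) ?_ fun κ p hp => ?_
  · obtain ⟨b, hb, h⟩ := (polyHeight_params hℓ hk).prod
      ((PolyHeight.bits (((PolyBounded.const 4).mul hℓ).add (.const 1))).prod (.units hJ))
    refine hb.mono fun κ => h κ (paramsOf ℓ k κ, nines (.replicate (ℓ κ) ()), .replicate (J κ) ())
      ⟨rfl, ?_, rfl⟩
    exact (pubOf_fits ℓ k J κ).length_theta.le
  · rw [hp]

end

theorem polyHeight_okMsg {ℓ U : ℕ → ℕ} (hℓ : PolyBounded ℓ) (hU : PolyBounded U) :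
    PolyHeight fun κ (p : BMsg) => OkMsg (ℓ κ) (U κ) p :=
  ((PolyHeight.bits (polyBounded_bitLen hℓ)).prod (.bits hU)).mono fun κ p hp => by
    obtain ⟨⟨C, hC⟩, h⟩ := hp
    exact ⟨by rw [← hC, length_codeB], h⟩

theorem polyHeight_code {ℓ : ℕ → ℕ} (hℓ : PolyBounded ℓ) :
    PolyHeight fun κ (X : Bits) => ∃ C : Code (ℓ κ), codeB C = X :=
  (PolyHeight.bits (polyBounded_bitLen hℓ)).mono fun κ p ⟨C, hC⟩ => by rw [← hC, length_codeB]

theorem polyHeight_block {m : ℕ → ℕ} (hm : PolyBounded m) :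
    PolyHeight fun κ (x : Bits) => x.length = m κ :=
  (PolyHeight.bits hm).mono fun _ _ h => h.le

section Simulator

variable {ℓ k J U Hq jj ii : ℕ → ℕ} {f : ∀ κ, AddInput → Code (ℓ κ) → BitVec (k κ)}

/-- The length of the blocks. -/
abbrev blockLen (ℓ k : ℕ → ℕ) (κ : ℕ) : ℕ := k κ + bitLen (ℓ κ)

/-- Polynomial bounds for the invariants of the simulator. -/
structure Bounds (ℓ k J U Hq jj ii : ℕ → ℕ) : Prop where
  ℓ : PolyBounded ℓ
  k : PolyBounded k
  J : PolyBounded J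
  U : PolyBounded U
  Hq : PolyBounded Hq
  jj : PolyBounded jj
  ii : PolyBounded ii

variable (hB : Bounds ℓ k J U Hq jj ii)
include hB

theorem Bounds.m : PolyBounded (blockLen ℓ k) := hB.k.add (polyBounded_bitLen hB.ℓ)

/-- The invariants bound both the number and the heights of the entries of each list in the state,
so every `PT` function of the state costs polynomial time only. -/
theorem polyHeight_sim : PolyHeight fun κ st =>
    SimInv (f κ) (pubOf ℓ k J κ) (U κ) (Hq κ) (jj κ) (ii κ) st := by
  have hmsg := polyHeight_okMsg hB.ℓ hB.U
  have hmsg' := polyHeight_okMsg hB.ℓ hB.Hq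
  obtain ⟨b, hb, h⟩ := (polyHeight_pub hB.ℓ hB.k hB.J).prod <| PolyHeight.bool.prod <|
    PolyHeight.bool.prod <| (PolyHeight.option (hmsg.prod hmsg)).prod <|
    ((polyHeight_code hB.ℓ).list hB.jj).prod <|
    ((polyHeight_block hB.m).list (hB.ii.mul PolyBounded.id)).prod <|
    (((polyHeight_block hB.m).prod hmsg).list hB.ii).prod <|
    (hmsg'.list hB.jj).prod (PolyHeight.option (hmsg'.prod hmsg'))
  refine .of_le hb fun κ st hst => h κ st.tuple ⟨hst.pub_eq, trivial, trivial, fun c hc => ?_,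
    ⟨hst.toks_len, hst.toks⟩, ⟨?_, hst.asked⟩, ⟨hst.done_len, fun e he => ?_⟩,
    ⟨hst.msgs_len, hst.msgs⟩, hst.pair⟩
  · exact ⟨(hst.coll c hc).1, (hst.coll c hc).2.1⟩
  · have := hst.asked_len
    rwa [show (pubOf ℓ k J κ).prm.1.length = κ by simp [pubOf, paramsOf]] at this
  · obtain ⟨h1, h2⟩ := hst.done e he
    exact ⟨by rw [h1]; exact length_blockB _ h2.1, h2⟩

variable (H : Handler (blockLen ℓ k))

/-- The blocks sent and the current block have the right length. -/
def WalkOk (ℓ k B : ℕ → ℕ) (κ : ℕ) (w : List Bits × Bits × Bool × Bool) : Prop :=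
  (w.1.length ≤ B κ ∧ ∀ x ∈ w.1, x.length = blockLen ℓ k κ) ∧ w.2.1.length = blockLen ℓ k κ ∧
    True ∧ True

theorem polyHeight_walk {B : ℕ → ℕ} (hBB : PolyBounded B) :
    PolyHeight fun κ (p : Pub × List Bits × Bits × Bool × Bool) =>
      p.1 = pubOf ℓ k J κ ∧ WalkOk ℓ k B κ p.2 :=
  (polyHeight_pub hB.ℓ hB.k hB.J).prod <| ((polyHeight_block hB.m).list hBB).prod <|
    (polyHeight_block hB.m).prod <| PolyHeight.bool.prod PolyHeight.bool

theorem FPH.walkStep {B : ℕ → ℕ} (hBB : PolyBounded B) :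
    FPH H (fun κ (p : Pub × List Bits × Bits × Bool × Bool) =>
      p.1 = pubOf ℓ k J κ ∧ WalkOk ℓ k B κ p.2) fun _ p => Tokenization.walkStep p.1 p.2 := by
  have hht := polyHeight_walk hB hBB
  refine .cond (t := fun p : Pub × List Bits × Bits × Bool × Bool => p.2.2.2.1 || p.2.2.2.2)
    (by fun_prop) hht (.of_pt (f := fun p : Pub × List Bits × Bits × Bool × Bool => p.2)
      (by fun_prop) (hht.mono fun _ _ h => h.1)) ?_
  refine .cond (t := fun p : Pub × List Bits × Bits × Bool × Bool => memb p.2.2.1 p.2.1)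
    (by fun_prop) (hht.mono fun _ _ h => h.1) (.of_pt
      (f := fun p : Pub × List Bits × Bits × Bool × Bool => (p.2.1, p.2.2.1, false, true))
      (by fun_prop) (hht.mono fun _ _ h => h.1.1)) ?_
  have h1 : FPH H (fun κ (p : Pub × List Bits × Bits × Bool × Bool) =>
      p.1 = pubOf ℓ k J κ ∧ WalkOk ℓ k B κ p.2) fun _ p => .ask p.2.2.1 fun r => .ret r :=
    FPH.ask.comp_pt (f := fun p : Pub × List Bits × Bits × Bool × Bool => p.2.2.1) (by fun_prop)
      hht fun κ p h => h.2.2.1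
  refine .mono (FPH.bind (g' := fun _ p c => .ret (p.2.2.1 :: p.2.1, c, p.1.inR c, false)) h1
    (.of_pt (S := fun κ p => (p.1.1 = pubOf ℓ k J κ ∧ WalkOk ℓ k B κ p.1.2) ∧
        p.2.length = blockLen ℓ k κ)
      (f := fun p : (Pub × List Bits × Bits × Bool × Bool) × Bits =>
        (p.1.2.2.1 :: p.1.2.1, p.2, p.1.1.inR p.2, false)) (by fun_prop)
      (hht.prod (polyHeight_block hB.m))) fun κ p r hp hr => ⟨hp, ?_⟩) fun _ _ h => h.1.1
  obtain ⟨r', h, h'⟩ := hr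
  obtain rfl := h'
  exact h

theorem FPH.walkB {B : ℕ → ℕ} (hBB : PolyBounded B) :
    FPH H (fun κ (p : Pub × List Bits × Bits) => p.1 = pubOf ℓ k J κ ∧
      (p.2.1.length ≤ B κ ∧ ∀ x ∈ p.2.1, x.length = blockLen ℓ k κ) ∧
      p.2.2.length = blockLen ℓ k κ) fun _ p => Tokenization.walkB p.1 p.2.1 p.2.2 := by
  have hfold : FPH H (fun κ (p : (Pub × List Bits × Bits × Bool × Bool) × List Unit) =>
      (p.1.1 = pubOf ℓ k J κ ∧ WalkOk ℓ k B κ p.1.2) ∧ p.2 = .replicate κ () ∧ p.1.2.2.2 = (false, false))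
      fun _ p => Dialog.foldM (fun w (_ : Unit) => Tokenization.walkStep p.1.1 w) p.1.2 p.2 := by
    refine .foldM (S' := fun κ p => (p.1.1 = pubOf ℓ k J κ ∧ WalkOk ℓ k (fun κ => B κ + κ) κ p.1.2) ∧ True)
      (g := fun _ pub w _ => Tokenization.walkStep pub w)
      (((FPH.walkStep hB H (hBB.add .id)).comp_pt (f := Prod.fst) (by fun_prop)
        ((polyHeight_walk hB (hBB.add .id)).prod .unit)) fun _ _ h => h.1)
      (fun κ p i w => WalkInv p.1.1 (blockLen ℓ k κ) p.1.2.1 p.1.2.2.1 i w)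
      (((polyHeight_walk hB hBB).prod (.units .id)).mono fun _ _ h => ⟨h.1, h.2.1⟩) ?_ ?_
    · rintro κ ⟨⟨pub, A, b, _⟩, us⟩ ⟨⟨rfl, h1, h2, -⟩, rfl, h3⟩
      dsimp only at h3
      subst h3
      exact ⟨h1.2, by simp, h2, by simp, fun x hx => Or.inl hx, fun _ => Or.inl rfl⟩
    · rintro κ ⟨⟨pub, A, b, _⟩, us⟩ ⟨⟨rfl, h1, h2, -⟩, rfl, h3⟩ i hi _ - w hw
      refine ⟨⟨⟨rfl, ⟨?_, hw.length⟩, hw.cur, trivial, trivial⟩, trivial⟩, fun w' hw' => ?_⟩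
      · have := hw.card
        have := h1.1
        simp at hi
        dsimp only at *
        omega
      · obtain ⟨A', -, h⟩ := wp_leaf (walkInv_step (ok := fun _ r => r.length = blockLen ℓ k κ)
          (fun _ _ _ h => h) hw) (fun _ _ h => h) hw'
        exact h
  refine hfold.comp_pt (f := fun p : Pub × List Bits × Bits =>
    ((p.1, p.2.1, p.2.2, false, false), p.1.prm.1)) (by fun_prop) ?_ ?_
  · exact (polyHeight_pub hB.ℓ hB.k hB.J).prod <| ((polyHeight_block hB.m).list hBB).prod <|
      polyHeight_block hB.m
  · rintro κ ⟨pub, A, b⟩ ⟨rfl, h1, h2⟩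
    exact ⟨⟨rfl, h1, h2, trivial, trivial⟩, rfl, rfl⟩

end Simulator

end Tokenization

/-! ### Running time of an attempt -/

namespace Tokenization
open Dialog Enc

variable {α β γ δ ε : Type} [Enc α] [Enc β] [Enc γ] [Enc δ] [Enc ε]

section Simulator

variable {ℓ k J U Hq jj ii : ℕ → ℕ} {f : ∀ κ, AddInput → Code (ℓ κ) → BitVec (k κ)}
  (hf : PolyTimeComputable ℓ k f) (hB : Bounds ℓ k J U Hq jj ii)
include hf hB

/-- What is needed in order to skip additional inputs. -/
def SkipOk (ℓ k U ii : ℕ → ℕ) (κ : ℕ) (e : Params × List (Bits × BMsg) × Bits) : Prop :=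
  e.1 = paramsOf ℓ k κ ∧ (e.2.1.length ≤ ii κ ∧
    ∀ x ∈ e.2.1, x.1.length = blockLen ℓ k κ ∧ OkMsg (ℓ κ) (U κ) x.2) ∧
    ∃ C : Code (ℓ κ), codeB C = e.2.2

/-- Bounds for the intermediate results while skipping additional inputs. -/
def SkipStOk (ℓ U : ℕ → ℕ) (κ : ℕ) (p : Bits × Bool × Option (BMsg × BMsg)) : Prop :=
  p.1.length ≤ U κ ∧ True ∧
    ∀ c, p.2.2 = some c → OkMsg (ℓ κ) (U κ) c.1 ∧ OkMsg (ℓ κ) (U κ) c.2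

omit hf in
theorem polyHeight_skip : PolyHeight (SkipOk ℓ k U ii) :=
  (polyHeight_params hB.ℓ hB.k).prod <|
    (((polyHeight_block hB.m).prod (polyHeight_okMsg hB.ℓ hB.U)).list hB.ii).prod
      (polyHeight_code hB.ℓ)

omit hf in
theorem polyHeight_skipSt {U' : ℕ → ℕ} (hU' : PolyBounded U') : PolyHeight (SkipStOk ℓ U') :=
  (PolyHeight.bits hU').prod <| PolyHeight.bool.prod <|
    PolyHeight.option <| (polyHeight_okMsg hB.ℓ hU').prod (polyHeight_okMsg hB.ℓ hU')

theorem FP.skipStep {U' : ℕ → ℕ} (hU' : PolyBounded U') :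
    FP (fun κ (p : (Params × List (Bits × BMsg) × Bits) × (Bits × Bool × Option (BMsg × BMsg))) =>
      SkipOk ℓ k U ii κ p.1 ∧ SkipStOk ℓ U' κ p.2)
      fun κ p => .ret (Tokenization.skipStep (f κ) p.1.2.1 p.1.2.2 p.2) := by
  have hht := (polyHeight_skip hB).prod (polyHeight_skipSt hB hU')
  have h1 := (FP.onBits hf hU').comp_pt
    (f := fun p : (Params × List (Bits × BMsg) × Bits) × (Bits × Bool × Option (BMsg × BMsg)) =>
      (p.1.1, p.2.1, p.1.2.2)) (by fun_prop) hht fun κ p h => ⟨h.1.1, h.2.1, h.1.2.2⟩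
  refine (FP.bind (g' := fun _ p b => .ret (_root_.cond p.2.2.1 p.2
    (skipNext p.1.2.2 p.2 (findb (b ++ p.1.2.2) p.1.2.1)))) h1
    (.of_pt (S := fun κ p => (SkipOk ℓ k U ii κ p.1.1 ∧ SkipStOk ℓ U' κ p.1.2) ∧ p.2.length ≤ k κ)
      (f := fun p : ((Params × List (Bits × BMsg) × Bits) ×
        (Bits × Bool × Option (BMsg × BMsg))) × Bits => _root_.cond p.1.2.2.1 p.1.2
        (skipNext p.1.1.2.2 p.1.2 (findb (p.2 ++ p.1.1.2.2) p.1.1.2.1)))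
      ?_ (hht.prod (.bits hB.k))) ?_).congr fun κ p _ => rfl
  · have h2 : PT fun p : ((Params × List (Bits × BMsg) × Bits) ×
        (Bits × Bool × Option (BMsg × BMsg))) × Bits =>
        (p.1.1.2.2, p.1.2, findb (p.2 ++ p.1.1.2.2) p.1.1.2.1) := by fun_prop
    have := PT.comp PT.skipNext h2
    fun_prop
  · rintro κ ⟨⟨prm, done, X⟩, p⟩ b h hb
    obtain ⟨C, rfl⟩ := h.1.2.2
    obtain rfl := hb
    refine ⟨h, ?_⟩
    rw [onBits_codeB, length_bitsOf]

omit hf hB in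
theorem skipStOk_step {κ : ℕ} {e : Params × List (Bits × BMsg) × Bits} (he : SkipOk ℓ k U ii κ e)
    {U' V : ℕ → ℕ} {p : Bits × Bool × Option (BMsg × BMsg)} (hp : SkipStOk ℓ U' κ p)
    (hU' : U' κ + 1 ≤ V κ) (hV : U κ ≤ V κ) :
    SkipStOk ℓ V κ (skipStep (f κ) e.2.1 e.2.2 p) := by
  obtain ⟨v, isEnd, c⟩ := p
  have hv := hp.1
  dsimp only at hv
  have hp' : SkipStOk ℓ V κ (v, isEnd, c) := ⟨by dsimp only; omega, trivial, fun c hc =>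
    ⟨(hp.2.2 c hc).1.mono (by omega), (hp.2.2 c hc).2.mono (by omega)⟩⟩
  rw [skipStep]
  cases isEnd with
  | true => exact hp'
  | false =>
    dsimp only
    cases hfb : findb (blockB (f κ) v e.2.2) e.2.1 with
    | none => exact ⟨hp'.1, trivial, by simp [skipNext]⟩
    | some q =>
      have hq := he.2.1.2 _ (mem_of_findb hfb)
      simp only [skipNext, Option.isSome_some, Option.getD_some, cond_true, cond_false]
      cases meqb q (e.2.2, v) with
      | true =>
        refine ⟨?_, trivial, by simp⟩
        have := length_incr_le v
        dsimp only [cond_true]; omega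
      | false =>
        refine ⟨hp'.1, trivial, fun c hc => ?_⟩
        obtain rfl := Option.some.inj hc
        exact ⟨hq.2.mono hV, he.2.2, by dsimp only; omega⟩

theorem FP.skip : FP (fun κ (p : (Params × List (Bits × BMsg) × Bits) × Bits) =>
      SkipOk ℓ k U ii κ p.1 ∧ p.2.length ≤ U κ)
      fun κ p => .ret (Tokenization.skip (f κ) p.1.2.1 p.1.2.2 p.2) := by
  -- There is a round for each entry of `done` and an extra one, and each appends at most one bit to
  -- the additional input.
  let V : ℕ → ℕ := fun κ => U κ + (ii κ + 1)
  have hV : PolyBounded V := hB.U.add (hB.ii.add (.const 1))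
  have hfold : FP (fun κ (p : ((Params × List (Bits × BMsg) × Bits) ×
      (Bits × Bool × Option (BMsg × BMsg))) × List (Bits × BMsg)) =>
        (SkipOk ℓ k U ii κ p.1.1 ∧ SkipStOk ℓ U κ p.1.2) ∧ (p.2.length ≤ ii κ + 1 ∧
          ∀ x ∈ p.2, x.1.length ≤ blockLen ℓ k κ ∧ x.2.1.length ≤ blockLen ℓ k κ ∧ x.2.2.length ≤ U κ))
      fun κ p => Dialog.foldM (fun q (_ : Bits × BMsg) =>
        .ret (Tokenization.skipStep (f κ) p.1.1.2.1 p.1.1.2.2 q)) p.1.2 p.2 := by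
    have hx := (PolyHeight.bits hB.m).prod ((PolyHeight.bits hB.m).prod (PolyHeight.bits hB.U))
    refine FP.foldM (g := fun κ e q (_ : Bits × BMsg) => .ret (Tokenization.skipStep (f κ) e.2.1 e.2.2 q))
      (S' := fun κ p => (SkipOk ℓ k U ii κ p.1.1 ∧ SkipStOk ℓ V κ p.1.2) ∧
        (p.2.1.length ≤ blockLen ℓ k κ ∧ p.2.2.1.length ≤ blockLen ℓ k κ ∧ p.2.2.2.length ≤ U κ))
      ((FP.skipStep hf hB hV).comp_pt (f := fun p : ((Params × List (Bits × BMsg) × Bits) ×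
        (Bits × Bool × Option (BMsg × BMsg))) × (Bits × BMsg) => p.1) (by fun_prop)
        (((polyHeight_skip hB).prod (polyHeight_skipSt hB hV)).prod hx) fun _ _ h => h.1)
      (fun κ p i q => SkipStOk ℓ (fun κ => U κ + i) κ q)
      (((polyHeight_skip hB).prod (polyHeight_skipSt hB hB.U)).prod
        (hx.list (hB.ii.add (.const 1)))) (fun κ p h => h.1.2) ?_
    rintro κ p ⟨⟨h1, h2⟩, h3, h4⟩ i hi x hx q hq
    refine ⟨⟨⟨h1, ?_⟩, h4 x hx⟩, fun b hb => ?_⟩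
    · have hle : U κ + i ≤ V κ := by dsimp only [V]; omega
      exact ⟨hq.1.trans hle, trivial, fun c hc => ⟨(hq.2.2 c hc).1.mono hle, (hq.2.2 c hc).2.mono hle⟩⟩
    · obtain rfl := hb
      exact skipStOk_step (V := fun κ => U κ + (i + 1)) h1 hq (by omega) (by omega)
  refine (hfold.comp_pt (f := fun p : (Params × List (Bits × BMsg) × Bits) × Bits =>
    ((p.1, (p.2, false, none)), default :: p.1.2.1)) (by fun_prop)
    ((polyHeight_skip hB).prod (.bits hB.U)) ?_).congr fun κ p _ => foldM_ret _ _ _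
  rintro κ ⟨e, u⟩ ⟨h1, h2⟩
  refine ⟨⟨h1, h2, trivial, by simp⟩, by simpa using h1.2.1.1, fun x hx => ?_⟩
  rcases List.mem_cons.1 hx with rfl | hx
  · exact ⟨Nat.zero_le _, Nat.zero_le _, Nat.zero_le _⟩
  · obtain ⟨h3, ⟨C, hC⟩, h4⟩ := h1.2.1.2 x hx
    exact ⟨h3.le, by rw [← hC, length_codeB]; exact Nat.le_add_left _ _, h4⟩

variable (H : Handler (blockLen ℓ k))

/-- The conditions under which an attempt is made. -/
def AttOk (f : ∀ κ, AddInput → Code (ℓ κ) → BitVec (k κ)) (J U Hq jj ii : ℕ → ℕ) (κ : ℕ)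
    (p : Sim × Bits × Bits) : Prop :=
  SimInv (f κ) (pubOf ℓ k J κ) (U κ) (Hq κ) (jj κ) (ii κ) p.1 ∧
    (∃ C : Code (ℓ κ), codeB C = p.2.1) ∧ p.2.2.length ≤ U κ

omit hf in
theorem polyHeight_att : PolyHeight (AttOk f J U Hq jj ii) :=
  (polyHeight_sim hB).prod <| (polyHeight_code hB.ℓ).prod (.bits hB.U)

omit hf hB in
theorem AttOk.skipOk {κ : ℕ} {p : Sim × Bits × Bits} (h : AttOk f J U Hq jj ii κ p) :
    SkipOk ℓ k U ii κ (p.1.pub.prm, p.1.done, p.2.1) := by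
  refine ⟨by rw [h.1.pub_eq]; rfl, ⟨h.1.done_len, fun x hx => ?_⟩, h.2.1⟩
  obtain ⟨h1, h2⟩ := h.1.done x hx
  exact ⟨by rw [h1]; exact length_blockB _ h2.1, h2⟩

/-- The attempt is decomposed into the search in `done`, a call of the program for `f`, the walk,
and the bookkeeping. `S₁`, `S₂` and `S₃` say what is known before the last three stages, so that
each stage starts from data of polynomial height. -/
theorem FPH.attempt : FPH H (AttOk f J U Hq jj ii)
    fun κ p => Tokenization.attempt (f κ) p.1 p.2.1 p.2.2 := by
  let V : ℕ → ℕ := fun κ => U κ + ii κ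
  have hV : PolyBounded V := hB.U.add hB.ii
  let σ := Sim × Bits × Bits
  let τ := Bits × Bool × Option (BMsg × BMsg)
  have hA := polyHeight_att (f := f) hB
  have hskip : FPH H (AttOk f J U Hq jj ii) fun κ (p : σ) =>
      .ret (Tokenization.skip (f κ) p.1.done p.2.1 p.2.2) :=
    .of_fp ((FP.skip hf hB).comp_pt (f := fun p : σ => ((p.1.pub.prm, p.1.done, p.2.1), p.2.2))
      (by dsimp only [σ]; fun_prop) hA fun κ p h => ⟨h.skipOk, h.2.2⟩)
  let S₁ : ℕ → σ × τ → Prop := fun κ q => AttOk f J U Hq jj ii κ q.1 ∧ SkipStOk ℓ V κ q.2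
  have hS₁ : PolyHeight S₁ := hA.prod (polyHeight_skipSt hB hV)
  have hblock : FPH H S₁ fun κ (q : σ × τ) => .ret (onBits (f κ) q.2.1 q.1.2.1) :=
    .of_fp ((FP.onBits hf hV).comp_pt (f := fun q : σ × τ => (q.1.1.pub.prm, q.2.1, q.1.2.1))
      (by dsimp only [σ, τ]; fun_prop) hS₁ fun κ q h => ⟨h.1.skipOk.1, h.2.1, h.1.2.1⟩)
  let S₂ : ℕ → (σ × τ) × Bits → Prop := fun κ r => S₁ κ r.1 ∧ r.2.length = k κ
  have hS₂ : PolyHeight S₂ := hS₁.prod (polyHeight_block hB.k)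
  have hbl : ∀ {κ r}, S₂ κ r → (r.2 ++ r.1.1.2.1).length = blockLen ℓ k κ := by
    rintro κ ⟨⟨p, s⟩, b⟩ ⟨⟨h1, h2⟩, h3⟩
    obtain ⟨C, hC⟩ := h1.2.1
    dsimp only at h3 hC ⊢
    rw [List.length_append, h3, ← hC, length_codeB]
  have hwalk : FPH H S₂ fun κ (r : (σ × τ) × Bits) =>
      Tokenization.walkB r.1.1.1.pub r.1.1.1.asked (r.2 ++ r.1.1.2.1) := by
    refine (FPH.walkB (B := fun κ => ii κ * κ) hB H (hB.ii.mul .id)).comp_pt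
      (f := fun r : (σ × τ) × Bits => (r.1.1.1.pub, r.1.1.1.asked, r.2 ++ r.1.1.2.1))
      (by dsimp only [σ, τ]; fun_prop) hS₂ fun κ r h => ⟨h.1.1.1.pub_eq, ⟨?_, h.1.1.1.asked⟩, hbl h⟩
    have := h.1.1.1.asked_len
    rwa [show (pubOf ℓ k J κ).prm.1.length = κ by simp [pubOf, paramsOf]] at this
  let S₃ : ℕ → ((σ × τ) × Bits) × List Bits × Bits × Bool × Bool → Prop := fun κ r =>
    S₂ κ r.1 ∧ r.2.1.length ≤ ii κ * κ + κ ∧ WalkOk ℓ k (fun κ => ii κ * κ + κ) κ r.2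
  have hS₃ : PolyHeight S₃ := (hS₂.prod (((polyHeight_block hB.m).list
    ((hB.ii.mul PolyBounded.id).add .id)).prod ((polyHeight_block hB.m).prod
    (PolyHeight.bool.prod PolyHeight.bool)))).mono fun κ r h => ⟨h.1, h.2.2⟩
  have hlast : FPH H S₃ fun κ r => .ret (Tokenization.afterWalk r.1.1.1.1 r.1.1.1.2.1 r.1.1.2.1
      (r.1.2 ++ r.1.1.1.2.1) r.2) := by
    refine .of_pt (f := fun r : ((σ × τ) × Bits) × List Bits × Bits × Bool × Bool =>
      Tokenization.afterWalk r.1.1.1.1 r.1.1.1.2.1 r.1.1.2.1 (r.1.2 ++ r.1.1.1.2.1) r.2) ?_ hS₃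
    exact PT.comp (f := fun r : ((σ × τ) × Bits) × List Bits × Bits × Bool × Bool =>
      (r.1.1.1.1, r.1.1.1.2.1, r.1.1.2.1, (r.1.2 ++ r.1.1.1.2.1), r.2)) PT.afterWalk
      (by dsimp only [σ, τ]; fun_prop)
  have hrest : FPH H S₁ fun κ (q : σ × τ) => (Dialog.ret (onBits (f κ) q.2.1 q.1.2.1)).bind fun b =>
      (Tokenization.walkB q.1.1.pub q.1.1.asked (b ++ q.1.2.1)).bind fun w =>
        .ret (Tokenization.afterWalk q.1.1 q.1.2.1 q.2.1 (b ++ q.1.2.1) w) := by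
    refine FPH.bind (S' := S₂) (g' := fun κ q b =>
      (Tokenization.walkB q.1.1.pub q.1.1.asked (b ++ q.1.2.1)).bind fun w =>
        .ret (Tokenization.afterWalk q.1.1 q.1.2.1 q.2.1 (b ++ q.1.2.1) w)) hblock
      (FPH.bind (S' := S₃) (g' := fun κ r w => .ret (Tokenization.afterWalk r.1.1.1 r.1.1.2.1 r.1.2.1
      (r.2 ++ r.1.1.2.1) w)) hwalk hlast fun κ r w hr hw => ?_) fun κ q b hq hb => ⟨hq, ?_⟩
    · obtain ⟨A', -, h⟩ := wp_leaf (walkInv_walk (ok := fun _ r => r.length = blockLen ℓ k κ)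
        (pub := r.1.1.1.pub) (fun _ _ _ h => h) hr.1.1.1.asked (hbl hr)) (fun _ _ h => h) hw
      have h1 := h.card
      have h2 := hr.1.1.1.asked_len
      rw [hr.1.1.1.pub_eq] at h1
      simp only [show (pubOf ℓ k J κ).prm.1.length = κ by simp [pubOf, paramsOf]] at h1 h2
      exact ⟨hr, by dsimp only; omega, ⟨by dsimp only; omega, h.length⟩, h.cur, trivial, trivial⟩
    · obtain ⟨C, hC⟩ := hq.1.2.1
      obtain rfl := hb
      rw [← hC, onBits_codeB, length_bitsOf]
  refine (FPH.bind (S' := S₁) (g' := fun κ p s => _root_.cond s.2.2.isSome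
      (.ret ({ p.1 with bad := true, coll := s.2.2 }, s.1, none))
      ((Dialog.ret (onBits (f κ) s.1 p.2.1)).bind fun b =>
      (Tokenization.walkB p.1.pub p.1.asked (b ++ p.2.1)).bind fun w =>
        .ret (Tokenization.afterWalk p.1 p.2.1 s.1 (b ++ p.2.1) w))) hskip
    (.cond (t := fun q : σ × τ => q.2.2.2.isSome) (by dsimp only [σ, τ]; fun_prop) hS₁ ?_
      (hrest.mono fun _ _ h => h.1)) ?_).congr fun κ p _ => rfl
  · exact .of_pt (f := fun q : σ × τ =>
        ({ q.1.1 with bad := true, coll := q.2.2.2 }, q.2.1, (none : Option Bits))) (by dsimp only [σ, τ]; fun_prop)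
      (hS₁.mono fun _ _ h => And.left h)
  · rintro κ p s hp hs
    obtain rfl := hs
    refine ⟨hp, ?_⟩
    obtain ⟨s, hs, hv, hd, hnone, hsome⟩ := skip_spec (f κ) p.1.done p.2.1 p.2.2
    have hvl := length_incr_iterate_le p.2.2 s
    have h2 := hp.2.2
    have h3 := hp.1.done_len
    refine ⟨by dsimp only [V]; rw [hv]; omega, trivial, fun c hc => ?_⟩
    obtain ⟨h4, h5, h6⟩ := hsome c hc
    refine ⟨(hp.1.done _ h6).2.mono (Nat.le_add_right _ _), ?_⟩
    rw [h5]
    exact ⟨hp.2.1, by dsimp only [V]; omega⟩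

theorem FPH.tokStep : FPH H (fun κ (p : Bits × Sim × Bits × Option Bits) =>
      AttOk f J U Hq jj ii κ (p.2.1, p.1, p.2.2.1) ∧
        ∀ t, p.2.2.2 = some t → ∃ C : Code (ℓ κ), codeB C = t)
    fun κ p => Tokenization.tokStep (f κ) p.1 p.2 := by
  obtain ⟨b, hb, hA⟩ := (polyHeight_att (f := f) hB).prod (polyHeight_code hB.ℓ).option
  have hht : PolyHeight (fun κ (p : Bits × Sim × Bits × Option Bits) =>
      AttOk f J U Hq jj ii κ (p.2.1, p.1, p.2.2.1) ∧
        ∀ t, p.2.2.2 = some t → ∃ C : Code (ℓ κ), codeB C = t) := by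
    refine ⟨fun κ => b κ + 3, hb.add (.const 3), fun κ p hp => ?_⟩
    have := hA κ ((p.2.1, p.1, p.2.2.1), p.2.2.2) hp
    change max (enc p.1).ht (max (enc p.2.1).ht (max (enc p.2.2.1).ht (enc p.2.2.2).ht + 1) + 1) + 1
      ≤ b κ + 3
    simp only [enc_pair, Val.ht_node] at this
    omega
  refine .cond (t := fun p : Bits × Sim × Bits × Option Bits => p.2.1.bad || p.2.2.2.isSome)
    (by fun_prop) hht (.of_pt (f := Prod.snd) (by fun_prop) (hht.mono fun _ _ h => h.1)) ?_
  exact (FPH.attempt hf hB H).comp_pt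
    (f := fun p : Bits × Sim × Bits × Option Bits => (p.2.1, p.1, p.2.2.1)) (by fun_prop)
    (hht.mono fun _ _ h => h.1) fun _ _ h => h.1.1

end Simulator

end Tokenization

/-! ### Running time of a request -/

namespace Tokenization
open Dialog Enc

variable {α β γ δ ε : Type} [Enc α] [Enc β] [Enc γ] [Enc δ] [Enc ε]

section Simulator

variable {ℓ k J U Hq jj ii : ℕ → ℕ} {f : ∀ κ, AddInput → Code (ℓ κ) → BitVec (k κ)}
  (hf : PolyTimeComputable ℓ k f) (hB : Bounds ℓ k J U Hq jj ii)
  (hU : ∀ κ, Hq κ + J κ * (ii κ + J κ + 2) ≤ U κ) (H : Handler (blockLen ℓ k))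
include hf hB

omit hf in
theorem Bounds.later : Bounds ℓ k J U Hq (fun κ => jj κ + 1) fun κ => ii κ + J κ :=
  { hB with jj := hB.jj.add (.const 1), ii := hB.ii.add hB.J }

/-- The conditions under which a message is tokenized. -/
def TokOk (f : ∀ κ, AddInput → Code (ℓ κ) → BitVec (k κ)) (J U Hq jj ii : ℕ → ℕ) (κ : ℕ)
    (p : Sim × BMsg) : Prop :=
  SimInv (f κ) (pubOf ℓ k J κ) (U κ) (Hq κ) (jj κ) (ii κ) p.1 ∧ OkMsg (ℓ κ) (Hq κ) p.2

omit hf in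
theorem polyHeight_tok : PolyHeight (TokOk f J U Hq jj ii) :=
  (polyHeight_sim hB).prod (polyHeight_okMsg hB.ℓ hB.Hq)

include hU

/-- The loop invariant is `TokInv`, with the list of questions forgotten. The hypothesis `hU`
reserves room for the growth of the additional input during `J` attempts, starting from the length
`Hq` that the height of a request allows. -/
theorem FPH.attempts : FPH H (TokOk f J U Hq jj ii) fun κ p =>
    Dialog.foldM (fun q (_ : Unit) => Tokenization.tokStep (f κ) p.2.1 q) (p.1, p.2.2, none)
      p.1.pub.fuel := by
  have hB' := hB.later
  have hJ : ∀ κ, (pubOf ℓ k J κ).fuel.length = J κ := fun κ => by simp [pubOf]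
  have hfold : FPH H (fun κ (p : (Bits × Sim × Bits × Option Bits) × List Unit) =>
      (TokOk f J U Hq jj ii κ (p.1.2.1, p.1.1, p.1.2.2.1) ∧ p.1.2.2.2 = none) ∧
        p.2 = .replicate (J κ) ())
      fun κ p => Dialog.foldM (fun q (_ : Unit) => Tokenization.tokStep (f κ) p.1.1 q) p.1.2 p.2 := by
    refine FPH.foldM (S' := fun κ p => (AttOk f J U Hq (fun κ => jj κ + 1) (fun κ => ii κ + J κ) κ
          (p.1.2.1, p.1.1, p.1.2.2.1) ∧ ∀ t, p.1.2.2.2 = some t → ∃ C : Code (ℓ κ), codeB C = t) ∧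
        True) (g := fun κ X q _ => Tokenization.tokStep (f κ) X q)
      ((FPH.tokStep hf hB' H).comp_pt (f := Prod.fst) (by fun_prop) ?_ fun _ _ h => h.1)
      (fun κ p i q => ∃ A, TokInv (f κ) (pubOf ℓ k J κ) (U κ) (Hq κ) (jj κ) (ii κ) (Hq κ)
        (ii κ + J κ) p.1.2.1 i A q) ?_ ?_ ?_
    · obtain ⟨b, hb, hA⟩ := (polyHeight_att (f := f) hB').prod (polyHeight_code hB.ℓ).option
      refine .of_le (b := fun κ => b κ + 4) (hb.add (.const 4)) fun κ p hp => ?_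
      have := hA κ ((p.1.2.1, p.1.1, p.1.2.2.1), p.1.2.2.2) hp.1
      change max (max (enc p.1.1).ht (max (enc p.1.2.1).ht (max (enc p.1.2.2.1).ht
        (enc p.1.2.2.2).ht + 1) + 1) + 1) 0 + 1 ≤ b κ + 4
      simp only [enc_pair, Val.ht_node] at this
      omega
    · obtain ⟨b, hb, hA⟩ := (polyHeight_tok (f := f) hB).prod (.units hB.J)
      refine .of_le (b := fun κ => b κ + 4) (hb.add (.const 4)) fun κ p hp => ?_
      have := hA κ ((p.1.2.1, p.1.1, p.1.2.2.1), p.2) ⟨hp.1.1, hp.2⟩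
      change max (max (enc p.1.1).ht (max (enc p.1.2.1).ht (max (enc p.1.2.2.1).ht
        (enc p.1.2.2.2).ht + 1) + 1) + 1) (enc p.2).ht + 1 ≤ b κ + 4
      rw [hp.1.2]
      simp only [enc_pair, Val.ht_node, enc_none, Val.ht_nil] at this ⊢
      omega
    · rintro κ ⟨⟨X, st, u, res⟩, us⟩ ⟨⟨⟨h1, h2⟩, h3⟩, h4⟩
      dsimp only at h1 h2 h3
      subst h3
      exact ⟨_, rfl, h1, ⟨rfl, rfl, rfl, rfl⟩, by simpa using h2.2, by simp⟩
    · rintro κ ⟨⟨X, st, p⟩, us⟩ ⟨⟨⟨h1, h2⟩, h3⟩, rfl⟩ i hi _ - q ⟨A, hq⟩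
      rw [List.length_replicate] at hi
      have hU' := hU κ
      have h5 : (i + 1) * (ii κ + J κ + 2) ≤ J κ * (ii κ + J κ + 2) := Nat.mul_le_mul_right _ hi
      rw [Nat.succ_mul] at h5
      refine ⟨⟨⟨⟨hq.2.1.mono (Nat.le_succ _) (by dsimp only; omega), h2.1, ?_⟩, fun t ht =>
        (hq.2.2.2.2 t ht).1⟩, trivial⟩, fun b hb => ?_⟩
      · exact hq.2.2.2.1.trans (by omega)
      · exact wp_leaf (tokInv_step (ok := fun _ r => r.length = blockLen ℓ k κ)
          (pubOf_fits ℓ k J κ) (fun _ _ _ h => h) h2.1 (by rwa [hJ]) (by rw [hJ])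
          (by rw [hJ]; exact hU') hq) (fun _ _ h => h) hb
  refine (hfold.comp_pt (f := fun p : Sim × BMsg =>
    ((p.2.1, p.1, p.2.2, (none : Option Bits)), p.1.pub.fuel)) (by fun_prop) (polyHeight_tok hB) ?_)
  rintro κ ⟨st, m⟩ ⟨h1, h2⟩
  refine ⟨⟨⟨h1, h2⟩, rfl⟩, ?_⟩
  dsimp only at h1 ⊢
  rw [h1.pub_eq]; rfl

theorem FPH.tokenizeB : FPH H (TokOk f J U Hq jj ii) fun κ p =>
    Tokenization.tokenizeB (f κ) p.1 p.2 := by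
  have hB' := hB.later
  have hJ : ∀ κ, (pubOf ℓ k J κ).fuel.length = J κ := fun κ => by simp [pubOf]
  have hht : PolyHeight fun κ (p : Sim × Bits × Option Bits) =>
      SimInv (f κ) (pubOf ℓ k J κ) (U κ) (Hq κ) (jj κ + 1) (ii κ + J κ) p.1 ∧ p.2.1.length ≤ U κ ∧
        ∀ t, p.2.2 = some t → ∃ C : Code (ℓ κ), codeB C = t :=
    (polyHeight_sim hB').prod ((PolyHeight.bits hB.U).prod (polyHeight_code hB.ℓ).option)
  refine FPH.bind (g' := fun _ _ p => .ret (Tokenization.finish p)) (FPH.attempts hf hB hU H)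
    (.of_pt (f := fun p : (Sim × BMsg) × Sim × Bits × Option Bits => Tokenization.finish p.2)
      (PT.comp PT.finish (by fun_prop)) ((polyHeight_tok (f := f) hB).prod hht)) ?_
  rintro κ ⟨st, m⟩ p ⟨h1, h2⟩ hp
  obtain ⟨A, -, h3, -, h4, h5⟩ := wp_leaf (tokInv_fold (ok := fun _ r => r.length = blockLen ℓ k κ)
    (pubOf_fits ℓ k J κ) (fun _ _ _ h => h) h1 h2 (I := ii κ + J κ) (by rw [hJ])
      (by rw [hJ]; exact hU κ)) (fun _ _ h => h) hp
  rw [hJ] at h3 h4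
  exact ⟨⟨h1, h2⟩, h3.mono (Nat.le_succ _) le_rfl, h4.trans (hU κ), fun t ht => (h5 t ht).1⟩

end Simulator

section Simulator

variable {ℓ k J U Hq jj ii : ℕ → ℕ} {f : ∀ κ, AddInput → Code (ℓ κ) → BitVec (k κ)}
  (hf : PolyTimeComputable ℓ k f) (hB : Bounds ℓ k J U Hq jj ii)
  (hU : ∀ κ, Hq κ + J κ * (ii κ + J κ + 2) ≤ U κ) (H : Handler (blockLen ℓ k))
include hf hB hU

theorem FPH.simStep : FPH H (fun κ (p : Sim × Val) =>
      SimInv (f κ) (pubOf ℓ k J κ) (U κ) (Hq κ) (jj κ) (ii κ) p.1 ∧ p.2.ht ≤ Hq κ)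
    fun κ p => Tokenization.simStep (f κ) p.1 p.2 := by
  have hB1 : Bounds ℓ k J U Hq (fun κ => jj κ + 1) ii := { hB with jj := hB.jj.add (.const 1) }
  have hJ : ∀ κ, (pubOf ℓ k J κ).fuel.length = J κ := fun κ => by simp [pubOf]
  have hht : PolyHeight fun κ (p : Sim × Val) =>
      SimInv (f κ) (pubOf ℓ k J κ) (U κ) (Hq κ) (jj κ) (ii κ) p.1 ∧ p.2.ht ≤ Hq κ :=
    (polyHeight_sim hB).prod (.of_le hB.Hq fun _ _ h => h)
  have hd := PT.decideReq
  refine .cond (t := fun p : Sim × Val => p.1.bad || !(decideReq p.1 p.2).isSome) (by fun_prop) hht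
    (.of_pt (f := fun p : Sim × Val => (Val.nil, p.1)) (by fun_prop) (hht.mono fun _ _ h => h.1)) ?_
  have h1 : FPH H (fun κ (p : Sim × Val) =>
      (SimInv (f κ) (pubOf ℓ k J κ) (U κ) (Hq κ) (jj κ) (ii κ) p.1 ∧ p.2.ht ≤ Hq κ) ∧
        (p.1.bad || !(decideReq p.1 p.2).isSome) = false)
      fun κ p => Tokenization.tokenizeB (f κ) ((decideReq p.1 p.2).getD (default, p.1)).2
        ((decideReq p.1 p.2).getD (default, p.1)).1 := by
    refine (FPH.tokenizeB hf hB1 hU H).comp_pt (f := fun p : Sim × Val =>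
      (((decideReq p.1 p.2).getD (default, p.1)).2, ((decideReq p.1 p.2).getD (default, p.1)).1))
      (by fun_prop) (hht.mono fun _ _ h => h.1) ?_
    rintro κ ⟨st, q⟩ ⟨⟨h1, h2⟩, h3⟩
    dsimp only at h1 h2 h3 ⊢
    simp only [Bool.or_eq_false_iff, Bool.not_eq_false'] at h3
    obtain ⟨r, hr⟩ := Option.isSome_iff_exists.1 h3.2
    obtain ⟨h4, h5, -⟩ := simInv_decide (pubOf_fits ℓ k J κ) h1 h2 hr
    rw [hr]
    exact ⟨h5, h4⟩
  refine FPH.bind (g' := fun _ _ p => .ret (enc (some p.2), p.1)) h1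
    (.of_pt (S := fun κ p => (SimInv (f κ) (pubOf ℓ k J κ) (U κ) (Hq κ) (jj κ) (ii κ) p.1.1 ∧
        p.1.2.ht ≤ Hq κ) ∧ SimInv (f κ) (pubOf ℓ k J κ) (U κ) (Hq κ) (jj κ + 2) (ii κ + J κ) p.2.1 ∧
          ∀ t, p.2.2 = some t → ∃ C : Code (ℓ κ), codeB C = t)
      (f := fun p : (Sim × Val) × Sim × Option Bits => (enc (some p.2.2), p.2.1))
      (by fun_prop) (hht.prod ((polyHeight_sim (jj := fun κ => jj κ + 2) (ii := fun κ => ii κ + J κ)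
        { hB with jj := hB.jj.add (.const 2), ii := hB.ii.add hB.J }).prod
        (polyHeight_code hB.ℓ).option))) ?_
  rintro κ ⟨st, q⟩ p ⟨⟨h1, h2⟩, h3⟩ hp
  dsimp only at h1 h2 h3 hp ⊢
  simp only [Bool.or_eq_false_iff, Bool.not_eq_false'] at h3
  obtain ⟨r, hr⟩ := Option.isSome_iff_exists.1 h3.2
  obtain ⟨h4, h5, -⟩ := simInv_decide (pubOf_fits ℓ k J κ) h1 h2 hr
  rw [hr] at hp
  obtain ⟨A, -, h6, h7⟩ := wp_leaf (simInv_tokenize (ok := fun _ r => r.length = blockLen ℓ k κ)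
    (pubOf_fits ℓ k J κ) (fun _ _ _ h => h) h5 h4 (I := ii κ + J κ) (by rw [hJ])
      (by rw [hJ]; exact hU κ)) (fun _ _ h => h) hp
  rw [hJ] at h6
  exact ⟨⟨h1, h2⟩, h6, h7⟩

end Simulator

end Tokenization

/-! ### Running an adversary against the simulator -/

namespace Tokenization
open Dialog Enc

variable {α β γ δ ε : Type} [Enc α] [Enc β] [Enc γ] [Enc δ] [Enc ε]

/-- At most `n` questions, all of height at most `h`, if all answers lie in `ok`. -/
def Dialog.Tame {α : Type} (ok : Set Val) (h : ℕ) : Dialog Val Val α → ℕ → Prop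
  | ret _, _ => True
  | flip k, n => ∀ b, (k b).Tame ok h n
  | ask q k, n => ∃ n', n = n' + 1 ∧ q.ht ≤ h ∧ ∀ a ∈ ok, (k a).Tame ok h n'

theorem Dialog.Tame.mono {α : Type} {ok : Set Val} {h : ℕ} {d : Dialog Val Val α} {n n' : ℕ}
    (hd : d.Tame ok h n) (hn : n ≤ n') : d.Tame ok h n' := by
  induction d generalizing n n' with
  | ret a => trivial
  | flip k ih => exact fun b => ih b (hd b) hn
  | ask q k ih =>
    obtain ⟨n, rfl, h1, h2⟩ := hd
    exact ⟨n' - 1, by omega, h1, fun a ha => ih a (h2 a ha) (by omega)⟩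

theorem Dialog.Tame.mono_height {α : Type} {ok : Set Val} {h h' : ℕ} {d : Dialog Val Val α} {n : ℕ}
    (hd : d.Tame ok h n) (hh : h ≤ h') : d.Tame ok h' n := by
  induction d generalizing n with
  | ret a => trivial
  | flip k ih => exact fun b => ih b (hd b)
  | ask q k ih =>
    obtain ⟨n, rfl, h1, h2⟩ := hd
    exact ⟨n, rfl, h1.trans hh, fun a ha => ih a (h2 a ha)⟩

/-- The maximal size of the expressions of a program. -/
def Prog.exprSize : Prog → ℕ
  | .assign _ e => e.size
  | .seq p q => max p.exprSize q.exprSize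
  | .ite _ p q => max p.exprSize q.exprSize
  | .loop _ p => p.exprSize
  | .flip _ => 0
  | .query _ e => e.size

theorem ht_update_le {s : Store} {b : ℕ} (hs : ∀ x, (s x).ht ≤ b) {y : ℕ} {v : Val}
    (hv : v.ht ≤ b) (x : ℕ) : (Function.update s y v x).ht ≤ b := by
  rw [Function.update_apply]
  split_ifs
  · exact hv
  · exact hs x

/-- An assignment raises the maximal height by at most the size of its expression, and an answer
contributes at most `D`. So heights grow linearly in time, and requests are of polynomial height
although trees with shared parts may be exponentially large. -/
theorem tame_dialog {ok : Set Val} {C D h : ℕ} (hok : ∀ a ∈ ok, a.ht ≤ D) {t : ℕ} {ps : List Prog}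
    {s : Store} {b : ℕ} (hc : HaltsWithin ok t (ps, s)) (hps : ∀ p ∈ ps, p.exprSize ≤ C)
    (hs : ∀ x, (s x).ht ≤ b) (hb : b + t * (C + D + 1) ≤ h) :
    (dialog t (ps, s)).Tame ok h t ∧
      ∀ s', (dialog t (ps, s)).Leaf (· ∈ ok) s' → ∀ x, (s' x).ht ≤ h := by
  induction t generalizing ps s b with
  | zero =>
    refine ⟨trivial, fun s' hs' x => ?_⟩
    obtain rfl := hs'
    exact (hs x).trans (by omega)
  | succ t ih =>
    rw [Nat.succ_mul] at hb
    have hs1 : ∀ x, (s x).ht ≤ b + (C + D + 1) := fun x => (hs x).trans (by omega)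
    cases ps with
    | nil =>
      refine ⟨trivial, fun s' hs' x => ?_⟩
      obtain rfl := hs'
      exact (hs x).trans (by omega)
    | cons p ps =>
      have hp := hps p (by simp)
      have hps' : ∀ q ∈ ps, q.exprSize ≤ C := fun q hq => hps q (by simp [hq])
      have tick : ∀ {ps' : List Prog} {s' : Store}, HaltsWithin ok t (ps', s') →
          (∀ q ∈ ps', q.exprSize ≤ C) → (∀ x, (s' x).ht ≤ b + (C + D + 1)) →
          (dialog t (ps', s')).Tame ok h (t + 1) ∧
            ∀ s'', (dialog t (ps', s')).Leaf (· ∈ ok) s'' → ∀ x, (s'' x).ht ≤ h :=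
        fun h1 h2 h3 => ⟨(ih h1 h2 h3 (by omega)).1.mono (Nat.le_succ _), (ih h1 h2 h3 (by omega)).2⟩
      cases p with
      | assign x e =>
        refine tick (s' := Function.update s x (e.eval s)) hc hps' (ht_update_le hs1 ?_)
        have := e.ht_eval_le hs
        change e.size ≤ C at hp
        omega
      | seq p q =>
        simp only [Prog.exprSize, max_le_iff] at hp
        exact tick (ps' := p :: q :: ps) hc (by simp; tauto) hs1
      | ite x p q =>
        simp only [Prog.exprSize, max_le_iff] at hp
        simp only [HaltsWithin, dialog, next] at hc ⊢
        refine tick hc ?_ hs1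
        split_ifs <;> simp <;> tauto
      | loop x p =>
        simp only [HaltsWithin, dialog, next] at hc ⊢
        refine tick hc ?_ hs1
        change p.exprSize ≤ C at hp
        split_ifs
        · exact hps'
        · simp only [List.mem_cons, forall_eq_or_imp, Prog.exprSize]
          exact ⟨hp, hp, hps'⟩
      | flip x =>
        have := fun c => tick (hc c) hps' (ht_update_le hs1 ((ht_enc_bool_le c).trans (by omega)))
        exact ⟨fun c => (this c).1, fun s' ⟨c, hs'⟩ => (this c).2 s' hs'⟩
      | query x e =>
        have := fun a ha => ih (hc a ha) hps' (ht_update_le (y := x) (v := a) hs1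
          ((hok a ha).trans (by omega))) (by omega)
        refine ⟨⟨t, rfl, ?_, fun a ha => (this a ha).1⟩, fun s' ⟨a, ha, hs'⟩ => (this a ha).2 s' hs'⟩
        have := e.ht_eval_le hs
        change e.size ≤ C at hp
        omega

theorem Expr.eval_congr {s s' : Store} {N : ℕ} (h : ∀ x < N, s' x = s x) {e : Expr}
    (he : e.regs ≤ N) : e.eval s' = e.eval s := by
  induction e with
  | var x => exact h x he
  | nil => rfl
  | cons a b iha ihb =>
    simp only [Expr.regs, max_le_iff] at he
    simp [Expr.eval, iha he.1, ihb he.2]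
  | hd a ih => simp [Expr.eval, ih he]
  | tl a ih => simp [Expr.eval, ih he]

/-- Replace the queries by calls of `P`, which works on a state kept in register `N`. -/
def Prog.withSim (N : ℕ) (P : ℕ → Prog) : Prog → Prog
  | .assign x e => .assign x e
  | .seq p q => .seq (p.withSim N P) (q.withSim N P)
  | .ite x p q => .ite x (p.withSim N P) (q.withSim N P)
  | .loop x p => .loop x (p.withSim N P)
  | .flip x => .flip x
  | .query x e =>
    .seq (.assign (N + 1) (.cons (.cons (.hd (.var N)) e) (.tl (.var N)))) <|
      .seq (P (N + 1)) <| .seq (.assign x (.hd (.hd (.var (N + 1)))))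
        (.assign N (.cons (.tl (.hd (.var (N + 1)))) (.tl (.var (N + 1)))))

section Compile

variable {ℓ k κ : ℕ} {f : AddInput → Code ℓ → BitVec k} {pub : Pub} {U Hq jj ii T N : ℕ}
  {bl : ℕ → ℕ} {H : Handler bl} {P : ℕ → Prog}

/-- The modified program runs in lockstep with the adversary on the registers below `N` and keeps
the states of simulator and handler in register `N`. The number `n` of questions still allowed
serves as a budget: each one uses two units of `jj` and `pub.fuel.length` units of `ii`, so the time
bound `T` is valid for every call. -/
theorem follows_withSim (hp : pub.Fits ℓ k) (hbl : bl κ = k + bitLen ℓ)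
    (hU : Hq + pub.fuel.length * (ii + pub.fuel.length + 2) ≤ U)
    (hP : ∀ (st : Sim) (σ : H.σ) (q : Val), SimInv f pub U Hq jj ii st → H.Inv κ σ → q.ht ≤ Hq →
      Computes P T ((st, q), σ) ((simStep f st q).handle H.step σ))
    {γ : Type} {Rel : γ → Store → Prop} {n₀ : ℕ} {rest : List Prog}
    {ok : Set Val} (hok : Set.range (encOption (encOption (encCode (ℓ := ℓ)))) ⊆ ok)
    {k' : (Store × Sim) × H.σ → Dialog Val Val γ} {t : ℕ} {ps : List Prog} {s s' : Store}
    {n j i : ℕ} {st : Sim} {σ : H.σ} (hps : ∀ p ∈ ps, p.regs ≤ N) (hc : HaltsWithin ok t (ps, s))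
    (ht : (dialog t (ps, s)).Tame ok Hq n) (hst : SimInv f pub U Hq j i st) (hσ : H.Inv κ σ)
    (hj : j + 2 * n ≤ jj) (hi : i + n * pub.fuel.length ≤ ii) (hs : ∀ x < N, s' x = s x)
    (hN : s' N = enc (st, σ))
    (hk : ∀ sf st' σ' s'', (dialog t (ps, s)).Leaf (· ∈ ok) sf → SimInv f pub U Hq jj ii st' →
      H.Inv κ σ' → (∀ x < N, s'' x = sf x) → s'' N = enc (st', σ') →
      Follows Rel n₀ (rest, s'') (k' ((sf, st'), σ'))) :
    Follows Rel (t * (T + 6) + n₀) (ps.map (Prog.withSim N P) ++ rest, s')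
      ((((dialog t (ps, s)).handle (simStep f) st).handle H.step σ).bind k') := by
  induction t generalizing ps s s' n j i st σ with
  | zero =>
    cases ps with
    | nil => simpa [dialog, handle] using hk s st σ s' rfl (hst.mono (by omega) (by omega)) hσ hs hN
    | cons p ps =>
      obtain ⟨s, hc⟩ := hc
      cases p <;> simp [next] at hc
  | succ t ih =>
    rw [show (t + 1) * (T + 6) + n₀ = (t * (T + 6) + n₀) + (T + 5) + 1 by ring]
    cases ps with
    | nil => exact (hk s st σ s' rfl (hst.mono (by omega) (by omega)) hσ hs hN).mono (by omega)
    | cons p ps =>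
      have hp' := hps p (by simp)
      have hps' : ∀ q ∈ ps, q.regs ≤ N := fun q hq => hps q (by simp [hq])
      cases p with
      | assign x e =>
        simp only [Prog.regs, max_le_iff] at hp'
        refine .tick rfl (.mono (ih (s := Function.update s x (e.eval s)) hps' hc ht hst hσ hj hi
          (fun y hy => ?_) ?_ hk) (Nat.le_add_right _ _))
        · rw [Expr.eval_congr hs hp'.2]
          simp [Function.update_apply, hs y hy]
        · rw [Function.update_of_ne (by omega), hN]
      | seq p q =>
        simp only [Prog.regs, max_le_iff] at hp'
        exact .tick rfl (.mono (ih (ps := p :: q :: ps) (by simp; tauto) hc ht hst hσ hj hi hs hN hk)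
          (Nat.le_add_right _ _))
      | ite x p q =>
        simp only [Prog.regs, max_le_iff] at hp'
        simp only [HaltsWithin, dialog, next] at hc ht hk ⊢
        refine .tick (by rw [List.map_cons, Prog.withSim, List.cons_append, next]) ?_
        rw [hs x hp'.1]
        refine .mono ?_ (Nat.le_add_right _ (T + 5))
        split_ifs at hc ht hk ⊢ with h
        · exact ih (ps := q :: ps) (by simp; tauto) hc ht hst hσ hj hi hs hN hk
        · exact ih (ps := p :: ps) (by simp; tauto) hc ht hst hσ hj hi hs hN hk
      | loop x p =>
        simp only [Prog.regs, max_le_iff] at hp'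
        simp only [HaltsWithin, dialog, next] at hc ht hk ⊢
        refine .tick (by rw [List.map_cons, Prog.withSim, List.cons_append, next]) ?_
        rw [hs x hp'.1]
        refine .mono ?_ (Nat.le_add_right _ (T + 5))
        split_ifs at hc ht hk ⊢ with h
        · exact ih hps' hc ht hst hσ hj hi hs hN hk
        · exact ih (ps := p :: .loop x p :: ps) (by simp [Prog.regs]; tauto) hc ht hst hσ hj hi hs
            hN hk
      | flip x =>
        simp only [Prog.regs] at hp'
        refine .flip (k := fun b => (ps.map (Prog.withSim N P) ++ rest,
          Function.update s' x (encBool b))) rfl fun b => .mono (ih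
          (s := Function.update s x (encBool b)) hps' (hc b) (ht b) hst hσ hj hi (fun y hy => ?_) ?_
          fun sf st' σ' s'' hl => hk sf st' σ' s'' ⟨b, hl⟩) (Nat.le_add_right _ _)
        · simp [Function.update_apply, hs y hy]
        · rw [Function.update_of_ne (by omega), hN]
      | query x e =>
        simp only [Prog.regs, max_le_iff] at hp'
        obtain ⟨n, rfl, hq, ht⟩ := ht
        have hi' : (n + 1) * pub.fuel.length = n * pub.fuel.length + pub.fuel.length := by ring
        change Follows Rel _ (.seq (.assign (N + 1) (.cons (.cons (.hd (.var N)) e) (.tl (.var N))))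
          (.seq (P (N + 1)) (.seq (.assign x (.hd (.hd (.var (N + 1)))))
          (.assign N (.cons (.tl (.hd (.var (N + 1)))) (.tl (.var (N + 1))))))) :: _, s')
          ((Dialog.handle H.step ((simStep f st (e.eval s)).bind fun p =>
            (dialog t (ps, Function.update s x p.1)).handle (simStep f) p.2) σ).bind k')
        rw [handle_bind, bind_assoc, show t * (T + 6) + n₀ + (T + 5) + 1 =
          (T + (t * (T + 6) + n₀ + 1 + 1 + 1)) + 1 + 1 + 1 by ring]
        refine .tick rfl (.tick rfl (.tick rfl ?_))
        refine hP st σ (e.eval s) (hst.mono (by omega) (by omega)) hσ hq Rel _ _ _ _ _ ?_ ?_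
        · simp [Expr.eval, hN, Val.left, Val.right, Expr.eval_congr hs hp'.2]
        · rintro ⟨⟨a, st'⟩, σ'⟩ s₁ hl hs₁ hx
          obtain ⟨hl', hσ'⟩ := H.leaf_handle hσ hl
          -- Since the simulated answer is legal, the halting time and the tameness of the adversary
          -- continue to hold after it.
          obtain ⟨A, -, hst', ha⟩ := wp_leaf (simInv_simStep (ok := fun _ r => r.length = bl κ)
            (I := ii + pub.fuel.length) hp (fun _ _ _ h => h.trans hbl) hst hq (by omega) hU) (fun _ _ h => h) hl'
          refine .tick rfl (.tick rfl (.tick rfl ?_))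
          refine ih (s := Function.update s x a) hps' (hc a (hok ha)) (ht a (hok ha)) hst' hσ'
            (by omega) (by omega) (fun y hy => ?_) ?_ fun sf st'' σ'' s'' hl =>
              hk sf st'' σ'' s'' ⟨a, hok ha, hl⟩
          · have := hx y (by omega)
            rw [Function.update_of_ne (by omega)] at this
            rw [Function.update_of_ne hy.ne]
            simp only [Function.update_apply, Expr.eval, hs₁, enc_pair, Val.left, enc_val, this, hs y hy]
          · simp [Expr.eval, hs₁, Val.left, Val.right, Function.update_of_ne (show N + 1 ≠ x by omega)]

end Compile

/-- Prepare a state, run `A` against the simulator, and evaluate the outcome. -/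
def mainProg (N : ℕ) (setup : ℕ → Prog) (A : Prog) (post : ℕ → Prog) : Prog :=
  .seq (.assign N (.cons (.var 0) (.cons (.var 1) (.cons (.var 2) (.var 3))))) <|
    .seq (setup N) <| .seq A <|
    .seq (.assign N (.cons (.cons (.var 0) (.hd (.var N))) (.tl (.var N)))) <|
    .seq (post N) (.assign 0 (.var N))

section Main

variable {ℓ k J U Hq jj ii : ℕ → ℕ} {f : ∀ κ, AddInput → Code (ℓ κ) → BitVec (k κ)}

theorem load_params_ht (κ x : ℕ) :
    (load (params ℓ k κ) x).ht ≤ κ + ℓ κ + bitLen (ℓ κ) + k κ := by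
  have h6 : x = 0 ∨ x = 1 ∨ x = 2 ∨ x = 3 ∨ 4 ≤ x := by omega
  have hu : ∀ n, (unary n).ht = n := fun n => by rw [← enc_units, ht_units]
  rcases h6 with rfl | rfl | rfl | rfl | h6
  iterate 4
    · simp only [load, params, List.getD_cons_zero, List.getD_cons_succ, hu]
      omega
  rw [load, List.getD_eq_default]
  · simp
  · simpa [params] using h6

theorem ht_resp_le {ℓ : ℕ} {a : Val}
    (ha : a ∈ Set.range (encOption (encOption (encCode (ℓ := ℓ))))) : a.ht ≤ bitLen ℓ + 3 := by
  obtain ⟨o, rfl⟩ := ha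
  cases o with
  | none => simp [encOption]
  | some o =>
    cases o with
    | none => simp [encOption]
    | some C =>
      have := ht_bits_le (codeB C)
      rw [length_codeB, enc_codeB] at this
      simp only [encOption, Val.ht_node, Val.ht_nil]
      omega

/-- The bound for the heights of the questions of `A`. -/
def askBound (ℓ k : ℕ → ℕ) (A : Prog) (p : Polynomial ℕ) (κ : ℕ) : ℕ :=
  κ + ℓ κ + bitLen (ℓ κ) + k κ + p.eval κ * (A.exprSize + (bitLen (ℓ κ) + 3) + 1)

theorem polyBounded_askBound (hℓ : PolyBounded ℓ) (hk : PolyBounded k) (A : Prog)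
    (p : Polynomial ℕ) : PolyBounded (askBound ℓ k A p) := by
  have hb := polyBounded_bitLen hℓ
  exact (((PolyBounded.id.add hℓ).add hb).add hk).add ((PolyBounded.eval p).mul
    (((PolyBounded.const _).add (hb.add (.const 3))).add (.const 1)))

theorem tame_adversary {A : Prog} {p : Polynomial ℕ} {κ : ℕ}
    (hA : HaltsWithin (Set.range (encOption (encOption (encCode (ℓ := ℓ κ))))) (p.eval κ)
      ([A], load (params ℓ k κ))) :
    (dialog (p.eval κ) ([A], load (params ℓ k κ))).Tame
        (Set.range (encOption (encOption (encCode (ℓ := ℓ κ))))) (askBound ℓ k A p κ) (p.eval κ) ∧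
      ∀ s, (dialog (p.eval κ) ([A], load (params ℓ k κ))).Leaf
        (· ∈ Set.range (encOption (encOption (encCode (ℓ := ℓ κ))))) s →
        ∀ x, (s x).ht ≤ askBound ℓ k A p κ :=
  tame_dialog (fun _ ha => ht_resp_le ha) hA (by simp) (load_params_ht κ) le_rfl

variable (hf : PolyTimeComputable ℓ k f) (hB : Bounds ℓ k J U Hq jj ii)
  (hU : ∀ κ, Hq κ + J κ * (ii κ + J κ + 2) ≤ U κ) (H : Handler (blockLen ℓ k))
include hf hB hU

/-- Common to both reductions, which differ only in the handler, the preparation and the evaluation.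
The set-up stage works above the registers of the adversary, so she starts with the memory she
expects. -/
theorem exists_mainProg {A : Prog} {p : Polynomial ℕ}
    (hA : ∀ κ, HaltsWithin (Set.range (encOption (encOption (encCode (ℓ := ℓ κ))))) (p.eval κ)
      ([A], load (params ℓ k κ)))
    (hHq : ∀ κ, askBound ℓ k A p κ ≤ Hq κ) (hjj : ∀ κ, 2 * p.eval κ ≤ jj κ)
    (hii : ∀ κ, p.eval κ * J κ ≤ ii κ) {setup : ℕ → Params → Dialog Val Val (Sim × H.σ)}
    (hsetup : FP (fun κ prm => prm = paramsOf ℓ k κ) setup)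
    (hleaf : ∀ κ q, (setup κ (paramsOf ℓ k κ)).AnyLeaf q →
      SimInv (f κ) (pubOf ℓ k J κ) (U κ) (Hq κ) 0 0 q.1 ∧ H.Inv κ q.2)
    {g : (Val × Sim) × H.σ → γ} (hg : PT g) :
    ∃ (M : Prog) (r : Polynomial ℕ), ∀ κ,
      Follows (fun v s => s 0 = enc v) (r.eval κ) ([M], load (params ℓ k κ))
        ((setup κ (paramsOf ℓ k κ)).bind fun q =>
          (((dialog (p.eval κ) ([A], load (params ℓ k κ))).handle (simStep (f κ)) q.1).handle
            H.step q.2).bind fun r => .ret (g ((r.1.1 0, r.1.2), r.2))) := by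
  obtain ⟨P, T, hP⟩ := FPH.simStep hf hB hU H
  obtain ⟨P₁, T₁, hP₁⟩ := hsetup
  obtain ⟨P₂, T₂, hP₂⟩ := FP.of_pt hg (S := fun κ p =>
    (p.1.1.ht ≤ Hq κ ∧ SimInv (f κ) (pubOf ℓ k J κ) (U κ) (Hq κ) (jj κ) (ii κ) p.1.2) ∧ H.Inv κ p.2)
    (((PolyHeight.of_le hB.Hq fun _ _ h => h).prod (polyHeight_sim hB)).prod H.polyHeight)
  -- At least four, because the public parameters in registers 0 to 3 must survive the set-up stage.
  let N := max A.regs 4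
  refine ⟨mainProg N P₁ (A.withSim N P) P₂, T₁ + p * (T + 6) + T₂ + 9, fun κ => ?_⟩
  obtain ⟨htame, hht⟩ := tame_adversary (hA κ)
  have hJ : (pubOf ℓ k J κ).fuel.length = J κ := by simp [pubOf]
  have h4 : 4 ≤ N := le_max_right _ _
  rw [show (T₁ + p * (T + 6) + T₂ + 9).eval κ = (T₁.eval κ + (p.eval κ * (T.eval κ + 6) +
    ((T₂.eval κ + (0 + 1)) + 1 + 1 + 1) + 1) + 1) + 1 + 1 + 1 by simp; ring]
  refine .tick rfl (.tick rfl (.tick rfl (.succ ?_)))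
  refine hP₁ κ (paramsOf ℓ k κ) rfl _ _ N _ _ _ ?_ fun ⟨st, σ⟩ s₁ hl hs₁ hx => ?_
  · simp [Expr.eval, load, params, paramsOf, enc_units]
  · obtain ⟨hst, hσ⟩ := hleaf κ _ hl
    refine .tick rfl ?_
    refine follows_withSim (H := H) (κ := κ) (ps := [A]) (N := N) (pubOf_fits ℓ k J κ) rfl (by rw [hJ]; exact hU κ)
      (fun st σ q h1 h2 h3 => hP κ ((st, q), σ) ⟨⟨h1, h3⟩, h2⟩) subset_rfl (by simp [N]) (hA κ)
      (htame.mono_height (hHq κ)) hst hσ (by simpa using hjj κ) (by rw [hJ]; simpa using hii κ)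
      (fun x hx' => ?_) hs₁ fun sf st' σ' s₂ hsf hst' hσ' hs₂ hN => ?_
    · rw [hx x hx', Function.update_of_ne hx'.ne]
    · refine .tick rfl (.tick rfl (.tick rfl ?_))
      have := hP₂ κ ((sf 0, st'), σ') ⟨⟨(hht sf hsf 0).trans (hHq κ), hst'⟩, hσ'⟩
      refine this (fun v s => s 0 = enc v) (0 + 1) N _ _ .ret ?_ fun b s₃ hb hs₃ hx₃ => ?_
      · simp [Expr.eval, hN, Val.left, Val.right, hs₂ 0 (by omega)]
      · exact .tick rfl (.halt rfl (by simp [Expr.eval, hs₃]))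

end Main

end Tokenization

namespace Tokenization
open Dialog Enc

variable {α β γ δ ε : Type} [Enc α] [Enc β] [Enc γ] [Enc δ] [Enc ε]

namespace FP

variable {S : ℕ → α → Prop}

theorem flip : FP S fun _ _ => .flip fun b => (.ret b : Dialog Val Val Bool) :=
  FP.flipCoin.comp_expr (f := fun _ => ()) .nil (fun _ => rfl) fun _ _ _ => trivial

theorem ask {F : α → Val} (hF : PT F) (hS : PolyHeight S) :
    FP S fun _ a => .ask (F a) fun r => (.ret r : Dialog Val Val Val) :=
  FP.query.comp_pt hF hS fun _ _ _ => trivial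

end FP

/-! ## Sampling -/

/-- A random list of bits. -/
def sampleBits (l : List Unit) : Dialog Val Val Bits :=
  foldM (fun acc _ => .flip fun b => .ret (b :: acc)) [] l

/-- A random number in unary, with as many binary digits as the given list has entries. -/
def sampleUnits (l : Bits) : Dialog Val Val (List Unit) :=
  foldM (fun acc _ => .flip fun b => .ret (cond b (() :: (acc ++ acc)) (acc ++ acc))) [] l

theorem FP.sampleBits {m : ℕ → ℕ} (hm : PolyBounded m) :
    FP (fun κ (l : List Unit) => l = .replicate (m κ) ()) fun _ l => Tokenization.sampleBits l := by
  have hht := (PolyHeight.unit.prod (PolyHeight.bits hm)).prod PolyHeight.unit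
  have h1 : FP (fun κ (p : (Unit × Bits) × Unit) => (True ∧ p.1.2.length ≤ m κ) ∧ True)
      fun _ p => .flip fun b => .ret (b :: p.1.2) :=
    FP.bind (g' := fun _ (p : (Unit × Bits) × Unit) b => .ret (b :: p.1.2)) FP.flip
      (.of_pt (S := fun κ p => ((True ∧ p.1.1.2.length ≤ m κ) ∧ True) ∧ True)
        (f := fun p : ((Unit × Bits) × Unit) × Bool => p.2 :: p.1.1.2) (by fun_prop)
        (hht.prod .bool)) fun _ _ _ h _ => ⟨h, trivial⟩
  have h2 : FP (fun κ (p : (Unit × Bits) × List Unit) => (True ∧ p.1.2 = []) ∧ p.2 = .replicate (m κ) ())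
      fun _ p => Dialog.foldM (fun acc _ => .flip fun b => .ret (b :: acc)) p.1.2 p.2 := by
    refine FP.foldM (g := fun _ _ acc _ => .flip fun b => .ret (b :: acc)) h1
      (fun κ p i acc => acc.length = i) ?_ (fun κ p h => by simp [h.1.2]) ?_
    · exact ((PolyHeight.unit.prod (PolyHeight.bits (.const 0))).prod (.units hm)).mono
        fun _ _ h => ⟨⟨trivial, by simp [h.1.2]⟩, h.2⟩
    · rintro κ ⟨_, us⟩ ⟨-, rfl⟩ i hi _ - acc rfl
      refine ⟨⟨⟨trivial, by simpa using hi.le⟩, trivial⟩, ?_⟩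
      rintro _ ⟨b, rfl⟩
      rfl
  exact h2.comp_pt (f := fun l : List Unit => (((), ([] : Bits)), l)) (by fun_prop) (.units hm)
    fun κ l h => ⟨⟨trivial, rfl⟩, h⟩

theorem length_sampleBits {ok : Val → Prop} {l : List Unit} {r : Bits}
    (h : (sampleBits l).Leaf ok r) : r.length = l.length := by
  refine leaf_foldM (fun i (acc : Bits) => acc.length = i) ?_ rfl h
  rintro i - _ - acc _ rfl ⟨b, rfl⟩
  rfl

theorem length_sampleUnits {ok : Val → Prop} {l : Bits} {r : List Unit}
    (h : (sampleUnits l).Leaf ok r) : r.length + 1 ≤ 2 ^ l.length := by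
  refine leaf_foldM (fun i (acc : List Unit) => acc.length + 1 ≤ 2 ^ i) ?_ (by simp) h
  rintro i - _ - acc _ hacc ⟨b, rfl⟩
  rw [pow_succ]
  cases b <;> simp <;> omega

/-- The unary accumulator doubles in each round, so the time is polynomial only because `2 ^
l.length` is assumed to be. -/
theorem FP.sampleUnits {C : ℕ → ℕ} (hC : PolyBounded C) :
    FP (fun κ (l : Bits) => 2 ^ l.length ≤ C κ) fun _ l => Tokenization.sampleUnits l := by
  have hu : PolyHeight fun κ (l : List Unit) => l.length ≤ C κ := .of_le hC fun κ l hl => by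
    rw [units_eq l, ht_units]; exact hl
  have hht := (PolyHeight.unit.prod hu).prod PolyHeight.bool
  have h1 : FP (fun κ (p : (Unit × List Unit) × Bool) => (True ∧ p.1.2.length ≤ C κ) ∧ True)
      fun _ p => .flip fun b => .ret (_root_.cond b (() :: (p.1.2 ++ p.1.2)) (p.1.2 ++ p.1.2)) :=
    FP.bind (g' := fun _ (p : (Unit × List Unit) × Bool) b =>
        .ret (_root_.cond b (() :: (p.1.2 ++ p.1.2)) (p.1.2 ++ p.1.2)))
      FP.flip (.of_pt (S := fun κ p => ((True ∧ p.1.1.2.length ≤ C κ) ∧ True) ∧ True) (f := fun p : ((Unit × List Unit) × Bool) × Bool =>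
        _root_.cond p.2 (() :: (p.1.1.2 ++ p.1.1.2)) (p.1.1.2 ++ p.1.1.2)) (by fun_prop)
        (hht.prod .bool)) fun _ _ _ h _ => ⟨h, trivial⟩
  have hb : PolyHeight fun κ (l : Bits) => 2 ^ l.length ≤ C κ :=
    (PolyHeight.bits hC).mono fun κ l h => Nat.lt_two_pow_self.le.trans h
  have h2 : FP (fun κ (p : (Unit × List Unit) × Bits) => (True ∧ p.1.2 = []) ∧ 2 ^ p.2.length ≤ C κ)
      fun _ p => Dialog.foldM (fun acc _ =>
        .flip fun b => .ret (_root_.cond b (() :: (acc ++ acc)) (acc ++ acc))) p.1.2 p.2 := by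
    refine FP.foldM (g := fun _ _ acc _ =>
      .flip fun b => .ret (_root_.cond b (() :: (acc ++ acc)) (acc ++ acc))) h1
      (fun κ p i acc => acc.length + 1 ≤ 2 ^ i) ?_ (fun κ p h => by simp [h.1.2]) ?_
    · exact ((PolyHeight.unit.prod (hu.mono fun κ (l : List Unit) (h : l = []) => by simp [h])).prod
        hb).mono fun _ _ h => h
    · rintro κ ⟨_, l⟩ ⟨-, hl⟩ i hi x - acc hacc
      have := Nat.pow_le_pow_right (show 0 < 2 by norm_num) hi.le
      dsimp only at hl this
      refine ⟨⟨⟨trivial, by dsimp only; omega⟩, trivial⟩, ?_⟩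
      rintro _ ⟨b, rfl⟩
      rw [pow_succ]
      cases b <;> simp <;> omega
  exact h2.comp_pt (f := fun l : Bits => (((), ([] : List Unit)), l)) (by fun_prop) hb
    fun κ l h => ⟨⟨trivial, rfl⟩, h⟩

/-! ## Handlers -/

/-- Answer all questions with random bits. -/
def randomHandler {m : ℕ → ℕ} (hm : PolyBounded m) : Handler m where
  σ := List Unit
  step s _ := (sampleBits s).bind fun r => .ret (r, s)
  Inv κ s := s = .replicate (m κ) ()
  polyHeight := .units hm
  leaf := by
    rintro κ s q r s' rfl h
    obtain ⟨r', hl, h'⟩ := leaf_bind.1 h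
    obtain ⟨rfl, rfl⟩ := Prod.mk.inj h'
    have := length_sampleBits hl
    exact ⟨by simpa using this, rfl⟩
  fp := by
    have hht := (PolyHeight.units hm).prod (polyHeight_block hm)
    refine FP.bind (g' := fun _ p r => .ret (r, p.1))
      ((FP.sampleBits hm).comp_pt (f := fun p : List Unit × Bits => p.1) (by fun_prop) hht
        fun _ _ h => h.1)
      (.expr (S := fun _ _ => True) (f := fun p : (List Unit × Bits) × Bits => (p.2, p.1.1))
        (.cons (.tl (.var 0)) (.hd (.hd (.var 0)))) fun _ => rfl) fun _ _ _ _ _ => trivial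

/-- Pass on as many questions as the second component of the state says, then use the challenge for
the next one, and answer the following ones with random bits. -/
def hybridStep (s : List Unit × List Unit × Bool) (q : Bits) :
    Dialog Val Val (Bits × List Unit × List Unit × Bool) :=
  cond s.2.1.isEmpty
    (cond s.2.2 ((sampleBits s.1).bind fun r => .ret (r, s))
      ((sampleBits s.1).bind fun r => .ask (.node (enc true) (enc (q, r))) fun a =>
        .ret (readBits s.1 a.right, s.1, s.2.1, true)))
    (.ask (.node .nil (enc q)) fun a => .ret (readBits s.1 a.right, s.1, s.2.1.tail, s.2.2))

/-- The states of the hybrid handler. -/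
def HybridOk (m B : ℕ → ℕ) (κ : ℕ) (s : List Unit × List Unit × Bool) : Prop :=
  s.1 = .replicate (m κ) () ∧ s.2.1.length ≤ B κ ∧ True

theorem polyHeight_hybrid {m B : ℕ → ℕ} (hm : PolyBounded m) (hB : PolyBounded B) :
    PolyHeight (HybridOk m B) :=
  have h : PolyHeight fun κ (l : List Unit) => l.length ≤ B κ := .of_le hB fun κ l hl => by
    rw [units_eq l, ht_units]; exact hl
  (PolyHeight.units hm).prod (h.prod .bool)

theorem FP.isNode_left : FP (fun _ (_ : Val) => True) fun _ v => .ret v.left.isNode :=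
  (show FP (fun _ (_ : Val) => True) fun _ v => .ret v.isNode from
    ⟨_, .C 2, fun _ v _ => by simpa using Computes.isNode v⟩).comp_expr (.hd (.var 0))
    (fun _ => rfl) fun _ _ _ => trivial

/-- The answers of an oracle may be arbitrarily large, but only the first bits of them are read. -/
theorem FP.readBits {m : ℕ → ℕ} (hm : PolyBounded m) :
    FP (fun κ (p : List Unit × Val) => p.1 = .replicate (m κ) ()) fun _ p =>
      .ret (Tokenization.readBits p.1 p.2) := by
  let g : ℕ → Unit → Val × Bits → Unit → Dialog Val Val (Val × Bits) :=
    fun _ _ p _ => .ret (p.1.right, p.1.left.isNode :: p.2)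
  have hstep : FP (fun _ (_ : (Unit × (Val × Bits)) × Unit) => True) fun κ p =>
      g κ p.1.1 p.1.2 p.2 :=
    FP.bind (S' := fun _ _ => True) (g' := fun _ (p : (Unit × (Val × Bits)) × Unit) b =>
        .ret (p.1.2.1.right, b :: p.1.2.2))
      (FP.isNode_left.comp_expr (f := fun p : (Unit × (Val × Bits)) × Unit => p.1.2.1)
        (.hd (.tl (.hd (.var 0)))) (fun _ => rfl) fun _ _ _ => trivial)
      (.expr (f := fun p : ((Unit × (Val × Bits)) × Unit) × Bool => (p.1.1.2.1.right, p.2 :: p.1.1.2.2))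
        (.cons (.tl (.hd (.tl (.hd (.hd (.var 0)))))) (.cons (.tl (.var 0))
          (.tl (.tl (.hd (.hd (.var 0))))))) fun _ => rfl) fun _ _ _ _ _ => trivial
  have hfold : FP (fun κ (p : (Unit × (Val × Bits)) × List Unit) =>
      p.2 = .replicate (m κ) () ∧ p.1.2.2 = []) fun κ p => Dialog.foldM (g κ p.1.1) p.1.2 p.2 :=
    FP.foldM_of_length hstep (fun _ _ i q => q.2.length = i) hm
      (fun κ p h => by simp [h.1]) (fun κ p h => by simp [h.2]) fun κ p _ i _ _ _ q hq =>
        ⟨trivial, fun b hb => by obtain rfl := hb; simpa using hq⟩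
  have hlast : FP (fun κ (p : Val × Bits) => p.2.length ≤ m κ) fun _ p => .ret p.2.reverse :=
    (FP.of_pt (f := fun l : Bits => l.reverse) (by fun_prop) (PolyHeight.bits hm)).comp_expr
      (.tl (.var 0)) (fun _ => rfl) fun _ _ h => h
  refine ((hfold.comp hlast ?_).comp_expr (f := fun p : List Unit × Val =>
    (((), (p.2, ([] : Bits))), p.1)) (.cons (.cons .nil (.cons (.tl (.var 0)) .nil)) (.hd (.var 0)))
    (fun _ => rfl) fun κ p h => ⟨h, rfl⟩).congr fun κ p _ => ?_
  · rintro κ ⟨⟨_, v, b⟩, l⟩ q ⟨hl, hb⟩ hq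
    dsimp only at hl hb
    subst hl hb
    refine (leaf_foldM (fun i (q : Val × Bits) => q.2.length = i) ?_ rfl hq).le.trans (by simp)
    rintro i - _ - a _ ha rfl
    simpa using ha
  · simp only [g]
    rw [foldM_ret]
    rfl

/-- The answers of the oracle have no height bound. Until `readBits` has reduced them to `m` bits
they are touched by single expressions only, which cost one step whatever the size of the data. -/
theorem FP.hybridStep {m B : ℕ → ℕ} (hm : PolyBounded m) (hB : PolyBounded B) :
    FP (fun κ (p : (List Unit × List Unit × Bool) × Bits) => HybridOk m B κ p.1 ∧ p.2.length = m κ)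
      fun _ p => Tokenization.hybridStep p.1 p.2 := by
  let τ := (List Unit × List Unit × Bool) × Bits
  let S : ℕ → τ → Prop := fun κ p => HybridOk m B κ p.1 ∧ p.2.length = m κ
  have hht : PolyHeight S := (polyHeight_hybrid hm hB).prod (polyHeight_block hm)
  have hs : FP S fun _ p => Tokenization.sampleBits p.1.1 :=
    (FP.sampleBits hm).comp_pt (f := fun p : τ => p.1.1) (by dsimp only [τ]; fun_prop) hht
      fun _ _ h => h.1.1
  have hread : FP (fun κ (p : τ × Val) => S κ p.1) fun _ p =>
      .ret (Tokenization.readBits p.1.1.1 p.2.right) :=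
    (FP.readBits hm).comp_expr (f := fun p : τ × Val => (p.1.1.1, p.2.right))
      (.cons (.hd (.hd (.hd (.var 0)))) (.tl (.tl (.var 0)))) (fun _ => rfl) fun _ _ h => h.1.1
  have hpass : FP S fun _ p => .ask (.node .nil (enc p.2)) fun a =>
      .ret (Tokenization.readBits p.1.1 a.right, p.1.1, p.1.2.1.tail, p.1.2.2) := by
    have h1 : FP S fun _ p => .ask (.node .nil (enc p.2)) fun a => (.ret a : Dialog Val Val Val) :=
      .ask (F := fun p : τ => .node .nil (enc p.2)) (by dsimp only [τ]; fun_prop) hht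
    refine FP.bind (g' := fun _ p a =>
      .ret (Tokenization.readBits p.1.1 a.right, p.1.1, p.1.2.1.tail, p.1.2.2)) h1
      (FP.bind (S' := fun _ _ => True) (g' := fun _ (p : τ × Val) b =>
        .ret (b, p.1.1.1, p.1.1.2.1.tail, p.1.1.2.2)) hread
        (.expr (f := fun p : (τ × Val) × Bits => (p.2, p.1.1.1.1, p.1.1.1.2.1.tail, p.1.1.1.2.2))
          (.cons (.tl (.var 0)) (.cons (.hd (.hd (.hd (.hd (.var 0))))) (.cons
            (.tl (.hd (.tl (.hd (.hd (.hd (.var 0))))))) (.tl (.tl (.hd (.hd (.hd (.var 0)))))))))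
          fun p => ?_) fun _ _ _ _ _ => trivial) fun _ _ _ h _ => h
    obtain ⟨⟨⟨⟨l, c, b⟩, q⟩, v⟩, r⟩ := p
    cases c <;> rfl
  have hchal : FP S fun _ p => (Tokenization.sampleBits p.1.1).bind fun r =>
      .ask (.node (enc true) (enc (p.2, r))) fun a =>
        .ret (Tokenization.readBits p.1.1 a.right, p.1.1, p.1.2.1, true) := by
    let S₁ : ℕ → τ × Bits → Prop := fun κ p => S κ p.1 ∧ p.2.length ≤ m κ
    have h1 : FP S₁ fun _ p => .ask (.node (enc true) (enc (p.1.2, p.2))) fun a =>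
        (.ret a : Dialog Val Val Val) :=
      .ask (F := fun p : τ × Bits => .node (enc true) (enc (p.1.2, p.2)))
        (by dsimp only [τ]; fun_prop) (hht.prod (.bits hm))
    have h2 : FP (fun κ (p : (τ × Bits) × Val) => S κ p.1.1) fun _ p =>
        .ret (Tokenization.readBits p.1.1.1.1 p.2.right) :=
      hread.comp_expr (f := fun p : (τ × Bits) × Val => (p.1.1, p.2))
        (.cons (.hd (.hd (.var 0))) (.tl (.var 0))) (fun _ => rfl) fun _ _ h => h
    refine FP.bind (S' := S₁) (g' := fun _ p r => .ask (.node (enc true) (enc (p.2, r))) fun a =>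
        .ret (Tokenization.readBits p.1.1 a.right, p.1.1, p.1.2.1, true)) hs
      (FP.bind (S' := fun κ p => S κ p.1.1) (g' := fun _ (p : τ × Bits) (a : Val) =>
        .ret (Tokenization.readBits p.1.1.1 a.right, p.1.1.1, p.1.1.2.1, true)) h1
        (FP.bind (S' := fun _ _ => True) (g' := fun _ (p : (τ × Bits) × Val) b =>
          .ret (b, p.1.1.1.1, p.1.1.1.2.1, true)) h2
          (.expr (f := fun p : ((τ × Bits) × Val) × Bits =>
              (p.2, p.1.1.1.1.1, p.1.1.1.1.2.1, true))
            (.cons (.tl (.var 0)) (.cons (.hd (.hd (.hd (.hd (.hd (.var 0)))))) (.cons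
              (.hd (.tl (.hd (.hd (.hd (.hd (.var 0))))))) (.cons .nil .nil))))
            fun _ => rfl) fun _ _ _ _ _ => trivial) fun _ _ _ h _ => h.1) fun κ p r h hr => ⟨h, ?_⟩
    rw [length_sampleBits hr, h.1.1]; simp
  have hlate : FP S fun _ p => (Tokenization.sampleBits p.1.1).bind fun r => .ret (r, p.1) :=
    FP.bind (S' := fun _ _ => True) (g' := fun _ (p : τ) r => .ret (r, p.1)) hs
      (.expr (f := fun p : τ × Bits => (p.2, p.1.1)) (.cons (.tl (.var 0)) (.hd (.hd (.var 0))))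
        fun _ => rfl) fun _ _ _ _ _ => trivial
  refine .cond (t := fun p : τ => p.1.2.1.isEmpty) (by dsimp only [τ]; fun_prop) hht
    (.cond (t := fun p : τ => p.1.2.2) (by dsimp only [τ]; fun_prop) (hht.mono fun _ _ h => And.left h)
      (hlate.mono fun _ _ h => h.1.1) (hchal.mono fun _ _ h => h.1.1)) (hpass.mono fun _ _ h => h.1)

/-- Use the cipher as an oracle. -/
def hybridHandler {m B : ℕ → ℕ} (hm : PolyBounded m) (hB : PolyBounded B) : Handler m where
  σ := List Unit × List Unit × Bool
  step := hybridStep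
  Inv := HybridOk m B
  polyHeight := polyHeight_hybrid hm hB
  leaf := by
    rintro κ ⟨l, c, b⟩ q r s' ⟨h1, h2, -⟩ h
    dsimp only at h1 h2
    subst h1
    rw [hybridStep] at h
    cases c with
    | nil =>
      cases b with
      | true =>
        obtain ⟨r', hl, h'⟩ := leaf_bind.1 h
        obtain ⟨rfl, rfl⟩ := Prod.mk.inj h'
        have := length_sampleBits hl
        exact ⟨by simpa using this, rfl, h2, trivial⟩
      | false =>
        obtain ⟨r', h, a, -, h'⟩ := leaf_bind.1 h
        obtain ⟨rfl, rfl⟩ := Prod.mk.inj h'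
        exact ⟨by simp, rfl, h2, trivial⟩
    | cons u c =>
      obtain ⟨a, -, h'⟩ := h
      obtain ⟨rfl, rfl⟩ := Prod.mk.inj h'
      exact ⟨by simp, rfl, (Nat.le_succ _).trans h2, trivial⟩
  fp := FP.hybridStep hm hB

end Tokenization

/-! ### The programs for the two reductions -/

namespace Tokenization
open Dialog Enc

variable {α β γ δ ε : Type} [Enc α] [Enc β] [Enc γ] [Enc δ] [Enc ε]

/-- The initial state of the simulator. -/
def initSim (Jp : Polynomial ℕ) (prm : Params) (nu : Bool) : Sim :=
  ⟨⟨prm, nines prm.2.1, .replicate (Jp.eval prm.1.length) ()⟩, nu, false, none, [], [], [], [], none⟩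

/-- Whether the simulator has failed, or the adversary has answered `v` and has won (`w = true`) or
lost (`w = false`). -/
def verdict (w : Bool) (v : Val) (st : Sim) : Bool := st.bad || xor w (xor v.isNode st.nu)

@[fun_prop] theorem PT.evalU' (q : Polynomial ℕ) {g : α → List Unit} (hg : PT g) :
    PT fun a => List.replicate (q.eval (g a).length) () :=
  PT.comp (PT.evalU q) hg

theorem PT.initSim (Jp : Polynomial ℕ) : PT fun p : Params × Bool => initSim Jp p.1 p.2 := by
  unfold Tokenization.initSim
  have h1 : PT fun _ : Params × Bool => (none : Option (BMsg × BMsg)) := .const _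
  have h2 : PT fun _ : Params × Bool => ([] : List Bits) := .const _
  have h3 : PT fun _ : Params × Bool => ([] : List (Bits × BMsg)) := .const _
  have h4 : PT fun _ : Params × Bool => ([] : List BMsg) := .const _
  fun_prop

theorem PT.verdict (w : Bool) : PT fun p : Val × Sim => verdict w p.1 p.2 := by
  unfold Tokenization.verdict
  fun_prop

/-- The lists of units as long as the blocks. -/
def blockUnits (prm : Params) : List Unit := prm.2.2.2 ++ prm.2.2.1

theorem blockUnits_paramsOf (ℓ k : ℕ → ℕ) (κ : ℕ) :
    blockUnits (paramsOf ℓ k κ) = .replicate (blockLen ℓ k κ) () := by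
  simp [blockUnits, paramsOf]

/-- Prepare the simulation for a random hybrid. -/
def hybridSetup (Jp Qp : Polynomial ℕ) (prm : Params) :
    Dialog Val Val (Sim × List Unit × List Unit × Bool) :=
  .flip fun b => (sampleUnits (count (.replicate (Qp.eval prm.1.length) () : List Unit))).bind fun idx =>
    .ret (initSim Jp prm b, blockUnits prm, idx, false)

/-- Prepare the simulation with random answers. -/
def randomSetup (Jp : Polynomial ℕ) (prm : Params) : Dialog Val Val (Sim × List Unit) :=
  .flip fun b => .ret (initSim Jp prm b, blockUnits prm)

/-- There is a power of two above `n` and at most `2 n`. It serves as the number of hybrids, because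
coin flips produce an exactly uniform index below a power of two. -/
theorem count_units_le (n : ℕ) (hn : 1 ≤ n) :
    2 ^ (count (List.replicate n ())).length ≤ 2 * n ∧ n < 2 ^ (count (List.replicate n ())).length := by
  obtain ⟨h1, h2⟩ := lval_count (List.replicate n ())
  have h3 := lval_lt (count (List.replicate n ())).reverse
  rw [h1] at h3
  refine ⟨by simpa using h2 (by simpa using Nat.ne_of_gt hn), by simpa using h3⟩

section

variable {ℓ k : ℕ → ℕ} (hℓ : PolyBounded ℓ) (hk : PolyBounded k)
include hℓ hk

theorem FP.randomSetup (Jp : Polynomial ℕ) : FP (fun κ prm => prm = paramsOf ℓ k κ) fun _ prm =>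
    Tokenization.randomSetup Jp prm := by
  have h := PT.initSim Jp
  refine FP.bind (g' := fun _ prm b => .ret (Tokenization.initSim Jp prm b, blockUnits prm)) FP.flip
    (.of_pt (S := fun κ p => p.1 = paramsOf ℓ k κ ∧ True) (f := fun p : Params × Bool =>
      (Tokenization.initSim Jp p.1 p.2, blockUnits p.1)) ?_ ((polyHeight_params hℓ hk).prod .bool))
    fun _ _ _ h _ => ⟨h, trivial⟩
  unfold blockUnits
  fun_prop

theorem FP.hybridSetup (Jp Qp : Polynomial ℕ) (hQ : ∀ κ, 1 ≤ Qp.eval κ) :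
    FP (fun κ prm => prm = paramsOf ℓ k κ) fun _ prm => Tokenization.hybridSetup Jp Qp prm := by
  have h := PT.initSim Jp
  have hC : PolyBounded fun κ => 2 * Qp.eval κ := (PolyBounded.const 2).mul (.eval Qp)
  have hp := (polyHeight_params hℓ hk).prod PolyHeight.bool
  have hlen : PolyHeight fun κ (l : List Unit) => l.length ≤ 2 * Qp.eval κ :=
    .of_le hC fun κ l hl => by rw [units_eq l, ht_units]; exact hl
  have hs : FP (fun κ (p : Params × Bool) => p.1 = paramsOf ℓ k κ ∧ True) fun _ p =>
      Tokenization.sampleUnits (count (.replicate (Qp.eval p.1.1.length) () : List Unit)) := by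
    refine (FP.sampleUnits hC).comp_pt (f := fun p : Params × Bool =>
      count (List.replicate (Qp.eval p.1.1.length) ())) (by fun_prop) hp ?_
    rintro κ ⟨_, b⟩ ⟨rfl, -⟩
    simpa [paramsOf] using (count_units_le _ (hQ κ)).1
  refine FP.bind (S := fun κ (prm : Params) => prm = paramsOf ℓ k κ) (g' := fun _ prm b => (Tokenization.sampleUnits (count (.replicate
      (Qp.eval prm.1.length) () : List Unit))).bind fun idx =>
      .ret (Tokenization.initSim Jp prm b, blockUnits prm, idx, false)) FP.flip
    (FP.bind (g' := fun _ p idx =>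
      .ret (Tokenization.initSim Jp p.1 p.2, blockUnits p.1, idx, false)) hs
      (.of_pt (S := fun κ p => (p.1.1 = paramsOf ℓ k κ ∧ True) ∧ p.2.length ≤ 2 * Qp.eval κ)
        (f := fun p : (Params × Bool) × List Unit =>
          (Tokenization.initSim Jp p.1.1 p.1.2, blockUnits p.1.1, p.2, false)) ?_
        (hp.prod hlen)) ?_)
    fun _ _ _ h _ => ⟨h, trivial⟩
  · have h' : PT fun p : (Params × Bool) × List Unit => Tokenization.initSim Jp p.1.1 p.1.2 :=
      PT.comp h (f := fun p : (Params × Bool) × List Unit => p.1) (by fun_prop)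
    unfold blockUnits
    fun_prop
  · rintro κ ⟨prm, b⟩ r h hr
    have := length_sampleUnits hr
    have h1 := (count_units_le _ (hQ κ)).1
    obtain ⟨rfl, -⟩ := h
    simp only [paramsOf, List.length_replicate] at this
    exact ⟨⟨rfl, trivial⟩, by dsimp only; omega⟩

end

theorem simInv_initSim {ℓ k : ℕ → ℕ} {f : ∀ κ, AddInput → Code (ℓ κ) → BitVec (k κ)}
    (Jp : Polynomial ℕ) (κ U Hq : ℕ) (b : Bool) :
    SimInv (f κ) (pubOf ℓ k (fun κ => Jp.eval κ) κ) U Hq 0 0 (initSim Jp (paramsOf ℓ k κ) b) := by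
  constructor <;> simp [initSim, pubOf, paramsOf]

section Programs

variable {ℓ k : ℕ → ℕ} {f : ∀ κ, AddInput → Code (ℓ κ) → BitVec (k κ)}
  (hf : PolyTimeComputable ℓ k f) (hℓ : PolyBounded ℓ) (hk : PolyBounded k)

/-- The bound for the lengths of the additional inputs. -/
def addBound (ℓ k : ℕ → ℕ) (A : Prog) (p Jp : Polynomial ℕ) (κ : ℕ) : ℕ :=
  askBound ℓ k A p κ + Jp.eval κ * (p.eval κ * Jp.eval κ + Jp.eval κ + 2)

include hℓ hk

theorem bounds_adversary (A : Prog) (p Jp : Polynomial ℕ) :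
    Bounds ℓ k (fun κ => Jp.eval κ) (addBound ℓ k A p Jp) (askBound ℓ k A p)
      (fun κ => 2 * p.eval κ) fun κ => p.eval κ * Jp.eval κ where
  ℓ := hℓ
  k := hk
  J := .eval _
  U := (polyBounded_askBound hℓ hk A p).add ((PolyBounded.eval _).mul
    ((((PolyBounded.eval p).mul (.eval _)).add (.eval _)).add (.const 2)))
  Hq := polyBounded_askBound hℓ hk A p
  jj := (PolyBounded.const 2).mul (.eval _)
  ii := (PolyBounded.eval _).mul (.eval _)

include hf

/-- The adversary against the cipher: she draws the secret bit of the token game herself, plays a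
hybrid with random index, and outputs the verdict on the simulation. -/
theorem exists_hybridProg {A : Prog} {p : Polynomial ℕ}
    (hA : ∀ κ, HaltsWithin (Set.range (encOption (encOption (encCode (ℓ := ℓ κ))))) (p.eval κ)
      ([A], load (params ℓ k κ))) (Jp Qp : Polynomial ℕ) (hQ : ∀ κ, 1 ≤ Qp.eval κ) (w : Bool) :
    ∃ (M : Prog) (r : Polynomial ℕ), ∀ κ,
      Follows (fun (v : Bool) s => s 0 = enc v) (r.eval κ) ([M], load (params ℓ k κ))
        ((hybridSetup Jp Qp (paramsOf ℓ k κ)).bind fun q =>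
          (((dialog (p.eval κ) ([A], load (params ℓ k κ))).handle (simStep (f κ)) q.1).handle
            hybridStep q.2).bind fun r => .ret (verdict w (r.1.1 0) r.1.2)) := by
  have hB := bounds_adversary hℓ hk A p Jp
  have hv := PT.verdict w
  refine exists_mainProg hf hB (fun κ => le_rfl)
    (hybridHandler hB.m ((PolyBounded.const 2).mul (.eval Qp))) hA
    (fun κ => le_rfl) (fun κ => le_rfl) (fun κ => le_rfl) (setup := fun _ => hybridSetup Jp Qp)
    (FP.hybridSetup hℓ hk Jp Qp hQ) ?_
    (g := fun q : (Val × Sim) × List Unit × List Unit × Bool => verdict w q.1.1 q.1.2)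
    (PT.comp hv (PT.fst PT.id'))
  rintro κ q ⟨b, hq⟩
  obtain ⟨idx, h, hq⟩ := leaf_bind.1 hq
  obtain rfl := hq
  refine ⟨simInv_initSim Jp κ _ _ b, blockUnits_paramsOf ℓ k κ, ?_, trivial⟩
  have := length_sampleUnits h
  have h1 := (count_units_le _ (hQ κ)).1
  simp only [paramsOf, List.length_replicate] at this
  dsimp only
  omega

/-- The collision finder: random bits replace the cipher, so no oracle is consulted, and the
recorded collision, if any, is the output. -/
theorem exists_collisionProg {A : Prog} {p : Polynomial ℕ}
    (hA : ∀ κ, HaltsWithin (Set.range (encOption (encOption (encCode (ℓ := ℓ κ))))) (p.eval κ)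
      ([A], load (params ℓ k κ))) (Jp : Polynomial ℕ) :
    ∃ (M : Prog) (r : Polynomial ℕ), ∀ κ,
      Follows (fun (v : BMsg × BMsg) s => s 0 = enc v) (r.eval κ) ([M], load (params ℓ k κ))
        ((randomSetup Jp (paramsOf ℓ k κ)).bind fun q =>
          (((dialog (p.eval κ) ([A], load (params ℓ k κ))).handle (simStep (f κ)) q.1).handle
            (fun s _ => (sampleBits s).bind fun r => .ret (r, s)) q.2).bind fun r =>
              .ret (r.1.2.coll.getD default)) := by
  have hB := bounds_adversary hℓ hk A p Jp
  refine exists_mainProg hf hB (fun κ => le_rfl) (randomHandler hB.m) hA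
    (fun κ => le_rfl) (fun κ => le_rfl) (fun κ => le_rfl) (setup := fun _ => randomSetup Jp)
    (FP.randomSetup hℓ hk Jp) ?_
    (g := fun q : (Val × Sim) × List Unit => q.1.2.coll.getD default)
    (show PT fun q : (Val × Sim) × List Unit => q.1.2.coll.getD default by fun_prop)
  rintro κ q ⟨b, hq⟩
  obtain rfl := hq
  exact ⟨simInv_initSim Jp κ _ _ b, blockUnits_paramsOf ℓ k κ⟩

end Programs

end Tokenization

namespace Tokenization
open Dialog Enc

/-! ## Averages over random bits -/

/-- The average over all lists of `n` bits. -/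
noncomputable def avgBits (n : ℕ) (F : Bits → ℝ) : ℝ := (∑ v : Fin n → Bool, F (List.ofFn v)) / 2 ^ n

section Average

variable {n : ℕ} {F G : Bits → ℝ}

theorem avgBits_mono (h : ∀ r, r.length = n → F r ≤ G r) : avgBits n F ≤ avgBits n G := by
  unfold avgBits
  gcongr with v
  exact h _ (by simp)

theorem avgBits_congr (h : ∀ r, r.length = n → F r = G r) : avgBits n F = avgBits n G :=
  le_antisymm (avgBits_mono fun r hr => (h r hr).le) (avgBits_mono fun r hr => (h r hr).ge)

theorem avgBits_const (x : ℝ) : avgBits n (fun _ => x) = x := by simp [avgBits]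

theorem avgBits_add : avgBits n (fun r => F r + G r) = avgBits n F + avgBits n G := by
  simp [avgBits, Finset.sum_add_distrib, add_div]

theorem avgBits_sub : avgBits n (fun r => F r - G r) = avgBits n F - avgBits n G := by
  simp [avgBits, Finset.sum_sub_distrib, sub_div]

theorem avgBits_zero : avgBits 0 F = F [] := by simp [avgBits]

theorem avgBits_succ : avgBits (n + 1) F =
    (avgBits n (fun r => F (false :: r)) + avgBits n (fun r => F (true :: r))) / 2 := by
  simp only [avgBits]
  rw [← (Fin.consEquiv fun _ => Bool).sum_comp, Fintype.sum_prod_type, Fintype.sum_bool]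
  have h : ∀ (b : Bool) (v : Fin n → Bool),
      List.ofFn (Fin.consEquiv (fun _ : Fin (n + 1) => Bool) (b, v)) = b :: List.ofFn v :=
    fun b v => by simp [Fin.consEquiv, List.ofFn_succ]
  simp only [h]
  rw [pow_succ]
  field_simp
  ring

theorem avgBits_reverse : avgBits n (fun r => F r.reverse) = avgBits n F := by
  simp only [avgBits]
  rw [← (Equiv.arrowCongr (Fin.revPerm (n := n)) (Equiv.refl Bool)).sum_comp]
  congr 2
  ext v
  congr 1
  refine List.ext_getElem (by simp) fun i h1 h2 => ?_
  simp only [List.length_ofFn] at h2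
  simp only [List.getElem_reverse, List.getElem_ofFn, List.length_ofFn]
  change v (Fin.rev _) = _
  congr 1
  ext
  simp [Fin.rev]
  omega

theorem avgBits_drop (k : ℕ) : avgBits (k + n) (fun r => F (r.drop k)) = avgBits n F := by
  induction k with
  | zero => simp
  | succ k ih => rw [show k + 1 + n = k + n + 1 by ring, avgBits_succ]; simp [ih]

/-- Bit vectors as functions. -/
def msbEquiv (m : ℕ) : BitVec m ≃ (Fin m → Bool) where
  toFun x i := x.getMsb i
  invFun v := ofBits m (List.ofFn v)
  left_inv x := ofBits_bitsOf x
  right_inv v := List.ofFn_injective (bitsOf_ofBits (List.length_ofFn (f := v)))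

theorem ofFn_msbEquiv {m : ℕ} (x : BitVec m) : List.ofFn (msbEquiv m x) = bitsOf x := rfl

/-- The action of a permutation of blocks on lists of bits. -/
def permBits {m : ℕ} (π : Equiv.Perm (BitVec m)) (q : Bits) : Bits := bitsOf (π (ofBits m q))

@[simp] theorem length_permBits {m : ℕ} (π : Equiv.Perm (BitVec m)) (q : Bits) :
    (permBits π q).length = m := length_bitsOf _

/-- Uniform blocks stay uniform under a permutation. For this reason the encryption of a random
challenge block can serve as a random answer. -/
theorem avgBits_perm (π : Equiv.Perm (BitVec n)) :
    avgBits n (fun r => F (permBits π r)) = avgBits n F := by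
  simp only [avgBits]
  rw [← (((msbEquiv n).symm.trans π).trans (msbEquiv n)).sum_comp fun v => F (List.ofFn v)]
  rfl

open Classical in
theorem avgBits_mem_le (A : List Bits) :
    avgBits n (fun r => if r ∈ A then 1 else 0) ≤ A.length / 2 ^ n := by
  unfold avgBits
  gcongr
  rw [Finset.sum_boole]
  norm_cast
  refine (Finset.card_le_card_of_injOn (t := A.toFinset) (fun v => List.ofFn v) (fun v hv => ?_)
    List.ofFn_injective.injOn).trans (List.toFinset_card_le A)
  simpa using hv

open Classical in
theorem avgBits_code {ℓ : ℕ} : avgBits (bitLen ℓ) (fun r => if ∃ C : Code ℓ, codeB C = r then F r else 0) =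
    (∑ C : Code ℓ, F (codeB C)) / 2 ^ bitLen ℓ := by
  rw [avgBits]
  congr 1
  refine (Fintype.sum_of_injective (fun C : Code ℓ => msbEquiv _ (codeBits C)) (fun C D h => ?_) _ _
    (fun v hv => ?_) fun C => ?_).symm
  · exact codeB_injective (congrArg List.ofFn h)
  · rw [if_neg]
    rintro ⟨C, hC⟩
    exact hv ⟨C, List.ofFn_injective hC⟩
  · rw [ofFn_msbEquiv, if_pos ⟨C, rfl⟩]; rfl

end Average

namespace Dialog

variable {α β : Type}

/-! ## Expectations of dialogues with a cipher -/

/-- The first `i` answers are given by `π`, the others are random. -/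
noncomputable def hyb (m : ℕ) (π : Bits → Bits) : BDialog α → ℕ → (α → ℝ) → ℝ
  | ret a, _, F => F a
  | flip k, i, F => ((k false).hyb m π i F + (k true).hyb m π i F) / 2
  | ask _ k, 0, F => avgBits m fun r => (k r).hyb m π 0 F
  | ask q k, i + 1, F => (k (π q)).hyb m π i F

/-- All answers are random. -/
noncomputable def unif (m : ℕ) : BDialog α → (α → ℝ) → ℝ
  | ret a, F => F a
  | flip k, F => ((k false).unif m F + (k true).unif m F) / 2
  | ask _ k, F => avgBits m fun r => (k r).unif m F

/-- All answers are given by `π`. -/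
noncomputable def real (π : Bits → Bits) : BDialog α → (α → ℝ) → ℝ
  | ret a, F => F a
  | flip k, F => ((k false).real π F + (k true).real π F) / 2
  | ask q k, F => (k (π q)).real π F

variable {m : ℕ} {π : Bits → Bits} {d : BDialog α} {F G : α → ℝ}

theorem hyb_zero : d.hyb m π 0 F = d.unif m F := by
  induction d with
  | ret a => rfl
  | flip k ih => simp [hyb, unif, ih]
  | ask q k ih => simp [hyb, unif, ih]

theorem unif_bind (g : α → BDialog β) (F : β → ℝ) :
    (d.bind g).unif m F = d.unif m fun a => (g a).unif m F := by
  induction d with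
  | ret a => rfl
  | flip k ih => simp [unif, ih]
  | ask q k ih => simp [unif, ih]

theorem real_bind (g : α → BDialog β) (F : β → ℝ) :
    (d.bind g).real π F = d.real π fun a => (g a).real π F := by
  induction d with
  | ret a => rfl
  | flip k ih => simp [real, ih]
  | ask q k ih => simp [real, ih]

theorem hyb_mem_Icc (hF : ∀ a, F a ∈ Set.Icc (0 : ℝ) 1) {i : ℕ} :
    d.hyb m π i F ∈ Set.Icc (0 : ℝ) 1 := by
  induction d generalizing i with
  | ret a => exact hF a
  | flip k ih =>
    have h1 := ih false (i := i)
    have h2 := ih true (i := i)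
    simp only [hyb, Set.mem_Icc] at *
    constructor <;> linarith
  | ask q k ih =>
    cases i with
    | zero =>
      exact ⟨(avgBits_const 0).symm.le.trans (avgBits_mono fun r _ => (ih r).1),
        (avgBits_mono fun r _ => (ih r).2).trans (avgBits_const 1).le⟩
    | succ i => exact ih _

/-- An upper bound for the expectation that holds for all possible results. -/
theorem unif_le_of_wp {A : List Bits} {Q : List Bits → α → Prop}
    (h : d.wp m (fun _ r => r.length = m) A Q) (hQ : ∀ A a, Q A a → F a ≤ G a) :
    d.unif m F ≤ d.unif m G := by
  induction d generalizing A with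
  | ret a => exact hQ _ _ h
  | flip k ih => simp only [unif]; linarith [ih false (h false), ih true (h true)]
  | ask q k ih => exact avgBits_mono fun r hr => ih r (h.2.2 r hr)

theorem length_le_of_wp {A : List Bits} {N : ℕ}
    (h : d.wp m (fun _ r => r.length = m) A fun A' _ => A'.length ≤ N) : A.length ≤ N := by
  induction d generalizing A with
  | ret a => exact h
  | flip k ih => exact ih false (h false)
  | ask q k ih =>
    have := ih (.replicate m false) (h.2.2 _ (by simp))
    simp at this
    omega

/-- Every question lengthens the list of questions, whose final length is at most `N`, so the supply
of `i` true answers never runs out. -/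
theorem hyb_eq_real (hπ : ∀ q, (π q).length = m) {A : List Bits} {N i : ℕ}
    (h : d.wp m (fun _ r => r.length = m) A fun A' _ => A'.length ≤ N) (hi : N ≤ A.length + i) :
    d.hyb m π i F = d.real π F := by
  induction d generalizing A i with
  | ret a => rfl
  | flip k ih => simp [hyb, real, ih _ (h _) hi]
  | ask q k ih =>
    have h' := h.2.2 (π q) (hπ q)
    cases i with
    | zero =>
      have := length_le_of_wp h'
      simp at this
      omega
    | succ i => exact ih _ h' (by simp; omega)

/-! ## Expectations and handlers -/

variable {σ : Type} {O : σ → Val → Val × σ} {s : σ}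

theorem value_bind_ret {d : Dialog Val Val α} {g : α → β} {F : β → ℝ} :
    (d.bind fun a => ret (g a)).value O s F = d.value O s fun a => F (g a) := by
  induction d generalizing s with
  | ret a => rfl
  | flip k ih => simp [value, ih]
  | ask q k ih => simp [value, ih]

theorem value_sampleBits_bind (l : List Unit) (g : Bits → Dialog Val Val α) :
    ((sampleBits l).bind g).value O s F = avgBits l.length fun r => (g r).value O s F := by
  have key : ∀ (l : List Unit) (acc : Bits),
      ((foldM (fun acc _ => .flip fun b => .ret (b :: acc)) acc l).bind g).value O s F =
        avgBits l.length fun r => (g (r.reverse ++ acc)).value O s F := by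
    intro l
    induction l with
    | nil => intro acc; simp [avgBits_zero]
    | cons x l ih => intro acc; simp [value, ih, avgBits_succ]
  rw [sampleBits, key l []]
  simpa using avgBits_reverse (F := fun r => (g r).value O s F)

theorem value_sampleUnits_bind (l : Bits) (g : List Unit → Dialog Val Val α) :
    ((sampleUnits l).bind g).value O s F =
      (∑ i ∈ Finset.range (2 ^ l.length), (g (.replicate i ())).value O s F) / 2 ^ l.length := by
  have key : ∀ (l : Bits) (a : ℕ),
      ((foldM (fun acc (_ : Bool) => .flip fun b => .ret (cond b (() :: (acc ++ acc)) (acc ++ acc)))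
        (.replicate a ()) l).bind g).value O s F =
      (∑ i ∈ Finset.range (2 ^ l.length), (g (.replicate (a * 2 ^ l.length + i) ())).value O s F) /
        2 ^ l.length := by
    intro l
    induction l with
    | nil => intro a; simp
    | cons x l ih =>
      intro a
      have h0 : (List.replicate a () ++ .replicate a () : List Unit) = .replicate (2 * a) () := by
        rw [List.replicate_append_replicate, two_mul]
      have h1 : (() :: .replicate (2 * a) () : List Unit) = .replicate (2 * a + 1) () := rfl
      simp only [foldM_cons, flip_bind, ret_bind, value, cond_true, cond_false, h0, h1, ih,
        List.length_cons, pow_succ, mul_two, Finset.sum_range_add]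
      have e0 : ∀ i, 2 * a * 2 ^ l.length + i = a * (2 ^ l.length + 2 ^ l.length) + i :=
        fun i => by ring
      have e1 : ∀ i, (2 * a + 1) * 2 ^ l.length + i =
        a * (2 ^ l.length + 2 ^ l.length) + (2 ^ l.length + i) := fun i => by ring
      simp only [e0, e1]
      field_simp
      ring
  simpa [sampleUnits] using key l 0

theorem value_randomHandler (l : List Unit) (d : BDialog α) (F : α → ℝ) :
    (d.handle (fun (s : List Unit) _ => (sampleBits s).bind fun r => .ret (r, s)) l).value O s
      (fun p => F p.1) = d.unif l.length F := by
  induction d with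
  | ret a => rfl
  | flip k ih => simp [handle, value, unif, ih]
  | ask q k ih => simp [handle, bind_assoc, value_sampleBits_bind, unif, ih]

end Dialog

end Tokenization

namespace Tokenization
open Dialog Enc

/-! ## Wire formats and games -/

theorem encList_bool_injective : Function.Injective (encList encBool) := fun a b h => by
  have h' : (enc a : Val) = enc b := h
  rw [← Val.toBits_enc a, h', Val.toBits_enc]

theorem encBits_injective {w : ℕ} : Function.Injective (encBits (w := w)) := fun _ _ h =>
  bitsOf_injective (encList_bool_injective h)

theorem encRequest_injective {M : Type} {g : M → Val} (hg : Function.Injective g) :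
    Function.Injective (encRequest g) := by
  intro a b h
  cases a <;> cases b <;> simp only [encRequest, Val.node.injEq, reduceCtorEq, false_and] at h
  · rw [hg h.2]
  · rw [hg h.2.1, hg h.2.2]

theorem challengerOracle_encRequest (S : Service) (hS : Function.Injective S.encMsg) (K : S.Key)
    (ν : Bool) (st : GameState S) (r : Request S.Msg) :
    challengerOracle S K ν st (encRequest S.encMsg r) =
      (encOption S.encResp (challenger S K ν st r).1, (challenger S K ν st r).2) := by
  rw [challengerOracle, Function.partialInv_left (encRequest_injective hS)]

theorem challengerOracle_of_forall_ne (S : Service) (K : S.Key) (ν : Bool) (st : GameState S)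
    {q : Val} (hq : ∀ r, encRequest S.encMsg r ≠ q) :
    challengerOracle S K ν st q = (.nil, st) := by
  have : Function.partialInv (encRequest S.encMsg) q = none := by
    rw [Function.partialInv, dif_neg]
    rintro ⟨r, hr⟩
    exact hq r hr
  rw [challengerOracle, this]
  rfl

theorem toReal_uniform_bind {ι α : Type} [Fintype ι] [Nonempty ι] (f : ι → PMF α) (S : Set α) :
    (((PMF.uniformOfFintype ι).bind f).toOuterMeasure S).toReal =
      (∑ i, ((f i).toOuterMeasure S).toReal) / Fintype.card ι := by
  have hne : ∀ b, (f b).toOuterMeasure S ≠ ⊤ := fun b =>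
    ne_top_of_le_ne_top ENNReal.one_ne_top <| by
      rw [PMF.toOuterMeasure_apply, ← (f b).tsum_coe]
      exact ENNReal.tsum_le_tsum fun x => Set.indicator_le_self _ _ x
  rw [PMF.toOuterMeasure_bind_apply, tsum_fintype, ENNReal.toReal_sum]
  · simp only [ENNReal.toReal_mul, PMF.uniformOfFintype_apply, ENNReal.toReal_inv,
      ENNReal.toReal_natCast, ← Finset.mul_sum]
    rw [div_eq_inv_mul]
  · exact fun i _ => ENNReal.mul_ne_top (PMF.apply_ne_top _ _) (hne _)

/-- The expectation of the guess of an adversary, given the key and the secret bit. -/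
noncomputable def guessVal (S : Service) (input : List Val) (A : Prog) (t : ℕ) (K : S.Key)
    (ν : Bool) : ℝ :=
  (dialog t ([A], load input)).value (challengerOracle S K ν) ⟨S.start, ∅, none⟩
    fun s => if guess s then 1 else 0

theorem toReal_game (S : Service) (input : List Val) (A : Prog) (t : ℕ) :
    ((game S input A t).toOuterMeasure {b | b.2 = b.1}).toReal =
      (∑ K, (1 - guessVal S input A t K false + guessVal S input A t K true) / 2) /
        Fintype.card S.Key := by
  classical
  rw [game, toReal_uniform_bind]
  congr 1
  refine Finset.sum_congr rfl fun K _ => ?_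
  rw [toReal_uniformBool_bind, PMF.toOuterMeasure_map_apply, PMF.toOuterMeasure_map_apply,
    toReal_run, toReal_run, guessVal, guessVal, ← value_sub_const]
  have h0 : ∀ s, (if s ∈ (fun s => (false, guess s)) ⁻¹' {b : Bool × Bool | b.2 = b.1} then (1 : ℝ) else 0) =
      1 - if guess s then 1 else 0 := fun s => by cases h : guess s <;> simp [h]
  have h1 : ∀ s, (if s ∈ (fun s => (true, guess s)) ⁻¹' {b : Bool × Bool | b.2 = b.1} then (1 : ℝ) else 0) =
      if guess s then 1 else 0 := fun s => by cases h : guess s <;> simp [h]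
  simp only [h0, h1]

theorem mean_const {ι : Type} [Fintype ι] [Nonempty ι] (x : ℝ) :
    (∑ _i : ι, x) / Fintype.card ι = x := by
  rw [Finset.sum_const, Finset.card_univ, nsmul_eq_mul]
  field_simp

/-- A correct guess has probability one half plus half the mean difference between the guesses for
the two secret bits, whence the factor `1 / 2`. -/
theorem advantage_eq (S : Service) (input : List Val) (A : Prog) (t : ℕ) :
    advantage S input A t =
      |(∑ K, (guessVal S input A t K true - guessVal S input A t K false)) / Fintype.card S.Key| / 2 := by
  have h : ((game S input A t).toOuterMeasure {b | b.2 = b.1}).toReal - 1 / 2 =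
      (∑ K, (guessVal S input A t K true - guessVal S input A t K false)) / Fintype.card S.Key / 2 := by
    rw [toReal_game, ← mean_const (ι := S.Key) (1 / 2 : ℝ), ← sub_div, ← Finset.sum_sub_distrib,
      div_right_comm _ _ (2 : ℝ), Finset.sum_div _ _ (2 : ℝ)]
    congr 1
    exact Finset.sum_congr rfl fun K _ => by ring
  rw [advantage, h, abs_div, abs_two]

/-! ### The hybrid handler in the game for the cipher -/

section Cipher

variable {K : Type} [Fintype K] [Nonempty K] {m : ℕ} (E : K → Equiv.Perm (BitVec m)) (key : K)

theorem cipher_ordinary (ν : Bool) {gs : GameState (cipherService E)} (hp : gs.pair = none)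
    {q : Bits} (hq : q.length = m) :
    challengerOracle (cipherService E) key ν gs (.node .nil (enc q)) =
      (.node .nil (enc (permBits (E key) q)), ⟨(), insert (ofBits m q) gs.asked, none⟩) := by
  have h1 : Val.node .nil (enc q) = encRequest encBits (.ordinary (ofBits m q)) := by
    rw [encRequest, ← enc_bitsOf, bitsOf_ofBits hq]
  rw [h1]
  refine (challengerOracle_encRequest (cipherService E) encBits_injective key ν gs
    (.ordinary (ofBits m q))).trans ?_
  simp only [challenger, hp]
  rfl

open Classical in
theorem cipher_challenge (ν : Bool) {gs : GameState (cipherService E)} (hp : gs.pair = none)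
    {q r : Bits} (hq : q.length = m) (hr : r.length = m) (hqA : ofBits m q ∉ gs.asked)
    (hrA : ofBits m r ∉ gs.asked) :
    (challengerOracle (cipherService E) key ν gs (.node (enc true) (enc (q, r)))).1 =
      .node .nil (enc (permBits (E key) (if ν then r else q))) := by
  have h1 : Val.node (enc true) (enc (q, r)) =
      encRequest encBits (.challenge (ofBits m q) (ofBits m r)) := by
    rw [encRequest, ← enc_bitsOf, ← enc_bitsOf, bitsOf_ofBits hq, bitsOf_ofBits hr]; rfl
  rw [h1]
  refine (congrArg Prod.fst (challengerOracle_encRequest (cipherService E) encBits_injective key ν gs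
    (.challenge (ofBits m q) (ofBits m r)))).trans ?_
  have h2 : ¬((gs.pair.isSome : Prop) ∨ ofBits m q ∈ gs.asked ∨ ofBits m r ∈ gs.asked) := by
    rintro (h | h | h)
    · simp [hp] at h
    · exact hqA h
    · exact hrA h
  refine (congrArg (fun x : Option (BitVec m) × GameState (cipherService E) => encOption encBits x.1)
    (if_neg h2)).trans ?_
  cases ν <;> rfl

variable {α : Type} {F : α → ℝ}

/-- After the challenge nothing is passed on, so Phase II of the cipher game is never used and the
oracle no longer matters. -/
theorem value_hybrid_late {σ : Type} {O : σ → Val → Val × σ} {gs : σ} (d : BDialog α) :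
    (d.handle hybridStep (.replicate m (), [], true)).value O gs (fun p => F p.1) = d.unif m F := by
  induction d with
  | ret a => rfl
  | flip k ih => simp [handle, value, unif, ih]
  | ask q k ih => simp [handle, hybridStep, bind_assoc, value_sampleBits_bind, unif, ih]

theorem abs_avgBits_sub_le {n : ℕ} {X Y : Bits → ℝ} {A : List Bits}
    (hX : ∀ r, X r ∈ Set.Icc (0 : ℝ) 1) (hY : ∀ r, Y r ∈ Set.Icc (0 : ℝ) 1)
    (h : ∀ r, r.length = n → r ∉ A → X r = Y r) :
    |avgBits n X - avgBits n Y| ≤ A.length / 2 ^ n := by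
  classical
  have key : ∀ X Y : Bits → ℝ, (∀ r, X r ∈ Set.Icc (0 : ℝ) 1) → (∀ r, Y r ∈ Set.Icc (0 : ℝ) 1) →
      (∀ r, r.length = n → r ∉ A → X r = Y r) → avgBits n X - avgBits n Y ≤ A.length / 2 ^ n := by
    intro X Y hX hY h
    rw [← avgBits_sub]
    refine (avgBits_mono fun r hr => ?_).trans (avgBits_mem_le A)
    split_ifs with hA
    · linarith [(hX r).2, (hY r).1]
    · rw [h r hr hA, sub_self]
  rw [abs_sub_le_iff]
  exact ⟨key X Y hX hY h, key Y X hY hX fun r hr hA => (h r hr hA).symm⟩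

/-- Up to the challenge, handler and hybrid agree. The challenge pair consists of the next question
`q` and a random block `r`. If `ν` is false, the reply is the true value at `q`, as in hybrid `i +
1`; if `ν` is true, it is the value at `r`, a uniform block, as in hybrid `i`. By distinctness `q`
has not been asked before, and `r` has with probability at most `N / 2 ^ m`. Only then is the
challenge refused. -/
theorem value_hybrid (hF : ∀ a, F a ∈ Set.Icc (0 : ℝ) 1) (ν : Bool) {N : ℕ} {d : BDialog α}
    {A : List Bits} {gs : GameState (cipherService E)} {i : ℕ}
    (hd : d.wp m (fun _ r => r.length = m) A fun A' _ => A'.length ≤ N)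
    (hp : gs.pair = none) (hA : ∀ q : Bits, q.length = m → (ofBits m q ∈ gs.asked ↔ q ∈ A)) :
    |(d.handle hybridStep (.replicate m (), .replicate i (), false)).value
        (challengerOracle (cipherService E) key ν) gs (fun p => F p.1) -
      d.hyb m (permBits (E key)) (if ν then i else i + 1) F| ≤ N / 2 ^ m := by
  have hN : (0 : ℝ) ≤ N / 2 ^ m := by positivity
  induction d generalizing A gs i with
  | ret a => simpa [handle, value, hyb] using hN
  | flip k ih =>
    have h1 := ih false (hd false) hp hA (i := i)
    have h2 := ih true (hd true) hp hA (i := i)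
    simp only [handle, value, hyb]
    rw [abs_le] at *
    constructor <;> linarith
  | ask q k ih =>
    obtain ⟨hqA, hq, hd⟩ := hd
    cases i with
    | succ i =>
      have h1 : ∀ r, (readBits (List.replicate m ()) (Val.node .nil (enc (permBits (E key) r))).right) =
          permBits (E key) r := fun r => readBits_enc (by simp)
      have h2 := ih (permBits (E key) q) (A := q :: A) (gs := ⟨(), insert (ofBits m q) gs.asked, none⟩)
        (i := i) (hd _ (by simp)) rfl fun r hr => ?_
      · simp only [handle, hybridStep, List.replicate_succ, List.isEmpty_cons, cond_false, ask_bind,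
          ret_bind, value, List.tail_cons, cipher_ordinary E key ν hp hq, h1]
        cases ν
        · simpa [hyb] using h2
        · simpa [hyb] using h2
      · rw [List.mem_cons, ← hA r hr]
        refine or_congr_left ⟨fun h => ?_, fun h => by rw [h]⟩
        rw [← bitsOf_ofBits hr, h, bitsOf_ofBits hq]
    | zero =>
      have hAN := length_le_of_wp (hd (.replicate m false) (by simp))
      simp only [List.length_cons] at hAN
      have h1 : ∀ r, (readBits (List.replicate m ()) (Val.node .nil (enc (permBits (E key) r))).right) =
          permBits (E key) r := fun r => readBits_enc (by simp)
      have h2 : ∀ r : Bits, r.length = m → r ∉ A →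
          (challengerOracle (cipherService E) key ν gs (.node (enc true) (enc (q, r)))).1 =
            .node .nil (enc (permBits (E key) (if ν then r else q))) := fun r hr hrA =>
        cipher_challenge E key ν hp hq hr (mt (hA q hq).1 hqA) (mt (hA r hr).1 hrA)
      simp only [handle, hybridStep, List.replicate_zero, List.isEmpty_nil, cond_true, cond_false,
        bind_assoc, ask_bind, ret_bind, value_sampleBits_bind, value, value_hybrid_late,
        List.length_replicate]
      have hAle : (A.length : ℝ) / 2 ^ m ≤ N / 2 ^ m := by
        gcongr
        omega
      have hu : ∀ r, (k r).unif m F ∈ Set.Icc (0 : ℝ) 1 := fun r => by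
        rw [← hyb_zero (π := id)]
        exact hyb_mem_Icc hF
      cases ν with
      | true =>
        simp only [if_true]
        rw [hyb_zero]
        change |_ - avgBits m fun r => (k r).unif m F| ≤ _
        -- The uniform answer of the hybrid is rewritten as the encryption of a uniform `r`, so that
        -- both sides average over the same `r`.
        rw [← avgBits_perm (E key) (F := fun r => (k r).unif m F)]
        refine (abs_avgBits_sub_le (A := A) (fun r => hu _) (fun r => hu _) fun r hr hrA => ?_).trans hAle
        rw [h2 r hr hrA, h1]; rfl
      | false =>
        simp only [Bool.false_eq_true, if_false]
        change |_ - (k (permBits (E key) q)).hyb m _ 0 F| ≤ _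
        -- Here the answer does not depend on `r`, except through a refusal; a constant is written
        -- as an average in order to compare the two sides pointwise.
        rw [hyb_zero, ← avgBits_const (n := m) ((k (permBits (E key) q)).unif m F)]
        refine (abs_avgBits_sub_le (A := A) (fun r => hu _) (fun r => hu _) fun r hr hrA => ?_).trans hAle
        rw [h2 r hr hrA, h1]; rfl

end Cipher

end Tokenization

namespace Tokenization
open Dialog Enc

/-! ## The hybrid argument -/

theorem wp_handle_simStep {ℓ k : ℕ} {f : AddInput → Code ℓ → BitVec k} {pub : Pub}
    {ok : Bits → Bits → Prop} (hp : pub.Fits ℓ k)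
    (hok : ∀ q r, q.length = k + bitLen ℓ → ok q r → r.length = k + bitLen ℓ) {U H j i n I : ℕ}
    {α : Type} {d : Dialog Val Val α} {st : Sim}
    (hd : d.Tame (Set.range (encOption (encOption (encCode (ℓ := ℓ))))) H n)
    (h : SimInv f pub U H j i st) (hI : i + n * pub.fuel.length ≤ I)
    (hU : H + pub.fuel.length * (I + pub.fuel.length + 2) ≤ U) :
    (d.handle (simStep f) st).wp (k + bitLen ℓ) ok st.asked fun A p => A = p.2.asked ∧
      SimInv f pub U H (j + 2 * n) (i + n * pub.fuel.length) p.2 := by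
  induction d generalizing st j i n with
  | ret a => exact ⟨rfl, h.mono (by omega) (by omega)⟩
  | flip k ih => exact fun b => ih b (hd b) h hI
  | ask q k ih =>
    obtain ⟨n, rfl, hq, hd⟩ := hd
    rw [Nat.succ_mul] at hI
    rw [handle, wp_bind]
    refine wp_mono (simInv_simStep hp hok h hq (I := I + pub.fuel.length) (by omega) hU) ?_
    rintro A ⟨v, st'⟩ ⟨rfl, h1, h2⟩
    refine wp_mono (ih v (hd v h2) h1 (by omega)) ?_
    rintro A p ⟨rfl, h3⟩
    exact ⟨rfl, h3.mono (by omega) (by rw [Nat.succ_mul]; omega)⟩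

theorem value_hybridSetup_bind {α β σ : Type} (Jp Qp : Polynomial ℕ) (prm : Params)
    (D : Sim → BDialog α) (g : α → β) (O : σ → Val → Val × σ) (s : σ) (G : β → ℝ) {N : ℕ}
    (hN : N = 2 ^ (count (List.replicate (Qp.eval prm.1.length) ())).length) :
    ((hybridSetup Jp Qp prm).bind fun q => ((D q.1).handle hybridStep q.2).bind fun r =>
      .ret (g r.1)).value O s G =
    ((∑ i ∈ Finset.range N, ((D (initSim Jp prm false)).handle hybridStep
        (blockUnits prm, .replicate i (), false)).value O s fun p => G (g p.1)) / N +
      (∑ i ∈ Finset.range N, ((D (initSim Jp prm true)).handle hybridStep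
        (blockUnits prm, .replicate i (), false)).value O s fun p => G (g p.1)) / N) / 2 := by
  subst hN
  simp [hybridSetup, bind_assoc, value, value_sampleUnits_bind, value_bind_ret]

section

variable {K : Type} [Fintype K] [Nonempty K] {m : ℕ} {E : K → Equiv.Perm (BitVec m)}
  {α : Type} {F : α → ℝ} {D : Bool → BDialog α}

/-- The value of the random hybrid with `N` steps. -/
noncomputable def hybridVal (E : K → Equiv.Perm (BitVec m)) (D : Bool → BDialog α) (F : α → ℝ)
    (N : ℕ) (key : K) (ν b : Bool) : ℝ :=
  (∑ i ∈ Finset.range N, ((D b).handle hybridStep (.replicate m (), .replicate i (), false)).value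
    (challengerOracle (cipherService E) key ν) ⟨(), ∅, none⟩ fun p => F p.1) / N

/-- The true and the uniform world are the last and the first of `N + 1` hybrids, and the difference
telescopes. Each summand is the difference between the two secret bits for that index, with an error
of `Q / 2 ^ m` on either side. Summing over the index is `N` times drawing it at random. -/
theorem real_sub_unif_le_key (hF : ∀ a, F a ∈ Set.Icc (0 : ℝ) 1) {N Q : ℕ} (hN : 0 < N) (hQ : Q ≤ N)
    {b : Bool} (hd : (D b).wp m (fun _ r => r.length = m) [] fun A' _ => A'.length ≤ Q) (key : K) :
    (D b).real (permBits (E key)) F - (D b).unif m F ≤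
      N * (hybridVal E D F N key false b - hybridVal E D F N key true b) + 2 * N * (Q / 2 ^ m) := by
  have h0 : ((D b).real (permBits (E key)) F - (D b).unif m F) =
      ∑ i ∈ Finset.range N, ((D b).hyb m (permBits (E key)) (i + 1) F -
        (D b).hyb m (permBits (E key)) i F) := by
    rw [Finset.sum_range_sub fun i => (D b).hyb m (permBits (E key)) i F, hyb_zero, hyb_eq_real (by simp) hd (by simpa using hQ)]
  have h1 : ∀ i ∈ Finset.range N, ((D b).hyb m (permBits (E key)) (i + 1) F -
        (D b).hyb m (permBits (E key)) i F) ≤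
      ((D b).handle hybridStep (.replicate m (), .replicate i (), false)).value
          (challengerOracle (cipherService E) key false) ⟨(), ∅, none⟩ (fun p => F p.1) -
        ((D b).handle hybridStep (.replicate m (), .replicate i (), false)).value
          (challengerOracle (cipherService E) key true) ⟨(), ∅, none⟩ (fun p => F p.1) +
        2 * (Q / 2 ^ m) := by
    intro i _
    have hA : ∀ q : Bits, q.length = m →
        (ofBits m q ∈ (⟨(), ∅, none⟩ : GameState (cipherService E)).asked ↔ q ∈ ([] : List Bits)) :=
      fun q _ => iff_of_false (Set.notMem_empty _) List.not_mem_nil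
    have h2 := abs_le.1 (value_hybrid E key hF false hd rfl hA (i := i))
    have h3 := abs_le.1 (value_hybrid E key hF true hd rfl hA (i := i))
    simp only [Bool.false_eq_true, if_false, if_true] at h2 h3
    linarith [h2.1, h3.2]
  have hN' : (N : ℝ) ≠ 0 := by positivity
  rw [h0]
  refine (Finset.sum_le_sum h1).trans_eq ?_
  rw [Finset.sum_add_distrib, Finset.sum_sub_distrib, hybridVal, hybridVal]
  simp only [Finset.sum_const, Finset.card_range, nsmul_eq_mul]
  field_simp

/-- Averages the bound over the keys and over the secret bit of the simulated token game. The factor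
`2` undoes the half in `advantage_eq`, and `N` is the loss of the hybrid argument. -/
theorem real_sub_unif_le (hF : ∀ a, F a ∈ Set.Icc (0 : ℝ) 1) {N Q : ℕ} (hN : 0 < N) (hQ : Q ≤ N)
    (hd : ∀ b, (D b).wp m (fun _ r => r.length = m) [] fun A' _ => A'.length ≤ Q) {a : ℝ}
    (ha : |(∑ key, ((hybridVal E D F N key true false + hybridVal E D F N key true true) / 2 -
      (hybridVal E D F N key false false + hybridVal E D F N key false true) / 2)) /
        Fintype.card K| / 2 ≤ a) :
    (∑ key, ((D false).real (permBits (E key)) F + (D true).real (permBits (E key)) F) / 2) /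
        Fintype.card K ≤
      ((D false).unif m F + (D true).unif m F) / 2 + 2 * N * (a + Q / 2 ^ m) := by
  have h1 : ∀ key, ((D false).real (permBits (E key)) F + (D true).real (permBits (E key)) F) / 2 ≤
      ((D false).unif m F + (D true).unif m F) / 2 + 2 * N * (Q / 2 ^ m) - N *
        ((hybridVal E D F N key true false + hybridVal E D F N key true true) / 2 -
      (hybridVal E D F N key false false + hybridVal E D F N key false true) / 2) := by
    intro key
    have h2 := real_sub_unif_le_key (E := E) hF hN hQ (hd false) key
    have h3 := real_sub_unif_le_key (E := E) hF hN hQ (hd true) key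
    linarith
  have hK : (0 : ℝ) < Fintype.card K := by exact_mod_cast Fintype.card_pos
  have h2 := Finset.sum_le_sum fun key (_ : key ∈ Finset.univ) => h1 key
  rw [Finset.sum_sub_distrib, ← Finset.mul_sum] at h2
  have h3 := div_le_div_of_nonneg_right h2 hK.le
  rw [sub_div, mean_const, mul_div_assoc] at h3
  refine h3.trans ?_
  have h4 := neg_abs_le ((∑ key, ((hybridVal E D F N key true false + hybridVal E D F N key true true) / 2 -
      (hybridVal E D F N key false false + hybridVal E D F N key false true) / 2)) / Fintype.card K)
  have hN' : (0 : ℝ) < N := by exact_mod_cast hN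
  nlinarith

end

/-- A bound for the number of blocks that the simulator sends to the cipher. -/
noncomputable def sentBound (p Jp : Polynomial ℕ) : Polynomial ℕ := p * Jp * .X + 1

section

variable {ℓ k : ℕ → ℕ} {f : ∀ κ, AddInput → Code (ℓ κ) → BitVec (k κ)} {A : Prog} {p : Polynomial ℕ}

/-- The simulated interaction. -/
noncomputable def simDialog (f : ∀ κ, AddInput → Code (ℓ κ) → BitVec (k κ)) (A : Prog)
    (p Jp : Polynomial ℕ) (κ : ℕ) (b : Bool) : BDialog (Store × Sim) :=
  (dialog (p.eval κ) ([A], load (params ℓ k κ))).handle (simStep (f κ))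
    (initSim Jp (paramsOf ℓ k κ) b)

variable (hA : ∀ κ, HaltsWithin (Set.range (encOption (encOption (encCode (ℓ := ℓ κ))))) (p.eval κ)
  ([A], load (params ℓ k κ)))
include hA

theorem wp_simDialog (Jp : Polynomial ℕ) (κ : ℕ) {ok : Bits → Bits → Prop}
    (hok : ∀ q r, q.length = blockLen ℓ k κ → ok q r → r.length = blockLen ℓ k κ) (b : Bool) :
    (simDialog f A p Jp κ b).wp (blockLen ℓ k κ) ok [] fun A' r => A' = r.2.asked ∧
      SimInv (f κ) (pubOf ℓ k (fun κ => Jp.eval κ) κ) (addBound ℓ k A p Jp κ) (askBound ℓ k A p κ)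
        (2 * p.eval κ) (p.eval κ * Jp.eval κ) r.2 := by
  have hJ : (pubOf ℓ k (fun κ => Jp.eval κ) κ).fuel.length = Jp.eval κ := by simp [pubOf]
  have := wp_handle_simStep (pubOf_fits ℓ k (fun κ => Jp.eval κ) κ) hok (tame_adversary (hA κ)).1
    (simInv_initSim (f := f) Jp κ (addBound ℓ k A p Jp κ) _ b) (by rw [zero_add])
    (by rw [hJ]; exact le_rfl)
  simp only [hJ, zero_add] at this
  exact this

/-- There are at most `κ` blocks per attempt, `Jp` attempts per request and `p` requests. -/
theorem length_sent_le (Jp : Polynomial ℕ) (κ : ℕ) (b : Bool) :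
    (simDialog f A p Jp κ b).wp (blockLen ℓ k κ) (fun _ r => r.length = blockLen ℓ k κ) []
      fun A' _ => A'.length ≤ (sentBound p Jp).eval κ := by
  refine wp_mono (wp_simDialog hA Jp κ (fun _ _ _ h => h) b) ?_
  rintro A' r ⟨rfl, h⟩
  have := h.asked_len
  simp only [pubOf, paramsOf, List.length_replicate] at this
  simp only [sentBound, Polynomial.eval_add, Polynomial.eval_mul, Polynomial.eval_X,
    Polynomial.eval_one]
  omega

/-- The simulation with the cipher differs little from the simulation with random answers. -/
theorem exists_hybrid_adversary (hf : PolyTimeComputable ℓ k f) (hℓ : PolyBounded ℓ)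
    (hk : PolyBounded k) {K : ℕ → Type} [∀ κ, Fintype (K κ)] [∀ κ, Nonempty (K κ)]
    (E : ∀ κ, K κ → Equiv.Perm (BitVec (k κ + bitLen (ℓ κ)))) (Jp : Polynomial ℕ) (w : Bool) :
    ∃ (M : Prog) (r : Polynomial ℕ), (∀ κ ok, HaltsWithin ok (r.eval κ) ([M], load (params ℓ k κ))) ∧
      ∀ κ (F : Store × Sim → ℝ), (F = fun a => if verdict w (a.1 0) a.2 then 1 else 0) →
        (∑ key, ((simDialog f A p Jp κ false).real (permBits (E κ key)) F +
          (simDialog f A p Jp κ true).real (permBits (E κ key)) F) / 2) / Fintype.card (K κ) ≤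
        ((simDialog f A p Jp κ false).unif (blockLen ℓ k κ) F +
          (simDialog f A p Jp κ true).unif (blockLen ℓ k κ) F) / 2 +
        4 * (sentBound p Jp).eval κ *
          (advantage (cipherService (E κ)) (params ℓ k κ) M (r.eval κ) +
            (sentBound p Jp).eval κ / 2 ^ blockLen ℓ k κ) := by
  have hQ : ∀ κ, 1 ≤ (sentBound p Jp).eval κ := fun κ => by simp [sentBound]
  obtain ⟨M, r, hM⟩ := exists_hybridProg hf hℓ hk hA Jp (sentBound p Jp) hQ w
  refine ⟨M, r, fun κ ok => (hM κ).haltsWithin ok, fun κ F hF => ?_⟩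
  have hl : (paramsOf ℓ k κ).1.length = κ := by simp [paramsOf]
  obtain ⟨hN1, hN2⟩ := count_units_le _ (hQ κ)
  set N := 2 ^ (count (List.replicate ((sentBound p Jp).eval κ) ())).length with hN
  have hF01 : ∀ a, F a ∈ Set.Icc (0 : ℝ) 1 := fun a => by subst hF; dsimp only; split_ifs <;> simp
  have hg : ∀ key ν, guessVal (cipherService (E κ)) (params ℓ k κ) M (r.eval κ) key ν =
      (hybridVal (E κ) (simDialog f A p Jp κ) F N key ν false +
        hybridVal (E κ) (simDialog f A p Jp κ) F N key ν true) / 2 := by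
    intro key ν
    rw [guessVal, (hM κ).value_dialog _ (G := fun v => if v then 1 else 0)]
    · rw [value_hybridSetup_bind (N := N) Jp (sentBound p Jp) (paramsOf ℓ k κ)
        (fun st => (dialog (p.eval κ) ([A], load (params ℓ k κ))).handle (simStep (f κ)) st)
        (fun r => verdict w (r.1 0) r.2) _ _ _ (by rw [hN, hl]), blockUnits_paramsOf, hF]
      rfl
    · intro v s hs
      cases v <;> simp [guess, hs, enc, encBool]
  have h := real_sub_unif_le (E := E κ) (D := simDialog f A p Jp κ) (F := F) (N := N) hF01 (by omega)
    hN2.le (length_sent_le hA Jp κ) (a := advantage (cipherService (E κ)) (params ℓ k κ) M (r.eval κ))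
    (by rw [advantage_eq]; simp only [hg]; exact le_rfl)
  refine h.trans (add_le_add_right (mul_le_mul_of_nonneg_right ?_
    (add_nonneg (abs_nonneg _) (by positivity))) _)
  have : (N : ℝ) ≤ 2 * (sentBound p Jp).eval κ := by exact_mod_cast hN1
  linarith

end

end Tokenization

namespace Tokenization
open Dialog Enc

/-! ## The simulation with the cipher -/

namespace Dialog

variable {α β γ : Type} {π : Bits → Bits}

/-- All results satisfy `P` if `π` gives the answers. -/
def Always (π : Bits → Bits) : BDialog α → (α → Prop) → Prop
  | ret a, P => P a
  | flip k, P => ∀ b, (k b).Always π P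
  | ask q k, P => (k (π q)).Always π P

theorem Always.mono {d : BDialog α} {P P' : α → Prop} (h : d.Always π P) (hP : ∀ a, P a → P' a) :
    d.Always π P' := by
  induction d with
  | ret a => exact hP _ h
  | flip k ih => exact fun b => ih b (h b)
  | ask q k ih => exact ih _ h

theorem always_of_forall {d : BDialog α} {P : α → Prop} (h : ∀ a, P a) : d.Always π P := by
  induction d with
  | ret a => exact h a
  | flip k ih => exact fun b => ih b
  | ask q k ih => exact ih _

theorem always_bind {d : BDialog α} {g : α → BDialog β} {P : β → Prop} :
    (d.bind g).Always π P ↔ d.Always π fun a => (g a).Always π P := by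
  induction d with
  | ret a => rfl
  | flip k ih => simp [Always, ih]
  | ask q k ih => simp [Always, ih]

theorem always_foldM {g : α → γ → BDialog α} {P : α → Prop} (h : ∀ a x, P a → (g a x).Always π P)
    {l : List γ} {a : α} (ha : P a) : (foldM g a l).Always π P := by
  induction l generalizing a with
  | nil => exact ha
  | cons x l ih => exact always_bind.2 ((h a x ha).mono fun a ha => ih ha)

theorem le_real_of_always {d : BDialog α} {F : α → ℝ} {x : ℝ} (h : d.Always π fun a => x ≤ F a) :
    x ≤ d.real π F := by
  induction d with
  | ret a => exact h
  | flip k ih => simp only [real]; linarith [ih false (h false), ih true (h true)]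
  | ask q k ih => exact ih _ h

end Dialog

section Codes

variable {ℓ k : ℕ} {pub : Pub} (hp : pub.Fits ℓ k)
include hp

theorem inR_bitsOf (x : BitVec (k + bitLen ℓ)) : pub.inR (bitsOf x) = true ↔ InRange ℓ k x := by
  rw [Pub.inR, hp.leb_iff (by simp [hp.low_eq]), hp.low_eq, lval_reverse_drop, lval_bitsOf, InRange]
  simp

theorem low_walk (f : AddInput → Code ℓ → BitVec k) (π : Equiv.Perm (BitVec (k + bitLen ℓ)))
    (u : AddInput) (X : Code ℓ) :
    pub.low (bitsOf (walk π (block f u X) (block_inRange f u X)).1) = codeB (candidate f π u X) := by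
  refine List.reverse_injective (lval_injective (by simp [hp.low_eq]) ?_)
  rw [lval_codeB, candidate, Equiv.apply_symm_apply, hp.low_eq, lval_reverse_drop, lval_bitsOf]
  simp

/-- The tokens are distinct codes, so comparing their number with `10 ^ ℓ` decides whether a code is
left, without a search through exponentially many codes. -/
theorem full_iff_length {st : Sim} (hpub : st.pub = pub) (hn : st.toks.Nodup)
    (hc : ∀ t ∈ st.toks, ∃ C : Code ℓ, codeB C = t) :
    st.toks.length ≤ 10 ^ ℓ ∧ (st.full = true ↔ 10 ^ ℓ ≤ st.toks.length) ∧
      (st.full = true ↔ ∀ C : Code ℓ, codeB C ∈ st.toks) := by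
  classical
  have hcard : (Finset.univ.image (codeB (ℓ := ℓ))).card = 10 ^ ℓ := by
    rw [Finset.card_image_of_injective _ codeB_injective]
    simp
  have hsub : st.toks.toFinset ⊆ Finset.univ.image (codeB (ℓ := ℓ)) := fun t ht => by
    obtain ⟨C, rfl⟩ := hc t (List.mem_toFinset.1 ht)
    simp
  have hle : st.toks.length ≤ 10 ^ ℓ := by
    rw [← hcard, ← List.toFinset_card_of_nodup hn]
    exact Finset.card_le_card hsub
  have hfull : st.full = true ↔ 10 ^ ℓ ≤ st.toks.length := by
    obtain ⟨h1, h2⟩ := lval_count st.toks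
    have h3 : (count st.toks).reverse.length ≤ st.pub.theta.length := by
      rw [List.length_reverse, hpub, hp.length_theta]
      rcases eq_or_ne st.toks [] with h | h
      · simp [h, count]
      -- The comparison requires that the counter be no longer than `theta`; `4 * ℓ + 1` digits
      -- suffice because `10 ^ ℓ` is at most `16 ^ ℓ`.
      · have h4 : 2 ^ (count st.toks).length ≤ 2 ^ (4 * ℓ + 1) := by
          refine (h2 h).trans ?_
          rw [pow_succ, mul_comm, pow_mul]
          exact Nat.mul_le_mul_right _ (hle.trans (Nat.pow_le_pow_left (by norm_num) ℓ))
        exact (Nat.pow_le_pow_iff_right (by norm_num)).1 h4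
    have h4 : leb st.pub.theta (count st.toks).reverse = true ↔ st.toks.length < 10 ^ ℓ := by
      rw [leb_iff h3, h1, ← hp.theta, hpub, Nat.lt_succ_iff]
    rw [Sim.full, Bool.not_eq_true', ← not_lt, ← h4, Bool.not_eq_true]
  refine ⟨hle, hfull, hfull.trans ⟨fun h C => ?_, fun h => ?_⟩⟩
  · have := Finset.eq_of_subset_of_card_le hsub (by rwa [hcard, List.toFinset_card_of_nodup hn])
    rw [← List.mem_toFinset, this]
    simp
  · rw [← hcard, ← List.toFinset_card_of_nodup hn]
    refine Finset.card_le_card fun t ht => ?_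
    obtain ⟨C, -, rfl⟩ := Finset.mem_image.1 ht
    simpa using h C

end Codes

/-- A message as the simulator represents it. -/
def msgB {ℓ : ℕ} (m : Code ℓ × AddInput) : BMsg := (codeB m.1, m.2)

theorem msgB_injective {ℓ : ℕ} : Function.Injective (msgB (ℓ := ℓ)) := fun m m' h => by
  obtain ⟨h1, h2⟩ := Prod.mk.inj h
  exact Prod.ext (codeB_injective h1) h2

theorem msgOf_msgB {ℓ : ℕ} (m : Code ℓ × AddInput) : msgOf (encPair encCode encInput m) = msgB m := by
  change msgOf (enc (msgB m)) = msgB m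
  simp [msgOf, enc_pair, Val.left, Val.right, msgB]

theorem encPair_injective {ℓ : ℕ} :
    Function.Injective (encPair (encCode (ℓ := ℓ)) encInput) := fun m m' h => by
  have := congrArg msgOf h
  rw [msgOf_msgB, msgOf_msgB] at this
  exact msgB_injective this

theorem validMsg_iff_exists {ℓ k : ℕ} {pub : Pub} (hp : pub.Fits ℓ k) {v : Val} :
    pub.validMsg v = true ↔ ∃ m : Code ℓ × AddInput, encPair encCode encInput m = v := by
  rw [hp.validMsg_iff]
  constructor
  · rintro ⟨h, C, hC⟩
    have h' : encPair encCode encInput (C, (msgOf v).2) = enc (msgOf v) := by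
      change enc (codeB C, (msgOf v).2) = _
      rw [hC]
    exact ⟨(C, (msgOf v).2), h'.trans h⟩
  · rintro ⟨m, rfl⟩
    rw [msgOf_msgB]
    exact ⟨rfl, m.1, rfl⟩

section Decide

variable {ℓ k : ℕ} {st : Sim} (hp : st.pub.Fits ℓ k)
include hp

theorem decideReq_ordinary (m : Code ℓ × AddInput) :
    decideReq st (encRequest (encPair encCode encInput) (.ordinary m)) =
      cond st.pair.isSome (cond (meqb (msgB m) (st.pair.getD default).1 ||
        meqb (msgB m) (st.pair.getD default).2) none (some (msgB m, st)))
        (some (msgB m, { st with msgs := msgB m :: st.msgs })) := by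
  have h := (validMsg_iff_exists hp).2 ⟨m, rfl⟩
  simp only [decideReq, encRequest, Val.isNode, Val.left, Val.right, cond_true, cond_false, h,
    msgOf_msgB]

theorem decideReq_challenge (m₀ m₁ : Code ℓ × AddInput) :
    decideReq st (encRequest (encPair encCode encInput) (.challenge m₀ m₁)) =
      cond (st.pair.isSome || mmemb (msgB m₀) st.msgs || mmemb (msgB m₁) st.msgs) none
        (some (cond st.nu (msgB m₁) (msgB m₀), { st with pair := some (msgB m₀, msgB m₁) })) := by
  have h := (validMsg_iff_exists hp).2 ⟨m₀, rfl⟩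
  have h' := (validMsg_iff_exists hp).2 ⟨m₁, rfl⟩
  simp only [decideReq, encRequest, Val.isNode, Val.left, Val.right, cond_true, h, h', msgOf_msgB,
    Bool.not_false, Bool.true_and]

omit hp in
theorem decideReq_node (a b r : Val) : decideReq st (.node (.node a b) r) =
    cond (!a.isNode && !b.isNode && r.isNode && st.pub.validMsg r.left && st.pub.validMsg r.right)
      (cond (st.pair.isSome || mmemb (msgOf r.left) st.msgs || mmemb (msgOf r.right) st.msgs) none
        (some (cond st.nu (msgOf r.right) (msgOf r.left),
          { st with pair := some (msgOf r.left, msgOf r.right) }))) none := rfl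

theorem decideReq_eq_none {q : Val}
    (hq : ∀ r, encRequest (encPair (encCode (ℓ := ℓ)) encInput) r ≠ q) : decideReq st q = none := by
  cases q with
  | nil => rfl
  | node l r =>
    cases l with
    | nil =>
      rw [decideReq]
      cases hv : st.pub.validMsg r with
      | false => simp [Val.isNode, Val.left, Val.right, hv]
      | true =>
        obtain ⟨m, rfl⟩ := (validMsg_iff_exists hp).1 hv
        exact absurd rfl (hq (.ordinary m))
    | node a b =>
      rw [decideReq_node]
      cases hv : (!a.isNode && !b.isNode && r.isNode && st.pub.validMsg r.left &&
        st.pub.validMsg r.right) with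
      | false => rfl
      | true =>
        simp only [Bool.and_eq_true, Bool.not_eq_true'] at hv
        obtain ⟨⟨⟨⟨h1, h2⟩, h3⟩, h4⟩, h5⟩ := hv
        obtain ⟨m₀, h4⟩ := (validMsg_iff_exists hp).1 h4
        obtain ⟨m₁, h5⟩ := (validMsg_iff_exists hp).1 h5
        refine absurd ?_ (hq (.challenge m₀ m₁))
        cases a <;> cases b <;> cases r <;> simp [Val.isNode] at h1 h2 h3
        rw [encRequest, h4, h5]
        rfl

end Decide

/-! ### Agreement of the simulator with the token service -/

section Real

variable {K : Type} [Fintype K] [Nonempty K] {ℓ k : ℕ} {f : AddInput → Code ℓ → BitVec k}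
  {E : K → Equiv.Perm (BitVec (k + bitLen ℓ))} {key : K} {pub : Pub}

/-- The state of the simulator matches that of the challenger. -/
structure Agree (pub : Pub) (f : AddInput → Code ℓ → BitVec k)
    (π : Equiv.Perm (BitVec (k + bitLen ℓ))) (nu : Bool) (db : Set (Code ℓ))
    (asked : Set (Code ℓ × AddInput)) (pair : Option ((Code ℓ × AddInput) × (Code ℓ × AddInput)))
    (st : Sim) : Prop where
  pub_eq : st.pub = pub
  nu_eq : st.nu = nu
  bad : st.bad = false
  nodup : st.toks.Nodup
  codes : ∀ t ∈ st.toks, ∃ C : Code ℓ, codeB C = t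
  toks : ∀ C : Code ℓ, codeB C ∈ st.toks ↔ C ∈ db
  msgs : ∀ m, msgB m ∈ st.msgs ↔ m ∈ asked
  pair_eq : st.pair = pair.map fun p => (msgB p.1, msgB p.2)
  done : ∀ e ∈ st.done, ∀ m : Code ℓ × AddInput, e.2 = msgB m →
    codeB (candidate f π m.2 m.1) ∈ st.toks

variable {nu : Bool} {db : Set (Code ℓ)} {asked : Set (Code ℓ × AddInput)}
  {pair : Option ((Code ℓ × AddInput) × (Code ℓ × AddInput))} {st : Sim}

/-- Valid requests are exactly the encoded ones, and `msgB` is injective, so the simulator's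
bookkeeping on bit strings refuses the same requests as the challenger and tokenizes the same
message. The comparison of the tokens themselves is left to `always_tokenizeB`. -/
theorem agree_decide (hp : pub.Fits ℓ k) (h : Agree pub f (E key) nu db asked pair st) (q : Val) :
    (decideReq st q = none ∧ challengerOracle (tokenService f E) key nu ⟨db, asked, pair⟩ q =
      (.nil, ⟨db, asked, pair⟩)) ∨
    ∃ m asked' pair' st', decideReq st q = some (msgB m, st') ∧
      Agree pub f (E key) nu db asked' pair' st' ∧
      challengerOracle (tokenService f E) key nu ⟨db, asked, pair⟩ q =
        (encOption (encOption encCode) (some (tokenize f (E key) db m.1 m.2)),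
          ⟨(db ∪ {a | tokenize f (E key) db m.1 m.2 = some a} : Set (Code ℓ)), asked', pair'⟩) := by
  classical
  have hp' : st.pub.Fits ℓ k := h.pub_eq ▸ hp
  by_cases hq : ∃ r, encRequest (encPair (encCode (ℓ := ℓ)) encInput) r = q
  swap
  · exact Or.inl ⟨decideReq_eq_none hp' fun r hr => hq ⟨r, hr⟩,
      challengerOracle_of_forall_ne (tokenService f E) key nu _ fun r hr => hq ⟨r, hr⟩⟩
  obtain ⟨r, rfl⟩ := hq
  have hO := challengerOracle_encRequest (tokenService f E) encPair_injective key nu ⟨db, asked, pair⟩ r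
  have hO : challengerOracle (tokenService f E) key nu ⟨db, asked, pair⟩
      (encRequest (encPair (encCode (ℓ := ℓ)) encInput) r) = _ := hO
  rw [hO]
  have hpair := h.pair_eq
  cases r with
  | ordinary m =>
    rw [decideReq_ordinary hp']
    cases pair with
    | none =>
      rw [hpair]
      refine Or.inr ⟨m, insert m asked, none, _, rfl, { h with msgs := fun m' => ?_, pair_eq := rfl }, rfl⟩
      rw [List.mem_cons, Set.mem_insert_iff, h.msgs, msgB_injective.eq_iff]
    | some p =>
      rw [hpair]
      simp only [Option.map_some, Option.isSome_some, Option.getD_some, cond_true]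
      by_cases hm : m = p.1 ∨ m = p.2
      · left
        constructor
        · have : (meqb (msgB m) (msgB p.1) || meqb (msgB m) (msgB p.2)) = true := by
            simpa [msgB_injective.eq_iff] using hm
          rw [this]; rfl
        · exact congrArg (fun x : Option (Option (Code ℓ)) × GameState (tokenService f E) =>
            (encOption (encOption encCode) x.1, x.2)) (if_pos hm)
      · right
        refine ⟨m, asked, some p, st, ?_, h, ?_⟩
        · have : (meqb (msgB m) (msgB p.1) || meqb (msgB m) (msgB p.2)) = false := by
            rw [Bool.eq_false_iff]
            simpa [msgB_injective.eq_iff] using hm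
          rw [this]; rfl
        · exact congrArg (fun x : Option (Option (Code ℓ)) × GameState (tokenService f E) =>
            (encOption (encOption encCode) x.1, x.2)) (if_neg hm)
  | challenge m₀ m₁ =>
    rw [decideReq_challenge hp']
    have hiff : (st.pair.isSome || mmemb (msgB m₀) st.msgs || mmemb (msgB m₁) st.msgs) = true ↔
        ((pair.isSome : Prop) ∨ m₀ ∈ asked ∨ m₁ ∈ asked) := by
      simp [hpair, h.msgs, or_assoc]
    by_cases hc : (pair.isSome : Prop) ∨ m₀ ∈ asked ∨ m₁ ∈ asked
    · left
      rw [hiff.2 hc]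
      exact ⟨rfl, congrArg (fun x : Option (Option (Code ℓ)) × GameState (tokenService f E) =>
        (encOption (encOption encCode) x.1, x.2)) (if_pos hc)⟩
    · right
      refine ⟨if nu then m₁ else m₀, asked, some (m₀, m₁),
        { st with pair := some (msgB m₀, msgB m₁) }, ?_, { h with pair_eq := rfl }, ?_⟩
      · rw [Bool.eq_false_iff.2 (mt hiff.1 hc), h.nu_eq]
        cases nu <;> rfl
      · exact congrArg (fun x : Option (Option (Code ℓ)) × GameState (tokenService f E) =>
          (encOption (encOption encCode) x.1, x.2)) (if_neg hc)

variable {π : Equiv.Perm (BitVec (k + bitLen ℓ))}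

-- A walk that has neither ended nor failed stands at an iterate of `π` with no return into range
-- before or at it. So when it ends it is at the first return, which is the `Nat.find` in `walk`.
open Classical in
theorem always_walkB (hp : pub.Fits ℓ k) (A : List Bits) {t : BitVec (k + bitLen ℓ)}
    (ht : InRange ℓ k t) :
    (walkB pub A (bitsOf t)).Always (permBits π) fun w =>
      w.2.2.1 = true → w.2.1 = bitsOf (walk π t ht).1 := by
  let P : List Bits × Bits × Bool × Bool → Prop := fun w =>
    (w.2.2.1 = true → w.2.1 = bitsOf (walk π t ht).1) ∧ (w.2.2.1 = false → w.2.2.2 = true ∨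
      ∃ n, w.2.1 = bitsOf (π^[n] t) ∧ ∀ i < n, ¬InRange ℓ k (π^[i + 1] t))
  refine (always_foldM (P := P) (fun w _ hw => ?_) ⟨by simp, fun _ => Or.inr ⟨0, rfl, by simp⟩⟩).mono
    fun w hw => hw.1
  obtain ⟨A, c, fin, bad⟩ := w
  rw [walkStep]
  cases hfb : (fin || bad) with
  | true => exact hw
  | false =>
    simp only [Bool.or_eq_false_iff] at hfb
    obtain ⟨rfl, rfl⟩ := hfb
    cases hm : memb c A with
    | true => exact ⟨by simp, fun _ => Or.inl rfl⟩
    | false =>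
      obtain h | ⟨n, hn, hi⟩ := hw.2 rfl
      · cases h
      dsimp only at hn
      have hr : permBits π c = bitsOf (π^[n + 1] t) := by
        rw [permBits, hn, ofBits_bitsOf, Function.iterate_succ_apply']
      have hR : pub.inR (permBits π c) = true ↔ InRange ℓ k (π^[n + 1] t) := by rw [hr, inR_bitsOf hp]
      refine ⟨fun h => ?_, fun h => Or.inr ⟨n + 1, hr, fun i hi' => ?_⟩⟩
      · have h' := hR.1 h
        have hfind : Nat.find (exists_inRange π t ht) = n := (Nat.find_eq_iff _).2 ⟨h', hi⟩
        change permBits π c = bitsOf (π^[Nat.find (exists_inRange π t ht) + 1] t)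
        rw [hr, hfind]
      · rcases Nat.lt_succ_iff_lt_or_eq.1 hi' with h1 | rfl
        · exact hi i h1
        · exact fun h' => by simp [hR.2 h'] at h

/-- The state of the attempts matches the loop of the tokenization algorithm. -/
def TokAgree (f : AddInput → Code ℓ → BitVec k) (π : Equiv.Perm (BitVec (k + bitLen ℓ)))
    (X : Code ℓ) (u : AddInput) (st₀ : Sim) (p : Sim × Bits × Option Bits) : Prop :=
  p.1.bad = true ∨ (p.1.pub = st₀.pub ∧ p.1.bad = st₀.bad ∧ st₀.Same p.1 ∧
    ∃ s, p.2.1 = incr^[s] u ∧ (∀ i < s, codeB (candidate f π (incr^[i] u) X) ∈ st₀.toks) ∧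
      (∀ e ∈ p.1.done, ∀ m : Code ℓ × AddInput, e.2 = msgB m →
        codeB (candidate f π m.2 m.1) ∈ st₀.toks ∨
          p.2.2 = some (codeB (candidate f π m.2 m.1))) ∧
      ∀ t, p.2.2 = some t → t = codeB (candidate f π (incr^[s] u) X) ∧ t ∉ st₀.toks)

/-- An entry of `done` means that the candidate of that message is a token already, so the algorithm
rejects what the simulator skips. Hence both loops run through the same additional inputs until one
of them yields a new token. -/
theorem always_tokStep {st₀ : Sim} (hp : st₀.pub.Fits ℓ k) {X : Code ℓ} {u : AddInput}
    {p : Sim × Bits × Option Bits} (h : TokAgree f π X u st₀ p) :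
    (tokStep f (codeB X) p).Always (permBits π) (TokAgree f π X u st₀) := by
  obtain ⟨st, v, res⟩ := p
  rw [tokStep]
  cases hb : (st.bad || res.isSome) with
  | true => exact h
  | false =>
    simp only [Bool.or_eq_false_iff, Option.isSome_eq_false_iff, Option.isNone_iff_eq_none] at hb
    obtain ⟨hb, rfl⟩ := hb
    obtain h | ⟨h1, h2, h3, s, hv, hs, hd, -⟩ := h
    · simp [hb] at h
    dsimp only at h1 h2 h3 hv hs hd
    simp only [reduceCtorEq, or_false] at hd
    subst hv
    simp only [cond_false]
    obtain ⟨j, -, hv, hdone, -, -⟩ := skip_spec f st.done (codeB X) (incr^[s] u)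
    rw [attempt]
    rw [hv]
    -- Candidates before position `s` were rejected in earlier attempts; those from `s` on have
    -- entries in `done`.
    have hlt : ∀ i < j + s, codeB (candidate f π (incr^[i] u) X) ∈ st₀.toks := by
      intro i hi
      rcases lt_or_ge i s with h | h
      · exact hs i h
      · have := hd _ (hdone (i - s) (by omega)) (X, incr^[i] u) (by
          rw [msgB, ← Function.iterate_add_apply, Nat.sub_add_cancel h])
        exact this
    rw [← Function.iterate_add_apply]
    cases hc : (skip f st.done (codeB X) (incr^[s] u)).2.2 with
    | some c => exact Or.inl rfl
    | none =>
      simp only [Option.isSome_none, cond_false]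
      rw [blockB_codeB]
      rw [always_bind, h1]
      refine (always_walkB hp st.asked (block_inRange f (incr^[j + s] u) X)).mono fun w hw => ?_
      change TokAgree f π X u st₀ _
      rw [afterWalk]
      have hnew : ∀ e ∈ (bitsOf (block f (incr^[j + s] u) X), codeB X, incr^[j + s] u) :: st.done,
          ∀ m : Code ℓ × AddInput, e.2 = msgB m → codeB (candidate f π m.2 m.1) ∈ st₀.toks ∨
            m = (X, incr^[j + s] u) := by
        intro e he m hm
        rcases List.mem_cons.1 he with rfl | he
        · exact Or.inr (msgB_injective hm.symm)
        · exact Or.inl (hd e he m hm)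
      cases hfin : w.2.2.1 with
      | false => exact Or.inl rfl
      | true =>
        rw [hw hfin, h1, low_walk hp, h3.toks]
        cases ht : memb (codeB (candidate f π (incr^[j + s] u) X)) st₀.toks with
        | true =>
          have ht := memb_iff.1 ht
          simp only [cond_true]
          refine Or.inr ⟨rfl, h2, ⟨h3.nu, h3.msgs, h3.pair, rfl⟩, j + s + 1,
            (Function.iterate_succ_apply' incr (j + s) u).symm, fun i hi => ?_, fun e he m hm => Or.inl ?_, by simp⟩
          · rcases Nat.lt_succ_iff_lt_or_eq.1 hi with h | rfl
            · exact hlt i h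
            · exact ht
          · rcases hnew e he m hm with h | rfl
            · exact h
            · exact ht
        | false =>
          have ht : codeB (candidate f π (incr^[j + s] u) X) ∉ st₀.toks := fun h => by
            simp [memb_iff.2 h] at ht
          simp only [cond_true, cond_false]
          refine Or.inr ⟨rfl, h2, ⟨h3.nu, h3.msgs, h3.pair, rfl⟩, j + s, rfl, hlt,
            fun e he m hm => ?_, fun t htt => ?_⟩
          · rcases hnew e he m hm with h | rfl
            · exact Or.inl h
            · exact Or.inr rfl
          · obtain rfl := Option.some.inj htt
            exact ⟨rfl, ht⟩

/-- If the attempts run out and every code is a token, the algorithm does not terminate and `none`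
is the right answer. If a code is still free, nothing is known about termination, and the simulator
gives up. -/
theorem always_tokenizeB (hp : pub.Fits ℓ k) (h : Agree pub f π nu db asked pair st)
    (m : Code ℓ × AddInput) :
    (tokenizeB f st (msgB m)).Always (permBits π) fun p => p.1.bad = true ∨
      (enc p.2 = encOption encCode (tokenize f π db m.1 m.2) ∧
        Agree pub f π nu (db ∪ {a | tokenize f π db m.1 m.2 = some a}) asked pair p.1) := by
  classical
  have hp' : st.pub.Fits ℓ k := h.pub_eq ▸ hp
  rw [tokenizeB, always_bind]
  refine (always_foldM (P := TokAgree f π m.1 m.2 st) (fun p _ hp => always_tokStep hp' hp)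
    (Or.inr ⟨rfl, rfl, ⟨rfl, rfl, rfl, rfl⟩, 0, rfl, by simp,
      fun e he m hm => Or.inl (h.done e he m hm), by simp⟩)).mono fun p hpa => ?_
  obtain ⟨st', v, res⟩ := p
  change (finish (st', v, res)).1.bad = true ∨ _
  obtain hb | ⟨h1, h2, h3, s, hv, hs, hd, hres⟩ := hpa
  · left
    dsimp only at hb
    rw [finish]
    cases res <;> cases hfull : st'.full <;> simp [hb]
  dsimp only at h1 h2 h3 hv hs hd hres
  have hcand : ∀ u, candidate f π u m.1 ∈ db ↔ codeB (candidate f π u m.1) ∈ st.toks :=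
    fun u => (h.toks _).symm
  cases res with
  | some t =>
    right
    obtain ⟨rfl, ht⟩ := hres t rfl
    have hex : ∃ j, candidate f π (incr^[j] m.2) m.1 ∉ db := ⟨s, by rwa [hcand]⟩
    have htok : tokenize f π db m.1 m.2 = some (candidate f π (incr^[s] m.2) m.1) := by
      rw [tokenize, dif_pos hex, (Nat.find_eq_iff hex).2 ⟨by rwa [hcand], fun n hn => ?_⟩]
      rw [not_not, hcand]
      exact hs n hn
    rw [htok]
    refine ⟨rfl, h1.trans h.pub_eq, h3.nu.trans h.nu_eq, h2.trans h.bad, ?_, ?_, ?_, ?_, ?_, ?_⟩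
    · simpa [finish, h3.toks] using ⟨ht, h.nodup⟩
    · simpa [finish, h3.toks] using h.codes
    · intro C
      simp only [finish, Option.isSome_some, Option.getD_some, cond_true, List.mem_cons, h3.toks,
        h.toks, Set.mem_union, Set.mem_ofPred_eq, Option.some.injEq, codeB_injective.eq_iff]
      rw [or_comm, eq_comm]
    · intro m'
      change msgB m' ∈ st'.msgs ↔ _
      rw [h3.msgs, h.msgs]
    · exact h3.pair.trans h.pair_eq
    · intro e he m' hm'
      change _ ∈ codeB _ :: st'.toks
      rw [List.mem_cons, h3.toks]
      rcases hd e he m' hm' with h | h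
      · exact Or.inr h
      · exact Or.inl (Option.some.inj h).symm
  | none =>
    simp only [finish, Option.isSome_none, cond_false]
    cases hfull : st'.full with
    | false => exact Or.inl rfl
    | true =>
      right
      have hall := ((full_iff_length hp (h1.trans h.pub_eq) (h3.toks ▸ h.nodup)
        (h3.toks ▸ h.codes)).2.2).1 hfull
      have htok : tokenize f π db m.1 m.2 = none := by
        rw [tokenize, dif_neg]
        rintro ⟨j, hj⟩
        exact hj (by rw [hcand, ← h3.toks]; exact hall _)
      rw [htok]
      refine ⟨rfl, h1.trans h.pub_eq, h3.nu.trans h.nu_eq, h2.trans h.bad, h3.toks ▸ h.nodup,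
        h3.toks ▸ h.codes, ?_, ?_, h3.pair.trans h.pair_eq, ?_⟩
      · intro C
        simp [h3.toks, h.toks]
      · intro m'
        rw [cond_true, h3.msgs, h.msgs]
      · intro e he m' hm'
        simpa [h3.toks] using hd e he m' hm'

/-- After a failure, the simulator answers without changing its state. -/
theorem handle_of_bad {α : Type} (f : AddInput → Code ℓ → BitVec k) (d : Dialog Val Val α) {st : Sim}
    (hb : st.bad = true) : ∃ d' : BDialog α, d.handle (simStep f) st = d'.bind fun a => .ret (a, st) := by
  induction d with
  | ret a => exact ⟨.ret a, rfl⟩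
  | flip k ih =>
    choose d' hd' using ih
    exact ⟨.flip d', by simp [handle, hd']⟩
  | ask q k ih =>
    obtain ⟨d', hd'⟩ := ih .nil
    exact ⟨d', by simpa [handle, simStep, hb] using hd'⟩

/-- As long as the simulator has not given up, its answers coincide with those of the token service;
afterwards the right side counts as `1`. So the inequality holds for each fixed key, and no
probability of failure has to be estimated with the true cipher. -/
theorem value_le_real {α : Type} (hp : pub.Fits ℓ k) {F : α → ℝ} {V : α × Sim → ℝ} (hF : ∀ a, F a ≤ 1)
    (hbad : ∀ a st, st.bad = true → V (a, st) = 1)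
    (hV : ∀ a st, st.bad = false → st.nu = nu → F a ≤ V (a, st)) (d : Dialog Val Val α)
    (h : Agree pub f (E key) nu db asked pair st) :
    d.value (challengerOracle (tokenService f E) key nu) ⟨db, asked, pair⟩ F ≤
      (d.handle (simStep f) st).real (permBits (E key)) V := by
  induction d generalizing db asked pair st with
  | ret a => exact hV a st h.bad h.nu_eq
  | flip k ih =>
    simp only [value, handle, real]
    linarith [ih false h, ih true h]
  | ask q k ih =>
    rw [value, handle, real_bind, simStep, h.bad, Bool.false_or]
    obtain ⟨h1, h2⟩ | ⟨m, asked', pair', st', h1, h2, h3⟩ := agree_decide hp h q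
    · rw [h1, h2]
      exact ih .nil h
    · rw [h1, h3]
      simp only [Option.isSome_some, Bool.not_true, cond_false, Option.getD_some]
      refine le_real_of_always (always_bind.2 ((always_tokenizeB hp h2 m).mono ?_))
      rintro ⟨st'', o⟩ (hb | ⟨ho, hag⟩)
      · obtain ⟨d', hd'⟩ := handle_of_bad f (k (enc (some o))) hb
        change _ ≤ ((k (enc (some o))).handle (simStep f) st'').real _ V
        rw [hd', real_bind]
        refine le_trans ((value_mono hF).trans (value_const (x := 1)).le) ?_
        exact le_real_of_always (always_of_forall fun a => (hbad a _ hb).ge)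
      · have : enc (some o) = encOption (encOption encCode) (some (tokenize f (E key) db m.1 m.2)) := by
          rw [encOption, ← ho]; rfl
        change _ ≤ ((k (enc (some o))).handle (simStep f) st'').real _ V
        rw [this]
        exact ih _ hag

end Real

end Tokenization

namespace Tokenization
open Dialog Enc

/-! ## The simulation with random answers -/

namespace Dialog

variable {α : Type} {m : ℕ} {d : BDialog α} {F : α → ℝ}

theorem unif_add_const {x : ℝ} : (d.unif m fun a => F a + x) = d.unif m F + x := by
  induction d with
  | ret a => rfl
  | flip k ih => simp only [unif, ih]; ring
  | ask q k ih => simp only [unif, ih, avgBits_add, avgBits_const]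

theorem unif_const {x : ℝ} : (d.unif m fun _ => x) = x := by
  have h : (d.unif m fun _ => (0 : ℝ)) = 0 := by
    induction d with
    | ret a => rfl
    | flip k ih => simp [unif, ih]
    | ask q k ih => simp [unif, ih, avgBits_const]
  simpa [h] using unif_add_const (d := d) (m := m) (F := fun _ => 0) (x := x)

theorem unif_mono {G : α → ℝ} (h : ∀ a, F a ≤ G a) : d.unif m F ≤ d.unif m G := by
  induction d with
  | ret a => exact h a
  | flip k ih => simp only [unif]; linarith [ih false, ih true]
  | ask q k ih => exact avgBits_mono fun r _ => ih r

theorem unif_add {G : α → ℝ} : (d.unif m fun a => F a + G a) = d.unif m F + d.unif m G := by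
  induction d with
  | ret a => rfl
  | flip k ih => simp only [unif, ih]; ring
  | ask q k ih => simp only [unif, ih, avgBits_add]

end Dialog

section Walk

variable {ℓ k : ℕ} {pub : Pub}

theorem foldM_walkStep_of_end {w : List Bits × Bits × Bool × Bool} (hw : (w.2.2.1 || w.2.2.2) = true)
    (l : List Unit) : foldM (fun w (_ : Unit) => walkStep pub w) w l = .ret w := by
  induction l with
  | nil => rfl
  | cons x l ih => rw [foldM_cons, walkStep, hw, cond_true, ret_bind, ih]

/-- By minimality of the rounded logarithm. A uniform block is therefore in range with probability
at least one half. -/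
theorem two_pow_bitLen_le (ℓ : ℕ) : 2 ^ bitLen ℓ ≤ 2 * 10 ^ ℓ := by
  rcases Nat.eq_zero_or_pos ℓ with rfl | h
  · simp [bitLen]
  · have h1 : 1 < 10 ^ ℓ := Nat.one_lt_pow h.ne' (by norm_num)
    have h2 := Nat.pow_pred_clog_lt_self (by norm_num : 1 < 2) h1
    have h3 := Nat.clog_pos (by norm_num : 1 < 2) h1
    rw [bitLen, ← Nat.succ_pred_eq_of_pos h3, pow_succ]
    omega

theorem card_code (ℓ : ℕ) : Fintype.card (Code ℓ) = 10 ^ ℓ := by simp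

variable (hp : pub.Fits ℓ k)
include hp

-- The last bits of a uniform block are uniform, and a block is in range exactly if they form a
-- code; all codes then have equal weight.
open Classical in
theorem avgBits_inR (γ : Bits → ℝ) :
    (avgBits (k + bitLen ℓ) fun c => if pub.inR c then γ (pub.low c) else 0) =
      (∑ C : Code ℓ, γ (codeB C)) / 2 ^ bitLen ℓ := by
  rw [← avgBits_code, ← avgBits_drop (n := bitLen ℓ) k]
  refine avgBits_congr fun c hc => ?_
  simp only [hp.inR_iff hc, hp.low_eq]

/-- Each answer ends the walk with the probability `ρ ≥ 1 / 2` of being in range, and then gives a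
uniform code. It repeats an earlier block with probability at most `Q / 2 ^ m`; otherwise the walk
goes on from a new block. So the mean of `γ` over all codes is exceeded only by the chance of a
repetition in some step and the chance `2 ^ (-length)` that the walk does not end. -/
theorem unif_walk_le {γ : Bits → ℝ} (hγ : ∀ t, 0 ≤ γ t) {Q : ℕ} (l : List Unit) {A : List Bits}
    {c : Bits} (hA : A.length + l.length ≤ Q) (hcA : c ∉ A) :
    (foldM (fun w (_ : Unit) => walkStep pub w) (A, c, false, false) l).unif (k + bitLen ℓ)
        (fun w => if w.2.2.1 then γ (pub.low w.2.1) else 1) ≤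
      (∑ C : Code ℓ, γ (codeB C)) / 10 ^ ℓ + l.length * (Q / 2 ^ (k + bitLen ℓ)) +
        (1 / 2) ^ l.length := by
  classical
  have hM : 0 ≤ (∑ C : Code ℓ, γ (codeB C)) / 10 ^ ℓ :=
    div_nonneg (Finset.sum_nonneg fun _ _ => hγ _) (by positivity)
  induction l generalizing A c with
  | nil => simpa [unif] using hM
  | cons x l ih =>
    have hm : memb c A = false := by rw [Bool.eq_false_iff, ne_eq, memb_iff]; exact hcA
    rw [foldM_cons, walkStep]
    simp only [Bool.or_self, cond_false, hm, ask_bind, ret_bind, unif]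
    set M := (∑ C : Code ℓ, γ (codeB C)) / 10 ^ ℓ with hMdef
    set B := M + l.length * (Q / 2 ^ (k + bitLen ℓ)) + (1 / 2 : ℝ) ^ l.length with hB
    have hB0 : 0 ≤ B := by positivity
    -- The three cases after an answer: in range, the value is that of `γ`; out of range and new,
    -- the induction hypothesis bounds it by `B`; a repetition is charged `1` on top.
    have hpt : ∀ c' : Bits, c'.length = k + bitLen ℓ →
        (foldM (fun w (_ : Unit) => walkStep pub w) (c :: A, c', pub.inR c', false) l).unif
            (k + bitLen ℓ) (fun w => if w.2.2.1 then γ (pub.low w.2.1) else 1) ≤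
          (if pub.inR c' then γ (pub.low c') else 0) + ((B - if pub.inR c' then B else 0) +
            if c' ∈ c :: A then 1 else 0) := by
      intro c' hc'
      cases hR : pub.inR c' with
      | true =>
        rw [foldM_walkStep_of_end rfl]
        simp only [unif, if_true, sub_self, zero_add]
        split_ifs <;> simp
      | false =>
        simp only [Bool.false_eq_true, if_false, zero_add, sub_zero]
        by_cases hmem : c' ∈ c :: A
        · rw [if_pos hmem]
          cases l with
          | nil => simpa [unif] using hB0
          | cons x l =>
            rw [foldM_cons, walkStep, memb_iff.2 hmem]
            simp only [Bool.or_self, cond_false, cond_true, ret_bind]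
            rw [foldM_walkStep_of_end rfl]
            simpa [unif] using hB0
        · rw [if_neg hmem, add_zero]
          exact ih (by simp at hA ⊢; omega) hmem
    refine (avgBits_mono hpt).trans ?_
    rw [avgBits_add, avgBits_add, avgBits_sub, avgBits_const, avgBits_inR hp,
      avgBits_inR hp fun _ => B]
    have h1 : (avgBits (k + bitLen ℓ) fun c' => if c' ∈ c :: A then 1 else 0) ≤
        Q / 2 ^ (k + bitLen ℓ) := by
      refine (avgBits_mem_le (c :: A)).trans ?_
      gcongr
      simp at hA ⊢
      omega
    have h10 : (0 : ℝ) < 10 ^ ℓ := by positivity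
    have h2n : (0 : ℝ) < 2 ^ bitLen ℓ := by positivity
    have h2 : (2 : ℝ) ^ bitLen ℓ ≤ 2 * 10 ^ ℓ := by exact_mod_cast two_pow_bitLen_le ℓ
    have h3 : (10 : ℝ) ^ ℓ ≤ 2 ^ bitLen ℓ := by exact_mod_cast ten_pow_le_two_pow ℓ
    -- The probability that a uniform block is in range.
    set ρ : ℝ := 10 ^ ℓ / 2 ^ bitLen ℓ with hρ
    have hρ1 : 1 / 2 ≤ ρ := by rw [hρ, div_le_div_iff₀ (by norm_num) h2n]; linarith
    have hρ2 : ρ ≤ 1 := by rw [hρ, div_le_one h2n]; exact h3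
    have e1 : (∑ C : Code ℓ, γ (codeB C)) / 2 ^ bitLen ℓ = ρ * M := by
      rw [hρ, hMdef]; field_simp
    have e2 : (∑ _C : Code ℓ, B) / 2 ^ bitLen ℓ = ρ * B := by
      rw [Finset.sum_const, Finset.card_univ, card_code, nsmul_eq_mul, hρ]
      push_cast
      ring
    rw [e1, e2, List.length_cons, pow_succ]
    push_cast
    have h4 : (1 - ρ) * (1 / 2) ^ l.length ≤ 1 / 2 * (1 / 2) ^ l.length := by
      gcongr
      linarith
    have h5 : 0 ≤ ρ * (l.length * (Q / 2 ^ (k + bitLen ℓ) : ℝ)) := by positivity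
    have h6 : ρ * M + (B - ρ * B) = M + (1 - ρ) * (l.length * (Q / 2 ^ (k + bitLen ℓ) : ℝ)) +
        (1 - ρ) * (1 / 2) ^ l.length := by rw [hB]; ring
    linarith

end Walk

/-! ### The ideal game, in which every answer is a uniform new token -/

section Ideal

/-- The states look the same to the adversary. -/
structure Sim.View (st st' : Sim) : Prop where
  pub : st'.pub = st.pub
  toks : st'.toks = st.toks
  msgs : st'.msgs = st.msgs
  pair : st'.pair = st.pair

/-- The secret bit only selects which challenge message is to be tokenized, a component that is not
compared here. Acceptance and bookkeeping depend on the fields in `Sim.View` alone. -/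
theorem decideReq_view {st st' : Sim} (h : st.View st') (q : Val) :
    (decideReq st q = none ∧ decideReq st' q = none) ∨
      ∃ r r', decideReq st q = some r ∧ decideReq st' q = some r' ∧ r.2.View r'.2 ∧
        r.2.pub = st.pub ∧ r.2.toks = st.toks ∧ r.2.nu = st.nu := by
  obtain ⟨h1, h2, h3, h4⟩ := h
  simp only [decideReq, h1, h3, h4]
  cases q.isNode
  · exact Or.inl ⟨rfl, rfl⟩
  cases q.left.isNode
  · simp only [cond_true, cond_false]
    cases st.pub.validMsg q.right
    · exact Or.inl ⟨rfl, rfl⟩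
    simp only [cond_true]
    cases hp : st.pair.isSome
    · exact Or.inr ⟨_, _, rfl, rfl, ⟨rfl, h2, rfl, rfl⟩, rfl, rfl, rfl⟩
    simp only [cond_true]
    cases (meqb (msgOf q.right) (st.pair.getD default).1 || meqb (msgOf q.right) (st.pair.getD default).2)
    · exact Or.inr ⟨_, _, rfl, rfl, ⟨h1, h2, h3, h4⟩, rfl, rfl, rfl⟩
    · exact Or.inl ⟨rfl, rfl⟩
  · simp only [cond_true]
    cases (!q.left.left.isNode && !q.left.right.isNode && q.right.isNode &&
      st.pub.validMsg q.right.left && st.pub.validMsg q.right.right)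
    · exact Or.inl ⟨rfl, rfl⟩
    simp only [cond_true]
    cases (st.pair.isSome || mmemb (msgOf q.right.left) st.msgs || mmemb (msgOf q.right.right) st.msgs)
    · exact Or.inr ⟨_, _, rfl, rfl, ⟨rfl, h2, rfl, rfl⟩, rfl, rfl, rfl⟩
    · exact Or.inl ⟨rfl, rfl⟩

variable {ℓ k : ℕ}

open Classical in
/-- The codes that are not in the database. -/
noncomputable def freeCodes (ℓ : ℕ) (toks : List Bits) : Finset (Code ℓ) :=
  Finset.univ.filter fun C => codeB C ∉ toks

/-- The expectation of `G` when the answer is a random new token, if there is one. -/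
noncomputable def idealAnswer (ℓ : ℕ) (st : Sim) (G : Option Bits → Sim → ℝ) : ℝ :=
  if st.full then G none st
  else (∑ C ∈ freeCodes ℓ st.toks, G (some (codeB C)) { st with toks := codeB C :: st.toks }) /
    (freeCodes ℓ st.toks).card

/-- The expectation of `F` if all requests are answered by random new tokens. -/
noncomputable def Dialog.ideal {α : Type} (ℓ : ℕ) : Dialog Val Val α → Sim → (α → ℝ) → ℝ
  | ret a, _, F => F a
  | flip k, st, F => ((k false).ideal ℓ st F + (k true).ideal ℓ st F) / 2
  | ask q k, st, F =>
    match decideReq st q with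
    | none => (k .nil).ideal ℓ st F
    | some r => idealAnswer ℓ r.2 fun o st' => (k (enc (some o))).ideal ℓ st' F

variable {α : Type} {F : α → ℝ}

theorem idealAnswer_view {st st' : Sim} (h : st.View st') {G : Option Bits → Sim → ℝ}
    (hG : ∀ o st st', st.View st' → G o st = G o st') : idealAnswer ℓ st G = idealAnswer ℓ st' G := by
  have hf : st'.full = st.full := by rw [Sim.full, Sim.full, h.pub, h.toks]
  rw [idealAnswer, idealAnswer, hf, h.toks, hG none st st' h]
  congr 2
  refine Finset.sum_congr rfl fun C _ => hG _ _ _ ⟨h.pub, rfl, h.msgs, h.pair⟩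

/-- Ideal answers are drawn from the free codes, whatever the message. So neither the secret bit nor
the records kept for the simulation influence the ideal game. -/
theorem ideal_view (d : Dialog Val Val α) {st st' : Sim} (h : st.View st') :
    d.ideal ℓ st F = d.ideal ℓ st' F := by
  induction d generalizing st st' with
  | ret a => rfl
  | flip k ih => simp only [ideal]; rw [ih false h, ih true h]
  | ask q k ih =>
    simp only [ideal]
    obtain ⟨h1, h2⟩ | ⟨r, r', h1, h2, h3, -⟩ := decideReq_view h q
    · rw [h1, h2]
      exact ih _ h
    · rw [h1, h2]
      exact idealAnswer_view h3 fun o st st' h => ih _ h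

theorem ideal_nonneg (hF : ∀ a, 0 ≤ F a) (d : Dialog Val Val α) (st : Sim) : 0 ≤ d.ideal ℓ st F := by
  induction d generalizing st with
  | ret a => exact hF a
  | flip k ih => simp only [ideal]; linarith [ih false st, ih true st]
  | ask q k ih =>
    rw [ideal]
    cases decideReq st q with
    | none => exact ih _ _
    | some r =>
      simp only [idealAnswer]
      split_ifs
      · exact ih _ _
      · exact div_nonneg (Finset.sum_nonneg fun _ _ => ih _ _) (by positivity)

variable {pub : Pub} (hp : pub.Fits ℓ k)
include hp

omit hp in
theorem card_freeCodes {st : Sim} (hn : st.toks.Nodup)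
    (hc : ∀ t ∈ st.toks, ∃ C : Code ℓ, codeB C = t) :
    (freeCodes ℓ st.toks).card + st.toks.length = 10 ^ ℓ := by
  classical
  have h1 : (Finset.univ.filter fun C : Code ℓ => codeB C ∈ st.toks).card = st.toks.length := by
    rw [← List.toFinset_card_of_nodup hn, ← Finset.card_image_of_injective _ codeB_injective]
    congr 1
    ext t
    simp only [Finset.mem_image, Finset.mem_filter, Finset.mem_univ, true_and, List.mem_toFinset]
    exact ⟨fun ⟨C, h, e⟩ => e ▸ h, fun h => (hc t h).imp fun C (e : codeB C = t) => ⟨by rwa [e], e⟩⟩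
  have h2 := Finset.card_filter_add_card_filter_not (s := (Finset.univ : Finset (Code ℓ)))
    (fun C => codeB C ∈ st.toks)
  rw [h1, Finset.card_univ, card_code] at h2
  rw [add_comm, ← h2, freeCodes]

/-- Linearity of the expectation. The point to check is that the weights of the new tokens add up to
one, that is, that a free code exists unless the database is full. -/
theorem ideal_one_sub (d : Dialog Val Val α) {st : Sim} (hpub : st.pub = pub) (hn : st.toks.Nodup)
    (hc : ∀ t ∈ st.toks, ∃ C : Code ℓ, codeB C = t) :
    d.ideal ℓ st (fun a => 1 - F a) = 1 - d.ideal ℓ st F := by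
  induction d generalizing st with
  | ret a => rfl
  | flip k ih => simp only [ideal, ih _ hpub hn hc]; ring
  | ask q k ih =>
    simp only [ideal]
    obtain ⟨h1, -⟩ | ⟨r, r', h1, -, -, h2, h3, -⟩ := decideReq_view (⟨rfl, rfl, rfl, rfl⟩ : st.View st) q
    · rw [h1]
      exact ih _ hpub hn hc
    · rw [h1]
      rw [← h3] at hn hc
      rw [← h2] at hpub
      have hcard := card_freeCodes hn hc
      have hfull := (full_iff_length hp hpub hn hc).2.1
      simp only [idealAnswer]
      split_ifs with h
      · exact ih _ hpub hn hc
      · have hpos : ((freeCodes ℓ r.2.toks).card : ℝ) ≠ 0 := by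
          rw [hfull] at h
          have : (freeCodes ℓ r.2.toks).card ≠ 0 := by omega
          exact_mod_cast this
        rw [Finset.sum_congr rfl fun C hC => ih (enc (some (some (codeB C))))
          (st := { r.2 with toks := codeB C :: r.2.toks }) hpub ?_ ?_]
        · rw [Finset.sum_sub_distrib, sub_div]
          simp [hpos]
        · exact List.nodup_cons.2 ⟨(Finset.mem_filter.1 hC).2, hn⟩
        · intro t ht
          rcases List.mem_cons.1 ht with rfl | ht
          · exact ⟨C, rfl⟩
          · exact hc t ht

end Ideal

end Tokenization

/-! ### From random cipher values to the ideal game -/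

namespace Tokenization
open Dialog Enc

section

variable {ℓ k : ℕ} {f : AddInput → Code ℓ → BitVec k} {pub : Pub} {U H j i : ℕ} {st : Sim}

theorem SimInv.coll_isSome (h : SimInv f pub U H j i st) (hbad : st.bad = false) :
    st.coll.isSome = false := by
  rw [Bool.eq_false_iff]
  intro hcs
  have := h.bad_of_coll hcs
  simp [hbad] at this

/-- The value of a state of the attempts: failures count `1` unless there is a collision, `G` is the
value of a token, and `x` the value if there is no token yet. -/
noncomputable def attemptVal (G : Bits → ℝ) (x : ℝ) (p : Sim × Bits × Option Bits) : ℝ :=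
  if p.1.coll.isSome then 0 else if p.1.bad then 1 else p.2.2.elim x G

open Classical in
/-- The bound for the value with one more attempt. -/
noncomputable def attemptBound (ℓ : ℕ) (toks : List Bits) (G : Bits → ℝ) (δ x : ℝ) : ℝ :=
  (∑ C : Code ℓ, if codeB C ∈ toks then x else G (codeB C)) / 10 ^ ℓ + δ

/-- The failure probability of a walk. -/
noncomputable def walkError (pub : Pub) (m Q : ℕ) : ℝ :=
  pub.prm.1.length * (Q / 2 ^ m) + (1 / 2) ^ pub.prm.1.length

theorem walkError_nonneg (pub : Pub) (m Q : ℕ) : 0 ≤ walkError pub m Q := by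
  unfold walkError; positivity

variable (hp : pub.Fits ℓ k)

-- The starting block is in range, so by `SimInv.fresh` it would have an entry in `done` if it had
-- been sent before, contrary to the outcome of `skip`. Hence `unif_walk_le` applies, with value `x`
-- for a used code, after which the attempts continue, and the value given by `G` for a new one.
include hp in
theorem unif_attempt_le (h : SimInv f pub U H j i st) (hbad : st.bad = false) {X u : Bits}
    (hX : ∃ C : Code ℓ, codeB C = X) {G : Bits → ℝ} (hG : ∀ t, 0 ≤ G t) {x : ℝ} (hx : 0 ≤ x) {Q : ℕ}
    (hQ : (i + 1) * pub.prm.1.length ≤ Q) :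
    (attempt f st X u).unif (k + bitLen ℓ) (attemptVal G x) ≤
      attemptBound ℓ st.toks G (walkError pub (k + bitLen ℓ) Q) x := by
  classical
  rw [attempt]
  cases hc : (skip f st.done X u).2.2 with
  | some c =>
    simp only [Option.isSome_some, cond_true, unif, attemptVal, if_true]
    refine add_nonneg (div_nonneg (Finset.sum_nonneg fun C _ => ?_) (by positivity))
      (walkError_nonneg _ _ _)
    split_ifs
    exacts [hx, hG _]
  | none =>
    simp only [Option.isSome_none, cond_false, unif_bind]
    obtain ⟨s, -, hs, -, hnone, -⟩ := skip_spec f st.done X u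
    have hnew : blockB f (skip f st.done X u).1 X ∉ st.asked := fun hmem => by
      obtain ⟨p, hpd⟩ := h.fresh hbad _ hmem (by
        rw [hp.inR_iff (length_blockB f hX), low_blockB f hp hX]; exact hX)
      rw [hs] at hpd
      exact hnone hc p hpd
    have hcoll := h.coll_isSome hbad
    have hal := h.asked_len
    rw [Nat.succ_mul] at hQ
    rw [h.pub_eq]
    have hw := unif_walk_le hp (γ := fun t => if t ∈ st.toks then x else G t)
      (fun t => by split_ifs; exacts [hx, hG _]) (Q := Q) pub.prm.1 (by omega) hnew
    refine (unif_mono fun w => ?_).trans (hw.trans (by rw [attemptBound, walkError, ← add_assoc]))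
    simp only [unif, afterWalk, h.pub_eq]
    cases hfin : w.2.2.1 with
    | false => simp [attemptVal, hcoll]
    | true =>
      cases ht : memb (pub.low w.2.1) st.toks with
      | true => simp [attemptVal, hcoll, hbad, memb_iff.1 ht]
      | false =>
        have ht : pub.low w.2.1 ∉ st.toks := fun h => by simp [memb_iff.2 h] at ht
        simp [attemptVal, hcoll, hbad, ht]

/-- The bound for the value with a given number of attempts left. -/
noncomputable def attemptsBound (ℓ : ℕ) (toks : List Bits) (G : Bits → ℝ) (δ x : ℝ) (a : ℕ) : ℝ :=
  (attemptBound ℓ toks G δ)^[a] x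

theorem attemptBound_nonneg {toks : List Bits} {G : Bits → ℝ} (hG : ∀ t, 0 ≤ G t) {δ x : ℝ}
    (hδ : 0 ≤ δ) (hx : 0 ≤ x) : 0 ≤ attemptBound ℓ toks G δ x := by
  refine add_nonneg (div_nonneg (Finset.sum_nonneg fun C _ => ?_) (by positivity)) hδ
  split_ifs
  exacts [hx, hG _]

theorem attemptsBound_nonneg {toks : List Bits} {G : Bits → ℝ} (hG : ∀ t, 0 ≤ G t) {δ x : ℝ}
    (hδ : 0 ≤ δ) (hx : 0 ≤ x) (a : ℕ) : 0 ≤ attemptsBound ℓ toks G δ x a := by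
  induction a with
  | zero => exact hx
  | succ a ih => rw [attemptsBound, Function.iterate_succ_apply']; exact attemptBound_nonneg hG hδ ih

-- The bound for the attempts that remain takes the role of the value `x` of an unsuccessful
-- attempt, which leads to the iterates of `attemptBound`. It depends on the tokens only, and these
-- do not change during the attempts.
include hp in
theorem unif_attempts_le {L I : ℕ} {X : Bits} (hX : ∃ C : Code ℓ, codeB C = X) {G : Bits → ℝ}
    (hG : ∀ t, 0 ≤ G t) {x : ℝ} (hx : 0 ≤ x) {Q : ℕ} (hI : i + pub.fuel.length ≤ I)
    (hU : L + pub.fuel.length * (I + 2) ≤ U) (hQ : (i + pub.fuel.length) * pub.prm.1.length ≤ Q)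
    {l : List Unit} {a : ℕ} (ha : l.length + a = pub.fuel.length) {p : Sim × Bits × Option Bits}
    (h : TokInv f pub U H j i L I st a p.1.asked p) :
    (foldM (fun p (_ : Unit) => tokStep f X p) p l).unif (k + bitLen ℓ) (attemptVal G x) ≤
      attemptVal G (attemptsBound ℓ st.toks G (walkError pub (k + bitLen ℓ) Q) x l.length) p := by
  induction l generalizing a p with
  | nil => exact le_rfl
  | cons y l ih =>
    rw [List.length_cons] at ha
    have hih := fun p => ih (a := a + 1) (p := p) (by omega)
    have hstep := tokInv_step (ok := fun _ r => r.length = k + bitLen ℓ) hp (fun _ _ _ h => h) hX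
      (by omega) hI hU h
    have hx' := attemptsBound_nonneg (ℓ := ℓ) (toks := st.toks) hG
      (walkError_nonneg pub (k + bitLen ℓ) Q) hx l.length
    rw [foldM_cons, unif_bind]
    refine (unif_le_of_wp hstep fun A p' hp' => hih p' (hp'.1 ▸ hp')).trans ?_
    rw [tokStep]
    cases hb : (p.1.bad || p.2.2.isSome) with
    | true =>
      simp only [cond_true, unif, attemptVal]
      split_ifs with h1 h2
      · exact le_rfl
      · exact le_rfl
      · obtain ⟨t, ht⟩ : ∃ t, p.2.2 = some t := Option.isSome_iff_exists.1 (by simpa [h2] using hb)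
        rw [ht]
        exact le_rfl
    | false =>
      simp only [Bool.or_eq_false_iff, Option.isSome_eq_false_iff, Option.isNone_iff_eq_none] at hb
      obtain ⟨-, h1, h2, -, -⟩ := h
      have hcoll := h1.coll_isSome hb.1
      rw [cond_false]
      refine (unif_attempt_le hp h1 hb.1 hX hG hx' (Q := Q)
        ((Nat.mul_le_mul_right _ (by omega)).trans hQ)).trans ?_
      simp only [attemptVal, hcoll, hb.1, hb.2, Bool.false_eq_true, if_false, Option.elim_none,
        List.length_cons]
      rw [attemptsBound, attemptsBound, Function.iterate_succ_apply', h2.toks]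

open Classical in
theorem attemptBound_eq (hn : st.toks.Nodup) (hc : ∀ t ∈ st.toks, ∃ C : Code ℓ, codeB C = t)
    (G : Bits → ℝ) (δ x : ℝ) : attemptBound ℓ st.toks G δ x =
      (st.toks.length * x + ∑ C ∈ freeCodes ℓ st.toks, G (codeB C)) / 10 ^ ℓ + δ := by
  have h1 := card_freeCodes hn hc
  have h2 : (Finset.univ.filter fun C : Code ℓ => codeB C ∈ st.toks).card = st.toks.length := by
    have h2 := Finset.card_filter_add_card_filter_not (s := (Finset.univ : Finset (Code ℓ)))
      (fun C => codeB C ∈ st.toks)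
    rw [Finset.card_univ, card_code] at h2
    have : (freeCodes ℓ st.toks).card =
      (Finset.univ.filter fun C : Code ℓ => codeB C ∉ st.toks).card := rfl
    omega
  rw [attemptBound, Finset.sum_ite, Finset.sum_const, h2, nsmul_eq_mul]
  rfl

-- If `V` is the mean of `G` over the free codes and `r` the proportion of used ones, an attempt
-- maps `x` to `V + r (x - V) + δ`, so the distance to `V` shrinks by the factor `r` apart from `δ`.
-- As at most `T` codes are used and at least one is free, `r ≤ T / (T + 1)`. If no code is free, `r
-- = 1` and every attempt just adds `δ` to the value of `none`.
include hp in
theorem attemptsBound_le (hpub : st.pub = pub) (hn : st.toks.Nodup)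
    (hc : ∀ t ∈ st.toks, ∃ C : Code ℓ, codeB C = t) {G : Option Bits → Sim → ℝ}
    (hG : ∀ o st, 0 ≤ G o st) {δ : ℝ} (hδ : 0 ≤ δ) {T : ℕ} (hT : st.toks.length ≤ T) (a : ℕ) :
    attemptsBound ℓ st.toks (fun t => G (some t) { st with toks := t :: st.toks }) δ
        (if st.full then G none st else 1) a ≤
      idealAnswer ℓ st G + a * δ + (if st.full then 0 else (T / (T + 1)) ^ a : ℝ) := by
  have hcard := card_freeCodes hn hc
  have hcard' : ((freeCodes ℓ st.toks).card : ℝ) + st.toks.length = 10 ^ ℓ := by exact_mod_cast hcard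
  have hfull := (full_iff_length hp hpub hn hc).2.1
  have h10 : (0 : ℝ) < 10 ^ ℓ := by positivity
  have hr0 : (0 : ℝ) ≤ T / (T + 1) := by positivity
  induction a with
  | zero =>
    simp only [attemptsBound, Function.iterate_zero, id, idealAnswer]
    split_ifs
    · simp
    · have : 0 ≤ (∑ C ∈ freeCodes ℓ st.toks, G (some (codeB C)) { st with toks := codeB C :: st.toks }) /
          (freeCodes ℓ st.toks).card := div_nonneg (Finset.sum_nonneg fun _ _ => hG _ _) (by positivity)
      simpa using this
  | succ a ih =>
    rw [attemptsBound, Function.iterate_succ_apply', attemptBound_eq hn hc]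
    change (_ * attemptsBound _ _ _ _ _ _ + _) / _ + _ ≤ _
    set x := attemptsBound ℓ st.toks (fun t => G (some t) { st with toks := t :: st.toks }) δ
        (if st.full then G none st else 1) a
    rw [idealAnswer] at ih ⊢
    split_ifs at ih ⊢ with hf
    · rw [hfull] at hf
      have h0 : (freeCodes ℓ st.toks).card = 0 := by omega
      have hlen : (st.toks.length : ℝ) = 10 ^ ℓ := by simpa [h0] using hcard'
      rw [Finset.card_eq_zero.1 h0, Finset.sum_empty, hlen, add_zero, mul_div_cancel_left₀ _ h10.ne']
      push_cast
      linarith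
    · rw [hfull] at hf
      have hpos : (0 : ℝ) < (freeCodes ℓ st.toks).card := by
        have : 0 < (freeCodes ℓ st.toks).card := by omega
        exact_mod_cast this
      set V := (∑ C ∈ freeCodes ℓ st.toks, G (some (codeB C)) { st with toks := codeB C :: st.toks }) /
        (freeCodes ℓ st.toks).card with hV
      have hsum : (∑ C ∈ freeCodes ℓ st.toks, G (some (codeB C)) { st with toks := codeB C :: st.toks }) =
          (freeCodes ℓ st.toks).card * V := by rw [hV]; field_simp
      rw [hsum]
      set r : ℝ := st.toks.length / 10 ^ ℓ with hr
      have hr1 : r ≤ T / (T + 1) := by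
        rw [hr, div_le_div_iff₀ h10 (by positivity)]
        have h1 : (1 : ℝ) ≤ (freeCodes ℓ st.toks).card := by
          have : 1 ≤ (freeCodes ℓ st.toks).card := by omega
          exact_mod_cast this
        have h2 : (st.toks.length : ℝ) ≤ T := by exact_mod_cast hT
        rw [← hcard']
        nlinarith
      have hr2 : 0 ≤ r := by positivity
      have e : (st.toks.length * x + (freeCodes ℓ st.toks).card * V) / 10 ^ ℓ = V + r * (x - V) := by
        rw [hr, div_eq_iff h10.ne', add_mul, mul_right_comm, div_mul_cancel₀ _ h10.ne', ← hcard']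
        ring
      have hr3 : r ≤ 1 := hr1.trans (by rw [div_le_one (by positivity)]; linarith)
      have h3 : r * (x - V) ≤ r * (a * δ + (T / (T + 1)) ^ a) :=
        mul_le_mul_of_nonneg_left (by linarith) hr2
      have h4 : r * (a * δ) ≤ 1 * (a * δ) := mul_le_mul_of_nonneg_right hr3 (by positivity)
      have h5 : r * (T / (T + 1)) ^ a ≤ (T / (T + 1)) * (T / (T + 1) : ℝ) ^ a :=
        mul_le_mul_of_nonneg_right hr1 (by positivity)
      rw [e, pow_succ']
      push_cast
      nlinarith

/-- The value of a result of the simulation. -/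
noncomputable def simVal {α : Type} (G : α → Sim → ℝ) (p : α × Sim) : ℝ :=
  if p.2.coll.isSome then 0 else if p.2.bad then 1 else G p.1 p.2

/-- The loss for each request. -/
noncomputable def stepError (pub : Pub) (m Q T : ℕ) : ℝ :=
  pub.fuel.length * walkError pub m Q + (T / (T + 1)) ^ pub.fuel.length

theorem stepError_nonneg (pub : Pub) (m Q T : ℕ) : 0 ≤ stepError pub m Q T :=
  add_nonneg (mul_nonneg (by positivity) (walkError_nonneg _ _ _)) (by positivity)

-- During the attempts only fields outside `Sim.View` change, to which `G` is insensitive. So the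
-- value of each token can be fixed beforehand, in terms of the state `st`, and `attemptsBound_le`
-- applies.
include hp in
theorem unif_tokenizeB_le {L I : ℕ} (h : SimInv f pub U H j i st) (hbad : st.bad = false) {m : BMsg}
    (hm : OkMsg ℓ L m) (hI : i + pub.fuel.length ≤ I) (hU : L + pub.fuel.length * (I + 2) ≤ U)
    {Q : ℕ} (hQ : (i + pub.fuel.length) * pub.prm.1.length ≤ Q) {T : ℕ} (hT : j ≤ T)
    {G : Option Bits → Sim → ℝ} (hG : ∀ o st, 0 ≤ G o st)
    (hGv : ∀ o st st', st.View st' → G o st = G o st') :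
    (tokenizeB f st m).unif (k + bitLen ℓ) (fun p => simVal G (p.2, p.1)) ≤
      idealAnswer ℓ st G + stepError pub (k + bitLen ℓ) Q T := by
  -- What running out of attempts is worth: the answer `none` if the database is full, and a
  -- failure, counted as `1`, otherwise.
  set x := if st.full then G none st else 1 with hx
  have hx0 : 0 ≤ x := by rw [hx]; split_ifs; exacts [hG _ _, zero_le_one]
  set g : Bits → ℝ := fun t => G (some t) { st with toks := t :: st.toks } with hg
  have hcoll := h.coll_isSome hbad
  have hfold := tokInv_fold (ok := fun _ r => r.length = k + bitLen ℓ) hp (fun _ _ _ h => h) h hm hI hU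
  have h0 : TokInv f pub U H j i L I st 0 (st, m.2, (none : Option Bits)).1.asked (st, m.2, none) :=
    ⟨rfl, h, ⟨rfl, rfl, rfl, rfl⟩, by simpa using hm.2, by simp⟩
  rw [tokenizeB, unif_bind]
  refine (unif_le_of_wp (G := attemptVal g x) hfold ?_).trans ?_
  · rintro A ⟨st', v, res⟩ ⟨-, h1, h2, -, -⟩
    dsimp only at h1 h2
    have hf : st'.full = st.full := by rw [Sim.full, Sim.full, h1.pub_eq, h.pub_eq, h2.toks]
    cases res with
    | some t =>
      have := hGv (some t) { st' with toks := t :: st'.toks } { st with toks := t :: st.toks }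
        ⟨h.pub_eq.trans h1.pub_eq.symm, by rw [h2.toks], h2.msgs.symm, h2.pair.symm⟩
      change (if st'.coll.isSome then 0 else if st'.bad then 1 else
        G (some t) { st' with toks := t :: st'.toks }) ≤
        if st'.coll.isSome then 0 else if st'.bad then 1 else G (some t) { st with toks := t :: st.toks }
      rw [this]
    | none =>
      simp only [unif, finish, simVal, attemptVal, Option.isSome_none, cond_false, Option.elim_none, hf, hx]
      cases hfull : st.full with
      | true =>
        simp only [cond_true, if_true]
        rw [hGv none st st' ⟨h1.pub_eq.trans h.pub_eq.symm, h2.toks, h2.msgs, h2.pair⟩]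
      | false =>
        simp only [cond_false, if_true]
        split_ifs <;> simp_all
  · rw [h.pub_eq]
    refine (unif_attempts_le hp hm.1 (fun t => hG _ _) hx0 hI hU hQ (by simp) h0).trans ?_
    have e : ∀ y, attemptVal g y (st, m.2, none) = y := fun y => by simp [attemptVal, hcoll, hbad]
    rw [e]
    refine (attemptsBound_le hp h.pub_eq h.nodup h.toks hG (walkError_nonneg _ _ _)
      (h.toks_len.trans hT) _).trans ?_
    rw [stepError, ← add_assoc]
    gcongr
    split_ifs
    exacts [by positivity, le_rfl]

-- The requests are made ideal one after the other, each at the price of `stepError`. Giving up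
-- without a collision counts as `1` from then on, whatever the adversary does; giving up with a
-- collision counts as `0` here and is accounted for elsewhere.
include hp in
theorem unif_handle_le {α : Type} {F : α → ℝ} (hF : ∀ a, 0 ≤ F a) {d : Dialog Val Val α} {n I T Q : ℕ}
    (hd : d.Tame (Set.range (encOption (encOption (encCode (ℓ := ℓ))))) H n)
    (h : SimInv f pub U H j i st) (hbad : st.bad = false) (hI : i + n * pub.fuel.length ≤ I)
    (hU : H + pub.fuel.length * (I + pub.fuel.length + 2) ≤ U) (hT : j + 2 * n ≤ T)
    (hQ : I * pub.prm.1.length ≤ Q) :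
    (d.handle (simStep f) st).unif (k + bitLen ℓ) (simVal fun a _ => F a) ≤
      d.ideal ℓ st F + n * stepError pub (k + bitLen ℓ) Q T := by
  have hδ := stepError_nonneg pub (k + bitLen ℓ) Q T
  induction d generalizing st j i n with
  | ret a =>
    simp only [handle, unif, simVal, h.coll_isSome hbad, hbad, ideal]
    simpa using by positivity
  | flip c ih =>
    have h1 := ih false (hd false) h hbad hI hT
    have h2 := ih true (hd true) h hbad hI hT
    simp only [handle, unif, ideal]
    linarith
  | ask q c ih =>
    obtain ⟨n, rfl, hq, hd⟩ := hd
    rw [Nat.succ_mul] at hI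
    rw [handle, unif_bind, simStep, hbad, ideal, Bool.false_or]
    push_cast
    cases hdec : decideReq st q with
    | none =>
      have := ih .nil (hd _ ⟨none, rfl⟩) h hbad (by omega) (by omega)
      simp only [Option.isSome_none, Bool.not_false, cond_true, unif]
      linarith
    | some r =>
      obtain ⟨m, st₁⟩ := r
      obtain ⟨hm, h1, h2, h3, -⟩ := simInv_decide hp h hq hdec
      simp only [Option.isSome_some, Bool.not_true, cond_false, Option.getD_some, unif_bind, unif]
      rw [hbad] at h3
      have hw := simInv_tokenize (ok := fun _ r => r.length = _) hp (fun _ _ _ h => h) h1 hm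
        (I := I + pub.fuel.length) (by omega) hU
      refine (unif_le_of_wp hw (G := fun p => simVal (fun o st' => (c (enc (some o))).ideal ℓ st' F)
        (p.2, p.1) + n * stepError pub (k + bitLen ℓ) Q T) ?_).trans ?_
      · rintro A ⟨st₂, o⟩ ⟨-, g1, g2⟩
        dsimp only at g1 g2 ⊢
        have hnδ : 0 ≤ n * stepError pub (k + bitLen ℓ) Q T := mul_nonneg (by positivity) hδ
        cases hb : st₂.bad with
        | true =>
          obtain ⟨d', hd'⟩ := handle_of_bad f (c (enc (some o))) hb
          rw [hd', unif_bind]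
          simp only [unif, simVal, hb, if_true]
          rw [unif_const]
          linarith
        | false =>
          simp only [simVal, g1.coll_isSome hb, hb, Bool.false_eq_true, if_false]
          refine ih _ (hd _ ?_) g1 hb (by omega) (by omega)
          cases o with
          | none => exact ⟨some none, rfl⟩
          | some t =>
            obtain ⟨C, rfl⟩ := g2 t rfl
            exact ⟨some (some C), rfl⟩
      · rw [unif_add_const]
        have := unif_tokenizeB_le hp h1 h3 hm (I := I + pub.fuel.length) (by omega) hU (Q := Q)
          ((Nat.mul_le_mul_right _ (by omega)).trans hQ) (T := T) (by omega)
          (G := fun o st' => (c (enc (some o))).ideal ℓ st' F) (fun _ _ => ideal_nonneg hF _ _)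
          (fun _ _ _ h => ideal_view _ h)
        linarith

end

end Tokenization

namespace Tokenization
open Dialog Enc

variable {α β γ δ ε : Type} [Enc α] [Enc β] [Enc γ] [Enc δ] [Enc ε]

/-! ## Collisions -/

section Found

variable {ℓ k : ℕ} {f : AddInput → Code ℓ → BitVec k}

theorem blockB_codeB_inj {u v : AddInput} {X Y : Code ℓ}
    (h : blockB f u (codeB X) = blockB f v (codeB Y)) : f u X = f v Y := by
  rw [blockB, blockB, onBits_codeB, onBits_codeB] at h
  exact bitsOf_injective (List.append_inj h (by simp)).1

theorem foundCollision_of_isColl {U : ℕ} {c : BMsg × BMsg} (h : IsColl ℓ U f c) {s : Store}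
    (hs : s 0 = enc c) : FoundCollision f s := by
  obtain ⟨⟨X, u⟩, ⟨Y, v⟩⟩ := c
  obtain ⟨⟨⟨C, rfl⟩, -⟩, ⟨⟨D, rfl⟩, -⟩, h3, h4⟩ := h
  refine ⟨(C, u), (D, v), fun he => h3 ?_, blockB_codeB_inj h4, hs⟩
  obtain ⟨rfl, rfl⟩ := Prod.mk.inj he
  rfl

end Found

section

variable {ℓ k : ℕ → ℕ} {f : ∀ κ, AddInput → Code (ℓ κ) → BitVec (k κ)}

/-- The probability that a program finds a collision. -/
noncomputable def collisionProb (f : ∀ κ, AddInput → Code (ℓ κ) → BitVec (k κ)) (M : Prog)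
    (r : Polynomial ℕ) (κ : ℕ) : ℝ :=
  ((run (fun (_ : Unit) _ => (Val.nil, ())) (r.eval κ) ([M], load (params ℓ k κ))
    ()).toOuterMeasure {s | FoundCollision (f κ) s}).toReal

open Classical in
theorem collisionProb_eq {M : Prog} {r : Polynomial ℕ} {κ : ℕ} {d : Dialog Val Val (BMsg × BMsg)}
    (h : Follows (fun (v : BMsg × BMsg) s => s 0 = enc v) (r.eval κ) ([M], load (params ℓ k κ)) d) :
    collisionProb f M r κ = d.value (fun (_ : Unit) _ => (Val.nil, ())) ()
      fun v => if FoundCollision (f κ) (fun _ => enc v) then 1 else 0 := by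
  rw [collisionProb, toReal_run]
  refine h.value_dialog _ (fun v s hs => ?_) _
  have : FoundCollision (f κ) s ↔ FoundCollision (f κ) fun _ => enc v := by
    unfold FoundCollision
    rw [hs]
  simp only [Set.mem_ofPred_eq, this]

/-- With random answers the simulation is a program that needs no oracle, and by `SimInv.coll`
whatever it records is a genuine collision. This bounds the probability that collisions make the
simulator give up. -/
theorem exists_collision_adversary {A : Prog} {p : Polynomial ℕ}
    (hA : ∀ κ, HaltsWithin (Set.range (encOption (encOption (encCode (ℓ := ℓ κ))))) (p.eval κ)
      ([A], load (params ℓ k κ)))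
    (hf : PolyTimeComputable ℓ k f) (hℓ : PolyBounded ℓ) (hk : PolyBounded k) (Jp : Polynomial ℕ) :
    ∃ (M : Prog) (r : Polynomial ℕ), (∀ κ ok, HaltsWithin ok (r.eval κ) ([M], load (params ℓ k κ))) ∧
      ∀ κ, ((simDialog f A p Jp κ false).unif (blockLen ℓ k κ)
            (fun a => if a.2.coll.isSome then 1 else 0) +
          (simDialog f A p Jp κ true).unif (blockLen ℓ k κ)
            (fun a => if a.2.coll.isSome then 1 else 0)) / 2 ≤ collisionProb f M r κ := by
  classical
  obtain ⟨M, r, hM⟩ := exists_collisionProg hf hℓ hk hA Jp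
  refine ⟨M, r, fun κ ok => (hM κ).haltsWithin ok, fun κ => ?_⟩
  have h : ∀ b, (simDialog f A p Jp κ b).unif (blockLen ℓ k κ)
      (fun a => if a.2.coll.isSome then 1 else 0) ≤
      (simDialog f A p Jp κ b).unif (blockLen ℓ k κ) fun a =>
        if FoundCollision (f κ) (fun _ => enc (a.2.coll.getD default)) then 1 else 0 := by
    refine fun b => unif_le_of_wp (wp_simDialog hA Jp κ (fun _ _ _ h => h) b) ?_
    rintro A' a ⟨-, ha⟩
    cases hc : a.2.coll with
    | none => simp only [Option.isSome_none, Bool.false_eq_true, if_false]; split_ifs <;> norm_num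
    | some c => simp [foundCollision_of_isColl (ha.coll c hc) (s := fun _ => enc c) rfl]
  rw [collisionProb_eq (hM κ)]
  have hv : ∀ b, (((simDialog f A p Jp κ b).handle
      (fun s _ => (sampleBits s).bind fun r => .ret (r, s)) (blockUnits (paramsOf ℓ k κ))).bind fun r =>
        .ret (r.1.2.coll.getD default)).value (fun (_ : Unit) _ => (Val.nil, ())) ()
          (fun v => if FoundCollision (f κ) (fun _ => enc v) then (1 : ℝ) else 0) =
      (simDialog f A p Jp κ b).unif (blockLen ℓ k κ) fun a =>
        if FoundCollision (f κ) (fun _ => enc (a.2.coll.getD default)) then 1 else 0 := by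
    intro b
    rw [value_bind_ret]
    refine (value_randomHandler _ _ fun a : Store × Sim => if FoundCollision (f κ)
      (fun _ => enc (a.2.coll.getD default)) then (1 : ℝ) else 0).trans ?_
    rw [blockUnits_paramsOf, List.length_replicate]
  rw [randomSetup, flip_bind, value]
  have h0 := (h false).trans_eq (hv false).symm
  have h1 := (h true).trans_eq (hv true).symm
  simp only [ret_bind]
  change _ ≤ ((((simDialog f A p Jp κ false).handle
      (fun s _ => (sampleBits s).bind fun r => .ret (r, s)) (blockUnits (paramsOf ℓ k κ))).bind fun r =>
        .ret (r.1.2.coll.getD default)).value _ _ _ + (((simDialog f A p Jp κ true).handle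
      (fun s _ => (sampleBits s).bind fun r => .ret (r, s)) (blockUnits (paramsOf ℓ k κ))).bind fun r =>
        .ret (r.1.2.coll.getD default)).value _ _ _) / 2
  linarith

/-! ## The length of the hash values -/

theorem FP.exists_prog {g : Params → Dialog Val Val β}
    (hg : FP (fun κ prm => prm = paramsOf ℓ k κ) fun _ => g) :
    ∃ (M : Prog) (r : Polynomial ℕ), ∀ κ,
      Follows (fun v s => s 0 = enc v) (r.eval κ) ([M], load (params ℓ k κ)) (g (paramsOf ℓ k κ)) := by
  obtain ⟨P, T, hP⟩ := hg
  refine ⟨.seq (.assign 4 (.cons (.var 0) (.cons (.var 1) (.cons (.var 2) (.var 3))))) <|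
    .seq (P 4) (.assign 0 (.var 4)), T + 4, fun κ => ?_⟩
  rw [show (T + 4).eval κ = (T.eval κ + (0 + 1)) + 1 + 1 + 1 by simp]
  refine .tick rfl (.tick rfl (.tick rfl ?_))
  rw [← bind_ret (g (paramsOf ℓ k κ))]
  refine hP κ (paramsOf ℓ k κ) rfl _ _ 4 _ _ _ ?_ fun b s hl hs hx => ?_
  · simp [Expr.eval, load, params, paramsOf, enc_units]
  · exact .tick rfl (.halt rfl (by simp [Expr.eval, hs]))

/-- Two random additional inputs with the first code. -/
def randomPair (prm : Params) : Dialog Val Val (BMsg × BMsg) :=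
  (sampleBits prm.1).bind fun u => (sampleBits prm.1).bind fun v =>
    .ret ((.replicate prm.2.2.1.length false, u), (.replicate prm.2.2.1.length false, v))

theorem PT.zeros {g : α → List Unit} (hg : PT g) :
    PT fun a => List.replicate (g a).length false := by
  refine PT.comp (g := fun l : List Unit => List.replicate l.length false) (.expr (.var 0) fun l => ?_) hg
  change enc l = _
  induction l with
  | nil => rfl
  | cons x l ih => rw [List.length_cons, List.replicate_succ, enc_cons, enc_cons, ih]; rfl

theorem FP.randomPair (hℓ : PolyBounded ℓ) (hk : PolyBounded k) :
    FP (fun κ prm => prm = paramsOf ℓ k κ) fun _ => Tokenization.randomPair := by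
  have hp := polyHeight_params hℓ hk
  have hbits : PolyHeight fun κ (l : Bits) => l.length ≤ κ := PolyHeight.bits PolyBounded.id
  have hs : FP (fun κ (prm : Params) => prm = paramsOf ℓ k κ) fun _ prm =>
      Tokenization.sampleBits prm.1 :=
    (FP.sampleBits PolyBounded.id).comp_pt (f := fun p : Params => p.1) (by fun_prop) hp
      (by rintro κ _ rfl; rfl)
  have hs' : FP (fun κ (p : Params × Bits) => p.1 = paramsOf ℓ k κ ∧ p.2.length ≤ κ) fun _ p =>
      Tokenization.sampleBits p.1.1 :=
    (FP.sampleBits PolyBounded.id).comp_pt (f := fun p : Params × Bits => p.1.1) (by fun_prop)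
      (hp.prod hbits) (by rintro κ ⟨_, u⟩ ⟨rfl, -⟩; rfl)
  have hz : PT fun p : (Params × Bits) × Bits => List.replicate p.1.1.2.2.1.length false :=
    PT.zeros (by fun_prop)
  refine FP.bind (g' := fun _ prm u => (Tokenization.sampleBits prm.1).bind fun v =>
    .ret ((List.replicate prm.2.2.1.length false, u), (List.replicate prm.2.2.1.length false, v))) hs
    (FP.bind (g' := fun _ p v => .ret ((List.replicate p.1.2.2.1.length false, p.2),
      (List.replicate p.1.2.2.1.length false, v))) hs'
      (.of_pt (S := fun κ p => (p.1.1 = paramsOf ℓ k κ ∧ p.1.2.length ≤ κ) ∧ p.2.length ≤ κ)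
        (f := fun p : (Params × Bits) × Bits => ((List.replicate p.1.1.2.2.1.length false, p.1.2),
          (List.replicate p.1.1.2.2.1.length false, p.2))) (by fun_prop) ((hp.prod hbits).prod hbits))
      ?_) ?_
  · rintro κ ⟨_, u⟩ v ⟨rfl, hu⟩ hv
    exact ⟨⟨rfl, hu⟩, by rw [length_sampleBits hv]; simp [paramsOf]⟩
  · rintro κ _ u rfl hu
    exact ⟨rfl, by rw [length_sampleBits hu]; simp [paramsOf]⟩

/-- Two random elements have the same image with probability at least `1 / 2 ^ w`. -/
theorem le_avgBits_collision {n w : ℕ} (g : Bits → BitVec w) :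
    (1 / 2 ^ w : ℝ) ≤ avgBits n fun u => avgBits n fun v => if g u = g v then 1 else 0 := by
  classical
  have hw : Fintype.card (BitVec w) = 2 ^ w := by
    rw [Fintype.card_congr (msbEquiv w)]; simp
  let c : BitVec w → ℝ := fun y => ∑ u : Fin n → Bool, if g (List.ofFn u) = y then 1 else 0
  have h1 : ∑ y, c y = 2 ^ n := by
    simp only [c]
    rw [Finset.sum_comm]
    simp
  have h2 : ∑ y, c y ^ 2 = ∑ u : Fin n → Bool, ∑ v : Fin n → Bool,
      if g (List.ofFn u) = g (List.ofFn v) then 1 else 0 := by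
    simp only [c, pow_two, Finset.sum_mul_sum]
    rw [Finset.sum_comm]
    refine Finset.sum_congr rfl fun u _ => ?_
    rw [Finset.sum_comm]
    refine Finset.sum_congr rfl fun v _ => ?_
    simp [eq_comm]
  -- Cauchy–Schwarz for the sizes `c y` of the fibres of `g`: their sum is `2 ^ n`, and the sum of
  -- their squares counts the pairs with equal image.
  have h3 := sq_sum_le_card_mul_sum_sq (s := (Finset.univ : Finset (BitVec w))) (f := c)
  rw [h1, h2, Finset.card_univ, hw] at h3
  simp only [avgBits]
  rw [← Finset.sum_div, div_div, div_le_div_iff₀ (by positivity) (by positivity)]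
  push_cast at h3
  linarith

theorem exists_codeB_zeros (ℓ : ℕ) : ∃ X : Code ℓ, codeB X = .replicate (bitLen ℓ) false := by
  have h : ∀ n, lval (List.replicate n false) = 0 := fun n => by
    induction n with
    | zero => rfl
    | succ n ih => rw [List.replicate_succ]; simp [lval, ih]
  exact exists_codeB_iff.2 ⟨by simp, by rw [List.reverse_replicate, h]; positivity⟩

/-- A collision-resistant function has long values. -/
theorem exists_random_collision (f : ∀ κ, AddInput → Code (ℓ κ) → BitVec (k κ)) (hℓ : PolyBounded ℓ)
    (hk : PolyBounded k) :
    ∃ (M : Prog) (r : Polynomial ℕ), (∀ κ ok, HaltsWithin ok (r.eval κ) ([M], load (params ℓ k κ))) ∧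
      ∀ κ, (1 / 2 ^ k κ : ℝ) ≤ collisionProb f M r κ + 1 / 2 ^ κ := by
  classical
  obtain ⟨M, r, hM⟩ := (FP.randomPair hℓ hk).exists_prog
  refine ⟨M, r, fun κ ok => (hM κ).haltsWithin ok, fun κ => ?_⟩
  obtain ⟨X, hX⟩ := exists_codeB_zeros (ℓ κ)
  rw [collisionProb_eq (hM κ), randomPair]
  simp only [value_sampleBits_bind, value, paramsOf, List.length_replicate]
  -- The two inputs coincide with probability `1 / 2 ^ κ`; such pairs have equal images but are no
  -- collisions.
  have h1 : (avgBits κ fun u => avgBits κ fun v => if v ∈ [u] then 1 else 0) ≤ (1 / 2 ^ κ : ℝ) := by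
    refine (avgBits_mono fun u _ => (avgBits_mem_le [u])).trans ?_
    simp [avgBits_const]
  refine (le_avgBits_collision (n := κ) fun u => f κ u X).trans
    (le_trans ?_ (add_le_add_right h1 _))
  rw [← avgBits_add]
  refine avgBits_mono fun u _ => ?_
  rw [← avgBits_add]
  refine avgBits_mono fun v _ => ?_
  by_cases huv : v = u
  · simp only [List.mem_singleton, huv, if_true]
    split_ifs <;> norm_num
  · by_cases hfuv : f κ u X = f κ v X
    · have : FoundCollision (f κ) fun _ => enc ((List.replicate (bitLen (ℓ κ)) false, u),
          (List.replicate (bitLen (ℓ κ)) false, v)) := by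
        refine ⟨(X, u), (X, v), fun he => huv (Prod.mk.inj he).2.symm, hfuv, ?_⟩
        rw [← hX]
        rfl
      rw [if_pos hfuv, if_pos this]
      split_ifs <;> norm_num
    · simp only [hfuv, if_false]
      split_ifs <;> norm_num

end

end Tokenization

namespace Tokenization
open Dialog Enc

/-! ## Negligible functions -/

theorem Negligible.mono {g h : ℕ → ℝ} (hh : Negligible h) (h0 : ∀ κ, 0 ≤ g κ) (hgh : ∀ κ, g κ ≤ h κ) :
    Negligible g :=
  hh.trans_abs_le fun κ => abs_le_abs_of_nonneg (h0 κ) (hgh κ)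

theorem Negligible.poly_mul {g : ℕ → ℝ} (hg : Negligible g) (p : Polynomial ℕ) :
    Negligible fun κ => ((p.eval κ : ℕ) : ℝ) * g κ := by
  have h := Asymptotics.SuperpolynomialDecay.polynomial_mul hg (p.map (Nat.castRingHom ℝ))
  simpa [Negligible, Polynomial.eval_natCast_map] using h

theorem negligible_half_pow : Negligible fun κ => (1 / 2 : ℝ) ^ κ := fun n =>
  tendsto_pow_const_mul_const_pow_of_abs_lt_one n (by rw [abs_of_pos] <;> norm_num)

/-- From `1 - 1 / (T + 1) ≤ exp (-1 / (T + 1))`: the power with exponent `T + 1` is at most `exp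
(-1)`, which is below one half. -/
theorem div_succ_pow_le (T κ : ℕ) : ((T : ℝ) / (T + 1)) ^ (κ * (T + 1)) ≤ (1 / 2) ^ κ := by
  rw [mul_comm, pow_mul]
  refine pow_le_pow_left₀ (by positivity) ?_ κ
  have h1 : (T : ℝ) / (T + 1) ≤ Real.exp (-(1 / (T + 1))) := by
    refine le_trans (le_of_eq ?_) (Real.add_one_le_exp _)
    field_simp
    ring
  refine (pow_le_pow_left₀ (by positivity) h1 _).trans ?_
  rw [← Real.exp_nat_mul]
  have h2 : ((T + 1 : ℕ) : ℝ) * -(1 / (T + 1)) = -1 := by push_cast; field_simp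
  rw [h2]
  linarith [Real.exp_neg_one_lt_d9]

/-! ## The secret bit is not changed -/

namespace Dialog

theorem unif_le_of_leaf {α : Type} {m : ℕ} {d : BDialog α} {F G : α → ℝ}
    (h : ∀ a, d.AnyLeaf a → F a ≤ G a) : d.unif m F ≤ d.unif m G := by
  induction d with
  | ret a => exact h a rfl
  | flip k ih =>
    simp only [unif]
    linarith [ih false fun a ha => h a ⟨false, ha⟩, ih true fun a ha => h a ⟨true, ha⟩]
  | ask q k ih => exact avgBits_mono fun r _ => ih r fun a ha => h a ⟨r, trivial, ha⟩

end Dialog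

section

variable {ℓ k : ℕ} {f : AddInput → Code ℓ → BitVec k}

theorem nu_attempt {st : Sim} {X u : Bits} {p : Sim × Bits × Option Bits}
    (h : (attempt f st X u).AnyLeaf p) : p.1.nu = st.nu := by
  rw [attempt] at h
  cases hc : (skip f st.done X u).2.2 with
  | some c =>
    simp only [hc, Option.isSome_some, cond_true] at h
    rw [leaf_ret.1 h]
  | none =>
    simp only [hc, Option.isSome_none, cond_false] at h
    obtain ⟨w, -, h⟩ := leaf_bind.1 h
    rw [leaf_ret.1 h, afterWalk]
    cases w.2.2.1
    · rfl
    · cases memb (st.pub.low w.2.1) st.toks <;> rfl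

theorem nu_simStep {st st' : Sim} {q v : Val} (h : (simStep f st q).AnyLeaf (v, st')) :
    st'.nu = st.nu := by
  rw [simStep] at h
  cases hc : (st.bad || !(decideReq st q).isSome) with
  | true =>
    rw [hc] at h
    exact congrArg (fun p : Val × Sim => p.2.nu) (leaf_ret.1 h)
  | false =>
    rw [hc] at h
    obtain ⟨h1, -⟩ | ⟨r, -, h1, -, -, -, -, hnu⟩ :=
      decideReq_view (⟨rfl, rfl, rfl, rfl⟩ : st.View st) q
    · simp [h1] at hc
    rw [h1] at h
    obtain ⟨p, h2, h3⟩ := leaf_bind.1 h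
    rw [show st' = p.1 from congrArg Prod.snd (leaf_ret.1 h3)]
    obtain ⟨p', h4, h5⟩ := leaf_bind.1 h2
    have h6 : p'.1.nu = st.nu := by
      refine leaf_foldM (fun _ p => p.1.nu = st.nu) (fun i _ x _ a b ha hb => ?_) hnu h4
      rw [tokStep] at hb
      cases hc : (a.1.bad || a.2.2.isSome) with
      | true => rw [hc] at hb; rw [leaf_ret.1 hb]; exact ha
      | false => rw [hc] at hb; exact (nu_attempt hb).trans ha
    rw [leaf_ret.1 h5, finish]
    cases p'.2.2.isSome
    · cases p'.1.full <;> exact h6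
    · exact h6

end

/-! ### The total loss is negligible -/

section Bound

variable {ℓ k : ℕ → ℕ} {f : ∀ κ, AddInput → Code (ℓ κ) → BitVec (k κ)} {A : Prog}
  {p : Polynomial ℕ} {K : ℕ → Type} [∀ κ, Fintype (K κ)] [∀ κ, Nonempty (K κ)]
  {E : ∀ κ, K κ → Equiv.Perm (BitVec (k κ + bitLen (ℓ κ)))}

/-- Whether the adversary has won or lost. -/
noncomputable def outcome (w b : Bool) (s : Store) : ℝ := if xor w (xor (s 0).isNode b) then 1 else 0

theorem outcome_nonneg (w b : Bool) (s : Store) : 0 ≤ outcome w b s := by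
  unfold outcome; split_ifs <;> norm_num

theorem outcome_le_one (w b : Bool) (s : Store) : outcome w b s ≤ 1 := by
  unfold outcome; split_ifs <;> norm_num

theorem outcome_true (w : Bool) : outcome w true = fun s => 1 - outcome w false s := by
  funext s
  unfold outcome
  cases w <;> cases (s 0).isNode <;> simp

/-- The number of attempts. -/
noncomputable def attemptsPoly (p : Polynomial ℕ) : Polynomial ℕ := .X * (2 * p + 1)

variable (hA : ∀ κ, HaltsWithin (Set.range (encOption (encOption (encCode (ℓ := ℓ κ))))) (p.eval κ)
  ([A], load (params ℓ k κ)))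

omit [∀ κ, Fintype (K κ)] [∀ κ, Nonempty (K κ)] in
theorem agree_initSim (Jp : Polynomial ℕ) (κ : ℕ) (key : K κ) (b : Bool) :
    Agree (pubOf ℓ k (fun κ => Jp.eval κ) κ) (f κ) (E κ key) b ∅ ∅ none
      (initSim Jp (paramsOf ℓ k κ) b) := by
  constructor <;> simp [initSim, pubOf, paramsOf]

theorem value_token_le_real (Jp : Polynomial ℕ) (κ : ℕ) (key : K κ) (w b : Bool) :
    (dialog (p.eval κ) ([A], load (params ℓ k κ))).value
        (challengerOracle (tokenService (f κ) (E κ)) key b) ⟨(∅ : Set (Code (ℓ κ))), ∅, none⟩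
        (outcome w b) ≤
      (simDialog f A p Jp κ b).real (permBits (E κ key))
        fun a => if verdict w (a.1 0) a.2 then 1 else 0 := by
  refine value_le_real (pubOf_fits ℓ k (fun κ => Jp.eval κ) κ) (outcome_le_one w b) (fun a st h => ?_)
    (fun a st h hnu => ?_) _ (agree_initSim Jp κ key b)
  · simp [verdict, h]
  · simp [verdict, h, hnu, outcome]

-- Failures are split: those with a collision go to the last summand, the others are counted by
-- `simVal` and bounded through `unif_handle_le`. That the secret bit in the final state is still
-- the initial one makes `verdict` comparable with `outcome`.
include hA in
theorem unif_simDialog_le (κ : ℕ) (w b : Bool) :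
    (simDialog f A p (attemptsPoly p) κ b).unif (blockLen ℓ k κ)
        (fun a => if verdict w (a.1 0) a.2 then 1 else 0) ≤
      (dialog (p.eval κ) ([A], load (params ℓ k κ))).ideal (ℓ κ)
          (initSim (attemptsPoly p) (paramsOf ℓ k κ) b) (outcome w b) +
        p.eval κ * stepError (pubOf ℓ k (fun κ => (attemptsPoly p).eval κ) κ) (blockLen ℓ k κ)
          ((sentBound p (attemptsPoly p)).eval κ) (2 * p.eval κ) +
        (simDialog f A p (attemptsPoly p) κ b).unif (blockLen ℓ k κ)
          (fun a => if a.2.coll.isSome then 1 else 0) := by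
  set Jp := attemptsPoly p
  have hJ : (pubOf ℓ k (fun κ => Jp.eval κ) κ).fuel.length = Jp.eval κ := by simp [pubOf]
  have h1 : (simDialog f A p Jp κ b).unif (blockLen ℓ k κ)
        (fun a => if verdict w (a.1 0) a.2 then 1 else 0) ≤
      (simDialog f A p Jp κ b).unif (blockLen ℓ k κ) fun a =>
        simVal (fun s _ => outcome w b s) a + if a.2.coll.isSome then 1 else 0 := by
    refine unif_le_of_leaf fun a ha => ?_
    have hnu : a.2.nu = b := (leaf_handle (ok := fun _ => True) (inv := fun st => st.nu = b)
      (fun s q r s' hs hl => ⟨trivial, (nu_simStep hl).trans hs⟩) rfl ha).2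
    rw [simVal, outcome, verdict, hnu]
    cases a.2.coll.isSome
    · cases a.2.bad <;> simp
    · simp only [if_true, zero_add]
      split_ifs <;> norm_num
  refine h1.trans ?_
  rw [unif_add]
  gcongr
  refine unif_handle_le (pubOf_fits ℓ k (fun κ => Jp.eval κ) κ) (I := p.eval κ * Jp.eval κ)
    (outcome_nonneg w b) (tame_adversary (hA κ)).1
    (simInv_initSim (f := f) Jp κ (addBound ℓ k A p Jp κ) _ b) rfl (by rw [hJ, zero_add])
    (by rw [hJ]; exact le_rfl) (by omega) ?_
  simp [sentBound, pubOf, paramsOf]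

/-- The ideal game does not see the secret bit, and for a given final memory the outcomes for the
two bits are complementary. So winning has probability exactly one half. -/
theorem ideal_add_ideal (Jp : Polynomial ℕ) (κ : ℕ) (w : Bool) (d : Dialog Val Val Store) :
    d.ideal (ℓ κ) (initSim Jp (paramsOf ℓ k κ) false) (outcome w false) +
      d.ideal (ℓ κ) (initSim Jp (paramsOf ℓ k κ) true) (outcome w true) = 1 := by
  rw [outcome_true, ideal_one_sub (pubOf_fits ℓ k (fun κ => Jp.eval κ) κ) d
    (simInv_initSim (f := fun _ _ _ => 0) Jp κ 0 0 true).pub_eq (by simp [initSim]) (by simp [initSim]),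
    ideal_view d (⟨rfl, rfl, rfl, rfl⟩ : (initSim Jp (paramsOf ℓ k κ) false).View
      (initSim Jp (paramsOf ℓ k κ) true))]
  ring

/-- The number of attempts is `κ * (T + 1)` with `T = 2 * p`, a bound for the size of the database,
so that all of them hit used codes with probability at most `(1 / 2) ^ κ`. -/
theorem stepError_le (κ : ℕ) (S : ℕ) :
    stepError (pubOf ℓ k (fun κ => (attemptsPoly p).eval κ) κ) (blockLen ℓ k κ) S (2 * p.eval κ) ≤
      (attemptsPoly p).eval κ * (κ * (S / 2 ^ blockLen ℓ k κ) + (1 / 2) ^ κ) + (1 / 2) ^ κ := by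
  have hJ : (pubOf ℓ k (fun κ => (attemptsPoly p).eval κ) κ).fuel.length = (attemptsPoly p).eval κ := by
    simp [pubOf]
  have hκ : (pubOf ℓ k (fun κ => (attemptsPoly p).eval κ) κ).prm.1.length = κ := by
    simp [pubOf, paramsOf]
  rw [stepError, walkError, hJ, hκ]
  gcongr
  have := div_succ_pow_le (2 * p.eval κ) κ
  simpa [attemptsPoly] using this

variable (hf : PolyTimeComputable ℓ k f) (hℓ : PolyBounded ℓ) (hk : PolyBounded k)
  (hcr : CollisionResistant ℓ k f) (hE : INDCPA (params ℓ k) fun κ => cipherService (E κ))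
include hA hf hℓ hk hcr hE

theorem exists_negligible_bound (w : Bool) : ∃ ε : ℕ → ℝ, Negligible ε ∧ ∀ κ,
    (∑ key, ((dialog (p.eval κ) ([A], load (params ℓ k κ))).value
        (challengerOracle (tokenService (f κ) (E κ)) key false) ⟨(∅ : Set (Code (ℓ κ))), ∅, none⟩
        (outcome w false) +
      (dialog (p.eval κ) ([A], load (params ℓ k κ))).value
        (challengerOracle (tokenService (f κ) (E κ)) key true) ⟨(∅ : Set (Code (ℓ κ))), ∅, none⟩
        (outcome w true)) / 2) / Fintype.card (K κ) ≤ 1 / 2 + ε κ := by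
  obtain ⟨M, r, hM, hyb⟩ := exists_hybrid_adversary hA hf hℓ hk E (attemptsPoly p) w
  obtain ⟨M₁, r₁, hM₁, hcol⟩ := exists_collision_adversary hA hf hℓ hk (attemptsPoly p)
  obtain ⟨M₂, r₂, hM₂, hlen⟩ := exists_random_collision f hℓ hk
  have nadv : Negligible fun κ => advantage (cipherService (E κ)) (params ℓ k κ) M (r.eval κ) :=
    hE M r fun κ => hM κ _
  have ncol : Negligible fun κ => collisionProb f M₁ r₁ κ := hcr M₁ r₁ fun κ => hM₁ κ _
  have ncol₂ : Negligible fun κ => collisionProb f M₂ r₂ κ := hcr M₂ r₂ fun κ => hM₂ κ _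
  -- The hash values must be long, since otherwise two random inputs would collide too often; the
  -- block is at least as long.
  have nblock : Negligible fun κ => (1 / 2 ^ blockLen ℓ k κ : ℝ) := by
    refine Negligible.mono (h := fun κ => collisionProb f M₂ r₂ κ + (1 / 2) ^ κ)
      (ncol₂.add negligible_half_pow) (fun κ => by positivity) fun κ => ?_
    refine le_trans ?_ ((hlen κ).trans_eq (by simp))
    gcongr
    · norm_num
    · exact Nat.le_add_right _ _
  set S := sentBound p (attemptsPoly p) with hS
  set J := attemptsPoly p with hJ
  -- In turn: the loss of the hybrid argument; refused challenges and repeated blocks in walks;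
  -- overlong walks (`p * J`) and exhausted attempts (`p`); collisions.
  refine ⟨fun κ => ((4 * S).eval κ : ℕ) * advantage (cipherService (E κ)) (params ℓ k κ) M (r.eval κ) +
    ((4 * S * S + p * J * .X * S).eval κ : ℕ) * (1 / 2 ^ blockLen ℓ k κ : ℝ) +
    ((p * J + p).eval κ : ℕ) * (1 / 2 : ℝ) ^ κ + collisionProb f M₁ r₁ κ,
    (((nadv.poly_mul _).add (nblock.poly_mul _)).add (negligible_half_pow.poly_mul _)).add ncol,
    fun κ => ?_⟩
  have hK : (0 : ℝ) < Fintype.card (K κ) := by exact_mod_cast Fintype.card_pos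
  have h1 : (∑ key, ((dialog (p.eval κ) ([A], load (params ℓ k κ))).value
        (challengerOracle (tokenService (f κ) (E κ)) key false) ⟨(∅ : Set (Code (ℓ κ))), ∅, none⟩
        (outcome w false) +
      (dialog (p.eval κ) ([A], load (params ℓ k κ))).value
        (challengerOracle (tokenService (f κ) (E κ)) key true) ⟨(∅ : Set (Code (ℓ κ))), ∅, none⟩
        (outcome w true)) / 2) / Fintype.card (K κ) ≤
      (∑ key, ((simDialog f A p J κ false).real (permBits (E κ key))
            (fun a => if verdict w (a.1 0) a.2 then 1 else 0) +
          (simDialog f A p J κ true).real (permBits (E κ key))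
            (fun a => if verdict w (a.1 0) a.2 then 1 else 0)) / 2) / Fintype.card (K κ) := by
    refine div_le_div_of_nonneg_right (Finset.sum_le_sum fun key _ => ?_) hK.le
    linarith [value_token_le_real (E := E) (f := f) (A := A) (p := p) J κ key w false,
      value_token_le_real (E := E) (f := f) (A := A) (p := p) J κ key w true]
  have h2 := hyb κ _ rfl
  have h3 := unif_simDialog_le (f := f) hA κ w false
  have h4 := unif_simDialog_le (f := f) hA κ w true
  have h5 := ideal_add_ideal (ℓ := ℓ) (k := k) J κ w (dialog (p.eval κ) ([A], load (params ℓ k κ)))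
  have h6 := hcol κ
  have h7 := mul_le_mul_of_nonneg_left (stepError_le (ℓ := ℓ) (k := k) (p := p) κ (S.eval κ))
    (Nat.cast_nonneg (α := ℝ) (p.eval κ))
  simp only [Polynomial.eval_add, Polynomial.eval_mul, Polynomial.eval_X, Polynomial.eval_ofNat]
  push_cast
  have e1 : 4 * ((S.eval κ : ℕ) : ℝ) *
      (advantage (cipherService (E κ)) (params ℓ k κ) M (r.eval κ) +
        (S.eval κ : ℕ) / 2 ^ blockLen ℓ k κ) = 4 * (S.eval κ : ℕ) *
        advantage (cipherService (E κ)) (params ℓ k κ) M (r.eval κ) +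
      4 * (S.eval κ : ℕ) * (S.eval κ : ℕ) * (1 / 2 ^ blockLen ℓ k κ) := by ring
  have e2 : ((p.eval κ : ℕ) : ℝ) * ((J.eval κ : ℕ) *
      (κ * ((S.eval κ : ℕ) / 2 ^ blockLen ℓ k κ) + (1 / 2) ^ κ) + (1 / 2) ^ κ) =
      (p.eval κ : ℕ) * (J.eval κ : ℕ) * κ * (S.eval κ : ℕ) * (1 / 2 ^ blockLen ℓ k κ) +
        ((p.eval κ : ℕ) * (J.eval κ : ℕ) + (p.eval κ : ℕ)) * (1 / 2) ^ κ := by ring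
  rw [e1] at h2
  rw [e2] at h7
  linarith

/-- The bound is used for winning (`w = true`) and for losing (`w = false`). These probabilities add
up to one, so two upper bounds near one half confine the probability of winning from both sides. -/
theorem token_indcpa_bound : Negligible fun κ =>
    advantage (tokenService (f κ) (E κ)) (params ℓ k κ) A (p.eval κ) := by
  obtain ⟨ε₁, n₁, h₁⟩ := exists_negligible_bound hA hf hℓ hk hcr hE true
  obtain ⟨ε₂, n₂, h₂⟩ := exists_negligible_bound hA hf hℓ hk hcr hE false
  have n : Negligible fun κ => |ε₁ κ| + |ε₂ κ| :=
    (n₁.trans_abs_le fun κ => (abs_abs _).le).add (n₂.trans_abs_le fun κ => (abs_abs _).le)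
  refine n.mono (fun κ => abs_nonneg _) fun κ => ?_
  have hv : ∀ w b key, (dialog (p.eval κ) ([A], load (params ℓ k κ))).value
      (challengerOracle (tokenService (f κ) (E κ)) key b) ⟨(∅ : Set (Code (ℓ κ))), ∅, none⟩
      (outcome w b) = if xor w b then
        1 - guessVal (tokenService (f κ) (E κ)) (params ℓ k κ) A (p.eval κ) key b else
        guessVal (tokenService (f κ) (E κ)) (params ℓ k κ) A (p.eval κ) key b := by
    intro w b key
    have ho : outcome w b = if xor w b then fun s => 1 - if guess s then 1 else 0
        else fun s => if guess s then 1 else 0 := by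
      funext s
      unfold outcome guess
      cases w <;> cases b <;> cases h : s 0 <;> simp [Val.isNode, h]
    rw [ho]
    split_ifs
    · exact value_sub_const
    · rfl
  specialize h₁ κ
  specialize h₂ κ
  simp only [hv] at h₁ h₂
  have h₃ := toReal_game (tokenService (f κ) (E κ)) (params ℓ k κ) A (p.eval κ)
  set G := guessVal (tokenService (f κ) (E κ)) (params ℓ k κ) A (p.eval κ)
  have h₄ : (∑ key, (G key false + (1 - G key true)) / 2) / (Fintype.card (K κ) : ℝ) =
      1 - (∑ key, (1 - G key false + G key true) / 2) / (Fintype.card (K κ) : ℝ) := by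
    rw [eq_sub_iff_add_eq, ← add_div, ← Finset.sum_add_distrib]
    refine Eq.trans ?_ (mean_const (ι := K κ) (1 : ℝ))
    congr 1
    exact Finset.sum_congr rfl fun key _ => by ring
  have h₅ : (∑ key, (G key false + (1 - G key true)) / 2) / (Fintype.card (K κ) : ℝ) ≤
      1 / 2 + ε₂ κ := h₂
  have h₆ : (∑ key, (1 - G key false + G key true) / 2) / (Fintype.card (K κ) : ℝ) ≤
      1 / 2 + ε₁ κ := h₁
  rw [advantage, h₃, abs_le]
  have h₇ : (∑ key, (1 - G key false + G key true) / 2) /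
      (Fintype.card (tokenService (f κ) (E κ)).Key : ℝ) =
      (∑ key, (1 - G key false + G key true) / 2) / (Fintype.card (K κ) : ℝ) := rfl
  rw [h₇]
  rw [h₄] at h₅
  constructor <;> linarith [le_abs_self (ε₁ κ), le_abs_self (ε₂ κ), abs_nonneg (ε₁ κ),
    abs_nonneg (ε₂ κ)]

end Bound

end Tokenization

theorem theorem1
    (ℓ k : ℕ → ℕ) (hℓ : PolyBounded ℓ) (hk : PolyBounded k)
    (K : ℕ → Type) [∀ κ, Fintype (K κ)] [∀ κ, Nonempty (K κ)]
    (E : ∀ κ, K κ → Equiv.Perm (BitVec (k κ + bitLen (ℓ κ))))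
    (f : ∀ κ, AddInput → Code (ℓ κ) → BitVec (k κ))
    (hf : PolyTimeComputable ℓ k f)
    (hcr : CollisionResistant ℓ k f)
    (hE : INDCPA (params ℓ k) fun κ => cipherService (E κ)) :
    INDCPA (params ℓ k) fun κ => tokenService (f κ) (E κ) := by
  intro A p hA
  exact token_indcpa_bound hA hf hℓ hk hcr hE
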